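/- Let $X=\mathbb R^4\times\mathbb R^5$ with coordinates $q=(q_1,\dots,q_4)$, $x=(x^1,\dots,x^5)$, and let $\mathcal F$ (of complex dimension $2^8$) be the irreducible Hilbert space representation of the Clifford algebra with self-adjoint generators $\lambda_1,\dots,\lambda_8,\psi_1,\dots,\psi_8$, $$\{\lambda_a,\lambda_b\}=\delta_{ab},\qquad \{\psi_a,\psi_b\}=\delta_{ab},\qquad \{\lambda_a,\psi_b\}=0 .$$ Let $1^R,I^R,J^R,K^R$ and $I^L,J^L,K^L$ be the real $4\times4$ matrices of right, respectively left, multiplication by the quaternion units in the basis $(1,I,J,K)$ of the quaternions. Let $s^1,s^2,s^3,s^4$ be the $8\times 8$ matrices $\mathrm{diag}(Q,Q)$ with $Q=1^R,I^R,J^R,K^R$ respectively, and let $$\gamma^1=\begin{pmatrix}1&0\\0&-1\end{pmatrix},\quad \gamma^2=\begin{pmatrix}0&1\\1&0\end{pmatrix},\quad \gamma^3=\begin{pmatrix}0&K^L\\-K^L&0\end{pmatrix},\quad \gamma^4=\begin{pmatrix}0&I^L\\-I^L&0\end{pmatrix},\quad \gamma^5=\begin{pmatrix}0&J^L\\-J^L&0\end{pmatrix}.$$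 Write $\theta A\eta=\sum_{a,b}\theta_aA_{ab}\eta_b$ and $p_j=-i\,\partial/\partial q_j$. Put $$J=(q_1p_2-q_2p_1)+(q_3p_4-q_4p_3)-\tfrac i2\,\psi s^2\psi,\qquad \mathcal H=\{\Psi\in L^2(X;\mathcal F)\mid J\Psi=0\},$$ $$H=-\Delta+|x|^2|q|^2+\tfrac14|q|^4-i\sum_{\mu}x^\mu\,\psi\gamma^\mu s^2\psi+2i\sum_j q_j\,\lambda s^js^2\psi,$$ where $\Delta$ is the Laplacian on $X$, and for real $k$ $$H_k=H+k^2+k(q_3^2+q_4^2)-k(q_1^2+q_2^2).$$ Here $J$ and $H_k$ act in the sense of distributions, and the domain of $H_k$ in $\mathcal H$ consists of all $\Psi\in\mathcal H$ with $H_k\Psi\in\mathcal H$. Then there is $k_0$ such that for every $k\ge k_0$ there exists a state $\Psi\in\mathcal H$ with $H_k\Psi=0$, and it is unique: there is $\Psi\in\mathcal H$ with $\|\Psi\|=1$ and $H_k\Psi=0$, and every $\Phi\in\mathcal H$ with $H_k\Phi=0$ is a complex multiple of $\Psi$. -/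

import Mathlib

open MeasureTheory
open scoped ContDiff InnerProductSpace Laplacian

noncomputable section

namespace DeformedSQM

/-! ### The fermionic space and the Clifford generators -/

/-- The fermionic space `ℱ`, of complex dimension `2 ^ 8`: the Fock space of 8 fermionic modes, with
orthonormal basis indexed by the sets of occupied modes. -/
abbrev Fermion : Type := EuclideanSpace ℂ (Finset (Fin 8))

/-- The Jordan-Wigner sign `(-1) ^ #{i ∈ S | i < j}`. -/
def jwSign (j : Fin 8) (S : Finset (Fin 8)) : ℂ := (-1) ^ (S.filter (fun i => i < j)).card

/-- The matrix that flips the occupation of the mode `j`, with coefficients `c`. -/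
def hop (j : Fin 8) (c : Finset (Fin 8) → ℂ) : Matrix (Finset (Fin 8)) (Finset (Fin 8)) ℂ :=
  Matrix.of fun S T => if T = symmDiff S {j} then c S else 0

/-- The coefficients of `λ_j` in the occupation basis. -/
def lamCoeff (j : Fin 8) (S : Finset (Fin 8)) : ℂ := ((Real.sqrt 2)⁻¹ : ℝ) * jwSign j S

/-- The coefficients of `ψ_j` in the occupation basis. -/
def psiCoeff (j : Fin 8) (S : Finset (Fin 8)) : ℂ :=
  ((Real.sqrt 2)⁻¹ : ℝ) * jwSign j S * (if j ∈ S then Complex.I else -Complex.I)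

/-- The Clifford generator `λ_j` as an operator on `ℱ`. -/
def lam (j : Fin 8) : Fermion →L[ℂ] Fermion := Matrix.toEuclideanCLM (𝕜 := ℂ) (hop j (lamCoeff j))

/-- The Clifford generator `ψ_j` as an operator on `ℱ`. -/
def psi (j : Fin 8) : Fermion →L[ℂ] Fermion := Matrix.toEuclideanCLM (𝕜 := ℂ) (hop j (psiCoeff j))

theorem finrank_fermion : Module.finrank ℂ Fermion = 2 ^ 8 := by simp

theorem hop_mul (j k : Fin 8) (c d : Finset (Fin 8) → ℂ) :
    hop j c * hop k d = Matrix.of fun S U =>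
      if U = symmDiff (symmDiff S {j}) {k} then c S * d (symmDiff S {j}) else 0 := by
  ext S U
  simp only [hop, Matrix.mul_apply, Matrix.of_apply]
  rw [Finset.sum_eq_single (symmDiff S {j})]
  · simp
  · intro T _ hT; simp [hT]
  · simp

theorem jwSign_flip (j k : Fin 8) (S : Finset (Fin 8)) :
    jwSign k (symmDiff S {j}) = (if j < k then -1 else 1) * jwSign k S := by
  unfold jwSign
  by_cases hjk : j < k
  · by_cases hj : j ∈ S
    · have h1 : S.filter (fun i => i < k) =
          insert j ((symmDiff S {j}).filter (fun i => i < k)) := by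
        ext i
        simp only [Finset.mem_filter, Finset.mem_insert, Finset.mem_symmDiff, Finset.mem_singleton]
        by_cases hi : i = j <;> simp_all
      have h2 : j ∉ (symmDiff S {j}).filter (fun i => i < k) := by
        simp [Finset.mem_symmDiff, hj]
      rw [h1, Finset.card_insert_of_notMem h2, pow_succ]
      simp [hjk]
    · have h1 : (symmDiff S {j}).filter (fun i => i < k) =
          insert j (S.filter (fun i => i < k)) := by
        ext i
        simp only [Finset.mem_filter, Finset.mem_insert, Finset.mem_symmDiff, Finset.mem_singleton]
        by_cases hi : i = j <;> simp_all
      have h2 : j ∉ S.filter (fun i => i < k) := by simp [hj]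
      rw [h1, Finset.card_insert_of_notMem h2, pow_succ]
      simp [hjk]
  · have h1 : (symmDiff S {j}).filter (fun i => i < k) = S.filter (fun i => i < k) := by
      ext i
      simp only [Finset.mem_filter, Finset.mem_symmDiff, Finset.mem_singleton]
      by_cases hi : i = j <;> simp_all
    simp [h1, hjk]

theorem mem_flip (j k : Fin 8) (S : Finset (Fin 8)) :
    k ∈ symmDiff S {j} ↔ (if j = k then k ∉ S else k ∈ S) := by
  by_cases h : j = k
  · subst h; simp [Finset.mem_symmDiff]
  · have h' : k ≠ j := fun e => h e.symm
    simp [Finset.mem_symmDiff, h, h']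

theorem jwSign_mul_self (j : Fin 8) (S : Finset (Fin 8)) : jwSign j S * jwSign j S = 1 := by
  unfold jwSign
  rw [← mul_pow]; simp

theorem inv_sqrt_two_mul_self :
    (((Real.sqrt 2)⁻¹ : ℝ) : ℂ) * (((Real.sqrt 2)⁻¹ : ℝ) : ℂ) = 1 / 2 := by
  rw [← Complex.ofReal_mul, ← mul_inv, Real.mul_self_sqrt (by norm_num)]
  norm_num

/-- The anticommutator of two flips is `r` as soon as the coefficients say so. -/
theorem hop_anticomm (j k : Fin 8) (c d : Finset (Fin 8) → ℂ) (r : ℂ) (hr : j ≠ k → r = 0)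
    (h : ∀ S, c S * d (symmDiff S {j}) + d S * c (symmDiff S {k}) = r) :
    hop j c * hop k d + hop k d * hop j c = r • (1 : Matrix _ _ ℂ) := by
  rw [hop_mul, hop_mul]
  ext S U
  have e : symmDiff (symmDiff S {k}) {j} = symmDiff (symmDiff S {j}) ({k} : Finset (Fin 8)) :=
    symmDiff_right_comm _ _ _
  simp only [Matrix.add_apply, Matrix.of_apply, Matrix.smul_apply, e, Matrix.one_apply,
    smul_eq_mul]
  by_cases hjk : j = k
  · subst hjk
    have e2 : symmDiff (symmDiff S {j}) ({j} : Finset (Fin 8)) = S :=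
      symmDiff_symmDiff_cancel_right _ _
    rw [e2]
    by_cases hU : U = S
    · subst hU; simp [h]
    · have hU' : ¬ S = U := fun e => hU e.symm
      simp [hU, hU']
  · rw [hr hjk] at h ⊢
    split_ifs <;> simp [h]

/-- `{λ_j, λ_k} = δ_jk`. -/
theorem lam_anticomm (j k : Fin 8) :
    lam j * lam k + lam k * lam j = (if j = k then (1 : ℂ) else 0) • 1 := by
  have := hop_anticomm j k (lamCoeff j) (lamCoeff k) (if j = k then (1 : ℂ) else 0)
    (fun h => by simp [h]) (fun S => by
      have h2 := inv_sqrt_two_mul_self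
      have hj := jwSign_mul_self j S
      simp only [lamCoeff, jwSign_flip]
      rcases lt_trichotomy j k with h | h | h
      · simp [h, h.ne, h.not_gt]; ring
      · subst h; simp only [lt_irrefl, if_true, if_false]
        linear_combination (2 * jwSign j S * jwSign j S) * h2 + hj
      · simp [h, h.ne', h.not_gt]; ring)
  simp only [lam, ← map_mul, ← map_add, this, map_smul, map_one]

/-- `{ψ_j, ψ_k} = δ_jk`. -/
theorem psi_anticomm (j k : Fin 8) :
    psi j * psi k + psi k * psi j = (if j = k then (1 : ℂ) else 0) • 1 := by
  have := hop_anticomm j k (psiCoeff j) (psiCoeff k) (if j = k then (1 : ℂ) else 0)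
    (fun h => by simp [h]) (fun S => by
      have h2 := inv_sqrt_two_mul_self
      have hj := jwSign_mul_self j S
      have hI := Complex.I_mul_I
      simp only [psiCoeff, jwSign_flip, mem_flip]
      rcases lt_trichotomy j k with h | h | h
      · by_cases hm : j ∈ S <;> by_cases hn : k ∈ S <;>
          simp [h, h.ne, h.ne', h.not_gt, hm, hn] <;> ring
      · subst h; simp only [lt_irrefl, if_true, if_false]
        by_cases hm : j ∈ S <;> simp only [hm, if_true, if_false, not_true, not_false_iff] <;>
        linear_combination (2 * jwSign j S * jwSign j S) * h2 + hj -
          (2 * jwSign j S * jwSign j S *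
            ((((Real.sqrt 2)⁻¹ : ℝ) : ℂ) * (((Real.sqrt 2)⁻¹ : ℝ) : ℂ))) * hI
      · by_cases hm : j ∈ S <;> by_cases hn : k ∈ S <;>
          simp [h, h.ne, h.ne', h.not_gt, hm, hn] <;> ring)
  simp only [psi, ← map_mul, ← map_add, this, map_smul, map_one]

/-- `{λ_j, ψ_k} = 0`. -/
theorem lam_psi_anticomm (j k : Fin 8) : lam j * psi k + psi k * lam j = 0 := by
  have := hop_anticomm j k (lamCoeff j) (psiCoeff k) 0 (fun _ => rfl) (fun S => by
      simp only [psiCoeff, lamCoeff, jwSign_flip, mem_flip]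
      rcases lt_trichotomy j k with h | h | h
      · by_cases hn : k ∈ S <;> simp [h, h.ne, h.not_gt, hn] <;> ring
      · subst h
        by_cases hm : j ∈ S <;> simp [hm] <;> ring
      · by_cases hn : k ∈ S <;> simp [h, h.ne', h.not_gt, hn] <;> ring)
  simp only [lam, psi, ← map_mul, ← map_add, this, zero_smul, map_zero]

theorem hop_isSelfAdjoint (j : Fin 8) (c : Finset (Fin 8) → ℂ)
    (h : ∀ S, star (c (symmDiff S {j})) = c S) : IsSelfAdjoint (hop j c) := by
  ext S T
  simp only [hop, Matrix.star_apply, Matrix.of_apply]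
  have e : S = symmDiff T {j} ↔ T = symmDiff S {j} := by
    constructor <;> rintro rfl <;> exact (symmDiff_symmDiff_cancel_right _ _).symm
  by_cases hT : T = symmDiff S {j}
  · rw [if_pos hT, if_pos (e.2 hT), hT, h]
  · rw [if_neg hT, if_neg (fun x => hT (e.1 x)), star_zero]

theorem star_jwSign (j : Fin 8) (S : Finset (Fin 8)) : star (jwSign j S) = jwSign j S := by
  simp [jwSign]

theorem lam_isSelfAdjoint (j : Fin 8) : IsSelfAdjoint (lam j) := by
  refine IsSelfAdjoint.map (hop_isSelfAdjoint j _ fun S => ?_) (Matrix.toEuclideanCLM (𝕜 := ℂ))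
  rw [lamCoeff, star_mul', star_jwSign, jwSign_flip]
  simp [lamCoeff]

theorem psi_isSelfAdjoint (j : Fin 8) : IsSelfAdjoint (psi j) := by
  refine IsSelfAdjoint.map (hop_isSelfAdjoint j _ fun S => ?_) (Matrix.toEuclideanCLM (𝕜 := ℂ))
  rw [psiCoeff, star_mul', star_mul', star_jwSign, jwSign_flip]
  by_cases h : j ∈ S <;> simp [psiCoeff, mem_flip, h]

/-- The bilinear expression `∑ a b, θ_a A_ab η_b` in two families of fermionic operators. -/
def bilin (θ : Fin 8 → Fermion →L[ℂ] Fermion) (A : Matrix (Fin 8) (Fin 8) ℝ)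
    (η : Fin 8 → Fermion →L[ℂ] Fermion) : Fermion →L[ℂ] Fermion :=
  ∑ a, ∑ b, (A a b : ℂ) • (θ a * η b)

/-! ### The real `8 × 8` matrices -/

/-- The `8 × 8` matrix with the given `4 × 4` blocks. -/
def block (A B C D : Matrix (Fin 4) (Fin 4) ℝ) : Matrix (Fin 8) (Fin 8) ℝ :=
  Matrix.reindex finSumFinEquiv finSumFinEquiv (Matrix.fromBlocks A B C D)

/-- Right multiplication by the quaternion units `1, I, J, K`. -/
def quatR : Fin 4 → Matrix (Fin 4) (Fin 4) ℝ :=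
  ![1,
    !![0, -1, 0, 0; 1, 0, 0, 0; 0, 0, 0, 1; 0, 0, -1, 0],
    !![0, 0, -1, 0; 0, 0, 0, -1; 1, 0, 0, 0; 0, 1, 0, 0],
    !![0, 0, 0, -1; 0, 0, 1, 0; 0, -1, 0, 0; 1, 0, 0, 0]]

/-- Left multiplication by the quaternion unit `I`. -/
def quatIL : Matrix (Fin 4) (Fin 4) ℝ := !![0, -1, 0, 0; 1, 0, 0, 0; 0, 0, 0, -1; 0, 0, 1, 0]

/-- Left multiplication by the quaternion unit `J`. -/
def quatJL : Matrix (Fin 4) (Fin 4) ℝ := !![0, 0, -1, 0; 0, 0, 0, 1; 1, 0, 0, 0; 0, -1, 0, 0]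

/-- Left multiplication by the quaternion unit `K`. -/
def quatKL : Matrix (Fin 4) (Fin 4) ℝ := !![0, 0, 0, -1; 0, 0, -1, 0; 0, 1, 0, 0; 1, 0, 0, 0]

/-- The matrices `s¹, …, s⁴` (indexed from `0`, so that `sMat 1` is `s²`). -/
def sMat (j : Fin 4) : Matrix (Fin 8) (Fin 8) ℝ := block (quatR j) 0 0 (quatR j)

/-- The gamma matrices `γ¹, …, γ⁵` (indexed from `0`). -/
def gammaMat : Fin 5 → Matrix (Fin 8) (Fin 8) ℝ :=
  ![block 1 0 0 (-1), block 0 1 1 0, block 0 quatKL (-quatKL) 0,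
    block 0 quatIL (-quatIL) 0, block 0 quatJL (-quatJL) 0]

/-! ### Configuration space and differential operators -/

/-- The configuration space `X = ℝ⁴ × ℝ⁵`, with its Euclidean structure and Lebesgue measure. -/
abbrev Config : Type := EuclideanSpace ℝ (Fin 4 ⊕ Fin 5)

/-- The coordinates `q_1, …, q_4` (indexed from `0`). -/
def qc (ξ : Config) (j : Fin 4) : ℝ := ξ (Sum.inl j)

/-- The coordinates `x^1, …, x^5` (indexed from `0`). -/
def xc (ξ : Config) (μ : Fin 5) : ℝ := ξ (Sum.inr μ)

/-- The momentum `p_j = -i ∂/∂q_j`. -/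
def pq (j : Fin 4) (φ : Config → Fermion) (ξ : Config) : Fermion :=
  (-Complex.I) • fderiv ℝ φ ξ (EuclideanSpace.single (Sum.inl j) 1)

/-- `W_ij = q_i p_j - q_j p_i`. -/
def rotW (i j : Fin 4) (φ : Config → Fermion) (ξ : Config) : Fermion :=
  (qc ξ i : ℂ) • pq j φ ξ - (qc ξ j : ℂ) • pq i φ ξ

/-- The generator of gauge transformations `J = W₁₂ + W₃₄ - (i/2) ψ s² ψ`. -/
def gaugeJ (φ : Config → Fermion) (ξ : Config) : Fermion :=
  rotW 0 1 φ ξ + rotW 2 3 φ ξ - (Complex.I / 2) • bilin psi (sMat 1) psi (φ ξ)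

/-- The scalar potential `V = |x|² |q|² + |q|⁴ / 4`. -/
def potV (ξ : Config) : ℝ :=
  (∑ μ, xc ξ μ ^ 2) * (∑ j, qc ξ j ^ 2) + (1 / 4) * (∑ j, qc ξ j ^ 2) ^ 2

/-- `H_F = - i x^μ ψ γ^μ s² ψ + 2 i q_j λ s^j s² ψ`. -/
def hamF (ξ : Config) : Fermion →L[ℂ] Fermion :=
  -Complex.I • ∑ μ, (xc ξ μ : ℂ) • bilin psi (gammaMat μ * sMat 1) psi +
    (2 * Complex.I) • ∑ j, (qc ξ j : ℂ) • bilin lam (sMat j * sMat 1) psi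

/-- The differential expression `H = -Δ + V + H_F`. -/
def ham (φ : Config → Fermion) (ξ : Config) : Fermion :=
  -(Δ φ ξ) + (potV ξ : ℂ) • φ ξ + hamF ξ (φ ξ)

/-- The deformed Hamiltonian `H_k = H + k² + k (q₃² + q₄²) - k (q₁² + q₂²)`. -/
def hamDef (k : ℝ) (φ : Config → Fermion) (ξ : Config) : Fermion :=
  ham φ ξ + ((k ^ 2 + k * (qc ξ 2 ^ 2 + qc ξ 3 ^ 2) - k * (qc ξ 0 ^ 2 + qc ξ 1 ^ 2) : ℝ) : ℂ) • φ ξ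

/-! ### Hilbert spaces and the distributional action of the operators -/

/-- `ℋ₀ = L²(X; ℱ)`. -/
abbrev PreHilbert : Type := Lp Fermion 2 (volume : Measure Config)

/-- `φ ∈ C₀^∞(X; ℱ)`. -/
def IsTest (φ : Config → Fermion) : Prop := ContDiff ℝ ∞ φ ∧ HasCompactSupport φ

/-- `A Ψ = Φ` in the sense of distributions, for a formally symmetric differential expression `A`
(both `gaugeJ` and `hamDef k` are formally symmetric). -/
def DistribEq (A : (Config → Fermion) → Config → Fermion) (Ψ Φ : PreHilbert) : Prop :=
  ∀ φ : Config → Fermion, IsTest φ →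
    ∫ ξ, inner ℂ (A φ ξ) (Ψ ξ) = ∫ ξ, inner ℂ (φ ξ) (Φ ξ)

theorem continuous_fderiv_apply_const {φ : Config → Fermion} (h : ContDiff ℝ ∞ φ) (v : Config) :
    Continuous fun ξ => fderiv ℝ φ ξ v :=
  (h.continuous_fderiv (by simp)).clm_apply continuous_const

theorem rotW_continuous (i j : Fin 4) {φ : Config → Fermion} (h : IsTest φ) :
    Continuous (rotW i j φ) := by
  have hp : ∀ j : Fin 4, Continuous (pq j φ) := fun j =>
    (continuous_fderiv_apply_const h.1 _).const_smul (-Complex.I)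
  have hq : ∀ j : Fin 4, Continuous fun ξ : Config => (qc ξ j : ℂ) := fun j => by
    unfold qc; fun_prop
  exact ((hq i).smul (hp j)).sub ((hq j).smul (hp i))

theorem gaugeJ_continuous {φ : Config → Fermion} (h : IsTest φ) : Continuous (gaugeJ φ) := by
  have h3 : Continuous fun ξ => bilin psi (sMat 1) psi (φ ξ) :=
    (bilin psi (sMat 1) psi).continuous.comp h.1.continuous
  exact ((rotW_continuous 0 1 h).add (rotW_continuous 2 3 h)).sub (h3.const_smul (Complex.I / 2))

theorem gaugeJ_hasCompactSupport {φ : Config → Fermion} (h : IsTest φ) :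
    HasCompactSupport (gaugeJ φ) := by
  refine HasCompactSupport.intro h.2 fun ξ hn => ?_
  have h0 : φ ξ = 0 := image_eq_zero_of_notMem_tsupport hn
  have h1 : fderiv ℝ φ ξ = 0 :=
    image_eq_zero_of_notMem_tsupport fun hm => hn (tsupport_fderiv_subset ℝ hm)
  simp [gaugeJ, rotW, pq, h0, h1]

theorem integrable_inner_gaugeJ {φ : Config → Fermion} (h : IsTest φ) (Ψ : PreHilbert) :
    Integrable fun ξ => inner ℂ (gaugeJ φ ξ) (Ψ ξ) := by
  have hm : MemLp (gaugeJ φ) 2 (volume : Measure Config) :=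
    (gaugeJ_continuous h).memLp_of_hasCompactSupport (gaugeJ_hasCompactSupport h)
  refine (L2.integrable_inner (𝕜 := ℂ) (hm.toLp _) Ψ).congr ?_
  filter_upwards [hm.coeFn_toLp] with ξ hξ
  rw [hξ]

theorem integral_inner_zero (φ : Config → Fermion) :
    ∫ ξ, inner ℂ (φ ξ) ((0 : PreHilbert) ξ) = 0 := by
  rw [integral_eq_zero_of_ae]
  filter_upwards [Lp.coeFn_zero Fermion 2 (volume : Measure Config)] with ξ hξ
  rw [hξ]; simp

/-- The physical Hilbert space `ℋ = {Ψ ∈ ℋ₀ | J Ψ = 0}`. -/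
def physicalSpace : Submodule ℂ PreHilbert where
  carrier := {Ψ | DistribEq gaugeJ Ψ 0}
  zero_mem' := fun φ _ => by rw [integral_inner_zero, integral_inner_zero]
  add_mem' := by
    intro Ψ Φ hΨ hΦ φ hφ
    have e : (fun ξ => inner ℂ (gaugeJ φ ξ) ((Ψ + Φ : PreHilbert) ξ)) =ᵐ[volume]
        fun ξ => inner ℂ (gaugeJ φ ξ) (Ψ ξ) + inner ℂ (gaugeJ φ ξ) (Φ ξ) := by
      filter_upwards [Lp.coeFn_add Ψ Φ] with ξ hξ
      rw [hξ, Pi.add_apply, inner_add_right]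
    rw [integral_congr_ae e, integral_add (integrable_inner_gaugeJ hφ Ψ)
      (integrable_inner_gaugeJ hφ Φ), hΨ φ hφ, hΦ φ hφ, integral_inner_zero, add_zero]
  smul_mem' := by
    intro c Ψ hΨ φ hφ
    have e : (fun ξ => inner ℂ (gaugeJ φ ξ) ((c • Ψ : PreHilbert) ξ)) =ᵐ[volume]
        fun ξ => c * inner ℂ (gaugeJ φ ξ) (Ψ ξ) := by
      filter_upwards [Lp.coeFn_smul c Ψ] with ξ hξ
      rw [hξ, Pi.smul_apply, inner_smul_right]
    rw [integral_congr_ae e, integral_const_mul, hΨ φ hφ, integral_inner_zero, mul_zero]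

/-- `Ψ ∈ ℋ` lies in the domain of `H_k` and `H_k Ψ = Φ`. The domain of `H_k` consists of the
`Ψ ∈ ℋ` for which the distribution `H_k Ψ` is again an element of `ℋ`. -/
def HamDefEq (k : ℝ) (Ψ Φ : physicalSpace) : Prop :=
  DistribEq (hamDef k) (Ψ : PreHilbert) (Φ : PreHilbert)

end DeformedSQM

end

/-!
The theorem rests on supersymmetry. The first-order operator `dirac k = -i ∑ c_i ∂_i + M_k`, with
Clifford vectors `c_i` (`chg`) and `M_k` (`superpot`), squares to `H_k / 2` up to a multiple of the
gauge generator (`two_smul_dirac_dirac`). It is odd for the parity `par` and commutes with the gauge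
generator, and so `H_k` is twice a square on gauge-invariant functions. Hence it suffices to show that
for large `k` the quadratic form `energy k` of `H_k` has, on gauge-invariant functions, a gap above
one even direction, and to produce an even state of small energy.

*The gap* (`energy_gap`). Put `k = ϖ² / 2`. The scalar potential has as minima the circle
`q₁² + q₂² = ϖ²`, `q₃ = q₄ = 0`, `x = 0`, which is one gauge orbit. Away from the circle the energy is
at least `ϖ` (`far_energy`): the potential dominates the fermionic terms, and in the flat directions,
where both grow linearly, the zero point energy of the transverse oscillators comes to help. Near the
circle the substitution `g = exp (-(ϖ / 2) well) w` turns the scalar part into the Dirichlet form of `w`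
with a weight that is almost Gaussian (`near_energy`), while the fermionic part becomes, up to small
errors, the number operator `-2i ∑ λ_a ψ_a` transported around the circle; its lowest eigenvalue `-8`,
which the zero point energy compensates exactly, is simple. As energy densities of gauge-invariant
functions are rotation invariant, a weight in the angle may be inserted that localizes at one point of
the circle (`angWeight`), where the Gaussian Poincaré inequality (`gauss_poincare`) provides the gap.
The localization formula for `sin` and `cos` of one cutoff function (`energy_localization`) joins the
two regions.

*Existence* (`exists_zero_mode`). The state `trial` follows the lowest spinor around the circle; it is
even, gauge invariant, and of energy much less than `ϖ` (`energy_trial`). On odd functions the gap makes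
`dirac` bounded below by about `√(ϖ / 50)`, and `dirac` maps `trial` to something small. So `trial` is
not in the closure of the range of `dirac` on odd functions, and its component orthogonal to that range
is a nonzero weak solution. That every test function splits into a gauge-invariant one and a gauge
variation (`exists_gauge_decomposition`) allows to test against invariant functions only.

*Uniqueness* (`eq_zero_of_orthogonal`). Let a solution `Φ` be orthogonal to the exceptional direction of
the gap. Mollify it with a gauge-invariant kernel and cut it off with a gauge-invariant function: this
stays gauge invariant, and its energy tends to zero, as only the commutators with the potential and with
the cutoff contribute (`energy_mol_le`). By the gap `Φ = 0`. Of two solutions some nonzero combination is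
orthogonal to that direction.

All of this is done over any Hilbert space with the Clifford generators, a parity operator and a
nondegenerate lowest spinor (`FermionRep`); `fermionRep` is the Fock space of the statement. The
derivative along the gauge orbits is `covD`, which is `i` times the gauge generator `gauge`.
-/

noncomputable section

namespace DeformedSQM

/-! ### Partial derivatives, test functions and integration by parts -/

/-- The index set of the nine coordinates of `X`. -/
abbrev Idx : Type := Fin 4 ⊕ Fin 5

/-- The `i`-th coordinate unit vector of `X`. -/
abbrev unitVec (i : Idx) : Config := EuclideanSpace.single i 1

section Calculus

variable {F : Type*} [NormedAddCommGroup F] [NormedSpace ℝ F]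

/-- The partial derivative `∂_i f`. -/
def pd (i : Idx) (f : Config → F) (ξ : Config) : F := fderiv ℝ f ξ (unitVec i)

theorem contDiff_pd {f : Config → F} (h : ContDiff ℝ ∞ f) (i : Idx) : ContDiff ℝ ∞ (pd i f) :=
  (h.fderiv_right (m := ∞) (by simp)).clm_apply contDiff_const

theorem hasCompactSupport_pd {f : Config → F} (h : HasCompactSupport f) (i : Idx) :
    HasCompactSupport (pd i f) := h.fderiv_apply (𝕜 := ℝ) _

theorem pd_add {f g : Config → F} (hf : Differentiable ℝ f) (hg : Differentiable ℝ g) (i : Idx) :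
    pd i (fun ξ => f ξ + g ξ) = fun ξ => pd i f ξ + pd i g ξ := by
  ext1 ξ; simp only [pd]; rw [fderiv_fun_add (hf ξ) (hg ξ)]; simp

theorem pd_sum {ι : Type*} {s : Finset ι} {f : ι → Config → F}
    (hf : ∀ j, Differentiable ℝ (f j)) (i : Idx) :
    pd i (fun ξ => ∑ j ∈ s, f j ξ) = fun ξ => ∑ j ∈ s, pd i (f j) ξ := by
  ext1 ξ; simp only [pd]; rw [fderiv_fun_sum (fun j _ => hf j ξ)]; simp

theorem pd_clm {G : Type*} [NormedAddCommGroup G] [NormedSpace ℝ G] (A : F →L[ℝ] G)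
    {f : Config → F} (hf : Differentiable ℝ f) (i : Idx) :
    pd i (fun ξ => A (f ξ)) = fun ξ => A (pd i f ξ) := by
  ext1 ξ
  have := (A.hasFDerivAt (x := f ξ)).comp ξ (hf ξ).hasFDerivAt
  simp only [pd]
  rw [show (fun ξ => A (f ξ)) = A ∘ f from rfl, this.fderiv]; simp

theorem pd_smul {c : Config → ℝ} {f : Config → F} {ξ : Config} (hc : DifferentiableAt ℝ c ξ)
    (hf : DifferentiableAt ℝ f ξ) (i : Idx) :
    pd i (fun ξ => c ξ • f ξ) ξ = c ξ • pd i f ξ + pd i c ξ • f ξ := by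
  simp only [pd]; rw [fderiv_fun_smul hc hf]; simp

theorem pd_comm {f : Config → F} (hf : ContDiff ℝ ∞ f) (i j : Idx) :
    pd i (pd j f) = pd j (pd i f) := by
  ext1 ξ
  have h2 : ∀ v w : Config, fderiv ℝ (fun η => fderiv ℝ f η v) ξ w
      = fderiv ℝ (fderiv ℝ f) ξ w v := by
    intro v w
    have hd : DifferentiableAt ℝ (fderiv ℝ f) ξ :=
      ((hf.fderiv_right (m := ∞) (by simp)).differentiable (by simp)) ξ
    rw [fderiv_clm_apply hd (differentiableAt_const v)]
    simp
  have hs : IsSymmSndFDerivAt ℝ f ξ :=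
    (hf.contDiffAt).isSymmSndFDerivAt (by
      simp only [minSmoothness_of_isRCLikeNormedField]
      exact WithTop.coe_le_coe.2 (le_top (a := (2 : ℕ∞))))
  unfold pd
  rw [h2, h2]
  exact hs _ _

theorem laplacian_eq_sum_pd {f : Config → F} (hf : ContDiff ℝ ∞ f) (ξ : Config) :
    Δ f ξ = ∑ i : Idx, pd i (pd i f) ξ := by
  rw [InnerProductSpace.laplacian_eq_iteratedFDeriv_orthonormalBasis f
    (EuclideanSpace.basisFun Idx ℝ)]
  refine Finset.sum_congr rfl fun i _ => ?_
  rw [iteratedFDeriv_two_apply]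
  have hd : DifferentiableAt ℝ (fderiv ℝ f) ξ :=
    ((hf.fderiv_right (m := ∞) (by simp)).differentiable (by simp)) ξ
  unfold pd
  rw [fderiv_clm_apply hd (differentiableAt_const _)]
  simp

/-- The integral of a derivative in a fixed direction vanishes. The function need only be
differentiable along that direction. -/
theorem integral_lineDeriv_eq_zero {f f' : Config → F} {v : Config} (hf : Continuous f)
    (hfc : HasCompactSupport f) (hf' : Continuous f') (hfc' : HasCompactSupport f')
    (h : ∀ ξ, HasLineDerivAt ℝ f (f' ξ) ξ v) : ∫ ξ, f' ξ = 0 := by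
  have := integral_bilinear_hasLineDerivAt_right_eq_neg_left_of_integrable (μ := volume)
    (f := fun _ : Config => (1 : ℝ)) (f' := fun _ => 0) (g := f) (g' := f') (v := v)
    (B := ContinuousLinearMap.lsmul ℝ ℝ) (by simp)
    (by simpa using hf'.integrable_of_hasCompactSupport hfc')
    (by simpa using hf.integrable_of_hasCompactSupport hfc)
    (fun x _ => by simpa using (hasFDerivAt_const (1:ℝ) x).hasLineDerivAt v) (fun x _ => h x)
  simpa using this

theorem integral_pd_eq_zero {f : Config → F} (hf : ContDiff ℝ 1 f) (hfc : HasCompactSupport f)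
    (i : Idx) : ∫ ξ, pd i f ξ = 0 :=
  integral_lineDeriv_eq_zero (v := unitVec i) hf.continuous hfc
    ((hf.continuous_fderiv (by simp)).clm_apply continuous_const)
    (hasCompactSupport_pd hfc i)
    fun ξ => ((hf.differentiable (by simp)) ξ).hasFDerivAt.hasLineDerivAt _

end Calculus

/-! The coordinate functions. -/

theorem contDiff_coord (i : Idx) {n : WithTop ℕ∞} : ContDiff ℝ n (fun ξ : Config => ξ i) := by
  fun_prop

theorem pd_coord (i j : Idx) (ξ : Config) :
    pd i (fun ξ : Config => ξ j) ξ = if i = j then 1 else 0 := by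
  have : HasFDerivAt (fun ξ : Config => ξ j) (EuclideanSpace.proj j : Config →L[ℝ] ℝ) ξ :=
    (EuclideanSpace.proj j : Config →L[ℝ] ℝ).hasFDerivAt
  simp [pd, this.fderiv, eq_comm]

@[fun_prop]
theorem contDiff_qc (j : Fin 4) {n : WithTop ℕ∞} : ContDiff ℝ n (fun ξ => qc ξ j) :=
  contDiff_coord _

@[fun_prop]
theorem contDiff_xc (j : Fin 5) {n : WithTop ℕ∞} : ContDiff ℝ n (fun ξ => xc ξ j) :=
  contDiff_coord _

@[fun_prop]
theorem continuous_qc (j : Fin 4) : Continuous (fun ξ => qc ξ j) :=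
  (contDiff_qc j (n := 0)).continuous

@[fun_prop]
theorem continuous_xc (j : Fin 5) : Continuous (fun ξ => xc ξ j) :=
  (contDiff_xc j (n := 0)).continuous

@[fun_prop]
theorem differentiable_qc (j : Fin 4) : Differentiable ℝ (fun ξ => qc ξ j) :=
  (contDiff_qc j (n := 1)).differentiable (by simp)

@[fun_prop]
theorem differentiable_xc (j : Fin 5) : Differentiable ℝ (fun ξ => xc ξ j) :=
  (contDiff_xc j (n := 1)).differentiable (by simp)

/-! Test functions. -/

section TestFunctions

variable {V : Type*} [NormedAddCommGroup V] [InnerProductSpace ℂ V]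

/-- `g ∈ C₀^∞(X; V)`. -/
def IsTestFn (g : Config → V) : Prop := ContDiff ℝ ∞ g ∧ HasCompactSupport g

theorem IsTestFn.continuous {g : Config → V} (h : IsTestFn g) : Continuous g := h.1.continuous

theorem IsTestFn.differentiable {g : Config → V} (h : IsTestFn g) : Differentiable ℝ g :=
  h.1.differentiable (by simp)

theorem IsTestFn.pd {g : Config → V} (h : IsTestFn g) (i : Idx) : IsTestFn (pd i g) :=
  ⟨contDiff_pd h.1 i, hasCompactSupport_pd h.2 i⟩

theorem IsTestFn.add {f g : Config → V} (hf : IsTestFn f) (hg : IsTestFn g) :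
    IsTestFn (fun ξ => f ξ + g ξ) := ⟨hf.1.add hg.1, hf.2.add hg.2⟩

theorem IsTestFn.clm {g : Config → V} (h : IsTestFn g) (A : V →L[ℂ] V) :
    IsTestFn (fun ξ => A (g ξ)) := by
  refine ⟨?_, HasCompactSupport.intro h.2 fun ξ hξ => ?_⟩
  · have hA : ContDiff ℝ ∞ (A.restrictScalars ℝ) := ContinuousLinearMap.contDiff _
    exact hA.comp h.1
  · rw [image_eq_zero_of_notMem_tsupport hξ, map_zero]

theorem IsTestFn.smul {g : Config → V} (h : IsTestFn g) {c : Config → ℝ} (hc : ContDiff ℝ ∞ c) :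
    IsTestFn (fun ξ => c ξ • g ξ) := by
  refine ⟨ContDiff.smul (F := V) (f := c) hc h.1, HasCompactSupport.intro h.2 fun ξ hξ => ?_⟩
  rw [image_eq_zero_of_notMem_tsupport hξ, smul_zero]

theorem IsTestFn.const_smul {g : Config → V} (h : IsTestFn g) (c : ℂ) :
    IsTestFn (fun ξ => c • g ξ) := h.clm (c • ContinuousLinearMap.id ℂ V)

theorem isTestFn_zero : IsTestFn (fun _ : Config => (0 : V)) := ⟨contDiff_const, HasCompactSupport.zero⟩

theorem IsTestFn.sum {ι : Type*} {s : Finset ι} {f : ι → Config → V}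
    (hf : ∀ j ∈ s, IsTestFn (f j)) : IsTestFn (fun ξ => ∑ j ∈ s, f j ξ) := by
  classical
  induction s using Finset.induction_on with
  | empty => simpa using isTestFn_zero
  | insert a s ha ih =>
    simp only [Finset.sum_insert ha]
    exact (hf a (by simp)).add (ih fun j hj => hf j (by simp [hj]))

theorem IsTestFn.memLp {g : Config → V} (h : IsTestFn g) :
    MemLp g 2 (volume : Measure Config) :=
  h.continuous.memLp_of_hasCompactSupport h.2

theorem pd_clm_complex (A : V →L[ℂ] V) {f : Config → V}
    (hf : Differentiable ℝ f) (i : Idx) :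
    pd i (fun ξ => A (f ξ)) = fun ξ => A (pd i f ξ) :=
  pd_clm (A.restrictScalars ℝ) hf i

theorem pd_inner {f g : Config → V} (hf : Differentiable ℝ f) (hg : Differentiable ℝ g)
    (i : Idx) (ξ : Config) :
    pd i (fun ξ => inner ℂ (f ξ) (g ξ)) ξ = inner ℂ (f ξ) (pd i g ξ) + inner ℂ (pd i f ξ) (g ξ) := by
  simp only [pd]
  rw [((hf ξ).hasFDerivAt.inner ℂ (hg ξ).hasFDerivAt).fderiv]
  simp

theorem pd_normSq {g : Config → V} (hg : Differentiable ℝ g)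
    (i : Idx) (ξ : Config) :
    pd i (fun ξ => ‖g ξ‖ ^ 2) ξ = 2 * (inner ℂ (g ξ) (pd i g ξ)).re := by
  have h1 : (fun ξ => ‖g ξ‖ ^ 2) = fun ξ => Complex.reCLM (inner ℂ (g ξ) (g ξ)) := by
    ext η
    have := inner_self_eq_norm_sq (𝕜 := ℂ) (g η)
    simpa using this.symm
  have hd : Differentiable ℝ fun ξ => inner ℂ (g ξ) (g ξ) := hg.inner ℂ hg
  rw [h1, pd_clm Complex.reCLM hd]
  simp only [pd_inner hg hg, Complex.reCLM_apply, Complex.add_re]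
  have := inner_re_symm (𝕜 := ℂ) (g ξ) (pd i g ξ)
  simp only [RCLike.re_to_complex] at this
  linarith

theorem HasCompactSupport.inner_left {f g : Config → V} (hf : HasCompactSupport f) :
    HasCompactSupport fun ξ => inner ℂ (f ξ) (g ξ) :=
  HasCompactSupport.intro hf fun ξ hξ => by
    rw [image_eq_zero_of_notMem_tsupport hξ, inner_zero_left]

theorem integrable_inner_cont {f g : Config → V} (hf : Continuous f) (hfc : HasCompactSupport f)
    (hg : Continuous g) : Integrable fun ξ => inner ℂ (f ξ) (g ξ) :=
  (hf.inner (𝕜 := ℂ) hg).integrable_of_hasCompactSupport (HasCompactSupport.inner_left hfc)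

/-- Integration by parts: `∂_i` is formally skew-symmetric. -/
theorem integral_inner_pd {f g : Config → V} (hf : IsTestFn f) (hg : ContDiff ℝ ∞ g) (i : Idx) :
    ∫ ξ, inner ℂ (pd i f ξ) (g ξ) = - ∫ ξ, inner ℂ (f ξ) (pd i g ξ) := by
  have hgd : Differentiable ℝ g := hg.differentiable (by simp)
  have h1 : ∫ ξ, pd i (fun ξ => inner ℂ (f ξ) (g ξ)) ξ = 0 :=
    integral_pd_eq_zero ((hf.1.inner ℂ hg).of_le (by simp)) (HasCompactSupport.inner_left hf.2) i
  simp only [pd_inner hf.differentiable hgd] at h1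
  rw [integral_add (integrable_inner_cont hf.continuous hf.2 (contDiff_pd hg i).continuous)
    (integrable_inner_cont (hf.pd i).continuous (hf.pd i).2 hg.continuous)] at h1
  linear_combination h1

end TestFunctions

end DeformedSQM

namespace DeformedSQM

/-! ### Clifford algebra -/

section Bilinear

variable {A : Type*} [Ring A] [Algebra ℂ A]

/-- The bilinear expression `∑ a b, θ_a M_ab η_b` in two families of elements of an algebra. -/
def bil (θ : Fin 8 → A) (M : Matrix (Fin 8) (Fin 8) ℝ) (η : Fin 8 → A) : A :=
  ∑ a, ∑ b, (M a b : ℂ) • (θ a * η b)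

/-- The Clifford relations of the sixteen generators `ψ_a`, `λ_a`. -/
structure CliffordRel (psi lam : Fin 8 → A) : Prop where
  psi_anticomm : ∀ a b, psi a * psi b + psi b * psi a = (if a = b then (1 : ℂ) else 0) • 1
  lam_anticomm : ∀ a b, lam a * lam b + lam b * lam a = (if a = b then (1 : ℂ) else 0) • 1
  lam_psi_anticomm : ∀ a b, lam a * psi b + psi b * lam a = 0

/-- The Clifford vector `∑ v_a g_a` in all generators: `ψ` on the left summand, `λ` on the right. -/
def cliff (psi lam : Fin 8 → A) (v : Fin 8 ⊕ Fin 8 → ℝ) : A :=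
  ∑ a, (v a : ℂ) • Sum.elim psi lam a

/-- The fermionic part `-½ ψ s² ψ` of the generator of rotations. -/
def rotGen (psi : Fin 8 → A) : A := (-(1 / 2) : ℂ) • bil psi (sMat 1) psi

theorem bil_add (θ η : Fin 8 → A) (M N : Matrix (Fin 8) (Fin 8) ℝ) :
    bil θ (M + N) η = bil θ M η + bil θ N η := by
  simp [bil, add_smul, Finset.sum_add_distrib]

theorem bil_smul (θ η : Fin 8 → A) (r : ℝ) (M : Matrix (Fin 8) (Fin 8) ℝ) :
    bil θ (r • M) η = (r : ℂ) • bil θ M η := by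
  simp [bil, mul_smul, Finset.smul_sum]

theorem bil_sum {ι : Type*} (s : Finset ι) (θ η : Fin 8 → A)
    (M : ι → Matrix (Fin 8) (Fin 8) ℝ) :
    bil θ (∑ i ∈ s, M i) η = ∑ i ∈ s, bil θ (M i) η := by
  classical
  induction s using Finset.induction_on with
  | empty => simp [bil]
  | insert a s ha ih => rw [Finset.sum_insert ha, Finset.sum_insert ha, bil_add, ih]

namespace CliffordRel

variable {psi lam : Fin 8 → A}

theorem gen_anticomm (h : CliffordRel psi lam) (a b : Fin 8 ⊕ Fin 8) :
    Sum.elim psi lam a * Sum.elim psi lam b + Sum.elim psi lam b * Sum.elim psi lam a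
      = (if a = b then (1 : ℂ) else 0) • 1 := by
  rcases a with a | a <;> rcases b with b | b
  · simpa using h.psi_anticomm a b
  · simpa [add_comm] using h.lam_psi_anticomm b a
  · simpa using h.lam_psi_anticomm a b
  · simpa using h.lam_anticomm a b

theorem cliff_anticomm (h : CliffordRel psi lam) (v w : Fin 8 ⊕ Fin 8 → ℝ) :
    cliff psi lam v * cliff psi lam w + cliff psi lam w * cliff psi lam v
      = ((∑ a, v a * w a : ℝ) : ℂ) • 1 := by
  simp only [cliff, Finset.sum_mul_sum]
  rw [Finset.sum_comm (f := fun i j => (w i : ℂ) • Sum.elim psi lam i * (v j : ℂ) • Sum.elim psi lam j),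
    ← Finset.sum_add_distrib]
  have h : ∀ a b, (v a : ℂ) • Sum.elim psi lam a * (w b : ℂ) • Sum.elim psi lam b
      + (w b : ℂ) • Sum.elim psi lam b * (v a : ℂ) • Sum.elim psi lam a
      = (if a = b then ((v a * w a : ℝ) : ℂ) else 0) • (1 : A) := by
    intro a b
    rw [smul_mul_smul_comm, smul_mul_smul_comm, mul_comm (w b : ℂ), ← smul_add, h.gen_anticomm,
      smul_smul]
    by_cases hab : a = b
    · subst hab; simp
    · simp [hab]
  simp only [← Finset.sum_add_distrib, h, ← Finset.sum_smul]
  congr 1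
  simp

theorem cliff_sq (h : CliffordRel psi lam) (v : Fin 8 ⊕ Fin 8 → ℝ) :
    cliff psi lam v * cliff psi lam v = (((∑ a, v a ^ 2) / 2 : ℝ) : ℂ) • 1 := by
  have h := h.cliff_anticomm v v
  have h2 : (2 : ℂ) • (cliff psi lam v * cliff psi lam v)
      = ((∑ a, v a * v a : ℝ) : ℂ) • (1 : A) := by
    rw [two_smul, h]
  have : cliff psi lam v * cliff psi lam v
      = (2 : ℂ)⁻¹ • ((2 : ℂ) • (cliff psi lam v * cliff psi lam v)) := by
    rw [smul_smul]; norm_num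
  rw [this, h2, smul_smul]
  congr 1
  push_cast
  simp only [pow_two]
  ring

/-- `ψ A λ = -λ Aᵀ ψ`. -/
theorem bil_psi_lam (h : CliffordRel psi lam) (M : Matrix (Fin 8) (Fin 8) ℝ) :
    bil psi M lam = bil lam (-M.transpose) psi := by
  simp only [bil]
  rw [Finset.sum_comm]
  refine Finset.sum_congr rfl fun b _ => Finset.sum_congr rfl fun a _ => ?_
  have := h.lam_psi_anticomm b a
  rw [eq_neg_of_add_eq_zero_right this]
  simp

/-- In `ψ A ψ` only the antisymmetric part and the trace of `A` matter. -/
theorem bil_psi_congr (h : CliffordRel psi lam) {M N : Matrix (Fin 8) (Fin 8) ℝ}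
    (hs : M - M.transpose = N - N.transpose) (htr : M.trace = N.trace) :
    bil psi M psi = bil psi N psi := by
  have key : ∀ M : Matrix (Fin 8) (Fin 8) ℝ, (2 : ℂ) • bil psi M psi =
      bil psi (M - M.transpose) psi + (M.trace : ℂ) • 1 := by
    intro A
    have h1 : bil psi A.transpose psi = ∑ a, ∑ b, (A a b : ℂ) • (psi b * psi a) := by
      rw [bil, Finset.sum_comm]; rfl
    have h2 : bil psi A psi + bil psi A.transpose psi = (A.trace : ℂ) • 1 := by
      rw [h1, bil]
      simp only [← Finset.sum_add_distrib, ← smul_add, h.psi_anticomm, smul_smul]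
      simp [Matrix.trace, Finset.sum_smul]
    rw [sub_eq_add_neg, show -A.transpose = (-1 : ℝ) • A.transpose by simp, bil_add, bil_smul,
      ← h2, two_smul]
    push_cast
    simp only [neg_smul, one_smul]
    abel
  have : (2 : ℂ) • bil psi M psi = (2 : ℂ) • bil psi N psi := by rw [key, key, hs, htr]
  have h3 := congrArg (fun x => (2 : ℂ)⁻¹ • x) this
  simpa [smul_smul] using h3

theorem psi_mul_psi_comm (h : CliffordRel psi lam) (c d b : Fin 8) :
    psi c * psi d * psi b - psi b * (psi c * psi d) =
      (if d = b then (1 : ℂ) else 0) • psi c - (if c = b then (1 : ℂ) else 0) • psi d := by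
  have h1 : psi d * psi b = (if d = b then (1 : ℂ) else 0) • 1 - psi b * psi d :=
    eq_sub_of_add_eq (h.psi_anticomm d b)
  have h2 : psi b * psi c = (if c = b then (1 : ℂ) else 0) • 1 - psi c * psi b := by
    rw [← h.psi_anticomm c b]; abel
  rw [mul_assoc, h1, ← mul_assoc, h2]
  simp only [mul_sub, sub_mul, mul_smul_comm, smul_mul_assoc, mul_one, one_mul, mul_assoc]
  abel

theorem psi_mul_lam_comm (h : CliffordRel psi lam) (c d b : Fin 8) :
    psi c * psi d * lam b - lam b * (psi c * psi d) = 0 := by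
  have h1 : psi d * lam b = - (lam b * psi d) :=
    eq_neg_of_add_eq_zero_right (h.lam_psi_anticomm b d)
  have h2 : psi c * lam b = - (lam b * psi c) :=
    eq_neg_of_add_eq_zero_right (h.lam_psi_anticomm b c)
  rw [mul_assoc, h1, mul_neg, ← mul_assoc, h2]
  simp [mul_assoc]

end CliffordRel

theorem block_apply (A B C D : Matrix (Fin 4) (Fin 4) ℝ) (i j : Fin 8) :
    block A B C D i j = Matrix.fromBlocks A B C D
      ((![Sum.inl 0, Sum.inl 1, Sum.inl 2, Sum.inl 3, Sum.inr 0, Sum.inr 1, Sum.inr 2,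
        Sum.inr 3] : Fin 8 → Fin 4 ⊕ Fin 4) i)
      ((![Sum.inl 0, Sum.inl 1, Sum.inl 2, Sum.inl 3, Sum.inr 0, Sum.inr 1, Sum.inr 2,
        Sum.inr 3] : Fin 8 → Fin 4 ⊕ Fin 4) j) := by
  fin_cases i <;> fin_cases j <;> rfl

theorem block_mul (A B C D A' B' C' D' : Matrix (Fin 4) (Fin 4) ℝ) :
    block A B C D * block A' B' C' D' = block (A * A' + B * C') (A * B' + B * D')
      (C * A' + D * C') (C * B' + D * D') := by
  unfold block
  rw [Matrix.reindex_apply, Matrix.reindex_apply, Matrix.reindex_apply, Matrix.submatrix_mul_equiv,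
    Matrix.fromBlocks_multiply]

theorem sMat_one_antisymm (a b : Fin 8) : sMat 1 a b = - sMat 1 b a := by
  fin_cases a <;> fin_cases b <;> simp [sMat, block_apply, quatR]

namespace CliffordRel

variable {psi lam : Fin 8 → A}

/-- `[X, ψ_b] = (s² ψ)_b`. -/
theorem rotGen_comm_psi (h : CliffordRel psi lam) (b : Fin 8) :
    rotGen psi * psi b - psi b * rotGen psi = ∑ d, (sMat 1 b d : ℂ) • psi d := by
  have h : bil psi (sMat 1) psi * psi b - psi b * bil psi (sMat 1) psi
      = ∑ c, ∑ d, (sMat 1 c d : ℂ) • ((if d = b then (1 : ℂ) else 0) • psi c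
        - (if c = b then (1 : ℂ) else 0) • psi d) := by
    simp only [bil, Finset.sum_mul, Finset.mul_sum, ← Finset.sum_sub_distrib, smul_mul_assoc,
      mul_smul_comm, ← smul_sub, h.psi_mul_psi_comm]
  have h2 : ∑ c, ∑ d, (sMat 1 c d : ℂ) • ((if d = b then (1 : ℂ) else 0) • psi c
        - (if c = b then (1 : ℂ) else 0) • psi d) = (-2 : ℂ) • ∑ d, (sMat 1 b d : ℂ) • psi d := by
    have e1 : ∀ c, ∑ d, (sMat 1 c d : ℂ) • ((if d = b then (1 : ℂ) else 0) • psi c)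
        = (sMat 1 c b : ℂ) • psi c := fun c => by
      rw [Finset.sum_eq_single b] <;> simp +contextual
    have e2 : ∑ c, ∑ d, (sMat 1 c d : ℂ) • ((if c = b then (1 : ℂ) else 0) • psi d)
        = ∑ d, (sMat 1 b d : ℂ) • psi d := by
      rw [Finset.sum_eq_single b] <;> simp +contextual
    simp only [smul_sub, Finset.sum_sub_distrib]
    rw [e2]
    simp only [e1]
    rw [Finset.smul_sum, ← Finset.sum_sub_distrib]
    refine Finset.sum_congr rfl fun c _ => ?_
    rw [sMat_one_antisymm c b, ← sub_smul, smul_smul]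
    congr 1; push_cast; ring
  unfold rotGen
  rw [smul_mul_assoc, mul_smul_comm, ← smul_sub, h, h2, smul_smul]
  norm_num

theorem rotGen_comm_lam (h : CliffordRel psi lam) (b : Fin 8) :
    rotGen psi * lam b - lam b * rotGen psi = 0 := by
  unfold rotGen
  rw [smul_mul_assoc, mul_smul_comm, ← smul_sub]
  simp only [bil, Finset.sum_mul, Finset.mul_sum, ← Finset.sum_sub_distrib, smul_mul_assoc,
      mul_smul_comm, ← smul_sub, h.psi_mul_lam_comm]
  simp

end CliffordRel

end Bilinear

end DeformedSQM

namespace DeformedSQM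

/-! ### The model over an abstract representation of the Clifford algebra -/

/-- A finite-dimensional Hilbert space with self-adjoint generators of the Clifford algebra, a parity
operator, and a vector `vac` which is the unique ground state of the number operator
`-2i ∑ λ_a ψ_a`, whose other eigenvalues are at least `-6`. -/
structure FermionRep (V : Type*) [NormedAddCommGroup V] [InnerProductSpace ℂ V]
    [CompleteSpace V] where
  psi : Fin 8 → V →L[ℂ] V
  lam : Fin 8 → V →L[ℂ] V
  rel : CliffordRel psi lam
  psi_sa : ∀ a, IsSelfAdjoint (psi a)
  lam_sa : ∀ a, IsSelfAdjoint (lam a)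
  par : V →L[ℂ] V
  par_sq : par * par = 1
  par_sa : IsSelfAdjoint par
  par_psi : ∀ a, par * psi a = -(psi a * par)
  par_lam : ∀ a, par * lam a = -(lam a * par)
  vac : V
  norm_vac : ‖vac‖ = 1
  par_vac : par vac = vac
  num_vac : (-(2 * Complex.I)) • ∑ a, lam a (psi a vac) = (-8 : ℂ) • vac
  num_gap : ∀ v : V, 6 * ‖v‖ ^ 2 + 2 * ‖inner ℂ vac v‖ ^ 2
    + (inner ℂ v ((-(2 * Complex.I)) • ∑ a, lam a (psi a v))).re ≥ 0

variable {V : Type*} [NormedAddCommGroup V] [InnerProductSpace ℂ V]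

/-- The generator `T = q₁∂₂ - q₂∂₁ + q₃∂₄ - q₄∂₃` of the rotations of `q`. -/
def rotT {F : Type*} [NormedAddCommGroup F] [NormedSpace ℝ F] (φ : Config → F) (ξ : Config) : F :=
  (qc ξ 0 • pd (Sum.inl 1) φ ξ - qc ξ 1 • pd (Sum.inl 0) φ ξ)
    + (qc ξ 2 • pd (Sum.inl 3) φ ξ - qc ξ 3 • pd (Sum.inl 2) φ ξ)

/-- The unit vector in `ℝ⁸ ⊕ ℝ⁸` giving the Clifford generator that multiplies `-i∂_i` in the
supercharge. -/
def chg : Idx → Fin 8 ⊕ Fin 8 → ℝ :=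
  Sum.elim
    ![Sum.elim ![1, 0, 0, 0, 0, 0, 0, 0] 0, Sum.elim ![0, -1, 0, 0, 0, 0, 0, 0] 0,
      Sum.elim ![0, 0, -1, 0, 0, 0, 0, 0] 0, Sum.elim ![0, 0, 0, -1, 0, 0, 0, 0] 0]
    ![Sum.elim 0 ![-1, 0, 0, 0, 0, 0, 0, 0], Sum.elim 0 ![0, 0, 0, 0, -1, 0, 0, 0],
      Sum.elim 0 ![0, 0, 0, 0, 0, 0, 0, 1], Sum.elim 0 ![0, 0, 0, 0, 0, 1, 0, 0],
      Sum.elim 0 ![0, 0, 0, 0, 0, 0, 1, 0]]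

/-- The coefficients of the multiplicative part of the supercharge: the `ψ`-coefficients are bilinear
in `x` and `q`, the `λ`-coefficients are the moment maps, the first of them shifted by `k`. -/
def superpot (k : ℝ) (ξ : Config) : Fin 8 ⊕ Fin 8 → ℝ :=
  let q := qc ξ
  let x := xc ξ
  Sum.elim
    ![-(x 0 * q 1), -(x 0 * q 0), x 0 * q 3, -(x 0 * q 2),
      -(x 1 * q 1) - x 2 * q 2 - x 3 * q 0 + x 4 * q 3,
      -(x 1 * q 0) + x 2 * q 3 + x 3 * q 1 + x 4 * q 2,
      x 1 * q 3 + x 2 * q 0 - x 3 * q 2 + x 4 * q 1,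
      -(x 1 * q 2) + x 2 * q 1 - x 3 * q 3 - x 4 * q 0]
    ![0, (1 / 2) * (q 0 * q 0 + q 1 * q 1 - q 2 * q 2 - q 3 * q 3) - k,
      q 1 * q 2 - q 0 * q 3, q 0 * q 2 + q 1 * q 3, 0, 0, 0, 0]

/-- The partial derivatives of `superpot`. -/
def dSuperpot (ξ : Config) : Idx → Fin 8 ⊕ Fin 8 → ℝ :=
  let q := qc ξ
  let x := xc ξ
  Sum.elim
    ![Sum.elim ![0, -x 0, 0, 0, -x 3, -x 1, x 2, -x 4] ![0, q 0, -q 3, q 2, 0, 0, 0, 0],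
      Sum.elim ![-x 0, 0, 0, 0, -x 1, x 3, x 4, x 2] ![0, q 1, q 2, q 3, 0, 0, 0, 0],
      Sum.elim ![0, 0, 0, -x 0, -x 2, x 4, -x 3, -x 1] ![0, -q 2, q 1, q 0, 0, 0, 0, 0],
      Sum.elim ![0, 0, x 0, 0, x 4, x 2, x 1, -x 3] ![0, -q 3, -q 0, q 1, 0, 0, 0, 0]]
    ![Sum.elim ![-q 1, -q 0, q 3, -q 2, 0, 0, 0, 0] 0,
      Sum.elim ![0, 0, 0, 0, -q 1, -q 0, q 3, -q 2] 0,
      Sum.elim ![0, 0, 0, 0, -q 2, q 3, q 0, q 1] 0,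
      Sum.elim ![0, 0, 0, 0, -q 0, q 1, -q 2, -q 3] 0,
      Sum.elim ![0, 0, 0, 0, q 3, q 2, q 1, -q 0] 0]

/-- The deformed scalar potential `V_k = V + k² + k(q₃² + q₄²) - k(q₁² + q₂²)`. -/
def potDef (k : ℝ) (ξ : Config) : ℝ :=
  potV ξ + (k ^ 2 + k * (qc ξ 2 ^ 2 + qc ξ 3 ^ 2) - k * (qc ξ 0 ^ 2 + qc ξ 1 ^ 2))

theorem pd_qc (i : Idx) (j : Fin 4) (ξ : Config) :
    pd i (fun ξ => qc ξ j) ξ = if i = Sum.inl j then 1 else 0 := pd_coord i _ ξ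

theorem pd_xc (i : Idx) (j : Fin 5) (ξ : Config) :
    pd i (fun ξ => xc ξ j) ξ = if i = Sum.inr j then 1 else 0 := pd_coord i _ ξ

theorem pd_mul {f g : Config → ℝ} {ξ : Config} (hf : DifferentiableAt ℝ f ξ)
    (hg : DifferentiableAt ℝ g ξ) (i : Idx) :
    pd i (fun ξ => f ξ * g ξ) ξ = f ξ * pd i g ξ + pd i f ξ * g ξ := pd_smul hf hg i

theorem pd_add_at {F : Type*} [NormedAddCommGroup F] [NormedSpace ℝ F] {f g : Config → F}
    {ξ : Config} (hf : DifferentiableAt ℝ f ξ) (hg : DifferentiableAt ℝ g ξ) (i : Idx) :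
    pd i (fun ξ => f ξ + g ξ) ξ = pd i f ξ + pd i g ξ := by
  simp only [pd]; rw [fderiv_fun_add hf hg]; simp

theorem pd_sub_at {F : Type*} [NormedAddCommGroup F] [NormedSpace ℝ F] {f g : Config → F}
    {ξ : Config} (hf : DifferentiableAt ℝ f ξ) (hg : DifferentiableAt ℝ g ξ) (i : Idx) :
    pd i (fun ξ => f ξ - g ξ) ξ = pd i f ξ - pd i g ξ := by
  simp only [pd]; rw [fderiv_fun_sub hf hg]; simp

theorem pd_neg {F : Type*} [NormedAddCommGroup F] [NormedSpace ℝ F] (f : Config → F)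
    (ξ : Config) (i : Idx) : pd i (fun ξ => - f ξ) ξ = - pd i f ξ := by
  simp [pd]

theorem pd_const {F : Type*} [NormedAddCommGroup F] [NormedSpace ℝ F] (c : F)
    (ξ : Config) (i : Idx) : pd i (fun _ => c) ξ = 0 := by
  simp [pd]

theorem contDiff_superpot (k : ℝ) (a : Fin 8 ⊕ Fin 8) {n : WithTop ℕ∞} :
    ContDiff ℝ n (fun ξ => superpot k ξ a) := by
  rcases a with a | a <;> fin_cases a <;> simp [superpot] <;> fun_prop

theorem pd_superpot (k : ℝ) (i : Idx) (a : Fin 8 ⊕ Fin 8) (ξ : Config) :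
    pd i (fun ξ => superpot k ξ a) ξ = dSuperpot ξ i a := by
  rcases a with a | a <;> fin_cases a <;>
  · simp (disch := fun_prop) only [superpot, Sum.elim_inl, Sum.elim_inr, Fin.zero_eta, Fin.mk_one,
      Fin.reduceFinMk, Matrix.cons_val, pd_mul, pd_add_at, pd_sub_at, pd_neg, pd_const, pd_qc,
      pd_xc]
    rcases i with i | i <;> fin_cases i <;> simp [dSuperpot] <;> ring

end DeformedSQM

namespace DeformedSQM

/-! ### Matrix identities behind supersymmetry -/

section Bilinear

variable {A : Type*} [Ring A] [Algebra ℂ A] {psi lam : Fin 8 → A}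

theorem cliff_mul_cliff (u w : Fin 8 ⊕ Fin 8 → ℝ) :
    cliff psi lam u * cliff psi lam w =
      bil psi (Matrix.vecMulVec (u ∘ Sum.inl) (w ∘ Sum.inl)) psi
        + bil psi (Matrix.vecMulVec (u ∘ Sum.inl) (w ∘ Sum.inr)) lam
        + bil lam (Matrix.vecMulVec (u ∘ Sum.inr) (w ∘ Sum.inl)) psi
        + bil lam (Matrix.vecMulVec (u ∘ Sum.inr) (w ∘ Sum.inr)) lam := by
  simp only [cliff, Fintype.sum_sum_type, Sum.elim_inl, Sum.elim_inr, add_mul, mul_add,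
    Finset.sum_mul_sum, smul_mul_smul_comm, bil, Matrix.vecMulVec_apply, Function.comp_apply,
    Complex.ofReal_mul]
  abel

theorem sMat_mul_sMat_one : sMat 0 * sMat 1 = block (quatR 1) 0 0 (quatR 1) ∧
    sMat 1 * sMat 1 = block (-1) 0 0 (-1) ∧ sMat 2 * sMat 1 = block (quatR 3) 0 0 (quatR 3) ∧
    sMat 3 * sMat 1 = block (-quatR 2) 0 0 (-quatR 2) := by
  have h : ∀ j, sMat j * sMat 1 = block (quatR j * quatR 1) 0 0 (quatR j * quatR 1) := fun j => by
    rw [sMat, sMat, block_mul]; simp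
  have h1 : quatR 0 * quatR 1 = quatR 1 := by simp [quatR]
  have h2 : quatR 1 * quatR 1 = -1 := by
    ext a b; fin_cases a <;> fin_cases b <;> simp [quatR, Matrix.mul_apply, Fin.sum_univ_four]
  have h3 : quatR 2 * quatR 1 = quatR 3 := by
    ext a b; fin_cases a <;> fin_cases b <;> simp [quatR, Matrix.mul_apply, Fin.sum_univ_four]
  have h4 : quatR 3 * quatR 1 = - quatR 2 := by
    ext a b; fin_cases a <;> fin_cases b <;> simp [quatR, Matrix.mul_apply, Fin.sum_univ_four]
  exact ⟨by rw [h, h1], by rw [h, h2], by rw [h, h3], by rw [h, h4]⟩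

theorem gammaMat_mul_sMat_one :
    gammaMat 0 * sMat 1 = block (quatR 1) 0 0 (-quatR 1) ∧
    gammaMat 1 * sMat 1 = block 0 (quatR 1) (quatR 1) 0 ∧
    gammaMat 2 * sMat 1 = block 0 !![0, 0, 1, 0; 0, 0, 0, -1; 1, 0, 0, 0; 0, -1, 0, 0]
        (-!![0, 0, 1, 0; 0, 0, 0, -1; 1, 0, 0, 0; 0, -1, 0, 0]) 0 ∧
    gammaMat 3 * sMat 1 = block 0 !![-1, 0, 0, 0; 0, -1, 0, 0; 0, 0, 1, 0; 0, 0, 0, 1]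
        (-!![-1, 0, 0, 0; 0, -1, 0, 0; 0, 0, 1, 0; 0, 0, 0, 1]) 0 ∧
    gammaMat 4 * sMat 1 = block 0 !![0, 0, 0, -1; 0, 0, -1, 0; 0, -1, 0, 0; -1, 0, 0, 0]
        (-!![0, 0, 0, -1; 0, 0, -1, 0; 0, -1, 0, 0; -1, 0, 0, 0]) 0 := by
  have g0 : gammaMat 0 * sMat 1 = block (quatR 1) 0 0 (-quatR 1) := by
    change block 1 0 0 (-1) * block _ _ _ _ = _
    rw [block_mul]; simp
  have g1 : gammaMat 1 * sMat 1 = block 0 (quatR 1) (quatR 1) 0 := by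
    change block 0 1 1 0 * block _ _ _ _ = _
    rw [block_mul]; simp
  have g : ∀ L : Matrix (Fin 4) (Fin 4) ℝ, block 0 L (-L) 0 * sMat 1
      = block 0 (L * quatR 1) (-(L * quatR 1)) 0 := fun L => by
    rw [sMat, block_mul]; simp
  have g2 : gammaMat 2 * sMat 1 = block 0 (quatKL * quatR 1) (-(quatKL * quatR 1)) 0 := g _
  have g3 : gammaMat 3 * sMat 1 = block 0 (quatIL * quatR 1) (-(quatIL * quatR 1)) 0 := g _
  have g4 : gammaMat 4 * sMat 1 = block 0 (quatJL * quatR 1) (-(quatJL * quatR 1)) 0 := g _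
  have k2 : quatKL * quatR 1 = !![0, 0, 1, 0; 0, 0, 0, -1; 1, 0, 0, 0; 0, -1, 0, 0] := by
    ext a b; fin_cases a <;> fin_cases b <;>
      simp [quatR, quatKL, Matrix.mul_apply, Fin.sum_univ_four]
  have k3 : quatIL * quatR 1 = !![-1, 0, 0, 0; 0, -1, 0, 0; 0, 0, 1, 0; 0, 0, 0, 1] := by
    ext a b; fin_cases a <;> fin_cases b <;>
      simp [quatR, quatIL, Matrix.mul_apply, Fin.sum_univ_four]
  have k4 : quatJL * quatR 1 = !![0, 0, 0, -1; 0, 0, -1, 0; 0, -1, 0, 0; -1, 0, 0, 0] := by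
    ext a b; fin_cases a <;> fin_cases b <;>
      simp [quatR, quatJL, Matrix.mul_apply, Fin.sum_univ_four]
  exact ⟨g0, g1, by rw [g2, k2], by rw [g3, k3], by rw [g4, k4]⟩

set_option maxHeartbeats 1000000 in
theorem sum_sMat_mul (ξ : Config) : ∑ j, qc ξ j • (sMat j * sMat 1) =
    -(∑ i, Matrix.vecMulVec (chg i ∘ Sum.inr) (dSuperpot ξ i ∘ Sum.inl)
      - (∑ i, Matrix.vecMulVec (chg i ∘ Sum.inl) (dSuperpot ξ i ∘ Sum.inr)).transpose) := by
  obtain ⟨h1, h2, h3, h4⟩ := sMat_mul_sMat_one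
  rw [Fin.sum_univ_four, h1, h2, h3, h4]
  ext a b
  simp only [Matrix.add_apply, Matrix.smul_apply, Matrix.neg_apply,
    Matrix.sub_apply, Matrix.transpose_apply, Fintype.sum_sum_type,
    Fin.sum_univ_four, Fin.sum_univ_five, block_apply, smul_eq_mul]
  fin_cases a <;> fin_cases b <;> simp [chg, dSuperpot, quatR]

theorem sum_gammaMat_mul (ξ : Config) :
    (∑ μ, xc ξ μ • (gammaMat μ * sMat 1) + xc ξ 0 • sMat 1) -
      (∑ μ, xc ξ μ • (gammaMat μ * sMat 1) + xc ξ 0 • sMat 1).transpose =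
    ((2 : ℝ) • ∑ i, Matrix.vecMulVec (chg i ∘ Sum.inl) (dSuperpot ξ i ∘ Sum.inl)) -
      ((2 : ℝ) • ∑ i, Matrix.vecMulVec (chg i ∘ Sum.inl) (dSuperpot ξ i ∘ Sum.inl)).transpose ∧
    (∑ μ, xc ξ μ • (gammaMat μ * sMat 1) + xc ξ 0 • sMat 1).trace =
    ((2 : ℝ) • ∑ i, Matrix.vecMulVec (chg i ∘ Sum.inl) (dSuperpot ξ i ∘ Sum.inl)).trace := by
  have hs : sMat 1 = block (quatR 1) 0 0 (quatR 1) := rfl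
  obtain ⟨g0, g1, g2, g3, g4⟩ := gammaMat_mul_sMat_one
  simp only [Fin.sum_univ_five, g0, g1, g2, g3, g4]
  rw [hs]
  constructor
  · ext a b
    simp only [Matrix.smul_apply, Matrix.sub_apply, Matrix.add_apply,
      Matrix.transpose_apply, Matrix.vecMulVec_apply, Function.comp_apply, Fintype.sum_sum_type,
      Fin.sum_univ_four, Fin.sum_univ_five, block_apply, smul_eq_mul]
    fin_cases a <;> fin_cases b <;> simp [chg, dSuperpot, quatR] <;> ring
  · simp only [Matrix.trace, Matrix.diag, Fin.sum_univ_eight, Matrix.smul_apply,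
      Matrix.add_apply, Matrix.vecMulVec_apply, Function.comp_apply, Fintype.sum_sum_type,
      Fin.sum_univ_four, Fin.sum_univ_five, block_apply, smul_eq_mul]
    simp [chg, dSuperpot, quatR]

end Bilinear

end DeformedSQM

namespace DeformedSQM

theorem chg_orthonormal (i j : Idx) : ∑ a, chg i a * chg j a = if i = j then 1 else 0 := by
  rcases i with i | i <;> rcases j with j | j <;> fin_cases i <;> fin_cases j <;>
    simp [chg, Fin.sum_univ_eight]

theorem chg_superpot (k : ℝ) (ξ : Config) (i : Idx) : ∑ a, chg i a * superpot k ξ a =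
    Sum.elim ![-(xc ξ 0 * qc ξ 1), xc ξ 0 * qc ξ 0, -(xc ξ 0 * qc ξ 3), xc ξ 0 * qc ξ 2] 0 i := by
  rcases i with i | i <;> fin_cases i <;> simp [chg, superpot, Fin.sum_univ_eight]

theorem sum_superpot_sq (k : ℝ) (ξ : Config) : ∑ a, superpot k ξ a ^ 2 = potDef k ξ := by
  simp only [Fintype.sum_sum_type, Fin.sum_univ_eight, superpot, Sum.elim_inl, Sum.elim_inr,
    Matrix.cons_val, potDef, potV, Fin.sum_univ_five, Fin.sum_univ_four]
  ring

variable {V : Type*} [NormedAddCommGroup V] [InnerProductSpace ℂ V] [CompleteSpace V]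

namespace FermionRep

variable (R : FermionRep V)

/-- The Clifford vector with coefficients `v`. -/
def cl (v : Fin 8 ⊕ Fin 8 → ℝ) : V →L[ℂ] V := cliff R.psi R.lam v

/-- The fermionic part of the generator of the gauge rotations, `-½ ψ s² ψ`. -/
def rotX : V →L[ℂ] V := rotGen R.psi

/-- The momentum `p_j = -i ∂/∂q_j`. -/
def _root_.DeformedSQM.mom (j : Fin 4) (φ : Config → V) (ξ : Config) : V :=
  (-Complex.I) • fderiv ℝ φ ξ (EuclideanSpace.single (Sum.inl j) 1)

/-- The generator of gauge transformations. -/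
def gauge (φ : Config → V) (ξ : Config) : V :=
  ((qc ξ 0 : ℂ) • mom 1 φ ξ - (qc ξ 1 : ℂ) • mom 0 φ ξ)
    + ((qc ξ 2 : ℂ) • mom 3 φ ξ - (qc ξ 3 : ℂ) • mom 2 φ ξ)
    - (Complex.I / 2) • bil R.psi (sMat 1) R.psi (φ ξ)

/-- The fermionic part `H_F` of the Hamiltonian. -/
def hF (ξ : Config) : V →L[ℂ] V :=
  -Complex.I • ∑ μ, (xc ξ μ : ℂ) • bil R.psi (gammaMat μ * sMat 1) R.psi +
    (2 * Complex.I) • ∑ j, (qc ξ j : ℂ) • bil R.lam (sMat j * sMat 1) R.psi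

/-- The deformed Hamiltonian `H_k`. -/
def hD (k : ℝ) (φ : Config → V) (ξ : Config) : V :=
  (-(Δ φ ξ) + (potV ξ : ℂ) • φ ξ + R.hF ξ (φ ξ)) +
    ((k ^ 2 + k * (qc ξ 2 ^ 2 + qc ξ 3 ^ 2) - k * (qc ξ 0 ^ 2 + qc ξ 1 ^ 2) : ℝ) : ℂ) • φ ξ

/-- The gauge-covariant rotation generator `T - X`, which is `i J`. -/
def covD (φ : Config → V) (ξ : Config) : V := rotT φ ξ - R.rotX (φ ξ)

/-- The first-order operator `-i ∑ c_i ∂_i + M`; the supercharge is `√2` times it. -/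
def dirac (k : ℝ) (φ : Config → V) (ξ : Config) : V :=
  ∑ i, (-Complex.I) • R.cl (chg i) (pd i φ ξ) + R.cl (superpot k ξ) (φ ξ)

theorem gauge_eq (φ : Config → V) (ξ : Config) :
    R.gauge φ ξ = (-Complex.I) • R.covD φ ξ := by
  simp only [gauge, covD, rotT, mom, pd, rotX, rotGen, unitVec]
  simp only [smul_apply, smul_sub, smul_add, smul_smul,
    ← Complex.coe_smul (E := V)]
  have e : -Complex.I * -(1 / 2) = Complex.I / 2 := by ring
  rw [e]
  simp only [mul_comm (-Complex.I)]

theorem hD_eq (k : ℝ) {φ : Config → V} (hφ : ContDiff ℝ ∞ φ) (ξ : Config) :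
    R.hD k φ ξ = -(∑ i, pd i (pd i φ) ξ) + (potDef k ξ : ℂ) • φ ξ + R.hF ξ (φ ξ) := by
  rw [hD, laplacian_eq_sum_pd hφ, potDef, Complex.ofReal_add, add_smul]
  abel

theorem sum_cl_dSuperpot (ξ : Config) :
    (-(2 * Complex.I)) • ∑ i, R.cl (chg i) * R.cl (dSuperpot ξ i)
      = R.hF ξ + ((2 * xc ξ 0 : ℝ) : ℂ) • (Complex.I • R.rotX) := by
  have h0 : ∑ i, Matrix.vecMulVec (chg i ∘ Sum.inr) (dSuperpot ξ i ∘ Sum.inr) = 0 := by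
    ext a b
    rw [Matrix.sum_apply, Fintype.sum_sum_type]
    simp only [Matrix.vecMulVec_apply, Function.comp_apply, Fin.sum_univ_four, Fin.sum_univ_five]
    simp [chg, dSuperpot]
  have h1 : ∑ i, R.cl (chg i) * R.cl (dSuperpot ξ i) =
      bil R.psi (∑ i, Matrix.vecMulVec (chg i ∘ Sum.inl) (dSuperpot ξ i ∘ Sum.inl)) R.psi
      + bil R.lam (∑ i, Matrix.vecMulVec (chg i ∘ Sum.inr) (dSuperpot ξ i ∘ Sum.inl)
      - (∑ i, Matrix.vecMulVec (chg i ∘ Sum.inl) (dSuperpot ξ i ∘ Sum.inr)).transpose) R.psi := by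
    have e : bil R.lam (∑ i, Matrix.vecMulVec (chg i ∘ Sum.inr) (dSuperpot ξ i ∘ Sum.inr)) R.lam
        = 0 := by rw [h0]; simp [bil]
    simp only [cl, cliff_mul_cliff, Finset.sum_add_distrib, ← bil_sum]
    rw [e, R.rel.bil_psi_lam, sub_eq_add_neg, bil_add]
    abel
  have h2 : bil R.lam (∑ i, Matrix.vecMulVec (chg i ∘ Sum.inr) (dSuperpot ξ i ∘ Sum.inl)
      - (∑ i, Matrix.vecMulVec (chg i ∘ Sum.inl) (dSuperpot ξ i ∘ Sum.inr)).transpose) R.psi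
      = (-1 : ℂ) • ∑ j, (qc ξ j : ℂ) • bil R.lam (sMat j * sMat 1) R.psi := by
    have := sum_sMat_mul ξ
    rw [← neg_eq_iff_eq_neg] at this
    rw [← this, show -∑ j, qc ξ j • (sMat j * sMat 1) = (-1 : ℝ) • ∑ j, qc ξ j • (sMat j * sMat 1)
      by simp, bil_smul, bil_sum]
    simp only [bil_smul]
    push_cast
    rfl
  have h3 : (2 : ℂ) • bil R.psi
      (∑ i, Matrix.vecMulVec (chg i ∘ Sum.inl) (dSuperpot ξ i ∘ Sum.inl)) R.psi
      = ∑ μ, (xc ξ μ : ℂ) • bil R.psi (gammaMat μ * sMat 1) R.psi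
        + (xc ξ 0 : ℂ) • bil R.psi (sMat 1) R.psi := by
    have h := sum_gammaMat_mul ξ
    have := R.rel.bil_psi_congr h.1 h.2
    rw [bil_smul, bil_add, bil_smul, bil_sum] at this
    simp only [bil_smul] at this
    rw [this]; push_cast; rfl
  rw [h1, h2, hF, rotX, rotGen]
  have e : (-(2 * Complex.I)) • bil R.psi
      (∑ i, Matrix.vecMulVec (chg i ∘ Sum.inl) (dSuperpot ξ i ∘ Sum.inl)) R.psi
      = (-Complex.I) • ((2 : ℂ) • bil R.psi
      (∑ i, Matrix.vecMulVec (chg i ∘ Sum.inl) (dSuperpot ξ i ∘ Sum.inl)) R.psi) := by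
    rw [smul_smul]; congr 1; ring
  rw [smul_add, e, h3]
  simp only [smul_add, smul_smul]
  rw [show -(2 * Complex.I) * -1 = 2 * Complex.I by ring]
  rw [show ((2 * xc ξ 0 : ℝ) : ℂ) * (Complex.I * -(1 / 2)) = -Complex.I * (xc ξ 0 : ℂ) by
    push_cast; ring]
  abel

theorem cl_anticomm (v w : Fin 8 ⊕ Fin 8 → ℝ) (φ : V) :
    R.cl v (R.cl w φ) + R.cl w (R.cl v φ) = ((∑ a, v a * w a : ℝ) : ℂ) • φ := by
  have := congrArg (fun A : V →L[ℂ] V => A φ) (R.rel.cliff_anticomm v w)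
  simpa [cl] using this

theorem cl_sq (v : Fin 8 ⊕ Fin 8 → ℝ) (φ : V) :
    R.cl v (R.cl v φ) = (((∑ a, v a ^ 2) / 2 : ℝ) : ℂ) • φ := by
  have := congrArg (fun A : V →L[ℂ] V => A φ) (R.rel.cliff_sq v)
  simpa [cl] using this

theorem cl_apply (v : Fin 8 ⊕ Fin 8 → ℝ) (φ : V) :
    R.cl v φ = ∑ a, v a • (Sum.elim R.psi R.lam a) φ := by
  simp [cl, cliff]

theorem contDiff_cl_superpot (k : ℝ) {φ : Config → V} (hφ : ContDiff ℝ ∞ φ) :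
    ContDiff ℝ ∞ (fun ξ => R.cl (superpot k ξ) (φ ξ)) := by
  simp only [cl_apply]
  refine ContDiff.sum fun a _ => ContDiff.smul (F := V) (f := fun ξ => superpot k ξ a) (contDiff_superpot k a) ?_
  have hA : ContDiff ℝ ∞ ((Sum.elim R.psi R.lam a).restrictScalars ℝ) :=
    ContinuousLinearMap.contDiff _
  exact hA.comp hφ

theorem pd_cl_superpot (k : ℝ) {φ : Config → V} (hφ : Differentiable ℝ φ) (i : Idx) (ξ : Config) :
    pd i (fun ξ => R.cl (superpot k ξ) (φ ξ)) ξ =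
      R.cl (superpot k ξ) (pd i φ ξ) + R.cl (dSuperpot ξ i) (φ ξ) := by
  have hd : ∀ a, Differentiable ℝ fun ξ => superpot k ξ a := fun a =>
    (contDiff_superpot k a (n := 1)).differentiable (by simp)
  have hA : ∀ a, Differentiable ℝ fun ξ => (Sum.elim R.psi R.lam a) (φ ξ) := fun a =>
    ((Sum.elim R.psi R.lam a).restrictScalars ℝ).differentiable.comp hφ
  simp only [cl_apply]
  rw [pd_sum (f := fun a ξ => superpot k ξ a • (Sum.elim R.psi R.lam a) (φ ξ))
    fun a => (hd a).smul (hA a), ← Finset.sum_add_distrib]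
  refine Finset.sum_congr rfl fun a _ => ?_
  rw [pd_smul (hd a ξ) (hA a ξ), pd_superpot, pd_clm_complex _ hφ]

theorem isTestFn_dirac (k : ℝ) {φ : Config → V} (hφ : IsTestFn φ) : IsTestFn (R.dirac k φ) := by
  refine IsTestFn.add (f := fun ξ => ∑ i, (-Complex.I) • R.cl (chg i) (pd i φ ξ)) ?_
    ⟨R.contDiff_cl_superpot k hφ.1, HasCompactSupport.intro hφ.2 fun ξ hξ => ?_⟩
  · exact IsTestFn.sum fun i _ => ((hφ.pd i).clm _).const_smul _
  · rw [image_eq_zero_of_notMem_tsupport hξ, map_zero]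

/-- **Supersymmetry**: up to a gauge transformation the square of the supercharge is `H_k`. -/
theorem two_smul_dirac_dirac (k : ℝ) {φ : Config → V} (hφ : IsTestFn φ) (ξ : Config) :
    (2 : ℂ) • R.dirac k (R.dirac k φ) ξ
      = R.hD k φ ξ + ((2 * xc ξ 0 : ℝ) : ℂ) • R.gauge φ ξ := by
  have hpd : ∀ i, pd i (R.dirac k φ) ξ = ∑ j, (-Complex.I) • R.cl (chg j) (pd i (pd j φ) ξ)
      + (R.cl (superpot k ξ) (pd i φ ξ) + R.cl (dSuperpot ξ i) (φ ξ)) := by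
    intro i
    have h1 : ∀ j, Differentiable ℝ fun ξ => (-Complex.I) • R.cl (chg j) (pd j φ ξ) := fun j =>
      (((hφ.pd j).clm _).const_smul _).differentiable
    have h2 : Differentiable ℝ fun ξ => R.cl (superpot k ξ) (φ ξ) :=
      (R.contDiff_cl_superpot k hφ.1).differentiable (by simp)
    have h3 : Differentiable ℝ fun ξ => ∑ j, (-Complex.I) • R.cl (chg j) (pd j φ ξ) :=
      (IsTestFn.sum fun i _ => ((hφ.pd i).clm _).const_smul _).differentiable
    have := congrFun (pd_add h3 h2 i) ξ
    unfold dirac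
    rw [this, pd_sum h1, R.pd_cl_superpot k hφ.differentiable]
    congr 1
    refine Finset.sum_congr rfl fun j _ => ?_
    exact congrFun (pd_clm_complex ((-Complex.I) • R.cl (chg j)) (hφ.pd j).differentiable i) ξ
  have hsecond : (2 : ℂ) • ∑ i, ∑ j, R.cl (chg i) (R.cl (chg j) (pd i (pd j φ) ξ))
      = ∑ i, pd i (pd i φ) ξ := by
    have h1 : ∑ i, ∑ j, R.cl (chg i) (R.cl (chg j) (pd i (pd j φ) ξ)) =
        ∑ i, ∑ j, R.cl (chg j) (R.cl (chg i) (pd i (pd j φ) ξ)) := by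
      rw [Finset.sum_comm]
      refine Finset.sum_congr rfl fun i _ => Finset.sum_congr rfl fun j _ => ?_
      rw [pd_comm hφ.1]
    rw [two_smul]
    nth_rewrite 2 [h1]
    simp only [← Finset.sum_add_distrib, cl_anticomm, chg_orthonormal]
    simp
  have hfirst : ∑ i, (R.cl (chg i) (R.cl (superpot k ξ) (pd i φ ξ))
      + R.cl (superpot k ξ) (R.cl (chg i) (pd i φ ξ))) = (xc ξ 0) • rotT φ ξ := by
    simp only [cl_anticomm, chg_superpot]
    simp only [Fintype.sum_sum_type, Fin.sum_univ_four, Sum.elim_inl,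
      Sum.elim_inr, Complex.coe_smul, rotT, Matrix.cons_val]
    simp only [Pi.zero_apply, zero_smul, Finset.sum_const_zero, add_zero, smul_add, smul_sub,
      smul_smul, neg_smul]
    abel
  have hpot : (2 : ℂ) • R.cl (superpot k ξ) (R.cl (superpot k ξ) (φ ξ))
      = (potDef k ξ : ℂ) • φ ξ := by
    rw [cl_sq, sum_superpot_sq, smul_smul]; congr 1; push_cast; ring
  have hferm := congrArg (fun A : V →L[ℂ] V => A (φ ξ)) (R.sum_cl_dSuperpot ξ)
  simp only [smul_apply, add_apply, sum_apply, mul_apply_eq_comp] at hferm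
  have hexp : R.dirac k (R.dirac k φ) ξ =
      (-1 : ℂ) • ∑ i, ∑ j, R.cl (chg i) (R.cl (chg j) (pd i (pd j φ) ξ))
      + (-Complex.I) • ∑ i, (R.cl (chg i) (R.cl (superpot k ξ) (pd i φ ξ))
        + R.cl (superpot k ξ) (R.cl (chg i) (pd i φ ξ)))
      + (-Complex.I) • ∑ i, R.cl (chg i) (R.cl (dSuperpot ξ i) (φ ξ))
      + R.cl (superpot k ξ) (R.cl (superpot k ξ) (φ ξ)) := by
    have hI : ∀ v : V, Complex.I • Complex.I • v = - v := fun v => by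
      rw [smul_smul, Complex.I_mul_I, neg_one_smul]
    conv_lhs => rw [dirac]
    simp only [hpd]
    conv_lhs => rw [show R.dirac k φ ξ = ∑ i, (-Complex.I) • R.cl (chg i) (pd i φ ξ)
      + R.cl (superpot k ξ) (φ ξ) from rfl]
    simp only [map_add, map_sum, map_smul, map_neg, smul_add, Finset.smul_sum,
      Finset.sum_add_distrib, neg_smul, smul_neg, neg_neg, hI, Finset.sum_neg_distrib, one_smul]
    abel
  rw [hexp, R.hD_eq k hφ.1, gauge_eq, covD]
  simp only [smul_add]
  rw [smul_comm (2 : ℂ) (-1 : ℂ), hsecond, hpot, hfirst, smul_smul (2 : ℂ) (-Complex.I) (∑ i, _),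
    show (2 : ℂ) * -Complex.I = -(2 * Complex.I) by ring, hferm]
  rw [smul_smul, show (2 : ℂ) * -Complex.I = -(2 * Complex.I) by ring]
  simp only [← Complex.coe_smul (E := V), smul_sub, smul_smul, neg_smul, one_smul]
  rw [show -(2 * Complex.I) * (xc ξ 0 : ℂ) = ((2 * xc ξ 0 : ℝ) : ℂ) * -Complex.I by push_cast; ring]
  simp only [mul_neg, neg_smul, smul_neg, smul_smul]
  abel

end FermionRep

end DeformedSQM

namespace DeformedSQM

/-! ### Gauge covariance, symmetry and parity of the supercharge -/

/-- The vector field of the infinitesimal gauge rotation. -/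
def rotVec (ξ : Config) : Config :=
  (qc ξ 0 • unitVec (Sum.inl 1) - qc ξ 1 • unitVec (Sum.inl 0))
    + (qc ξ 2 • unitVec (Sum.inl 3) - qc ξ 3 • unitVec (Sum.inl 2))

section RotT

variable {F : Type*} [NormedAddCommGroup F] [NormedSpace ℝ F]

theorem rotT_eq_fderiv (f : Config → F) (ξ : Config) : rotT f ξ = fderiv ℝ f ξ (rotVec ξ) := by
  simp only [rotT, rotVec, pd, map_add, map_sub, map_smul]

theorem rotT_add {f g : Config → F} {ξ : Config} (hf : DifferentiableAt ℝ f ξ)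
    (hg : DifferentiableAt ℝ g ξ) : rotT (fun ξ => f ξ + g ξ) ξ = rotT f ξ + rotT g ξ := by
  simp only [rotT_eq_fderiv]; rw [fderiv_fun_add hf hg]; simp

theorem rotT_sum {ι : Type*} {s : Finset ι} {f : ι → Config → F} {ξ : Config}
    (hf : ∀ j, DifferentiableAt ℝ (f j) ξ) :
    rotT (fun ξ => ∑ j ∈ s, f j ξ) ξ = ∑ j ∈ s, rotT (f j) ξ := by
  simp only [rotT_eq_fderiv]; rw [fderiv_fun_sum (fun j _ => hf j)]; simp

theorem rotT_clm {G : Type*} [NormedAddCommGroup G] [NormedSpace ℝ G] (A : F →L[ℝ] G)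
    {f : Config → F} {ξ : Config} (hf : DifferentiableAt ℝ f ξ) :
    rotT (fun ξ => A (f ξ)) ξ = A (rotT f ξ) := by
  have := (A.hasFDerivAt (x := f ξ)).comp ξ hf.hasFDerivAt
  simp only [rotT_eq_fderiv]
  rw [show (fun ξ => A (f ξ)) = A ∘ f from rfl, this.fderiv]; simp

theorem rotT_smul {c : Config → ℝ} {f : Config → F} {ξ : Config} (hc : DifferentiableAt ℝ c ξ)
    (hf : DifferentiableAt ℝ f ξ) :
    rotT (fun ξ => c ξ • f ξ) ξ = c ξ • rotT f ξ + rotT c ξ • f ξ := by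
  simp only [rotT_eq_fderiv]; rw [fderiv_fun_smul hc hf]; simp

/-- The commutator of `∂_i` with the rotation generator. -/
def rotPd (f : Config → F) (ξ : Config) : Idx → F :=
  Sum.elim ![pd (Sum.inl 1) f ξ, -pd (Sum.inl 0) f ξ, pd (Sum.inl 3) f ξ, -pd (Sum.inl 2) f ξ] 0

theorem contDiff_rotT {f : Config → F} (hf : ContDiff ℝ ∞ f) : ContDiff ℝ ∞ (rotT f) := by
  unfold rotT
  exact (((contDiff_qc 0).smul (contDiff_pd hf _)).sub
    ((contDiff_qc 1).smul (contDiff_pd hf _))).add (((contDiff_qc 2).smul (contDiff_pd hf _)).sub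
    ((contDiff_qc 3).smul (contDiff_pd hf _)))

theorem pd_rotT {f : Config → F} (hf : ContDiff ℝ ∞ f) (i : Idx) (ξ : Config) :
    pd i (rotT f) ξ = rotT (pd i f) ξ + rotPd f ξ i := by
  have hd : ∀ j, Differentiable ℝ (pd j f) := fun j => (contDiff_pd hf j).differentiable (by simp)
  have hq : ∀ j, Differentiable ℝ fun ξ => qc ξ j := differentiable_qc
  have hs : ∀ j l, DifferentiableAt ℝ (fun ξ => qc ξ j • pd l f ξ) ξ := fun j l =>
    ((hq j).smul (hd l)) ξ
  have hs2 : ∀ j l j' l', DifferentiableAt ℝ (fun ξ => qc ξ j • pd l f ξ - qc ξ j' • pd l' f ξ) ξ :=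
    fun j l j' l' => (hs j l).sub (hs j' l')
  unfold rotT
  rw [pd_add_at (hs2 _ _ _ _) (hs2 _ _ _ _), pd_sub_at (hs _ _) (hs _ _),
    pd_sub_at (hs _ _) (hs _ _)]
  simp only [pd_smul (hq _ ξ) (hd _ ξ), pd_qc, pd_comm hf i]
  rcases i with i | i <;> fin_cases i <;> simp [rotPd] <;> abel

end RotT

/-- The action of the rotation generator on the coefficients of Clifford vectors. -/
def rotCoeff (v : Fin 8 ⊕ Fin 8 → ℝ) : Fin 8 ⊕ Fin 8 → ℝ :=
  let w := v ∘ Sum.inl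
  Sum.elim ![w 1, -w 0, -w 3, w 2, w 5, -w 4, -w 7, w 6] 0

theorem rotT_superpot (k : ℝ) (ξ : Config) (a : Fin 8 ⊕ Fin 8) :
    rotT (fun ξ => superpot k ξ a) ξ = rotCoeff (superpot k ξ) a := by
  simp only [rotT, pd_superpot]
  rcases a with a | a <;> fin_cases a <;> simp [rotCoeff, superpot, dSuperpot] <;> ring

variable {V : Type*} [NormedAddCommGroup V] [InnerProductSpace ℂ V]

theorem IsTestFn.rotT {g : Config → V} (h : IsTestFn g) : IsTestFn (rotT g) := by
  refine ⟨contDiff_rotT h.1, HasCompactSupport.intro h.2 fun ξ hξ => ?_⟩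
  have h1 : ∀ i, DeformedSQM.pd i g ξ = 0 := fun i => by
    have : ξ ∉ tsupport (DeformedSQM.pd i g) := fun hm => hξ (tsupport_fderiv_apply_subset ℝ _ hm)
    exact image_eq_zero_of_notMem_tsupport this
  simp [DeformedSQM.rotT, h1]

theorem rotT_clm_complex (A : V →L[ℂ] V) {f : Config → V} (hf : Differentiable ℝ f) (ξ : Config) :
    rotT (fun ξ => A (f ξ)) ξ = A (rotT f ξ) := rotT_clm (A.restrictScalars ℝ) (hf ξ)

namespace FermionRep

variable [CompleteSpace V] (R : FermionRep V)

theorem rotX_cl (v : Fin 8 ⊕ Fin 8 → ℝ) (φ : V) :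
    R.rotX (R.cl v φ) = R.cl v (R.rotX φ) + R.cl (rotCoeff v) φ := by
  have hl : ∀ b, R.rotX (R.lam b φ) = R.lam b (R.rotX φ) := fun b => by
    have := congrArg (fun A : V →L[ℂ] V => A φ) (R.rel.rotGen_comm_lam b)
    exact sub_eq_zero.1 (by simpa [rotX] using this)
  have hp : ∀ b, R.rotX (R.psi b φ) = R.psi b (R.rotX φ) + ∑ d, (sMat 1 b d : ℂ) • R.psi d φ :=
    fun b => by
    have := congrArg (fun A : V →L[ℂ] V => A φ) (R.rel.rotGen_comm_psi b)
    exact sub_eq_iff_eq_add'.1 (by simpa [rotX] using this)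
  simp only [cl_apply, map_sum, Fintype.sum_sum_type, map_add, Sum.elim_inl, Sum.elim_inr,
    ← Complex.coe_smul (E := V), map_smul, hl, hp, smul_add, Finset.sum_add_distrib]
  have e : ∑ b, (v (Sum.inl b) : ℂ) • ∑ d, (sMat 1 b d : ℂ) • R.psi d φ
      = ∑ d, (rotCoeff v (Sum.inl d) : ℂ) • R.psi d φ := by
    simp only [Finset.smul_sum, smul_smul]
    rw [Finset.sum_comm]
    refine Finset.sum_congr rfl fun d _ => ?_
    rw [← Finset.sum_smul]
    congr 1
    rw [Fin.sum_univ_eight]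
    fin_cases d <;> simp [sMat, block_apply, quatR, rotCoeff]
  rw [e]
  simp only [rotCoeff, Sum.elim_inr, Pi.zero_apply, Complex.ofReal_zero, zero_smul,
    Finset.sum_const_zero, add_zero]
  abel

theorem rotT_cl_superpot (k : ℝ) {φ : Config → V} (hφ : Differentiable ℝ φ) (ξ : Config) :
    rotT (fun ξ => R.cl (superpot k ξ) (φ ξ)) ξ =
      R.cl (superpot k ξ) (rotT φ ξ) + R.cl (rotCoeff (superpot k ξ)) (φ ξ) := by
  have hd : ∀ a, Differentiable ℝ fun ξ => superpot k ξ a := fun a =>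
    (contDiff_superpot k a (n := 1)).differentiable (by simp)
  have hA : ∀ a, Differentiable ℝ fun ξ => (Sum.elim R.psi R.lam a) (φ ξ) := fun a =>
    ((Sum.elim R.psi R.lam a).restrictScalars ℝ).differentiable.comp hφ
  simp only [cl_apply]
  rw [rotT_sum (f := fun a ξ => superpot k ξ a • (Sum.elim R.psi R.lam a) (φ ξ))
    fun a => ((hd a).smul (hA a)) ξ, ← Finset.sum_add_distrib]
  refine Finset.sum_congr rfl fun a _ => ?_
  rw [rotT_smul (hd a ξ) (hA a ξ), rotT_superpot, rotT_clm_complex _ hφ]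

theorem isTestFn_covD {φ : Config → V} (hφ : IsTestFn φ) : IsTestFn (R.covD φ) := by
  have := hφ.rotT.add ((hφ.clm R.rotX).const_smul (-1))
  refine (funext fun ξ => ?_ : R.covD φ = _) ▸ this
  simp [covD, sub_eq_add_neg]

theorem sum_cl_rotCoeff (φ : Config → V) (ξ : Config) :
    ∑ i, R.cl (chg i) (rotPd φ ξ i) = -∑ i, R.cl (rotCoeff (chg i)) (pd i φ ξ) := by
  simp only [Fintype.sum_sum_type, Fin.sum_univ_four, Fin.sum_univ_five]
  simp [cl_apply, chg, rotCoeff, rotPd, Fin.sum_univ_eight]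
  abel

theorem covD_dirac (k : ℝ) {φ : Config → V} (hφ : IsTestFn φ) (ξ : Config) :
    R.covD (R.dirac k φ) ξ = R.dirac k (R.covD φ) ξ := by
  have h1 : ∀ j, Differentiable ℝ fun ξ => (-Complex.I) • R.cl (chg j) (pd j φ ξ) := fun j =>
    (((hφ.pd j).clm _).const_smul _).differentiable
  have h2 : Differentiable ℝ fun ξ => R.cl (superpot k ξ) (φ ξ) :=
    (R.contDiff_cl_superpot k hφ.1).differentiable (by simp)
  have h3 : Differentiable ℝ fun ξ => ∑ j, (-Complex.I) • R.cl (chg j) (pd j φ ξ) :=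
    (IsTestFn.sum fun i _ => ((hφ.pd i).clm _).const_smul _).differentiable
  have e1 : rotT (R.dirac k φ) ξ = ∑ j, (-Complex.I) • R.cl (chg j) (rotT (pd j φ) ξ)
      + (R.cl (superpot k ξ) (rotT φ ξ) + R.cl (rotCoeff (superpot k ξ)) (φ ξ)) := by
    have := rotT_add (h3 ξ) (h2 ξ)
    unfold dirac
    rw [this, rotT_sum fun j => h1 j ξ, R.rotT_cl_superpot k hφ.differentiable]
    congr 1
    refine Finset.sum_congr rfl fun j _ => ?_
    exact rotT_clm_complex ((-Complex.I) • R.cl (chg j)) (hφ.pd j).differentiable ξ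
  have e2 : ∀ i, pd i (R.covD φ) ξ = rotT (pd i φ) ξ + rotPd φ ξ i - R.rotX (pd i φ ξ) := by
    intro i
    unfold covD
    rw [pd_sub_at (hφ.rotT.differentiable ξ) ((hφ.clm R.rotX).differentiable ξ), pd_rotT hφ.1,
      pd_clm_complex _ hφ.differentiable]
  have e3 := R.sum_cl_rotCoeff φ ξ
  rw [covD, e1]
  simp only [dirac, e2]
  simp only [covD, map_add, map_sub, map_sum, map_smul, rotX_cl, smul_add, smul_sub,
    Finset.sum_add_distrib, Finset.sum_sub_distrib]
  simp only [← Finset.smul_sum, e3, smul_neg]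
  abel

theorem cl_sa (v : Fin 8 ⊕ Fin 8 → ℝ) (φ η : V) : inner ℂ (R.cl v φ) η = inner ℂ φ (R.cl v η) := by
  have h : ∀ a, IsSelfAdjoint (Sum.elim R.psi R.lam a) := by
    rintro (a | a)
    · exact R.psi_sa a
    · exact R.lam_sa a
  simp only [cl_apply, sum_inner, inner_sum, ← Complex.coe_smul (E := V), inner_smul_left,
    inner_smul_right, Complex.conj_ofReal]
  refine Finset.sum_congr rfl fun a _ => ?_
  have := ContinuousLinearMap.isSelfAdjoint_iff_isSymmetric.1 (h a) φ η
  rw [ContinuousLinearMap.coe_coe] at this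
  rw [this]

theorem rotX_skew (φ η : V) : inner ℂ (R.rotX φ) η = - inner ℂ φ (R.rotX η) := by
  have h : ∀ a φ η, inner ℂ (R.psi a φ) η = inner ℂ φ (R.psi a η) := fun a φ η =>
    ContinuousLinearMap.isSelfAdjoint_iff_isSymmetric.1 (R.psi_sa a) φ η
  simp only [rotX, rotGen, bil, smul_apply, sum_apply, mul_apply_eq_comp, inner_smul_left,
    inner_smul_right, sum_inner, inner_sum, Complex.conj_ofReal, h]
  rw [Finset.sum_comm]
  simp only [Finset.mul_sum, ← Finset.sum_neg_distrib]
  refine Finset.sum_congr rfl fun a _ => Finset.sum_congr rfl fun b _ => ?_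
  rw [sMat_one_antisymm b a]
  simp [Complex.conj_ofNat]

theorem integral_inner_dirac (k : ℝ) {f g : Config → V} (hf : IsTestFn f) (hg : ContDiff ℝ ∞ g) :
    ∫ ξ, inner ℂ (R.dirac k f ξ) (g ξ) = ∫ ξ, inner ℂ (f ξ) (R.dirac k g ξ) := by
  have hg' : ∀ A : V →L[ℂ] V, ContDiff ℝ ∞ fun ξ => A (g ξ) := fun A => by
    have hA : ContDiff ℝ ∞ (A.restrictScalars ℝ) := ContinuousLinearMap.contDiff _
    exact hA.comp hg
  have hgp : ∀ i, ∀ A : V →L[ℂ] V, Continuous fun ξ => A (pd i g ξ) := fun i A =>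
    A.continuous.comp (contDiff_pd hg i).continuous
  simp only [dirac, inner_add_left, inner_add_right, sum_inner, inner_sum, inner_smul_left,
    inner_smul_right, cl_sa]
  have i1 : ∀ i, Integrable fun ξ => inner ℂ (pd i f ξ) (R.cl (chg i) (g ξ)) := fun i =>
    integrable_inner_cont (hf.pd i).continuous (hf.pd i).2 (hg' _).continuous
  have i2 : ∀ i, Integrable fun ξ => inner ℂ (f ξ) (R.cl (chg i) (pd i g ξ)) := fun i =>
    integrable_inner_cont hf.continuous hf.2 (hgp _ _)
  have i3 : Integrable fun ξ => inner ℂ (f ξ) (R.cl (superpot k ξ) (g ξ)) :=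
    integrable_inner_cont hf.continuous hf.2 (R.contDiff_cl_superpot k hg).continuous
  rw [integral_add (integrable_finsetSum _ fun i _ => (i1 i).const_mul _) i3,
    integral_add (integrable_finsetSum _ fun i _ => (i2 i).const_mul _) i3,
    integral_finsetSum _ fun i _ => (i1 i).const_mul _,
    integral_finsetSum _ fun i _ => (i2 i).const_mul _]
  congr 1
  refine Finset.sum_congr rfl fun i _ => ?_
  rw [integral_const_mul, integral_const_mul, integral_inner_pd hf (hg' _) i,
    pd_clm_complex _ (hg.differentiable (by simp))]
  simp

theorem integral_inner_covD {f g : Config → V} (hf : IsTestFn f) (hg : IsTestFn g) :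
    ∫ ξ, inner ℂ (R.covD f ξ) (g ξ) = - ∫ ξ, inner ℂ (f ξ) (R.covD g ξ) := by
  have key : ∀ (j : Fin 4) (l : Idx), (l ≠ Sum.inl j) →
      ∫ ξ, inner ℂ (qc ξ j • pd l f ξ) (g ξ) = - ∫ ξ, inner ℂ (f ξ) (qc ξ j • pd l g ξ) := by
    intro j l hl
    have e := integral_inner_pd hf (hg.smul (contDiff_qc j)).1 l
    have e2 : ∀ ξ, pd l (fun ξ => qc ξ j • g ξ) ξ = qc ξ j • pd l g ξ := fun ξ => by
      rw [pd_smul (differentiable_qc j ξ) (hg.differentiable ξ), pd_qc, if_neg hl]; simp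
    simp only [e2] at e
    rw [← e]
    congr 1; ext ξ
    simp only [← Complex.coe_smul (E := V), inner_smul_left, inner_smul_right, Complex.conj_ofReal]
  have i1 : ∀ j l, Integrable fun ξ => inner ℂ (qc ξ j • pd l f ξ) (g ξ) := fun j l =>
    integrable_inner_cont ((hf.pd l).smul (contDiff_qc j)).continuous
      ((hf.pd l).smul (contDiff_qc j)).2 hg.continuous
  have i2 : ∀ j l, Integrable fun ξ => inner ℂ (f ξ) (qc ξ j • pd l g ξ) := fun j l =>
    integrable_inner_cont hf.continuous hf.2 ((hg.pd l).smul (contDiff_qc j)).continuous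
  have i3 : Integrable fun ξ => inner ℂ (f ξ) (R.rotX (g ξ)) :=
    integrable_inner_cont hf.continuous hf.2 (hg.clm _).continuous
  have h1 : ∫ ξ, inner ℂ (rotT f ξ) (g ξ) = - ∫ ξ, inner ℂ (f ξ) (rotT g ξ) := by
    simp only [rotT, inner_add_left, inner_add_right, inner_sub_left, inner_sub_right]
    have j1 : ∀ j l j' l', Integrable fun ξ => inner ℂ (qc ξ j • pd l f ξ) (g ξ) -
        inner ℂ (qc ξ j' • pd l' f ξ) (g ξ) := fun j l j' l' => (i1 j l).sub (i1 j' l')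
    have j2 : ∀ j l j' l', Integrable fun ξ => inner ℂ (f ξ) (qc ξ j • pd l g ξ) -
        inner ℂ (f ξ) (qc ξ j' • pd l' g ξ) := fun j l j' l' => (i2 j l).sub (i2 j' l')
    rw [integral_add (j1 _ _ _ _) (j1 _ _ _ _), integral_sub (i1 _ _) (i1 _ _),
      integral_sub (i1 _ _) (i1 _ _), integral_add (j2 _ _ _ _) (j2 _ _ _ _),
      integral_sub (i2 _ _) (i2 _ _), integral_sub (i2 _ _) (i2 _ _),
      key 0 _ (by simp), key 1 _ (by simp), key 2 _ (by simp), key 3 _ (by simp)]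
    ring
  simp only [covD, inner_sub_left, inner_sub_right, rotX_skew, sub_neg_eq_add]
  rw [integral_add (integrable_inner_cont hf.rotT.continuous hf.rotT.2 hg.continuous) i3,
    integral_sub (integrable_inner_cont hf.continuous hf.2 hg.rotT.continuous) i3, h1]
  ring

theorem par_cl (v : Fin 8 ⊕ Fin 8 → ℝ) (φ : V) : R.par (R.cl v φ) = - R.cl v (R.par φ) := by
  have h : ∀ a φ, R.par (Sum.elim R.psi R.lam a φ) = - Sum.elim R.psi R.lam a (R.par φ) := by
    rintro (a | a) φ
    · exact congrArg (fun A : V →L[ℂ] V => A φ) (R.par_psi a)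
    · exact congrArg (fun A : V →L[ℂ] V => A φ) (R.par_lam a)
  simp only [cl_apply, map_sum, ← Complex.coe_smul (E := V), map_smul, h, smul_neg,
    Finset.sum_neg_distrib]

/-- The supercharge is odd. -/
theorem par_dirac (k : ℝ) {φ : Config → V} (hφ : Differentiable ℝ φ) (ξ : Config) :
    R.par (R.dirac k φ ξ) = - R.dirac k (fun ξ => R.par (φ ξ)) ξ := by
  simp only [dirac, pd_clm_complex _ hφ, map_add, map_sum, map_smul, par_cl, smul_neg,
    Finset.sum_neg_distrib, neg_add]

theorem par_rotX (φ : V) : R.par (R.rotX φ) = R.rotX (R.par φ) := by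
  have h : ∀ a φ, R.par (R.psi a φ) = - R.psi a (R.par φ) := fun a φ =>
    congrArg (fun A : V →L[ℂ] V => A φ) (R.par_psi a)
  simp only [rotX, rotGen, bil, smul_apply, sum_apply, mul_apply_eq_comp, map_sum, map_smul, h,
    map_neg, neg_neg]

theorem covD_par {φ : Config → V} (hφ : Differentiable ℝ φ) (ξ : Config) :
    R.covD (fun ξ => R.par (φ ξ)) ξ = R.par (R.covD φ ξ) := by
  simp only [covD, rotT_clm_complex _ hφ, map_sub, par_rotX]

end FermionRep

end DeformedSQM

namespace DeformedSQM

/-! ### The gauge group and averaging over it -/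

/-- The `q`-part of a configuration. -/
def qPart (ξ : Config) : Config := ∑ j, qc ξ j • unitVec (Sum.inl j)

/-- The gauge rotation by the angle `θ`. -/
def rot (θ : ℝ) (ξ : Config) : Config := ξ + (Real.cos θ - 1) • qPart ξ + Real.sin θ • rotVec ξ

theorem rot_qc (θ : ℝ) (ξ : Config) : qc (rot θ ξ) =
    ![Real.cos θ * qc ξ 0 - Real.sin θ * qc ξ 1, Real.cos θ * qc ξ 1 + Real.sin θ * qc ξ 0,
      Real.cos θ * qc ξ 2 - Real.sin θ * qc ξ 3, Real.cos θ * qc ξ 3 + Real.sin θ * qc ξ 2] := by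
  ext j
  fin_cases j <;> simp [qc, rot, qPart, rotVec, Fin.sum_univ_four] <;> ring

theorem rot_xc (θ : ℝ) (ξ : Config) : xc (rot θ ξ) = xc ξ := by
  ext j
  simp [xc, rot, qPart, rotVec, Fin.sum_univ_four]

theorem rotVec_qc (ξ : Config) : qc (rotVec ξ) = ![-qc ξ 1, qc ξ 0, -qc ξ 3, qc ξ 2] := by
  ext j
  fin_cases j <;> simp [qc, rotVec]

theorem rotVec_xc (ξ : Config) : xc (rotVec ξ) = 0 := by
  ext j
  simp [xc, rotVec]

theorem config_ext {ξ η : Config} (h : qc ξ = qc η) (h' : xc ξ = xc η) : ξ = η := by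
  ext i
  rcases i with i | i
  · exact congrFun h i
  · exact congrFun h' i

theorem qc_add (ξ η : Config) : qc (ξ + η) = qc ξ + qc η := rfl

theorem xc_add (ξ η : Config) : xc (ξ + η) = xc ξ + xc η := rfl

theorem qc_smul (c : ℝ) (ξ : Config) : qc (c • ξ) = c • qc ξ := rfl

theorem xc_smul (c : ℝ) (ξ : Config) : xc (c • ξ) = c • xc ξ := rfl

theorem rot_zero (ξ : Config) : rot 0 ξ = ξ := by simp [rot]

theorem rot_two_pi (ξ : Config) : rot (-(2 * Real.pi)) ξ = ξ := by simp [rot]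

theorem rot_rot (α β : ℝ) (ξ : Config) : rot α (rot β ξ) = rot (α + β) ξ := by
  refine config_ext ?_ ?_
  · simp only [rot_qc, Real.cos_add, Real.sin_add]
    ext j
    fin_cases j <;> simp <;> ring
  · simp only [rot_xc]

theorem rot_rotVec (α : ℝ) (ξ : Config) : rot α (rotVec ξ) = rotVec (rot α ξ) := by
  refine config_ext ?_ ?_
  · simp only [rot_qc, rotVec_qc]
    ext j
    fin_cases j <;> simp <;> ring
  · simp only [rot_xc, rotVec_xc]

theorem norm_sq_config (ξ : Config) : ‖ξ‖ ^ 2 = ∑ j, qc ξ j ^ 2 + ∑ μ, xc ξ μ ^ 2 := by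
  rw [EuclideanSpace.norm_sq_eq, Fintype.sum_sum_type]
  simp [qc, xc]

theorem sum_qc_rot_sq (θ : ℝ) (ξ : Config) : ∑ j, qc (rot θ ξ) j ^ 2 = ∑ j, qc ξ j ^ 2 := by
  have h := Real.cos_sq_add_sin_sq θ
  rw [rot_qc]
  simp only [Fin.sum_univ_four, Matrix.cons_val]
  linear_combination (qc ξ 0 ^ 2 + qc ξ 1 ^ 2 + qc ξ 2 ^ 2 + qc ξ 3 ^ 2) * h

theorem norm_rot (θ : ℝ) (ξ : Config) : ‖rot θ ξ‖ = ‖ξ‖ := by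
  rw [← sq_eq_sq₀ (norm_nonneg _) (norm_nonneg _), norm_sq_config, norm_sq_config, sum_qc_rot_sq,
    rot_xc]

/-- The gauge rotation as a linear isometry. -/
def rotL (θ : ℝ) : Config ≃ₗᵢ[ℝ] Config where
  toFun := rot θ
  invFun := rot (-θ)
  left_inv ξ := by rw [rot_rot]; simp [rot_zero]
  right_inv ξ := by rw [rot_rot]; simp [rot_zero]
  map_add' ξ η := by
    refine config_ext ?_ ?_
    · rw [rot_qc, qc_add, qc_add, rot_qc, rot_qc]
      ext j
      fin_cases j <;> simp <;> ring
    · simp only [rot_xc, xc_add]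
  map_smul' c ξ := by
    refine config_ext ?_ ?_
    · rw [rot_qc, qc_smul, RingHom.id_apply, qc_smul, rot_qc]
      ext j
      fin_cases j <;> simp <;> ring
    · simp only [rot_xc, xc_smul, RingHom.id_apply]
  norm_map' := norm_rot θ

theorem measurePreserving_rot (θ : ℝ) : MeasurePreserving (rot θ) volume volume :=
  (rotL θ).measurePreserving

theorem contDiff_rot_uncurry : ContDiff ℝ ∞ fun z : ℝ × Config => rot (-z.1) z.2 := by
  have hq : ∀ j, ContDiff ℝ ∞ fun z : ℝ × Config => qc z.2 j := fun j =>
    (contDiff_qc j).comp contDiff_snd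
  unfold rot qPart rotVec
  have hs : ContDiff ℝ ∞ fun z : ℝ × Config => Real.sin (-z.1) :=
    Real.contDiff_sin.comp contDiff_fst.neg
  have hc : ContDiff ℝ ∞ fun z : ℝ × Config => Real.cos (-z.1) - 1 :=
    (Real.contDiff_cos.comp contDiff_fst.neg).sub contDiff_const
  refine (contDiff_snd.add (hc.smul (ContDiff.sum fun j _ => (hq j).smul contDiff_const))).add
    (hs.smul ?_)
  exact (((hq 0).smul contDiff_const).sub ((hq 1).smul contDiff_const)).add
    (((hq 2).smul contDiff_const).sub ((hq 3).smul contDiff_const))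

theorem hasDerivAt_rot_neg (ξ : Config) (θ : ℝ) :
    HasDerivAt (fun θ => rot (-θ) ξ) (-rotVec (rot (-θ) ξ)) θ := by
  have h1 : HasDerivAt (fun θ => Real.cos (-θ) - 1) (Real.sin (-θ)) θ :=
    ((hasDerivAt_neg θ).cos.sub_const 1).congr_deriv (by ring)
  have h2 : HasDerivAt (fun θ => Real.sin (-θ)) (-Real.cos (-θ)) θ :=
    (hasDerivAt_neg θ).sin.congr_deriv (by ring)
  refine (((h1.smul_const (qPart ξ)).const_add ξ).add
    (h2.smul_const (rotVec ξ))).congr_deriv ?_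
  refine config_ext ?_ ?_
  · have e : ∀ j, qc (qPart ξ) j = qc ξ j := by
      intro j; fin_cases j <;> simp [qc, qPart, Fin.sum_univ_four]
    ext j
    rw [qc_add, qc_smul, qc_smul, ← neg_one_smul ℝ (rotVec _), qc_smul, rotVec_qc, rotVec_qc, rot_qc]
    fin_cases j <;> simp [e] <;> ring
  · have e : xc (qPart ξ) = 0 := by
      ext j; simp [xc, qPart, Fin.sum_univ_four]
    rw [xc_add, xc_smul, xc_smul, ← neg_one_smul ℝ (rotVec _), xc_smul, rotVec_xc, rotVec_xc, e]
    simp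

section Parametric

variable {G : Type*} [NormedAddCommGroup G] [NormedSpace ℝ G]

theorem hasFDerivAt_parametric_integral {F : ℝ × Config → G} (hF : ContDiff ℝ ∞ F) (a b : ℝ)
    (ξ : Config) : HasFDerivAt (fun ξ => ∫ θ in a..b, F (θ, ξ))
      (∫ θ in a..b, (fderiv ℝ F (θ, ξ)).comp (ContinuousLinearMap.inr ℝ ℝ Config)) ξ := by
  have hc : Continuous fun z : ℝ × Config =>
      (fderiv ℝ F z).comp (ContinuousLinearMap.inr ℝ ℝ Config) :=
    (hF.continuous_fderiv (by simp)).clm_comp continuous_const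
  obtain ⟨C, hC⟩ := ((isCompact_uIcc (a := a) (b := b)).prod
    (isCompact_closedBall ξ 1)).exists_bound_of_continuousOn hc.continuousOn
  refine (intervalIntegral.hasFDerivAt_integral_of_dominated_of_fderiv_le (bound := fun _ => C)
    (F' := fun ξ θ => (fderiv ℝ F (θ, ξ)).comp (ContinuousLinearMap.inr ℝ ℝ Config))
    (Metric.ball_mem_nhds ξ one_pos) ?_ ?_ ?_ ?_ ?_ ?_)
  · exact Filter.Eventually.of_forall fun η =>
      (hF.continuous.comp (by fun_prop : Continuous fun θ : ℝ => (θ, η))).aestronglyMeasurable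
  · exact (hF.continuous.comp
      (by fun_prop : Continuous fun θ : ℝ => (θ, ξ))).intervalIntegrable _ _
  · exact (hc.comp (by fun_prop : Continuous fun θ : ℝ => (θ, ξ))).aestronglyMeasurable
  · exact Filter.Eventually.of_forall fun θ hθ η hη =>
      hC (θ, η) ⟨Set.uIoc_subset_uIcc hθ, Metric.ball_subset_closedBall hη⟩
  · exact intervalIntegrable_const
  · refine Filter.Eventually.of_forall fun θ _ η _ => ?_
    exact ((hF.differentiable (by simp)) (θ, η)).hasFDerivAt.comp η (hasFDerivAt_prodMk_right θ η)

theorem contDiff_parametric_integral_nat (n : ℕ) : ∀ {G : Type*} [NormedAddCommGroup G]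
    [NormedSpace ℝ G] [CompleteSpace G] {F : ℝ × Config → G}, ContDiff ℝ ∞ F → ∀ a b : ℝ,
    ContDiff ℝ n (fun ξ => ∫ θ in a..b, F (θ, ξ)) := by
  induction n with
  | zero =>
    intro G _ _ _ F hF a b
    refine contDiff_zero.2 (continuous_iff_continuousAt.2 fun ξ => ?_)
    exact (hasFDerivAt_parametric_integral hF a b ξ).continuousAt
  | succ n ih =>
    intro G _ _ _ F hF a b
    rw [show ((n + 1 : ℕ) : WithTop ℕ∞) = n + 1 by norm_cast, contDiff_succ_iff_hasFDerivAt]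
    refine ⟨_, ih (F := fun z => (fderiv ℝ F z).comp (ContinuousLinearMap.inr ℝ ℝ Config)) ?_ a b,
      fun ξ => hasFDerivAt_parametric_integral hF a b ξ⟩
    exact (hF.fderiv_right (m := ∞) (by simp)).clm_comp contDiff_const

theorem contDiff_parametric_integral [CompleteSpace G] {F : ℝ × Config → G} (hF : ContDiff ℝ ∞ F) (a b : ℝ) :
    ContDiff ℝ ∞ (fun ξ => ∫ θ in a..b, F (θ, ξ)) :=
  contDiff_infty.2 fun n => contDiff_parametric_integral_nat n hF a b

theorem rotT_parametric_integral {F : ℝ × Config → G} (hF : ContDiff ℝ ∞ F) (a b : ℝ)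
    (ξ : Config) : rotT (fun ξ => ∫ θ in a..b, F (θ, ξ)) ξ =
      ∫ θ in a..b, rotT (fun ξ => F (θ, ξ)) ξ := by
  have hc : Continuous fun z : ℝ × Config =>
      (fderiv ℝ F z).comp (ContinuousLinearMap.inr ℝ ℝ Config) :=
    (hF.continuous_fderiv (by simp)).clm_comp continuous_const
  rw [rotT_eq_fderiv, (hasFDerivAt_parametric_integral hF a b ξ).fderiv,
    ContinuousLinearMap.intervalIntegral_apply (show IntervalIntegrable (fun θ =>
      (fderiv ℝ F (θ, ξ)).comp (ContinuousLinearMap.inr ℝ ℝ Config)) volume a b from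
      (hc.comp (by fun_prop : Continuous fun θ : ℝ => (θ, ξ))).intervalIntegrable _ _)]
  refine intervalIntegral.integral_congr fun θ _ => ?_
  have := ((hF.differentiable (by simp)) (θ, ξ)).hasFDerivAt.comp ξ (hasFDerivAt_prodMk_right θ ξ)
  simp only [rotT_eq_fderiv]
  rw [show (fun ξ => F (θ, ξ)) = F ∘ (fun ξ => (θ, ξ)) from rfl, this.fderiv]

theorem integral_id_smul_deriv [CompleteSpace G] {f f' : ℝ → G} (h : ∀ t, HasDerivAt f (f' t) t)
    (hf' : Continuous f') (b : ℝ) :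
    ∫ t in (0 : ℝ)..b, t • f' t = b • f b - ∫ t in (0 : ℝ)..b, f t := by
  have hf : Continuous f := continuous_iff_continuousAt.2 fun t => (h t).continuousAt
  have hf2 : Continuous fun t => t • f' t := continuous_id.smul hf'
  have h1 := intervalIntegral.integral_eq_sub_of_hasDerivAt (f := fun t => t • f t)
    (f' := fun t => t • f' t + (1 : ℝ) • f t) (fun t _ => (hasDerivAt_id' t).smul (h t))
    ((hf2.add (hf.const_smul (1 : ℝ))).intervalIntegrable 0 b)
  simp only [one_smul, zero_smul, sub_zero] at h1
  rw [intervalIntegral.integral_add (hf2.intervalIntegrable 0 b) (hf.intervalIntegrable 0 b)] at h1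
  exact eq_sub_of_add_eq h1

end Parametric

section HalfTurn

variable {V : Type*} [NormedAddCommGroup V] [InnerProductSpace ℂ V]

/-- For an operator `P` with `P² = -1/4` this is `exp (θ P)`. -/
def halfTurn (P : V →L[ℂ] V) (θ : ℝ) (v : V) : V :=
  Real.cos (θ / 2) • v + (2 * Real.sin (θ / 2)) • P v

theorem contDiff_halfTurn (P : V →L[ℂ] V) {E : Type*} [NormedAddCommGroup E] [NormedSpace ℝ E]
    {t : E → ℝ} {v : E → V} (ht : ContDiff ℝ ∞ t) (hv : ContDiff ℝ ∞ v) :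
    ContDiff ℝ ∞ fun z => halfTurn P (t z) (v z) := by
  have hP : ContDiff ℝ ∞ (P.restrictScalars ℝ) := ContinuousLinearMap.contDiff _
  exact (ContDiff.smul (F := V) (f := fun z => Real.cos (t z / 2))
    (Real.contDiff_cos.comp (ht.div_const 2)) hv).add
    (ContDiff.smul (F := V) (f := fun z => 2 * Real.sin (t z / 2))
    (contDiff_const.mul (Real.contDiff_sin.comp (ht.div_const 2))) (hP.comp hv))

theorem halfTurn_comm {P Q : V →L[ℂ] V} (h : P * Q = Q * P) (θ : ℝ) (v : V) :
    Q (halfTurn P θ v) = halfTurn P θ (Q v) := by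
  have h' : ∀ v, Q (P v) = P (Q v) := fun v => (congrArg (fun A : V →L[ℂ] V => A v) h).symm
  simp only [halfTurn, map_add, ← Complex.coe_smul (E := V), map_smul, h']

theorem halfTurn_add (P : V →L[ℂ] V) (θ : ℝ) (v w : V) :
    halfTurn P θ (v + w) = halfTurn P θ v + halfTurn P θ w := by
  simp only [halfTurn, map_add, smul_add]; abel

theorem hasDerivAt_halfTurn {P : V →L[ℂ] V} (hP : P * P = (-(1 / 4) : ℂ) • 1) {v : ℝ → V} {v' : V}
    {θ : ℝ} (hv : HasDerivAt v v' θ) :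
    HasDerivAt (fun θ => halfTurn P θ (v θ)) (P (halfTurn P θ (v θ)) + halfTurn P θ v') θ := by
  have hP' : ∀ v, P (P v) = (-(1 / 4) : ℝ) • v := fun v => by
    have := congrArg (fun A : V →L[ℂ] V => A v) hP
    simp only [mul_apply_eq_comp, smul_apply, one_apply_eq_self] at this
    rw [this, ← Complex.coe_smul (E := V)]; norm_num
  have h1 : HasDerivAt (fun θ : ℝ => Real.cos (θ / 2)) (-Real.sin (θ / 2) * (1 / 2)) θ :=
    ((hasDerivAt_id' θ).div_const 2).cos
  have h2 : HasDerivAt (fun θ : ℝ => 2 * Real.sin (θ / 2)) (2 * (Real.cos (θ / 2) * (1 / 2))) θ :=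
    ((hasDerivAt_id' θ).div_const 2).sin.const_mul 2
  have hPv : HasDerivAt (fun θ => P (v θ)) (P v') θ :=
    (P.restrictScalars ℝ).hasFDerivAt.comp_hasDerivAt θ hv
  refine ((h1.smul (F := V) hv).add (h2.smul (F := V) hPv)).congr_deriv ?_
  have hr : ∀ (r : ℝ) (v : V), P (r • v) = r • P v := fun r v => by
    rw [← Complex.coe_smul (E := V), map_smul, Complex.coe_smul]
  simp only [halfTurn, map_add, hr, hP', smul_smul]
  rw [show 2 * Real.sin (θ / 2) * (-(1 / 4)) = -Real.sin (θ / 2) * (1 / 2) by ring,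
    show 2 * (Real.cos (θ / 2) * (1 / 2)) = Real.cos (θ / 2) by ring]
  abel

end HalfTurn

variable {V : Type*} [NormedAddCommGroup V] [InnerProductSpace ℂ V]

namespace CliffordRel

variable {A : Type*} [Ring A] [Algebra ℂ A] {psi lam : Fin 8 → A}

theorem pair_comm (h : CliffordRel psi lam) {a b c d : Fin 8} (h1 : b ≠ c) (h2 : a ≠ c) (h3 : b ≠ d)
    (h4 : a ≠ d) : psi a * psi b * (psi c * psi d) = psi c * psi d * (psi a * psi b) := by
  have e1 := h.psi_mul_psi_comm a b c
  have e2 := h.psi_mul_psi_comm a b d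
  simp only [h1, h2, h3, h4, if_false, zero_smul, sub_zero] at e1 e2
  rw [sub_eq_zero] at e1 e2
  rw [← mul_assoc, e1, mul_assoc, e2, mul_assoc]

theorem pair_sq (h : CliffordRel psi lam) {a b : Fin 8} (hab : a ≠ b) :
    psi a * psi b * (psi a * psi b) = (-(1 / 4) : ℂ) • 1 := by
  have hs : ∀ a, psi a * psi a = (1 / 2 : ℂ) • 1 := fun a => by
    have := h.psi_anticomm a a
    rw [← two_smul ℂ, if_pos rfl] at this
    rw [show (1 / 2 : ℂ) • (1 : A) = (1 / 2 : ℂ) • ((1 : ℂ) • 1) by rw [one_smul], ← this, smul_smul]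
    norm_num
  have e : psi b * psi a = - (psi a * psi b) := by
    have := h.psi_anticomm a b
    rw [if_neg hab, zero_smul] at this
    exact eq_neg_of_add_eq_zero_right this
  rw [mul_assoc, ← mul_assoc (psi b), e, neg_mul, mul_neg, mul_assoc (psi a) (psi b) (psi b), hs,
    mul_smul_comm, mul_smul_comm, mul_one, hs, smul_smul, ← neg_smul]
  norm_num

theorem rotGen_eq (h : CliffordRel psi lam) : rotGen psi =
    psi 0 * psi 1 + (-1 : ℂ) • (psi 2 * psi 3) + psi 4 * psi 5 + (-1 : ℂ) • (psi 6 * psi 7) := by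
  have e : ∀ a b, a ≠ b → psi b * psi a = - (psi a * psi b) := fun a b hab => by
    have := h.psi_anticomm a b
    rw [if_neg hab, zero_smul] at this
    exact eq_neg_of_add_eq_zero_right this
  rw [rotGen, bil]
  simp [Fin.sum_univ_eight, sMat, block_apply, quatR]
  rw [e 0 1 (by decide), e 2 3 (by decide), e 4 5 (by decide), e 6 7 (by decide)]
  module

end CliffordRel

namespace FermionRep

variable [CompleteSpace V] (R : FermionRep V)

/-- The four commuting rotation planes in the spinor space. -/
def plane : Fin 4 → V →L[ℂ] V := ![R.psi 0 * R.psi 1, (-1 : ℂ) • (R.psi 2 * R.psi 3),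
  R.psi 4 * R.psi 5, (-1 : ℂ) • (R.psi 6 * R.psi 7)]

theorem plane_sq (i : Fin 4) : R.plane i * R.plane i = (-(1 / 4) : ℂ) • 1 := by
  have h : ∀ a b, a ≠ b → R.psi a * R.psi b * (R.psi a * R.psi b) = (-(1 / 4) : ℂ) • 1 :=
    fun a b => R.rel.pair_sq
  fin_cases i
  · exact h 0 1 (by decide)
  · simpa [plane] using h 2 3 (by decide)
  · exact h 4 5 (by decide)
  · simpa [plane] using h 6 7 (by decide)

theorem plane_comm (i j : Fin 4) : R.plane i * R.plane j = R.plane j * R.plane i := by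
  have h : ∀ a b c d, b ≠ c → a ≠ c → b ≠ d → a ≠ d →
      R.psi a * R.psi b * (R.psi c * R.psi d) = R.psi c * R.psi d * (R.psi a * R.psi b) :=
    fun a b c d h1 h2 h3 h4 => R.rel.pair_comm h1 h2 h3 h4
  fin_cases i <;> fin_cases j <;>
    simp only [plane, Fin.zero_eta, Fin.mk_one, Fin.reduceFinMk, Matrix.cons_val, smul_mul_assoc,
      mul_smul_comm] <;> first
    | rfl
    | (first | exact h _ _ _ _ (by decide) (by decide) (by decide) (by decide)
             | rw [h _ _ _ _ (by decide) (by decide) (by decide) (by decide)])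

theorem rotX_eq : R.rotX = R.plane 0 + R.plane 1 + R.plane 2 + R.plane 3 := R.rel.rotGen_eq

/-- The spinor rotation `exp (θ X)`. -/
def rotU (θ : ℝ) (v : V) : V :=
  halfTurn (R.plane 0) θ (halfTurn (R.plane 1) θ (halfTurn (R.plane 2) θ
    (halfTurn (R.plane 3) θ v)))

theorem rotU_zero (v : V) : R.rotU 0 v = v := by simp [rotU, halfTurn]

theorem rotU_two_pi (v : V) : R.rotU (2 * Real.pi) v = v := by
  have : 2 * Real.pi / 2 = Real.pi := by ring
  simp [rotU, halfTurn, this]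

theorem contDiff_rotU {E : Type*} [NormedAddCommGroup E] [NormedSpace ℝ E]
    {t : E → ℝ} {v : E → V} (ht : ContDiff ℝ ∞ t) (hv : ContDiff ℝ ∞ v) :
    ContDiff ℝ ∞ fun z => R.rotU (t z) (v z) :=
  contDiff_halfTurn _ ht (contDiff_halfTurn _ ht (contDiff_halfTurn _ ht
    (contDiff_halfTurn _ ht hv)))

/-- `rotU` as a continuous linear map. -/
def rotUL (θ : ℝ) : V →L[ℝ] V :=
  let h (i : Fin 4) : V →L[ℝ] V := Real.cos (θ / 2) • ContinuousLinearMap.id ℝ V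
    + (2 * Real.sin (θ / 2)) • (R.plane i).restrictScalars ℝ
  (h 0).comp ((h 1).comp ((h 2).comp (h 3)))

theorem rotU_zero_right (θ : ℝ) : R.rotU θ 0 = 0 := (R.rotUL θ).map_zero

theorem rotU_sub (θ : ℝ) (v w : V) : R.rotU θ (v - w) = R.rotU θ v - R.rotU θ w :=
  (R.rotUL θ).map_sub v w

theorem rotU_neg (θ : ℝ) (v : V) : R.rotU θ (-v) = - R.rotU θ v := (R.rotUL θ).map_neg v

theorem rotU_comm {Q : V →L[ℂ] V} (h : ∀ i, R.plane i * Q = Q * R.plane i) (θ : ℝ) (v : V) :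
    Q (R.rotU θ v) = R.rotU θ (Q v) := by
  simp only [rotU, halfTurn_comm (h _)]

theorem rotX_rotU (θ : ℝ) (v : V) : R.rotX (R.rotU θ v) = R.rotU θ (R.rotX v) :=
  R.rotU_comm (fun i => by
    rw [rotX_eq]
    simp only [mul_add, add_mul]
    rw [R.plane_comm i 0, R.plane_comm i 1, R.plane_comm i 2, R.plane_comm i 3]) θ v

theorem hasDerivAt_rotU {v : ℝ → V} {v' : V} {θ : ℝ} (hv : HasDerivAt v v' θ) :
    HasDerivAt (fun θ => R.rotU θ (v θ)) (R.rotX (R.rotU θ (v θ)) + R.rotU θ v') θ := by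
  refine (hasDerivAt_halfTurn (R.plane_sq 0) (hasDerivAt_halfTurn (R.plane_sq 1)
    (hasDerivAt_halfTurn (R.plane_sq 2) (hasDerivAt_halfTurn (R.plane_sq 3) hv)))).congr_deriv ?_
  simp only [rotX_eq, add_apply, rotU, halfTurn_add, halfTurn_comm (R.plane_comm _ _)]
  abel

theorem inner_rotU (θ : ℝ) (v w : V) : inner ℂ (R.rotU θ v) (R.rotU θ w) = inner ℂ v w := by
  have hd : ∀ t, HasDerivAt (fun θ => inner ℂ (R.rotU θ v) (R.rotU θ w)) 0 t := by
    intro t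
    have h1 : ∀ v, HasDerivAt (fun θ => R.rotU θ v) (R.rotX (R.rotU t v)) t := fun v => by
      refine (R.hasDerivAt_rotU (hasDerivAt_const t v)).congr_deriv ?_
      simp [rotU, halfTurn]
    refine ((h1 v).inner ℂ (h1 w)).congr_deriv ?_
    rw [rotX_skew]; simp
  have := is_const_of_deriv_eq_zero (fun t => (hd t).differentiableAt) (fun t => (hd t).deriv) θ 0
  simpa [rotU_zero] using this

theorem norm_rotU (θ : ℝ) (v : V) : ‖R.rotU θ v‖ = ‖v‖ := by
  have h := R.inner_rotU θ v v
  rw [inner_self_eq_norm_sq_to_K, inner_self_eq_norm_sq_to_K] at h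
  have h2 : ‖R.rotU θ v‖ ^ 2 = ‖v‖ ^ 2 := by exact_mod_cast h
  exact (sq_eq_sq₀ (norm_nonneg _) (norm_nonneg _)).1 h2

/-- The gauge transform of `η`. -/
def transform (η : Config → V) (z : ℝ × Config) : V := R.rotU z.1 (η (rot (-z.1) z.2))

theorem contDiff_transform {η : Config → V} (hη : ContDiff ℝ ∞ η) : ContDiff ℝ ∞ (R.transform η) :=
  R.contDiff_rotU contDiff_fst (hη.comp contDiff_rot_uncurry)

theorem rotT_comp_rot {F : Type*} [NormedAddCommGroup F] [NormedSpace ℝ F] {η : Config → F}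
    (hη : Differentiable ℝ η) (θ : ℝ) (ξ : Config) :
    rotT (fun ξ => η (rot θ ξ)) ξ = rotT η (rot θ ξ) := by
  have h1 : HasFDerivAt (rot θ) ((rotL θ : Config ≃L[ℝ] Config) : Config →L[ℝ] Config) ξ :=
    ((rotL θ : Config ≃L[ℝ] Config) : Config →L[ℝ] Config).hasFDerivAt
  have := (hη (rot θ ξ)).hasFDerivAt.comp ξ h1
  rw [rotT_eq_fderiv, rotT_eq_fderiv, show (fun ξ => η (rot θ ξ)) = η ∘ rot θ from rfl, this.fderiv,
    ← rot_rotVec]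
  rfl

theorem hasDerivAt_transform {η : Config → V} (hη : Differentiable ℝ η) (ξ : Config) (θ : ℝ) :
    HasDerivAt (fun θ => R.transform η (θ, ξ)) (-R.rotU θ (R.covD η (rot (-θ) ξ))) θ := by
  have h1 : HasDerivAt (fun θ => η (rot (-θ) ξ)) (-rotT η (rot (-θ) ξ)) θ := by
    have := (hη (rot (-θ) ξ)).hasFDerivAt.comp_hasDerivAt θ (hasDerivAt_rot_neg ξ θ)
    rw [map_neg, ← rotT_eq_fderiv] at this
    exact this
  refine (R.hasDerivAt_rotU h1).congr_deriv ?_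
  rw [rotX_rotU, covD, rotU_sub, rotU_neg]
  abel

/-- A physical function is covariant under finite gauge rotations. -/
theorem apply_rot {g : Config → V} (hg : Differentiable ℝ g) (h : ∀ ξ, R.covD g ξ = 0) (θ : ℝ)
    (ξ : Config) : g (rot θ ξ) = R.rotU θ (g ξ) := by
  have hd : ∀ t, HasDerivAt (fun t => R.transform g (t, rot θ ξ)) 0 t := fun t =>
    (R.hasDerivAt_transform hg _ t).congr_deriv (by rw [h, R.rotU_zero_right, neg_zero])
  have := is_const_of_deriv_eq_zero (fun t => (hd t).differentiableAt) (fun t => (hd t).deriv) θ 0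
  simpa [transform, rot_rot, rot_zero, rotU_zero] using this.symm

theorem covD_transform {η : Config → V} (hη : Differentiable ℝ η) (θ : ℝ) (ξ : Config) :
    R.covD (fun ξ => R.transform η (θ, ξ)) ξ = R.rotU θ (R.covD η (rot (-θ) ξ)) := by
  have h1 : Differentiable ℝ fun ξ => η (rot (-θ) ξ) :=
    hη.comp ((rotL (-θ) : Config ≃L[ℝ] Config) : Config →L[ℝ] Config).differentiable
  have h2 : ∀ v, R.rotU θ v = R.rotUL θ v := fun v => rfl
  simp only [covD, transform, h2]
  rw [rotT_clm _ (h1 ξ), rotT_comp_rot hη, ← h2, ← h2, ← h2, rotX_rotU, rotU_sub]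

theorem isTestFn_average {η : Config → V} (hη : IsTestFn η) {c : ℝ → ℝ} (hc : ContDiff ℝ ∞ c)
    (a b : ℝ) : IsTestFn fun ξ => ∫ θ in a..b, c θ • R.transform η (θ, ξ) := by
  have hF : ContDiff ℝ ∞ fun z : ℝ × Config => c z.1 • R.transform η z :=
    ContDiff.smul (F := V) (f := fun z : ℝ × Config => c z.1) (hc.comp contDiff_fst)
      (R.contDiff_transform hη.1)
  refine ⟨contDiff_parametric_integral hF a b, ?_⟩
  obtain ⟨r, hr⟩ := hη.2.isCompact.isBounded.subset_closedBall (0 : Config)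
  refine HasCompactSupport.intro (isCompact_closedBall (0 : Config) r) fun ξ hξ => ?_
  have h0 : ∀ θ, R.transform η (θ, ξ) = 0 := fun θ => by
    have : η (rot (-θ) ξ) = 0 := image_eq_zero_of_notMem_tsupport fun hm => hξ (by
      have := hr hm
      simpa [norm_rot] using this)
    simp only [transform, this, rotU_zero_right]
  simp [h0]

theorem covD_average {η : Config → V} (hη : IsTestFn η) {c : ℝ → ℝ} (hc : ContDiff ℝ ∞ c)
    (a b : ℝ) (ξ : Config) : R.covD (fun ξ => ∫ θ in a..b, c θ • R.transform η (θ, ξ)) ξ =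
      ∫ θ in a..b, c θ • R.rotU θ (R.covD η (rot (-θ) ξ)) := by
  have hF : ContDiff ℝ ∞ fun z : ℝ × Config => c z.1 • R.transform η z :=
    ContDiff.smul (F := V) (f := fun z : ℝ × Config => c z.1) (hc.comp contDiff_fst)
      (R.contDiff_transform hη.1)
  have hs : ∀ θ, Differentiable ℝ fun ξ => R.transform η (θ, ξ) := fun θ =>
    ((R.contDiff_transform hη.1).comp (contDiff_prodMk_right θ)).differentiable (by simp)
  have hX : R.rotX (∫ θ in a..b, c θ • R.transform η (θ, ξ)) =
      ∫ θ in a..b, R.rotX (c θ • R.transform η (θ, ξ)) :=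
    ((R.rotX.restrictScalars ℝ).intervalIntegral_comp_comm
      ((hF.continuous.comp (by fun_prop : Continuous fun θ : ℝ => (θ, ξ))).intervalIntegrable _ _)).symm
  have hT := rotT_parametric_integral hF a b ξ
  have hr : ∀ (r : ℝ) (v : V), R.rotX (r • v) = r • R.rotX v := fun r v => by
    rw [← Complex.coe_smul (E := V), map_smul, Complex.coe_smul]
  have hT1 : ∀ θ, rotT (fun ξ => c θ • R.transform η (θ, ξ)) ξ
      = c θ • rotT (fun ξ => R.transform η (θ, ξ)) ξ := fun θ => by
    rw [rotT_smul (differentiableAt_const _) (hs θ ξ)]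
    simp [rotT_eq_fderiv]
  have hcov : ∀ θ, c θ • R.rotU θ (R.covD η (rot (-θ) ξ)) =
      rotT (fun ξ => c θ • R.transform η (θ, ξ)) ξ - R.rotX (c θ • R.transform η (θ, ξ)) :=
    fun θ => by
      rw [hT1, hr, ← smul_sub, ← R.covD_transform hη.differentiable]; rfl
  rw [covD, hT, hX]
  simp only [hcov]
  have hTc : Continuous fun θ => rotT (fun ξ => c θ • R.transform η (θ, ξ)) ξ := by
    have h1 : Continuous fun θ => fderiv ℝ (fun z : ℝ × Config => c z.1 • R.transform η z) (θ, ξ)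
        (0, rotVec ξ) :=
      ((hF.continuous_fderiv (by simp)).comp
        (by fun_prop : Continuous fun θ : ℝ => (θ, ξ))).clm_apply continuous_const
    refine h1.congr fun θ => ?_
    have := ((hF.differentiable (by simp)) (θ, ξ)).hasFDerivAt.comp ξ (hasFDerivAt_prodMk_right θ ξ)
    rw [rotT_eq_fderiv, show (fun ξ => c θ • R.transform η (θ, ξ)) =
      (fun z : ℝ × Config => c z.1 • R.transform η z) ∘ (fun ξ => (θ, ξ)) from rfl, this.fderiv]
    simp
  have hXc : Continuous fun θ => R.rotX (c θ • R.transform η (θ, ξ)) :=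
    R.rotX.continuous.comp (hF.continuous.comp (by fun_prop : Continuous fun θ : ℝ => (θ, ξ)))
  rw [intervalIntegral.integral_sub (hTc.intervalIntegrable _ _) (hXc.intervalIntegrable _ _)]

theorem transform_two_pi (η : Config → V) (ξ : Config) :
    R.transform η (2 * Real.pi, ξ) = η ξ := by
  rw [transform, rotU_two_pi, rot_two_pi]

theorem transform_zero (η : Config → V) (ξ : Config) : R.transform η (0, ξ) = η ξ := by
  rw [transform, rotU_zero, neg_zero, rot_zero]

theorem continuous_transform {η : Config → V} (hη : ContDiff ℝ ∞ η) (ξ : Config) :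
    Continuous fun θ => R.transform η (θ, ξ) :=
  (R.contDiff_transform hη).continuous.comp (by fun_prop : Continuous fun θ : ℝ => (θ, ξ))

/-- Every test function is the sum of a physical one and a gauge variation. -/
theorem exists_gauge_decomposition {η : Config → V} (hη : IsTestFn η) :
    ∃ p τ : Config → V, IsTestFn p ∧ IsTestFn τ ∧ (∀ ξ, R.covD p ξ = 0) ∧
      ∀ ξ, η ξ = p ξ + R.covD τ ξ := by
  obtain ⟨Θ, hΘ0, hend⟩ : ∃ Θ : ℝ, Θ ≠ 0 ∧ ∀ ξ, R.transform η (Θ, ξ) = η ξ :=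
    ⟨2 * Real.pi, by positivity, R.transform_two_pi η⟩
  have hd := fun ξ θ => R.hasDerivAt_transform hη.differentiable ξ θ
  have hcont := fun ξ => R.continuous_transform (R.isTestFn_covD hη).1 ξ
  have hcont' := fun ξ => R.continuous_transform hη.1 ξ
  have h0 := R.transform_zero η
  have hp1 : ∀ ξ, ∫ θ in (0 : ℝ)..Θ, R.rotU θ (R.covD η (rot (-θ) ξ)) = 0 := fun ξ => by
    have := intervalIntegral.integral_eq_sub_of_hasDerivAt (fun θ _ => hd ξ θ)
      ((hcont ξ).neg.intervalIntegrable 0 Θ)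
    rw [hend, h0, sub_self, intervalIntegral.integral_neg, neg_eq_zero] at this
    exact this
  have hp2 : ∀ ξ, ∫ θ in (0 : ℝ)..Θ, θ • R.rotU θ (R.covD η (rot (-θ) ξ)) =
      (∫ θ in (0 : ℝ)..Θ, R.transform η (θ, ξ)) - Θ • η ξ := fun ξ => by
    have := integral_id_smul_deriv (hd ξ) (hcont ξ).neg Θ
    simp only [smul_neg, intervalIntegral.integral_neg, hend] at this
    rw [← neg_sub, ← this, neg_neg]
  refine ⟨fun ξ => ∫ θ in (0 : ℝ)..Θ, Θ⁻¹ • R.transform η (θ, ξ),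
    fun ξ => ∫ θ in (0 : ℝ)..Θ, (-Θ⁻¹ * θ) • R.transform η (θ, ξ),
    R.isTestFn_average hη (c := fun _ => Θ⁻¹) contDiff_const 0 Θ,
    R.isTestFn_average hη (c := fun θ => -Θ⁻¹ * θ) (contDiff_const.mul contDiff_id) 0 Θ, fun ξ => ?_, fun ξ => ?_⟩
  · rw [R.covD_average hη (c := fun _ => Θ⁻¹) contDiff_const, intervalIntegral.integral_smul, hp1, smul_zero]
  · rw [R.covD_average hη (c := fun θ => -Θ⁻¹ * θ) (contDiff_const.mul contDiff_id)]
    simp only [mul_smul]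
    rw [intervalIntegral.integral_smul, intervalIntegral.integral_smul, hp2, smul_sub, smul_smul,
      neg_mul, inv_mul_cancel₀ hΘ0]
    simp


end FermionRep

end DeformedSQM

namespace DeformedSQM

/-! ### The energy form -/

/-- The squared length of the gradient. -/
def gradSq {F : Type*} [NormedAddCommGroup F] [NormedSpace ℝ F] (f : Config → F) (ξ : Config) : ℝ :=
  ∑ i, ‖pd i f ξ‖ ^ 2

theorem gradSq_nonneg {F : Type*} [NormedAddCommGroup F] [NormedSpace ℝ F] (f : Config → F)
    (ξ : Config) : 0 ≤ gradSq f ξ := Finset.sum_nonneg fun _ _ => by positivity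

theorem continuous_gradSq {F : Type*} [NormedAddCommGroup F] [NormedSpace ℝ F] {f : Config → F}
    (hf : ContDiff ℝ ∞ f) : Continuous (gradSq f) :=
  continuous_finsetSum _ fun i _ => (contDiff_pd hf i).continuous.norm.pow 2

variable {V : Type*} [NormedAddCommGroup V] [InnerProductSpace ℂ V]

theorem pd_eq_zero {F : Type*} [NormedAddCommGroup F] [NormedSpace ℝ F] {f : Config → F}
    {ξ : Config} (h : ξ ∉ tsupport f) (i : Idx) : pd i f ξ = 0 := by
  have : ξ ∉ tsupport (pd i f) := fun hm => h (tsupport_fderiv_apply_subset ℝ _ hm)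
  exact image_eq_zero_of_notMem_tsupport this

theorem hasCompactSupport_gradSq {F : Type*} [NormedAddCommGroup F] [NormedSpace ℝ F]
    {f : Config → F} (hf : HasCompactSupport f) : HasCompactSupport (gradSq f) :=
  HasCompactSupport.intro hf fun ξ hξ => by simp [gradSq, pd_eq_zero hξ]

theorem normSq_add (v w : V) : ‖v + w‖ ^ 2 = ‖v‖ ^ 2 + 2 * (inner ℂ v w).re + ‖w‖ ^ 2 := by
  simpa using norm_add_sq (𝕜 := ℂ) v w

theorem normSq_smul (c : ℝ) (v : V) : ‖c • v‖ ^ 2 = c ^ 2 * ‖v‖ ^ 2 := by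
  rw [← Complex.coe_smul (E := V), norm_smul, mul_pow, Complex.norm_real, Real.norm_eq_abs, sq_abs]

theorem inner_smul_smul_re (a b : ℝ) (v w : V) :
    (inner ℂ (a • v) (b • w)).re = a * b * (inner ℂ v w).re := by
  rw [← Complex.coe_smul (E := V), ← Complex.coe_smul (E := V), inner_smul_left, inner_smul_right,
    Complex.conj_ofReal, ← mul_assoc, ← Complex.ofReal_mul, Complex.re_ofReal_mul]

theorem gradSq_smul {c : Config → ℝ} {g : Config → V} {ξ : Config} (hc : DifferentiableAt ℝ c ξ)
    (hg : DifferentiableAt ℝ g ξ) : gradSq (fun ξ => c ξ • g ξ) ξ =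
      c ξ ^ 2 * gradSq g ξ + (∑ i, 2 * c ξ * pd i c ξ * (inner ℂ (pd i g ξ) (g ξ)).re)
        + gradSq c ξ * ‖g ξ‖ ^ 2 := by
  simp only [gradSq, pd_smul hc hg, normSq_add, normSq_smul, Finset.sum_add_distrib,
    inner_smul_smul_re, Finset.mul_sum, Finset.sum_mul, Real.norm_eq_abs, sq_abs]
  congr 2
  refine Finset.sum_congr rfl fun i _ => by ring

/-- The localization formula: splitting `g` into `c g` and `s g` with `c² + s² = 1` changes the
kinetic energy density only by the gradients of `c` and `s`. -/
theorem gradSq_localization {c s : Config → ℝ} {g : Config → V} {ξ : Config}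
    (hc : Differentiable ℝ c) (hs : Differentiable ℝ s)
    (hg : DifferentiableAt ℝ g ξ) (h : ∀ ξ, c ξ ^ 2 + s ξ ^ 2 = 1) :
    gradSq (fun ξ => c ξ • g ξ) ξ + gradSq (fun ξ => s ξ • g ξ) ξ
      = gradSq g ξ + (gradSq c ξ + gradSq s ξ) * ‖g ξ‖ ^ 2 := by
  have h0 : ∀ i, c ξ * pd i c ξ + s ξ * pd i s ξ = 0 := fun i => by
    have h1 : pd i (fun ξ => c ξ * c ξ + s ξ * s ξ) ξ = 0 := by
      have : (fun ξ => c ξ * c ξ + s ξ * s ξ) = fun _ => (1 : ℝ) := by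
        ext η; rw [← h η]; ring
      rw [this, pd_const]
    have hcc : DifferentiableAt ℝ (fun ξ => c ξ * c ξ) ξ := (hc ξ).mul (hc ξ)
    have hss : DifferentiableAt ℝ (fun ξ => s ξ * s ξ) ξ := (hs ξ).mul (hs ξ)
    rw [pd_add_at hcc hss, pd_mul (hc ξ) (hc ξ),
      pd_mul (hs ξ) (hs ξ)] at h1
    linarith
  rw [gradSq_smul (hc ξ) hg, gradSq_smul (hs ξ) hg]
  have h2 : (∑ i, 2 * c ξ * pd i c ξ * (inner ℂ (pd i g ξ) (g ξ)).re)
      + (∑ i, 2 * s ξ * pd i s ξ * (inner ℂ (pd i g ξ) (g ξ)).re) = 0 := by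
    rw [← Finset.sum_add_distrib]
    refine Finset.sum_eq_zero fun i _ => ?_
    linear_combination 2 * (inner ℂ (pd i g ξ) (g ξ)).re * h0 i
  linear_combination h2 + gradSq g ξ * h ξ

theorem integrable_of_test {F : Type*} [NormedAddCommGroup F] {f : Config → ℝ} (hf : Continuous f)
    {g : Config → F}
    (hg : HasCompactSupport g) (h : ∀ ξ, ξ ∉ tsupport g → f ξ = 0) : Integrable f :=
  hf.integrable_of_hasCompactSupport (HasCompactSupport.intro hg h)

theorem integrable_mul_normSq {f : Config → ℝ} (hf : Continuous f) {g : Config → V}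
    (hg : Continuous g) (hgc : HasCompactSupport g) : Integrable fun ξ => f ξ * ‖g ξ‖ ^ 2 :=
  integrable_of_test (hf.mul (hg.norm.pow 2)) hgc fun ξ hξ => by
    simp [image_eq_zero_of_notMem_tsupport hξ]

/-- Integration by parts against a weight that is differentiable in the direction of integration. -/
theorem integral_mul_pd_normSq {g : Config → V} (hg : IsTestFn g) {a a' : Config → ℝ} {i : Idx}
    (ha : Continuous a) (ha' : Continuous a')
    (h : ∀ ξ, HasLineDerivAt ℝ a (a' ξ) ξ (unitVec i)) :
    ∫ ξ, 2 * a ξ * (inner ℂ (pd i g ξ) (g ξ)).re = - ∫ ξ, a' ξ * ‖g ξ‖ ^ 2 := by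
  have hz : ∀ ξ, ξ ∉ tsupport g → g ξ = 0 := fun ξ hξ => image_eq_zero_of_notMem_tsupport hξ
  have hn : ∀ ξ, HasLineDerivAt ℝ (fun ξ => ‖g ξ‖ ^ 2) (2 * (inner ℂ (pd i g ξ) (g ξ)).re) ξ
      (unitVec i) := fun ξ => by
    have hd : DifferentiableAt ℝ (fun ξ => ‖g ξ‖ ^ 2) ξ :=
      (hg.1.norm_sq ℂ).differentiable (by simp) ξ
    have := hd.hasFDerivAt.hasLineDerivAt (unitVec i)
    have e := pd_normSq hg.differentiable i ξ
    rw [pd] at e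
    rw [e] at this
    have e2 := inner_re_symm (𝕜 := ℂ) (g ξ) (pd i g ξ)
    simp only [RCLike.re_to_complex] at e2
    rwa [e2] at this
  have hcn : Continuous fun ξ => (inner ℂ (pd i g ξ) (g ξ)).re :=
    Complex.continuous_re.comp ((hg.pd i).continuous.inner hg.continuous)
  have i1 : Integrable fun ξ => 2 * a ξ * (inner ℂ (pd i g ξ) (g ξ)).re :=
    integrable_of_test ((continuous_const.mul ha).mul hcn) hg.2 fun ξ hξ => by simp [hz ξ hξ]
  have i2 := integrable_mul_normSq ha' hg.continuous hg.2
  have := integral_lineDeriv_eq_zero (f := fun ξ => a ξ * ‖g ξ‖ ^ 2)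
    (f' := fun ξ => 2 * a ξ * (inner ℂ (pd i g ξ) (g ξ)).re + a' ξ * ‖g ξ‖ ^ 2) (v := unitVec i)
    (ha.mul (hg.continuous.norm.pow 2)) (HasCompactSupport.intro hg.2 fun ξ hξ => by simp [hz ξ hξ])
    (((continuous_const.mul ha).mul hcn).add (ha'.mul (hg.continuous.norm.pow 2)))
    (HasCompactSupport.intro hg.2 fun ξ hξ => by simp [hz ξ hξ]) fun ξ => by
      have h1 := (h ξ).mul (hn ξ)
      refine HasDerivAt.congr_deriv h1 ?_
      simp
      ring
  rw [integral_add i1 i2] at this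
  linarith

/-- The ground state representation in one direction. -/
theorem integral_normSq_pd {g : Config → V} (hg : IsTestFn g) {a a' : Config → ℝ} {i : Idx}
    (ha : Continuous a) (ha' : Continuous a')
    (h : ∀ ξ, HasLineDerivAt ℝ a (a' ξ) ξ (unitVec i)) :
    ∫ ξ, ‖pd i g ξ‖ ^ 2 = ∫ ξ, (‖pd i g ξ + a ξ • g ξ‖ ^ 2 + (a' ξ - a ξ ^ 2) * ‖g ξ‖ ^ 2) := by
  have hz : ∀ ξ, ξ ∉ tsupport g → g ξ = 0 := fun ξ hξ => image_eq_zero_of_notMem_tsupport hξ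
  have hcn : Continuous fun ξ => (inner ℂ (pd i g ξ) (g ξ)).re :=
    Complex.continuous_re.comp ((hg.pd i).continuous.inner hg.continuous)
  have i1 : Integrable fun ξ => 2 * a ξ * (inner ℂ (pd i g ξ) (g ξ)).re :=
    integrable_of_test ((continuous_const.mul ha).mul hcn) hg.2 fun ξ hξ => by simp [hz ξ hξ]
  have i2 := integrable_mul_normSq ha' hg.continuous hg.2
  have i3 : Integrable fun ξ => ‖pd i g ξ‖ ^ 2 :=
    integrable_of_test ((hg.pd i).continuous.norm.pow 2) hg.2 fun ξ hξ => by simp [pd_eq_zero hξ]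
  have e : (fun ξ => ‖pd i g ξ + a ξ • g ξ‖ ^ 2 + (a' ξ - a ξ ^ 2) * ‖g ξ‖ ^ 2) = fun ξ =>
      ‖pd i g ξ‖ ^ 2 + (2 * a ξ * (inner ℂ (pd i g ξ) (g ξ)).re + a' ξ * ‖g ξ‖ ^ 2) := by
    ext ξ
    have := inner_smul_smul_re 1 (a ξ) (pd i g ξ) (g ξ)
    rw [one_smul] at this
    rw [normSq_add, normSq_smul, this]
    ring
  have i4 : Integrable fun ξ => 2 * a ξ * (inner ℂ (pd i g ξ) (g ξ)).re + a' ξ * ‖g ξ‖ ^ 2 :=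
    i1.add i2
  rw [e, integral_add i3 i4, integral_add i1 i2, integral_mul_pd_normSq hg ha ha' h]
  ring

namespace FermionRep

variable [CompleteSpace V] (R : FermionRep V)

/-- The expectation value `⟨v, H_F(ξ) v⟩`. -/
def hFexp (ξ : Config) (v : V) : ℝ := (inner ℂ v (R.hF ξ v)).re

/-- The energy density of `g` with respect to `H_k`. -/
def enDens (k : ℝ) (g : Config → V) (ξ : Config) : ℝ :=
  gradSq g ξ + potDef k ξ * ‖g ξ‖ ^ 2 + R.hFexp ξ (g ξ)

/-- The quadratic form of `H_k`. -/
def energy (k : ℝ) (g : Config → V) : ℝ := ∫ ξ, R.enDens k g ξ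

theorem continuous_potDef (k : ℝ) : Continuous (potDef k) := by
  unfold potDef potV; fun_prop

theorem continuous_hF : Continuous R.hF := by
  have h1 : Continuous fun ξ => ∑ μ, (xc ξ μ : ℂ) • bil R.psi (gammaMat μ * sMat 1) R.psi :=
    continuous_finsetSum _ fun μ _ =>
      Continuous.smul (f := fun ξ => (xc ξ μ : ℂ)) (Complex.continuous_ofReal.comp (continuous_xc μ))
        continuous_const
  have h2 : Continuous fun ξ => ∑ j, (qc ξ j : ℂ) • bil R.lam (sMat j * sMat 1) R.psi :=
    continuous_finsetSum _ fun j _ =>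
      Continuous.smul (f := fun ξ => (qc ξ j : ℂ)) (Complex.continuous_ofReal.comp (continuous_qc j))
        continuous_const
  exact Continuous.add (Continuous.const_smul h1 (-Complex.I))
    (Continuous.const_smul h2 (2 * Complex.I))

theorem continuous_hFexp {g : Config → V} (hg : Continuous g) :
    Continuous fun ξ => R.hFexp ξ (g ξ) :=
  Complex.continuous_re.comp (hg.inner (R.continuous_hF.clm_apply hg))

omit [CompleteSpace V] in
theorem integrable_gradSq {g : Config → V} (hg : IsTestFn g) : Integrable (gradSq g) :=
  (continuous_gradSq hg.1).integrable_of_hasCompactSupport (hasCompactSupport_gradSq hg.2)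

theorem integrable_hFexp {g : Config → V} (hg : IsTestFn g) :
    Integrable fun ξ => R.hFexp ξ (g ξ) :=
  integrable_of_test (R.continuous_hFexp hg.continuous) hg.2 fun ξ hξ => by
    simp [hFexp, image_eq_zero_of_notMem_tsupport hξ]

theorem integrable_enDens (k : ℝ) {g : Config → V} (hg : IsTestFn g) :
    Integrable (R.enDens k g) :=
  ((integrable_gradSq hg).add (integrable_mul_normSq (continuous_potDef k) hg.continuous hg.2)).add
    (R.integrable_hFexp hg)

theorem hFexp_smul (ξ : Config) (c : ℝ) (v : V) : R.hFexp ξ (c • v) = c ^ 2 * R.hFexp ξ v := by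
  rw [hFexp, ← Complex.coe_smul (E := V), map_smul, Complex.coe_smul, Complex.coe_smul,
    inner_smul_smul_re, hFexp]
  ring

/-- The energy of a smooth function cut off by `χ`. -/
theorem energy_smul (k : ℝ) {χ : Config → ℝ} {u : Config → V} (hχ : ContDiff ℝ ∞ χ)
    (hu : ContDiff ℝ ∞ u) (hs : IsTestFn fun ξ => χ ξ • u ξ)
    (hi : Integrable fun ξ => gradSq χ ξ * ‖u ξ‖ ^ 2) :
    R.energy k (fun ξ => χ ξ • u ξ) =
      (∫ ξ, inner ℂ (χ ξ • χ ξ • u ξ) (R.hD k u ξ)).re + ∫ ξ, gradSq χ ξ * ‖u ξ‖ ^ 2 := by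
  have hs2 : IsTestFn fun ξ => χ ξ • χ ξ • u ξ := hs.smul hχ
  have hud := hu.differentiable (by simp)
  have hχd := hχ.differentiable (by simp)
  have hpt : ∀ ξ, R.enDens k (fun ξ => χ ξ • u ξ) ξ = (∑ i, (inner ℂ (pd i (fun ξ => χ ξ • χ ξ • u ξ) ξ)
      (pd i u ξ)).re) + (inner ℂ (χ ξ • χ ξ • u ξ) ((potDef k ξ : ℂ) • u ξ + R.hF ξ (u ξ))).re
      + gradSq χ ξ * ‖u ξ‖ ^ 2 := by
    intro ξ
    rw [enDens, gradSq_smul (hχd ξ) (hud ξ), hFexp_smul, normSq_smul]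
    have h1 : ∀ i, (inner ℂ (pd i (fun ξ => χ ξ • χ ξ • u ξ) ξ) (pd i u ξ)).re =
        χ ξ ^ 2 * ‖pd i u ξ‖ ^ 2 + 2 * χ ξ * pd i χ ξ * (inner ℂ (pd i u ξ) (u ξ)).re := by
      intro i
      rw [pd_smul (hχd ξ) (hs.differentiable ξ), pd_smul (hχd ξ) (hud ξ)]
      have e1 : (inner ℂ (pd i u ξ) (pd i u ξ)).re = ‖pd i u ξ‖ ^ 2 := by
        simpa using inner_self_eq_norm_sq (𝕜 := ℂ) (pd i u ξ)
      have e2 := inner_re_symm (𝕜 := ℂ) (u ξ) (pd i u ξ)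
      simp only [RCLike.re_to_complex] at e2
      have e3 : ∀ (a : ℝ) (v w : V), (inner ℂ (a • v) w).re = a * (inner ℂ v w).re := fun a v w => by
        have := inner_smul_smul_re a 1 v w
        rwa [one_smul, mul_one] at this
      simp only [smul_add, smul_smul, inner_add_left, Complex.add_re, e3, e1, e2]
      ring
    simp only [h1, Finset.sum_add_distrib, ← Finset.mul_sum]
    have e4 : (inner ℂ (χ ξ • χ ξ • u ξ) ((potDef k ξ : ℂ) • u ξ + R.hF ξ (u ξ))).re =
        χ ξ ^ 2 * (potDef k ξ * ‖u ξ‖ ^ 2 + R.hFexp ξ (u ξ)) := by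
      have e5 : (inner ℂ (u ξ) (u ξ)).re = ‖u ξ‖ ^ 2 := by
        simpa using inner_self_eq_norm_sq (𝕜 := ℂ) (u ξ)
      have e6 := inner_smul_smul_re (χ ξ * χ ξ) 1 (u ξ) ((potDef k ξ : ℂ) • u ξ + R.hF ξ (u ξ))
      rw [one_smul] at e6
      rw [smul_smul, e6, inner_add_right, inner_smul_right, Complex.add_re, Complex.re_ofReal_mul,
        e5, hFexp]
      ring
    rw [e4]
    simp only [gradSq]
    ring
  have hc2 : Continuous fun ξ => (potDef k ξ : ℂ) • u ξ + R.hF ξ (u ξ) :=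
    ((Complex.continuous_ofReal.comp (continuous_potDef k)).smul hu.continuous).add
      (R.continuous_hF.clm_apply hu.continuous)
  have i1 : ∀ i, Integrable fun ξ => inner ℂ (pd i (fun ξ => χ ξ • χ ξ • u ξ) ξ) (pd i u ξ) :=
    fun i => integrable_inner_cont (hs2.pd i).continuous (hs2.pd i).2 (contDiff_pd hu i).continuous
  have i2 : Integrable fun ξ => inner ℂ (χ ξ • χ ξ • u ξ) ((potDef k ξ : ℂ) • u ξ + R.hF ξ (u ξ)) :=
    integrable_inner_cont hs2.continuous hs2.2 hc2
  have i3 : ∀ i, Integrable fun ξ => inner ℂ (χ ξ • χ ξ • u ξ) (pd i (pd i u) ξ) := fun i =>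
    integrable_inner_cont hs2.continuous hs2.2 (contDiff_pd (contDiff_pd hu i) i).continuous
  have i1' : Integrable fun ξ => ∑ i, (inner ℂ (pd i (fun ξ => χ ξ • χ ξ • u ξ) ξ) (pd i u ξ)).re :=
    integrable_finsetSum _ fun i _ => (i1 i).re
  have i2' : Integrable fun ξ =>
      (inner ℂ (χ ξ • χ ξ • u ξ) ((potDef k ξ : ℂ) • u ξ + R.hF ξ (u ξ))).re := i2.re
  have i12 : Integrable fun ξ => (∑ i, (inner ℂ (pd i (fun ξ => χ ξ • χ ξ • u ξ) ξ) (pd i u ξ)).re)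
      + (inner ℂ (χ ξ • χ ξ • u ξ) ((potDef k ξ : ℂ) • u ξ + R.hF ξ (u ξ))).re := i1'.add i2'
  have hre : ∀ {f : Config → ℂ}, Integrable f → ∫ ξ, (f ξ).re = (∫ ξ, f ξ).re := fun hf => by
    simpa using integral_re hf
  rw [energy]
  simp only [hpt]
  rw [integral_add i12 hi, integral_add i1' i2', integral_finsetSum _ fun i _ => (show Integrable fun ξ =>
      (inner ℂ (pd i (fun ξ => χ ξ • χ ξ • u ξ) ξ) (pd i u ξ)).re from (i1 i).re)]
  congr 1
  simp only [hre (i1 _), hre i2, integral_inner_pd hs2 (contDiff_pd hu _)]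
  have e : ∀ ξ, inner ℂ (χ ξ • χ ξ • u ξ) (R.hD k u ξ) =
      (∑ i, -inner ℂ (χ ξ • χ ξ • u ξ) (pd i (pd i u) ξ))
      + inner ℂ (χ ξ • χ ξ • u ξ) ((potDef k ξ : ℂ) • u ξ + R.hF ξ (u ξ)) := fun ξ => by
    rw [R.hD_eq k hu, add_assoc, inner_add_right, inner_neg_right, inner_sum,
      Finset.sum_neg_distrib]
  simp only [e]
  have i3' : ∀ i, Integrable fun ξ => -inner ℂ (χ ξ • χ ξ • u ξ) (pd i (pd i u) ξ) := fun i =>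
    (i3 i).neg
  rw [integral_add (integrable_finsetSum _ fun i _ => i3' i) i2,
    integral_finsetSum _ fun i _ => i3' i, Complex.add_re, Complex.re_sum]
  simp only [integral_neg]

theorem energy_eq (k : ℝ) {g : Config → V} (hg : IsTestFn g) :
    R.energy k g = (∫ ξ, inner ℂ (g ξ) (R.hD k g ξ)).re := by
  have h0 : ∀ ξ, gradSq (fun _ : Config => (1 : ℝ)) ξ = 0 := fun ξ => by simp [gradSq, pd_const]
  have := R.energy_smul k (χ := fun _ => 1) contDiff_const hg.1 (by simpa using hg) (by simp [h0])
  simpa [h0] using this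

/-- On physical functions the energy is the squared norm of the supercharge. -/
theorem energy_eq_dirac (k : ℝ) {g : Config → V} (hg : IsTestFn g) (h : ∀ ξ, R.covD g ξ = 0) :
    R.energy k g = 2 * ∫ ξ, ‖R.dirac k g ξ‖ ^ 2 := by
  have e : ∀ ξ, R.hD k g ξ = (2 : ℂ) • R.dirac k (R.dirac k g) ξ := fun ξ => by
    rw [R.two_smul_dirac_dirac k hg, gauge_eq, h]; simp
  have e2 : ∀ v : V, inner ℂ v v = ((‖v‖ ^ 2 : ℝ) : ℂ) := fun v => by
    rw [inner_self_eq_norm_sq_to_K]; norm_cast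
  rw [R.energy_eq k hg]
  simp only [e, inner_smul_right]
  rw [integral_const_mul, ← R.integral_inner_dirac k hg (R.isTestFn_dirac k hg).1]
  simp only [e2]
  rw [integral_complex_ofReal]
  norm_cast

end FermionRep

end DeformedSQM

namespace DeformedSQM

/-! ### Bounds on the fermionic part of the Hamiltonian -/

theorem sum_row_sMat_sq (q : Fin 4 → ℝ) (a : Fin 8) :
    ∑ b, (∑ j, q j • (sMat j * sMat 1)) a b ^ 2 = ∑ j, q j ^ 2 := by
  obtain ⟨h1, h2, h3, h4⟩ := sMat_mul_sMat_one
  rw [Fin.sum_univ_four, h1, h2, h3, h4]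
  simp only [Matrix.add_apply, Matrix.smul_apply, Fin.sum_univ_eight, block_apply, smul_eq_mul]
  fin_cases a <;> simp [quatR, Fin.sum_univ_four] <;> ring

theorem sum_row_gammaMat_sq (x : Fin 5 → ℝ) (a : Fin 8) :
    ∑ b, (∑ μ, x μ • (gammaMat μ * sMat 1)) a b ^ 2 = ∑ μ, x μ ^ 2 := by
  obtain ⟨g0, g1, g2, g3, g4⟩ := gammaMat_mul_sMat_one
  rw [Fin.sum_univ_five, g0, g1, g2, g3, g4]
  simp only [Matrix.add_apply, Matrix.smul_apply, Fin.sum_univ_eight, block_apply, smul_eq_mul]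
  fin_cases a <;> simp [quatR, Fin.sum_univ_five] <;> ring

variable {V : Type*} [NormedAddCommGroup V] [InnerProductSpace ℂ V] [CompleteSpace V]

namespace FermionRep

variable (R : FermionRep V)

theorem norm_cl_sq (v : Fin 8 ⊕ Fin 8 → ℝ) (φ : V) :
    ‖R.cl v φ‖ ^ 2 = (∑ a, v a ^ 2) / 2 * ‖φ‖ ^ 2 := by
  have h : (inner ℂ (R.cl v φ) (R.cl v φ)).re = ‖R.cl v φ‖ ^ 2 := by
    simpa using inner_self_eq_norm_sq (𝕜 := ℂ) (R.cl v φ)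
  have h2 : (inner ℂ φ φ).re = ‖φ‖ ^ 2 := by
    simpa using inner_self_eq_norm_sq (𝕜 := ℂ) φ
  rw [← h, cl_sa, cl_sq, inner_smul_right, Complex.re_ofReal_mul, h2]

theorem norm_cl_le (v : Fin 8 ⊕ Fin 8 → ℝ) (φ : V) {m : ℝ} (hm : 0 ≤ m)
    (h : ∑ a, v a ^ 2 ≤ m ^ 2) : ‖R.cl v φ‖ ≤ m / Real.sqrt 2 * ‖φ‖ := by
  refine abs_le_of_sq_le_sq' ?_ (by positivity) |>.2
  rw [norm_cl_sq, mul_pow, div_pow, Real.sq_sqrt (by norm_num)]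
  gcongr

theorem norm_gen_le (a : Fin 8 ⊕ Fin 8) (φ : V) :
    ‖Sum.elim R.psi R.lam a φ‖ ≤ 1 / Real.sqrt 2 * ‖φ‖ := by
  classical
  have h1 : R.cl (Pi.single a 1) φ = Sum.elim R.psi R.lam a φ := by
    rw [cl_apply, Finset.sum_eq_single a] <;> simp +contextual
  rw [← h1]
  refine R.norm_cl_le _ φ zero_le_one ?_
  rw [Finset.sum_eq_single a] <;> simp +contextual

/-- A bilinear expression whose matrix has rows of length at most `m` is bounded by `4 m`. -/
theorem norm_bil_le (e : Fin 8 → Fin 8 ⊕ Fin 8) (M : Matrix (Fin 8) (Fin 8) ℝ) {m : ℝ} (hm : 0 ≤ m)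
    (h : ∀ a, ∑ b, M a b ^ 2 ≤ m ^ 2) (φ : V) :
    ‖bil (fun a => Sum.elim R.psi R.lam (e a)) M R.psi φ‖ ≤ 4 * m * ‖φ‖ := by
  have h1 : bil (fun a => Sum.elim R.psi R.lam (e a)) M R.psi φ =
      ∑ a, Sum.elim R.psi R.lam (e a) (R.cl (Sum.elim (M a) 0) φ) := by
    simp only [bil, sum_apply, smul_apply, mul_apply_eq_comp, cl_apply, Fintype.sum_sum_type,
      Sum.elim_inl, Sum.elim_inr, Pi.zero_apply]
    simp only [← Complex.coe_smul (E := V), Complex.ofReal_zero, zero_smul, Finset.sum_const_zero,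
      add_zero, map_sum, map_smul]
  rw [h1]
  refine (norm_sum_le _ _).trans ?_
  have h2 : ∀ a ∈ Finset.univ, ‖Sum.elim R.psi R.lam (e a) (R.cl (Sum.elim (M a) 0) φ)‖ ≤
      m / 2 * ‖φ‖ := fun a _ => by
    refine (R.norm_gen_le _ _).trans ?_
    have := R.norm_cl_le (Sum.elim (M a) 0) φ hm (by simpa [Fintype.sum_sum_type] using h a)
    calc 1 / Real.sqrt 2 * ‖R.cl (Sum.elim (M a) 0) φ‖
        ≤ 1 / Real.sqrt 2 * (m / Real.sqrt 2 * ‖φ‖) := by gcongr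
      _ = m / (Real.sqrt 2 * Real.sqrt 2) * ‖φ‖ := by field_simp
      _ = m / 2 * ‖φ‖ := by rw [Real.mul_self_sqrt (by norm_num)]
  refine (Finset.sum_le_sum h2).trans (le_of_eq ?_)
  simp
  ring

/-- The Yukawa coupling `2i ∑ q_j λ s^j s² ψ`. -/
def yukQ (q : Fin 4 → ℝ) : V →L[ℂ] V :=
  (2 * Complex.I) • ∑ j, (q j : ℂ) • bil R.lam (sMat j * sMat 1) R.psi

/-- The Yukawa coupling `-i ∑ x^μ ψ γ^μ s² ψ`. -/
def yukX (x : Fin 5 → ℝ) : V →L[ℂ] V :=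
  -Complex.I • ∑ μ, (x μ : ℂ) • bil R.psi (gammaMat μ * sMat 1) R.psi

theorem hF_eq (ξ : Config) : R.hF ξ = R.yukX (xc ξ) + R.yukQ (qc ξ) := rfl

theorem norm_yukQ_le (q : Fin 4 → ℝ) (φ : V) {m : ℝ} (hm : 0 ≤ m) (h : ∑ j, q j ^ 2 ≤ m ^ 2) :
    ‖R.yukQ q φ‖ ≤ 8 * m * ‖φ‖ := by
  have e : ∑ j, (q j : ℂ) • bil R.lam (sMat j * sMat 1) R.psi =
      bil R.lam (∑ j, q j • (sMat j * sMat 1)) R.psi := by simp only [bil_sum, bil_smul]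
  have := R.norm_bil_le Sum.inr (∑ j, q j • (sMat j * sMat 1)) hm
    (fun a => (sum_row_sMat_sq q a).le.trans h) φ
  rw [yukQ, e, smul_apply, norm_smul]
  have h2 : ‖(2 * Complex.I : ℂ)‖ = 2 := by simp
  rw [h2]
  have h3 : bil R.lam (∑ j, q j • (sMat j * sMat 1)) R.psi =
    bil (fun a => Sum.elim R.psi R.lam (Sum.inr a)) (∑ j, q j • (sMat j * sMat 1)) R.psi := rfl
  rw [h3]
  linarith

theorem norm_yukX_le (x : Fin 5 → ℝ) (φ : V) {m : ℝ} (hm : 0 ≤ m) (h : ∑ μ, x μ ^ 2 ≤ m ^ 2) :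
    ‖R.yukX x φ‖ ≤ 4 * m * ‖φ‖ := by
  have e : ∑ μ, (x μ : ℂ) • bil R.psi (gammaMat μ * sMat 1) R.psi =
      bil R.psi (∑ μ, x μ • (gammaMat μ * sMat 1)) R.psi := by simp only [bil_sum, bil_smul]
  have := R.norm_bil_le Sum.inl (∑ μ, x μ • (gammaMat μ * sMat 1)) hm
    (fun a => (sum_row_gammaMat_sq x a).le.trans h) φ
  rw [yukX, e, smul_apply, norm_smul]
  have h2 : ‖(-Complex.I : ℂ)‖ = 1 := by simp
  rw [h2, one_mul]
  exact this

omit [CompleteSpace V] in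
theorem _root_.DeformedSQM.abs_re_inner_le (v w : V) {m : ℝ} (h : ‖w‖ ≤ m * ‖v‖) :
    |(inner ℂ v w).re| ≤ m * ‖v‖ ^ 2 := by
  calc |(inner ℂ v w).re| ≤ ‖inner ℂ v w‖ := Complex.abs_re_le_norm _
    _ ≤ ‖v‖ * ‖w‖ := norm_inner_le_norm _ _
    _ ≤ ‖v‖ * (m * ‖v‖) := by gcongr
    _ = m * ‖v‖ ^ 2 := by ring

/-- The coupling to `q₁, q₂` only. -/
def hVac (ξ : Config) : V →L[ℂ] V := R.yukQ ![qc ξ 0, qc ξ 1, 0, 0]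

/-- The expectation value of the coupling to `q₁, q₂`. -/
def vacExp (ξ : Config) (v : V) : ℝ := (inner ℂ v (R.hVac ξ v)).re

theorem yukQ_add (q q' : Fin 4 → ℝ) : R.yukQ (q + q') = R.yukQ q + R.yukQ q' := by
  simp only [yukQ, Pi.add_apply, Complex.ofReal_add, add_smul, Finset.sum_add_distrib, smul_add]

theorem hFexp_lower (ξ : Config) (v : V) :
    -(8 * Real.sqrt (∑ j, qc ξ j ^ 2) + 4 * Real.sqrt (∑ μ, xc ξ μ ^ 2)) * ‖v‖ ^ 2
      ≤ R.hFexp ξ v := by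
  have h1 := abs_re_inner_le v _ (R.norm_yukQ_le (qc ξ) v (Real.sqrt_nonneg _)
    (Real.sq_sqrt (Finset.sum_nonneg fun _ _ => sq_nonneg _)).ge)
  have h2 := abs_re_inner_le v _ (R.norm_yukX_le (xc ξ) v (Real.sqrt_nonneg _)
    (Real.sq_sqrt (Finset.sum_nonneg fun _ _ => sq_nonneg _)).ge)
  rw [hFexp, hF_eq, add_apply, inner_add_right, Complex.add_re]
  linarith [neg_abs_le (inner ℂ v (R.yukQ (qc ξ) v)).re, neg_abs_le (inner ℂ v (R.yukX (xc ξ) v)).re]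

theorem hFexp_near (ξ : Config) (v : V) {m : ℝ} (hm : 0 ≤ m) (hq : qc ξ 2 ^ 2 + qc ξ 3 ^ 2 ≤ m ^ 2)
    (hx : ∑ μ, xc ξ μ ^ 2 ≤ m ^ 2) : |R.hFexp ξ v - R.vacExp ξ v| ≤ 12 * m * ‖v‖ ^ 2 := by
  have h1 := abs_re_inner_le v _ (R.norm_yukQ_le ![0, 0, qc ξ 2, qc ξ 3] v hm
    (by simpa [Fin.sum_univ_four] using hq))
  have h2 := abs_re_inner_le v _ (R.norm_yukX_le (xc ξ) v hm hx)
  have e : qc ξ = ![qc ξ 0, qc ξ 1, 0, 0] + ![0, 0, qc ξ 2, qc ξ 3] := by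
    ext j; fin_cases j <;> simp
  have h3 : R.hFexp ξ v - R.vacExp ξ v = (inner ℂ v (R.yukX (xc ξ) v)).re +
      (inner ℂ v (R.yukQ ![0, 0, qc ξ 2, qc ξ 3] v)).re := by
    rw [hFexp, vacExp, hVac, hF_eq, add_apply, inner_add_right, Complex.add_re]
    conv_lhs => rw [e]
    rw [yukQ_add, add_apply, inner_add_right, Complex.add_re]
    simp only [Pi.add_apply, Matrix.cons_val, add_zero]
    ring
  rw [h3]
  refine (abs_add_le _ _).trans ?_
  linarith

theorem yukQ_one (c : ℝ) (v : V) : R.yukQ ![0, c, 0, 0] v =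
    (c : ℂ) • ((-(2 * Complex.I)) • ∑ a, R.lam a (R.psi a v)) := by
  have h : sMat 1 * sMat 1 = (-1 : ℝ) • 1 := by
    rw [sMat_mul_sMat_one.2.1]
    ext a b
    simp only [block_apply, Matrix.smul_apply]
    fin_cases a <;> fin_cases b <;> simp
  have h2 : bil R.lam (sMat 1 * sMat 1) R.psi = (-1 : ℂ) • ∑ a, R.lam a * R.psi a := by
    rw [h, bil_smul]
    push_cast
    congr 1
    simp [bil, Matrix.one_apply]
  simp only [yukQ, Fin.sum_univ_four, Matrix.cons_val, Complex.ofReal_zero, zero_smul, zero_add,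
    add_zero, h2, smul_smul, smul_apply, sum_apply, mul_apply_eq_comp]
  congr 1; ring

/-- At a point with `q₁` small and `q₂` close to `ρ`, the coupling to `(q₁, q₂)` is bounded below by
`-8ρ`, and by `-6ρ` on the orthogonal complement of the vacuum. -/
theorem vacExp_lower (ξ : Config) (v : V) {ρ : ℝ} (h0 : 0 ≤ ρ) (hρ : |qc ξ 1| ≤ ρ) :
    2 * ρ * (‖v‖ ^ 2 - ‖inner ℂ R.vac v‖ ^ 2) - 8 * |qc ξ 0| * ‖v‖ ^ 2
      - 8 * (ρ - qc ξ 1) * ‖v‖ ^ 2 ≤ R.vacExp ξ v + 8 * ρ * ‖v‖ ^ 2 := by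
  have e : (![qc ξ 0, qc ξ 1, 0, 0] : Fin 4 → ℝ) =
      ![qc ξ 0, 0, 0, 0] + (![0, ρ, 0, 0] + ![0, qc ξ 1 - ρ, 0, 0]) := by
    ext j; fin_cases j <;> simp
  have h1 := abs_re_inner_le v _ (R.norm_yukQ_le ![qc ξ 0, 0, 0, 0] v (abs_nonneg (qc ξ 0))
    (by simp [Fin.sum_univ_four]))
  have h2 := abs_re_inner_le v _ (R.norm_yukQ_le ![0, qc ξ 1 - ρ, 0, 0] v
    (sub_nonneg.2 ((le_abs_self _).trans hρ)) (by simp [Fin.sum_univ_four]; nlinarith))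
  have h3 : -(6 * ‖v‖ ^ 2 + 2 * ‖inner ℂ R.vac v‖ ^ 2) * ρ
      ≤ (inner ℂ v (R.yukQ ![0, ρ, 0, 0] v)).re := by
    rw [yukQ_one, inner_smul_right, Complex.re_ofReal_mul]
    nlinarith [R.num_gap v]
  rw [vacExp, hVac, e, yukQ_add, yukQ_add, add_apply, add_apply, inner_add_right, inner_add_right,
    Complex.add_re, Complex.add_re]
  nlinarith [neg_abs_le (inner ℂ v (R.yukQ ![qc ξ 0, 0, 0, 0] v)).re,
    neg_abs_le (inner ℂ v (R.yukQ ![0, qc ξ 1 - ρ, 0, 0] v)).re]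

theorem vacExp_nonneg (ξ : Config) (v : V) {ρ : ℝ} (h0 : 0 ≤ ρ)
    (hρ : qc ξ 0 ^ 2 + qc ξ 1 ^ 2 ≤ ρ ^ 2) : 0 ≤ R.vacExp ξ v + 8 * ρ * ‖v‖ ^ 2 := by
  have h1 := abs_re_inner_le v _ (R.norm_yukQ_le ![qc ξ 0, qc ξ 1, 0, 0] v h0
    (by simpa [Fin.sum_univ_four] using hρ))
  rw [vacExp, hVac]
  linarith [neg_abs_le (inner ℂ v (R.yukQ ![qc ξ 0, qc ξ 1, 0, 0] v)).re]

/-- The commutator of the rotation generator with the coupling to `q`. -/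
theorem rotX_yukQ (q : Fin 4 → ℝ) (v : V) : R.rotX (R.yukQ q v) =
    R.yukQ q (R.rotX v) + R.yukQ ![-q 1, q 0, -q 3, q 2] v := by
  have hl : ∀ b φ, R.rotX (R.lam b φ) = R.lam b (R.rotX φ) := fun b φ => by
    have := congrArg (fun A : V →L[ℂ] V => A φ) (R.rel.rotGen_comm_lam b)
    exact sub_eq_zero.1 (by simpa [rotX] using this)
  have hp : ∀ b φ, R.rotX (R.psi b φ) = R.psi b (R.rotX φ) + ∑ d, (sMat 1 b d : ℂ) • R.psi d φ :=
    fun b φ => by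
    have := congrArg (fun A : V →L[ℂ] V => A φ) (R.rel.rotGen_comm_psi b)
    exact sub_eq_iff_eq_add'.1 (by simpa [rotX] using this)
  have hb : ∀ M : Matrix (Fin 8) (Fin 8) ℝ, R.rotX (bil R.lam M R.psi v) =
      bil R.lam M R.psi (R.rotX v) + bil R.lam (M * sMat 1) R.psi v := fun M => by
    simp only [bil, sum_apply, smul_apply, mul_apply_eq_comp, map_sum, map_smul, hl, hp, map_add,
      smul_add, Finset.sum_add_distrib, add_right_inj, Finset.smul_sum, smul_smul]
    refine Finset.sum_congr rfl fun a _ => ?_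
    rw [Finset.sum_comm]
    refine Finset.sum_congr rfl fun d _ => ?_
    rw [← Finset.sum_smul, Matrix.mul_apply]
    push_cast
    rfl
  have e : ∀ q : Fin 4 → ℝ, ∑ j, (q j : ℂ) • bil R.lam (sMat j * sMat 1) R.psi =
      bil R.lam (∑ j, q j • (sMat j * sMat 1)) R.psi := fun q => by simp only [bil_sum, bil_smul]
  have hM : (∑ j, q j • (sMat j * sMat 1)) * sMat 1 =
      ∑ j, (![-q 1, q 0, -q 3, q 2] : Fin 4 → ℝ) j • (sMat j * sMat 1) := by
    have h : sMat 1 * sMat 1 = (-1 : ℝ) • 1 := by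
      rw [sMat_mul_sMat_one.2.1]
      ext a b
      simp only [block_apply, Matrix.smul_apply]
      fin_cases a <;> fin_cases b <;> simp
    have h0 : sMat 0 = 1 := by
      ext a b
      simp only [sMat, block_apply]
      fin_cases a <;> fin_cases b <;> simp [quatR]
    have h3 : sMat 3 * sMat 1 = (-1 : ℝ) • sMat 2 := by
      rw [sMat_mul_sMat_one.2.2.2]
      ext a b
      simp only [sMat, block_apply, Matrix.smul_apply]
      fin_cases a <;> fin_cases b <;> simp [quatR]
    have h2 : sMat 2 * sMat 1 = sMat 3 := sMat_mul_sMat_one.2.2.1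
    simp only [Fin.sum_univ_four, Matrix.cons_val, add_mul, smul_mul_assoc, h, h0, h2, h3, one_mul]
    module
  rw [yukQ, yukQ, e, e, smul_apply, smul_apply, smul_apply, map_smul, hb, hM, smul_add]

end FermionRep

end DeformedSQM

namespace DeformedSQM

/-! ### The potential well -/

/-- `|q|²`. -/
def qsq (ξ : Config) : ℝ := ∑ j, qc ξ j ^ 2

/-- `|x|²`. -/
def xsq (ξ : Config) : ℝ := ∑ μ, xc ξ μ ^ 2

/-- The part of the potential that depends on `q` only, for `k = ϖ²/2`. -/
def qPot (ϖ : ℝ) (ξ : Config) : ℝ :=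
  (1 / 4) * (qsq ξ - ϖ ^ 2) ^ 2 + ϖ ^ 2 * (qc ξ 2 ^ 2 + qc ξ 3 ^ 2)

/-- An approximation to the squared distance from the circle `q₁² + q₂² = ϖ²`, `q₃ = q₄ = 0`, `x = 0`
of minima of the potential. -/
def well (ϖ : ℝ) (ξ : Config) : ℝ := qPot ϖ ξ / ϖ ^ 2 + xsq ξ

/-- The gradient of `(ϖ / 2) * well ϖ`. -/
def dWell (ϖ : ℝ) (ξ : Config) : Idx → ℝ :=
  Sum.elim (fun j => ((qsq ξ - ϖ ^ 2) * qc ξ j +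
    2 * ϖ ^ 2 * (![0, 0, qc ξ 2, qc ξ 3] : Fin 4 → ℝ) j) / (2 * ϖ)) (fun μ => ϖ * xc ξ μ)

/-- The diagonal of the Hessian of `(ϖ / 2) * well ϖ`. -/
def ddWell (ϖ : ℝ) (ξ : Config) : Idx → ℝ :=
  Sum.elim (fun j => ((qsq ξ - ϖ ^ 2) + 2 * qc ξ j ^ 2 +
    2 * ϖ ^ 2 * (![0, 0, 1, 1] : Fin 4 → ℝ) j) / (2 * ϖ)) (fun _ => ϖ)

theorem qsq_nonneg (ξ : Config) : 0 ≤ qsq ξ := Finset.sum_nonneg fun _ _ => sq_nonneg _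

theorem xsq_nonneg (ξ : Config) : 0 ≤ xsq ξ := Finset.sum_nonneg fun _ _ => sq_nonneg _

theorem qsq_eq (ξ : Config) :
    qsq ξ = qc ξ 0 ^ 2 + qc ξ 1 ^ 2 + qc ξ 2 ^ 2 + qc ξ 3 ^ 2 := Fin.sum_univ_four _

theorem xsq_eq (ξ : Config) :
    xsq ξ = xc ξ 0 ^ 2 + xc ξ 1 ^ 2 + xc ξ 2 ^ 2 + xc ξ 3 ^ 2 + xc ξ 4 ^ 2 := Fin.sum_univ_five _

theorem qPot_nonneg (ϖ : ℝ) (ξ : Config) : 0 ≤ qPot ϖ ξ := by unfold qPot; positivity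

theorem well_nonneg (ϖ : ℝ) (ξ : Config) : 0 ≤ well ϖ ξ :=
  add_nonneg (div_nonneg (qPot_nonneg _ _) (sq_nonneg _)) (xsq_nonneg _)

@[fun_prop]
theorem contDiff_qsq {n : WithTop ℕ∞} : ContDiff ℝ n qsq := by unfold qsq; fun_prop

@[fun_prop]
theorem contDiff_xsq {n : WithTop ℕ∞} : ContDiff ℝ n xsq := by unfold xsq; fun_prop

theorem contDiff_qPot (ϖ : ℝ) {n : WithTop ℕ∞} : ContDiff ℝ n (qPot ϖ) := by
  unfold qPot; fun_prop

theorem contDiff_well (ϖ : ℝ) {n : WithTop ℕ∞} : ContDiff ℝ n (well ϖ) :=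
  ((contDiff_qPot ϖ).div_const _).add contDiff_xsq

theorem contDiff_dWell (ϖ : ℝ) (i : Idx) {n : WithTop ℕ∞} :
    ContDiff ℝ n fun ξ => dWell ϖ ξ i := by
  rcases i with i | i
  · fin_cases i <;> simp [dWell] <;> fun_prop
  · simp [dWell]; fun_prop

theorem contDiff_ddWell (ϖ : ℝ) (i : Idx) {n : WithTop ℕ∞} :
    ContDiff ℝ n fun ξ => ddWell ϖ ξ i := by
  rcases i with i | i
  · simp [ddWell]; fun_prop
  · simp [ddWell]; fun_prop

theorem pd_qsq (i : Idx) (ξ : Config) :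
    pd i qsq ξ = Sum.elim (fun j => 2 * qc ξ j) (fun _ => 0) i := by
  have e : qsq = fun ξ => qc ξ 0 * qc ξ 0 + qc ξ 1 * qc ξ 1 + qc ξ 2 * qc ξ 2 + qc ξ 3 * qc ξ 3 := by
    ext ξ; rw [qsq_eq]; ring
  rw [e]
  simp (disch := fun_prop) only [pd_add_at, pd_mul, pd_qc]
  rcases i with i | i
  · fin_cases i <;> simp <;> ring
  · simp

theorem pd_xsq (i : Idx) (ξ : Config) :
    pd i xsq ξ = Sum.elim (fun _ => 0) (fun μ => 2 * xc ξ μ) i := by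
  have e : xsq = fun ξ => xc ξ 0 * xc ξ 0 + xc ξ 1 * xc ξ 1 + xc ξ 2 * xc ξ 2 + xc ξ 3 * xc ξ 3
      + xc ξ 4 * xc ξ 4 := by
    ext ξ; rw [xsq_eq]; ring
  rw [e]
  simp (disch := fun_prop) only [pd_add_at, pd_mul, pd_xc]
  rcases i with i | i
  · simp
  · fin_cases i <;> simp <;> ring

@[fun_prop]
theorem differentiable_qsq : Differentiable ℝ qsq := contDiff_qsq.differentiable (n := 1) (by simp)

@[fun_prop]
theorem differentiable_xsq : Differentiable ℝ xsq := contDiff_xsq.differentiable (n := 1) (by simp)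

theorem pd_well {ϖ : ℝ} (hϖ : 0 < ϖ) (i : Idx) (ξ : Config) :
    pd i (well ϖ) ξ = 2 / ϖ * dWell ϖ ξ i := by
  have e : well ϖ = fun ξ => (1 / (4 * ϖ ^ 2)) * ((qsq ξ - ϖ ^ 2) * (qsq ξ - ϖ ^ 2)) +
      (qc ξ 2 * qc ξ 2 + qc ξ 3 * qc ξ 3) + xsq ξ := by
    ext ξ; rw [well, qPot]; field_simp
  rw [e]
  simp (disch := fun_prop) only [pd_add_at, pd_mul, pd_sub_at, pd_qc, pd_const]
  rw [pd_qsq, pd_xsq]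
  rcases i with i | i
  · fin_cases i <;> simp [dWell] <;> field_simp <;> ring
  · simp [dWell]; field_simp

theorem pd_dWell {ϖ : ℝ} (hϖ : 0 < ϖ) (i : Idx) (ξ : Config) :
    pd i (fun ξ => dWell ϖ ξ i) ξ = ddWell ϖ ξ i := by
  rcases i with i | i
  · have e : (fun ξ => dWell ϖ ξ (Sum.inl i)) = fun ξ => (1 / (2 * ϖ)) * ((qsq ξ - ϖ ^ 2) * qc ξ i) +
        ϖ * ((![0, 0, 1, 1] : Fin 4 → ℝ) i * qc ξ i) := by
      ext ξ; simp only [dWell, Sum.elim_inl]; fin_cases i <;> simp <;> field_simp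
    rw [e]
    simp (disch := fun_prop) only [pd_add_at, pd_mul, pd_sub_at, pd_qc, pd_const]
    rw [pd_qsq]
    simp [ddWell]; field_simp
  · have e : (fun ξ => dWell ϖ ξ (Sum.inr i)) = fun ξ => ϖ * xc ξ i := rfl
    rw [e]
    simp (disch := fun_prop) only [pd_mul, pd_xc, pd_const]
    simp [ddWell]

theorem hasLineDerivAt_dWell {ϖ : ℝ} (hϖ : 0 < ϖ) (i : Idx) (ξ : Config) :
    HasLineDerivAt ℝ (fun ξ => dWell ϖ ξ i) (ddWell ϖ ξ i) ξ (unitVec i) := by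
  have := ((contDiff_dWell ϖ i (n := 1)).differentiable (by simp) ξ).hasFDerivAt.hasLineDerivAt
    (unitVec i)
  rwa [← pd, pd_dWell hϖ] at this

theorem sum_dWell_sq {ϖ : ℝ} (hϖ : 0 < ϖ) (ξ : Config) :
    ∑ i, dWell ϖ ξ i ^ 2 = qsq ξ * qPot ϖ ξ / ϖ ^ 2 + ϖ ^ 2 * xsq ξ := by
  simp only [Fintype.sum_sum_type, Fin.sum_univ_four, Fin.sum_univ_five, dWell, Sum.elim_inl,
    Sum.elim_inr, Matrix.cons_val, xsq_eq, qPot]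
  rw [qsq_eq]
  field_simp
  ring

theorem sum_ddWell {ϖ : ℝ} (hϖ : 0 < ϖ) (ξ : Config) :
    ∑ i, ddWell ϖ ξ i = 3 * qsq ξ / ϖ + 5 * ϖ := by
  simp only [Fintype.sum_sum_type, Fin.sum_univ_four, Fin.sum_univ_five, ddWell, Sum.elim_inl,
    Sum.elim_inr, Matrix.cons_val]
  rw [qsq_eq]
  field_simp
  ring

theorem potDef_eq (ϖ : ℝ) (ξ : Config) :
    potDef (ϖ ^ 2 / 2) ξ = xsq ξ * qsq ξ + qPot ϖ ξ := by
  have e1 : ∑ μ, xc ξ μ ^ 2 = xsq ξ := rfl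
  have e2 : ∑ j, qc ξ j ^ 2 = qsq ξ := rfl
  rw [potDef, potV, e1, e2, qPot, qsq_eq]
  ring

theorem gradSq_well {ϖ : ℝ} (hϖ : 0 < ϖ) (ξ : Config) :
    gradSq (well ϖ) ξ = 4 * (qsq ξ * qPot ϖ ξ / ϖ ^ 4 + xsq ξ) := by
  have h := sum_dWell_sq hϖ ξ
  simp only [gradSq, pd_well hϖ, Real.norm_eq_abs, sq_abs, mul_pow, ← Finset.mul_sum, h]
  field_simp
  ring

/-- Inside the tube `well ϖ ≤ 1/100` all quantities are close to their values on the circle. -/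
theorem tube_bounds {ϖ : ℝ} (hϖ : 1 ≤ ϖ) {ξ : Config} (h : well ϖ ξ ≤ 1 / 100) :
    |qsq ξ - ϖ ^ 2| ≤ ϖ / 5 ∧ qc ξ 2 ^ 2 + qc ξ 3 ^ 2 ≤ (1 / 10) ^ 2 ∧ xsq ξ ≤ (1 / 10) ^ 2 ∧
      qPot ϖ ξ ≤ ϖ ^ 2 / 100 := by
  have hϖ2 : 0 < ϖ ^ 2 := by positivity
  have h1 : qPot ϖ ξ / ϖ ^ 2 ≤ 1 / 100 := by
    have := xsq_nonneg ξ
    unfold well at h; linarith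
  have h2 : qPot ϖ ξ ≤ ϖ ^ 2 / 100 := by
    rw [div_le_iff₀ hϖ2] at h1; linarith
  have h3 := h2
  unfold qPot at h3
  refine ⟨?_, ?_, ?_, h2⟩
  · refine abs_le_of_sq_le_sq ?_ (by positivity)
    nlinarith [sq_nonneg (qc ξ 2), sq_nonneg (qc ξ 3),
      mul_nonneg hϖ2.le (add_nonneg (sq_nonneg (qc ξ 2)) (sq_nonneg (qc ξ 3)))]
  · have : ϖ ^ 2 * (qc ξ 2 ^ 2 + qc ξ 3 ^ 2) ≤ ϖ ^ 2 * (1 / 10) ^ 2 := by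
      nlinarith [sq_nonneg (qsq ξ - ϖ ^ 2)]
    exact le_of_mul_le_mul_left this hϖ2
  · have : 0 ≤ qPot ϖ ξ / ϖ ^ 2 := div_nonneg (qPot_nonneg _ _) hϖ2.le
    unfold well at h; linarith

/-- The distance `ρ = √(q₁² + q₂²)`. -/
def rad (ξ : Config) : ℝ := Real.sqrt (qc ξ 0 ^ 2 + qc ξ 1 ^ 2)

theorem rad_nonneg (ξ : Config) : 0 ≤ rad ξ := Real.sqrt_nonneg _

theorem rad_sq (ξ : Config) : rad ξ ^ 2 = qc ξ 0 ^ 2 + qc ξ 1 ^ 2 := Real.sq_sqrt (by positivity)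

theorem tube_rad {ϖ : ℝ} (hϖ : 1 ≤ ϖ) {ξ : Config} (h : well ϖ ξ ≤ 1 / 100) :
    |rad ξ - ϖ| ≤ 3 / 10 := by
  obtain ⟨h1, h2, -, -⟩ := tube_bounds hϖ h
  have h3 := rad_sq ξ
  have h4 := qsq_eq ξ
  have h5 := rad_nonneg ξ
  rw [abs_le] at h1 ⊢
  constructor <;> nlinarith [sq_nonneg (qc ξ 2), sq_nonneg (qc ξ 3)]

/-- The effective potential of the ground state representation in the tube. -/
theorem tube_potential {ϖ : ℝ} (hϖ : 1 ≤ ϖ) {ξ : Config} (h : well ϖ ξ ≤ 1 / 100) :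
    |(∑ i, ddWell ϖ ξ i) - (∑ i, dWell ϖ ξ i ^ 2) + potDef (ϖ ^ 2 / 2) ξ - 8 * rad ξ|
      ≤ ϖ / 500 + 3 := by
  have hϖ0 : 0 < ϖ := by linarith
  obtain ⟨h1, h2, h3, h6⟩ := tube_bounds hϖ h
  have h4 := tube_rad hϖ h
  have h5 := qPot_nonneg ϖ ξ
  have h7 := xsq_nonneg ξ
  set t := (qsq ξ - ϖ ^ 2) / ϖ with ht
  have ht1 : |t| ≤ 1 / 5 := by
    rw [ht, abs_div, abs_of_pos hϖ0, div_le_iff₀ hϖ0]; linarith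
  have hq : qsq ξ = ϖ ^ 2 + ϖ * t := by rw [ht]; field_simp; ring
  have e : (∑ i, ddWell ϖ ξ i) - (∑ i, dWell ϖ ξ i ^ 2) + potDef (ϖ ^ 2 / 2) ξ - 8 * rad ξ =
      3 * t - 8 * (rad ξ - ϖ) - t * (qPot ϖ ξ / ϖ) + t * (ϖ * xsq ξ) := by
    rw [sum_ddWell hϖ0, sum_dWell_sq hϖ0, potDef_eq, hq]
    field_simp
    ring
  have e1 : |t * (ϖ * xsq ξ - qPot ϖ ξ / ϖ)| ≤ 1 / 5 * (ϖ / 100) := by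
    have h8 : 0 ≤ qPot ϖ ξ / ϖ := by positivity
    have h9 : qPot ϖ ξ / ϖ ≤ ϖ / 100 := by rw [div_le_iff₀ hϖ0]; nlinarith
    rw [abs_mul]
    gcongr
    rw [abs_le]
    constructor <;> nlinarith
  rw [e]
  rw [abs_le] at ht1 h4 e1 ⊢
  constructor <;> linarith

theorem tube_gradSq_well {ϖ : ℝ} (hϖ : 1 ≤ ϖ) {ξ : Config} (h : well ϖ ξ ≤ 1 / 100) :
    gradSq (well ϖ) ξ ≤ 1 := by
  obtain ⟨h1, h2, h3, h6⟩ := tube_bounds hϖ h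
  have h5 := qPot_nonneg ϖ ξ
  rw [gradSq_well (by linarith)]
  have hq : qsq ξ ≤ 2 * ϖ ^ 2 := by
    rw [abs_le] at h1; nlinarith
  have : qsq ξ * qPot ϖ ξ / ϖ ^ 4 ≤ 2 / 100 := by
    rw [div_le_iff₀ (by positivity)]
    calc qsq ξ * qPot ϖ ξ ≤ (2 * ϖ ^ 2) * (ϖ ^ 2 / 100) := by gcongr
      _ = 2 / 100 * ϖ ^ 4 := by ring
  linarith

/-- Away from the circle of minima the potential, the fermionic part and the zero point energy of
the `q`-oscillators for large `|x|` add up to at least `ϖ`. -/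
theorem far_potential {ϖ : ℝ} (hϖ : 100000 ≤ ϖ) {ξ : Config} (h : 1 / 200 ≤ well ϖ ξ) {a : ℝ}
    (ha : a = max (Real.sqrt (xsq ξ) - 1 / 40) 0) :
    ϖ ≤ 4 * a - a ^ 2 * qsq ξ + potDef (ϖ ^ 2 / 2) ξ
      - (8 * Real.sqrt (qsq ξ) + 4 * Real.sqrt (xsq ξ)) := by
  have hϖ2 : 0 < ϖ ^ 2 := by positivity
  set r := Real.sqrt (qsq ξ) with hr
  set X := Real.sqrt (xsq ξ) with hX
  have hr0 : 0 ≤ r := Real.sqrt_nonneg _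
  have hX0 : 0 ≤ X := Real.sqrt_nonneg _
  have hr2 : qsq ξ = r ^ 2 := (Real.sq_sqrt (qsq_nonneg ξ)).symm
  have hX2 : xsq ξ = X ^ 2 := (Real.sq_sqrt (xsq_nonneg ξ)).symm
  have hD : (1 / 4) * (r ^ 2 - ϖ ^ 2) ^ 2 ≤ qPot ϖ ξ := by
    have : 0 ≤ ϖ ^ 2 * (qc ξ 2 ^ 2 + qc ξ 3 ^ 2) := by positivity
    rw [qPot, hr2]; linarith
  rw [well, hX2] at h
  rw [potDef_eq, hX2, hr2]
  rcases le_total X (1 / 40) with hb | hb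
  · rw [max_eq_right (by linarith)] at ha
    have h1 : ϖ ^ 2 / 400 ≤ qPot ϖ ξ := by
      have : 1 / 400 ≤ qPot ϖ ξ / ϖ ^ 2 := by nlinarith
      rw [le_div_iff₀ hϖ2] at this; linarith
    have h2 : 0 ≤ X ^ 2 * r ^ 2 := by positivity
    rw [ha]
    rcases le_total r (2 * ϖ) with h3 | h3
    · nlinarith
    · have h4 : r ^ 2 / 2 ≤ r ^ 2 - ϖ ^ 2 := by nlinarith
      have h5 : (r ^ 2 / 2) ^ 2 ≤ (r ^ 2 - ϖ ^ 2) ^ 2 := by gcongr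
      have h6 : 400 * r ≤ r ^ 2 := by nlinarith
      have h7 : r ^ 2 ≤ r ^ 2 * r ^ 2 := by nlinarith
      nlinarith
  · rw [max_eq_left (by linarith)] at ha
    have h1 : (X ^ 2 - a ^ 2) * r ^ 2 ≥ (1 / 1600) * r ^ 2 := by
      have : 1 / 1600 ≤ X ^ 2 - a ^ 2 := by rw [ha]; nlinarith
      gcongr
    have h2 : 4 * a - 4 * X = - (1 / 10) := by rw [ha]; ring
    have h0 := qPot_nonneg ϖ ξ
    rcases le_total (ϖ / 2) r with h3 | h3
    · nlinarith
    · have h4 : ϖ ^ 2 / 2 ≤ ϖ ^ 2 - r ^ 2 := by nlinarith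
      have h5 : (ϖ ^ 2 / 2) ^ 2 ≤ (ϖ ^ 2 - r ^ 2) ^ 2 := by gcongr
      have h7 : 1 ≤ ϖ ^ 2 := by nlinarith
      have h6 : ϖ ^ 2 ≤ ϖ ^ 2 * ϖ ^ 2 := by nlinarith
      nlinarith [sq_nonneg r]

end DeformedSQM

namespace DeformedSQM

/-! ### Localization near the circle of minima -/

theorem pd_comp {f : ℝ → ℝ} {u : Config → ℝ} {ξ : Config} (hf : DifferentiableAt ℝ f (u ξ))
    (hu : DifferentiableAt ℝ u ξ) (i : Idx) :
    pd i (fun ξ => f (u ξ)) ξ = deriv f (u ξ) * pd i u ξ := by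
  have := hf.hasDerivAt.comp_hasFDerivAt ξ hu.hasFDerivAt
  simp only [pd]
  rw [show (fun ξ => f (u ξ)) = f ∘ u from rfl, this.fderiv]
  simp

/-- A smooth cutoff on the half line, equal to `1` below `1/200` and to `0` above `1/100`. -/
def bump (t : ℝ) : ℝ := Real.smoothTransition (2 - 200 * t)

theorem contDiff_bump : ContDiff ℝ ∞ bump :=
  Real.smoothTransition.contDiff.comp (contDiff_const.sub (contDiff_const.mul contDiff_id))

theorem bump_eq_one {t : ℝ} (h : t ≤ 1 / 200) : bump t = 1 :=
  Real.smoothTransition.one_of_one_le (by linarith)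

theorem bump_eq_zero {t : ℝ} (h : 1 / 100 ≤ t) : bump t = 0 :=
  Real.smoothTransition.zero_of_nonpos (by linarith)

theorem bump_nonneg (t : ℝ) : 0 ≤ bump t := Real.smoothTransition.nonneg _

theorem bump_le_one (t : ℝ) : bump t ≤ 1 := Real.smoothTransition.le_one _

theorem deriv_bump_eq_zero {t : ℝ} (h : 1 / 100 < t) : deriv bump t = 0 := by
  have : bump =ᶠ[nhds t] fun _ => 0 := by
    filter_upwards [lt_mem_nhds h] with s hs using bump_eq_zero hs.le
  rw [this.deriv_eq]; simp

theorem exists_deriv_bump_bound : ∃ C : ℝ, 0 ≤ C ∧ ∀ t, 0 ≤ t → (deriv bump t) ^ 2 ≤ C := by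
  have hc : Continuous fun t => (deriv bump t) ^ 2 :=
    (contDiff_bump.continuous_deriv (by simp)).pow 2
  obtain ⟨C, hC⟩ := (isCompact_Icc (a := (0 : ℝ)) (b := 1 / 100)).exists_bound_of_continuousOn
    hc.continuousOn
  refine ⟨max C 0, le_max_right _ _, fun t ht => ?_⟩
  by_cases h : t ≤ 1 / 100
  · exact ((le_abs_self _).trans (hC t ⟨ht, h⟩)).trans (le_max_left _ _)
  · rw [deriv_bump_eq_zero (by linarith)]; simp

/-- The cutoff to the tube around the circle of minima. -/
def cutIn (ϖ : ℝ) (ξ : Config) : ℝ := Real.sin (Real.pi / 2 * bump (well ϖ ξ))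

/-- The complementary cutoff. -/
def cutOut (ϖ : ℝ) (ξ : Config) : ℝ := Real.cos (Real.pi / 2 * bump (well ϖ ξ))

theorem contDiff_cutIn (ϖ : ℝ) : ContDiff ℝ ∞ (cutIn ϖ) :=
  Real.contDiff_sin.comp (contDiff_const.mul (contDiff_bump.comp (contDiff_well ϖ)))

theorem contDiff_cutOut (ϖ : ℝ) : ContDiff ℝ ∞ (cutOut ϖ) :=
  Real.contDiff_cos.comp (contDiff_const.mul (contDiff_bump.comp (contDiff_well ϖ)))

theorem cutOut_sq_add (ϖ : ℝ) (ξ : Config) : cutIn ϖ ξ ^ 2 + cutOut ϖ ξ ^ 2 = 1 :=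
  Real.sin_sq_add_cos_sq _

theorem cutIn_eq_zero {ϖ : ℝ} {ξ : Config} (h : 1 / 100 ≤ well ϖ ξ) : cutIn ϖ ξ = 0 := by
  simp [cutIn, bump_eq_zero h]

theorem cutOut_eq_zero {ϖ : ℝ} {ξ : Config} (h : well ϖ ξ ≤ 1 / 200) : cutOut ϖ ξ = 0 := by
  simp [cutOut, bump_eq_one h]

theorem gradSq_bump_le {C : ℝ} (hC : ∀ t, 0 ≤ t → (deriv bump t) ^ 2 ≤ C) {ϖ : ℝ} (hϖ : 1 ≤ ϖ)
    (ξ : Config) : gradSq (fun ξ => bump (well ϖ ξ)) ξ ≤ C := by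
  have hd : Differentiable ℝ (well ϖ) := (contDiff_well ϖ (n := 1)).differentiable (by simp)
  have h1 : gradSq (fun ξ => bump (well ϖ ξ)) ξ = deriv bump (well ϖ ξ) ^ 2 * gradSq (well ϖ) ξ := by
    simp only [gradSq, pd_comp (contDiff_bump.differentiable (by simp) _) (hd ξ), Real.norm_eq_abs,
      sq_abs, mul_pow, Finset.mul_sum]
  have hC0 : 0 ≤ C := (sq_nonneg _).trans (hC 0 le_rfl)
  rw [h1]
  by_cases h : well ϖ ξ ≤ 1 / 100
  · calc deriv bump (well ϖ ξ) ^ 2 * gradSq (well ϖ) ξ ≤ C * 1 := by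
          gcongr
          · exact gradSq_nonneg _ _
          · exact hC _ (well_nonneg _ _)
          · exact tube_gradSq_well hϖ h
      _ = C := mul_one _
  · rw [deriv_bump_eq_zero (by linarith)]; simpa using hC0

theorem gradSq_cut (ϖ : ℝ) (ξ : Config) : gradSq (cutIn ϖ) ξ + gradSq (cutOut ϖ) ξ =
    (Real.pi / 2) ^ 2 * gradSq (fun ξ => bump (well ϖ ξ)) ξ := by
  have hb : Differentiable ℝ fun ξ => bump (well ϖ ξ) :=
    (contDiff_bump.comp (contDiff_well ϖ)).differentiable (by simp)
  have hu : Differentiable ℝ fun ξ => Real.pi / 2 * bump (well ϖ ξ) := hb.const_mul _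
  have h1 : ∀ i, pd i (fun ξ => Real.pi / 2 * bump (well ϖ ξ)) ξ =
      Real.pi / 2 * pd i (fun ξ => bump (well ϖ ξ)) ξ := fun i => by
    rw [pd_mul (differentiableAt_const _) (hb ξ), pd_const]; simp
  simp only [gradSq, Real.norm_eq_abs, sq_abs]
  unfold cutIn cutOut
  simp only [pd_comp Real.differentiableAt_sin (hu ξ), pd_comp Real.differentiableAt_cos (hu ξ),
    Real.deriv_sin, Real.deriv_cos', h1, ← Finset.sum_add_distrib, Finset.mul_sum]
  refine Finset.sum_congr rfl fun i _ => ?_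
  linear_combination (Real.pi / 2 * pd i (fun ξ => bump (well ϖ ξ)) ξ) ^ 2 *
    Real.sin_sq_add_cos_sq (Real.pi / 2 * bump (well ϖ ξ))

theorem continuous_rad : Continuous rad := by unfold rad; fun_prop

variable {V : Type*} [NormedAddCommGroup V] [InnerProductSpace ℂ V]

theorem integrable_normSq {g : Config → V} (hg : IsTestFn g) : Integrable fun ξ => ‖g ξ‖ ^ 2 := by
  simpa using integrable_mul_normSq (continuous_const (y := (1 : ℝ))) hg.continuous hg.2

theorem isTestFn_shift {ϖ : ℝ} {g : Config → V} (hg : IsTestFn g) (i : Idx) :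
    IsTestFn fun ξ => pd i g ξ + dWell ϖ ξ i • g ξ :=
  (hg.pd i).add (hg.smul (contDiff_dWell ϖ i))

namespace FermionRep

variable [CompleteSpace V] (R : FermionRep V)

theorem energy_localization (k : ℝ) {c s : Config → ℝ} (hc : ContDiff ℝ ∞ c) (hs : ContDiff ℝ ∞ s)
    (h : ∀ ξ, c ξ ^ 2 + s ξ ^ 2 = 1) {g : Config → V} (hg : IsTestFn g) {C : ℝ}
    (hC : ∀ ξ, gradSq c ξ + gradSq s ξ ≤ C) :
    R.energy k (fun ξ => c ξ • g ξ) + R.energy k (fun ξ => s ξ • g ξ)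
      ≤ R.energy k g + C * ∫ ξ, ‖g ξ‖ ^ 2 := by
  have hcg := hg.smul hc
  have hsg := hg.smul hs
  have e : ∀ ξ, R.enDens k (fun ξ => c ξ • g ξ) ξ + R.enDens k (fun ξ => s ξ • g ξ) ξ ≤
      R.enDens k g ξ + C * ‖g ξ‖ ^ 2 := fun ξ => by
    have h1 := gradSq_localization (ξ := ξ) (hc.differentiable (by simp)) (hs.differentiable (by simp))
      (hg.differentiable ξ) h
    have h2 : (gradSq c ξ + gradSq s ξ) * ‖g ξ‖ ^ 2 ≤ C * ‖g ξ‖ ^ 2 := by gcongr; exact hC ξ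
    simp only [enDens, hFexp_smul, normSq_smul]
    linear_combination h2 + h1 + (potDef k ξ * ‖g ξ‖ ^ 2 + R.hFexp ξ (g ξ)) * h ξ
  rw [energy, energy, energy, ← integral_add (R.integrable_enDens k hcg) (R.integrable_enDens k hsg),
    ← integral_const_mul, ← integral_add (R.integrable_enDens k hg)
      ((integrable_normSq hg).const_mul C)]
  exact integral_mono ((R.integrable_enDens k hcg).add (R.integrable_enDens k hsg))
    ((R.integrable_enDens k hg).add ((integrable_normSq hg).const_mul C)) e

/-- Functions supported away from the circle of minima have large energy. -/
theorem far_energy {ϖ : ℝ} (hϖ : 100000 ≤ ϖ) {g : Config → V} (hg : IsTestFn g)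
    (h : ∀ ξ, g ξ ≠ 0 → 1 / 200 ≤ well ϖ ξ) :
    ϖ * ∫ ξ, ‖g ξ‖ ^ 2 ≤ R.energy (ϖ ^ 2 / 2) g := by
  set a : Config → ℝ := fun ξ => max (Real.sqrt (xsq ξ) - 1 / 40) 0 with ha
  have hac : Continuous a := by
    have : Continuous xsq := contDiff_xsq (n := 0) |>.continuous
    fun_prop
  have hxs : ∀ (ξ : Config) (t : ℝ) (j : Fin 4), a (ξ + t • unitVec (Sum.inl j)) = a ξ := by
    intro ξ t j
    have : xc (ξ + t • unitVec (Sum.inl j)) = xc ξ := by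
      ext μ; simp [xc]
    simp only [ha, xsq, this]
  have hline : ∀ (j : Fin 4) (ξ : Config), HasLineDerivAt ℝ (fun ξ => a ξ * qc ξ j) (a ξ) ξ
      (unitVec (Sum.inl j)) := by
    intro j ξ
    have e : (fun t : ℝ => a (ξ + t • unitVec (Sum.inl j)) * qc (ξ + t • unitVec (Sum.inl j)) j) =
        fun t => a ξ * (qc ξ j + t) := by
      ext t; rw [hxs]; simp [qc]
    unfold HasLineDerivAt
    rw [e]
    simpa using ((hasDerivAt_id (0 : ℝ)).const_add (qc ξ j)).const_mul (a ξ)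
  have hrep := fun j : Fin 4 => integral_normSq_pd hg (i := Sum.inl j)
    (hac.mul (continuous_qc j)) hac (hline j)
  have i0 : ∀ i, Integrable fun ξ => ‖pd i g ξ‖ ^ 2 := fun i => integrable_normSq (hg.pd i)
  have i1 : ∀ j : Fin 4, Integrable fun ξ => (a ξ - (a ξ * qc ξ j) ^ 2) * ‖g ξ‖ ^ 2 := fun j =>
    integrable_mul_normSq (hac.sub ((hac.mul (continuous_qc j)).pow 2)) hg.continuous hg.2
  have i2 : ∀ j : Fin 4, Integrable fun ξ => ‖pd (Sum.inl j) g ξ + (a ξ * qc ξ j) • g ξ‖ ^ 2 :=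
    fun j => integrable_of_test ((((hg.pd _).continuous).add (Continuous.smul
      (f := fun ξ => a ξ * qc ξ j) (hac.mul (continuous_qc j)) hg.continuous)).norm.pow 2) hg.2
      fun ξ hξ => by
        simp [pd_eq_zero hξ, image_eq_zero_of_notMem_tsupport hξ]
  have hkin : ∀ j : Fin 4, ∫ ξ, (a ξ - (a ξ * qc ξ j) ^ 2) * ‖g ξ‖ ^ 2 ≤
      ∫ ξ, ‖pd (Sum.inl j) g ξ‖ ^ 2 := fun j => by
    rw [hrep j]
    refine integral_mono (i1 j) ((i2 j).add (i1 j)) fun ξ => ?_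
    exact le_add_of_nonneg_left (sq_nonneg _)
  have i3 := integrable_mul_normSq (continuous_potDef (ϖ ^ 2 / 2)) hg.continuous hg.2
  have i4 := R.integrable_hFexp hg
  have i34 : Integrable fun ξ => potDef (ϖ ^ 2 / 2) ξ * ‖g ξ‖ ^ 2 + R.hFexp ξ (g ξ) := i3.add i4
  have h1 : R.energy (ϖ ^ 2 / 2) g = (∑ i, ∫ ξ, ‖pd i g ξ‖ ^ 2) +
      ∫ ξ, (potDef (ϖ ^ 2 / 2) ξ * ‖g ξ‖ ^ 2 + R.hFexp ξ (g ξ)) := by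
    rw [← integral_finsetSum _ fun i _ => i0 i, ← integral_add (integrable_finsetSum _ fun i _ => i0 i)
      i34]
    simp only [energy, enDens, gradSq, add_assoc]
  have h2 : ∫ ξ, ((∑ j, (a ξ - (a ξ * qc ξ j) ^ 2) * ‖g ξ‖ ^ 2) +
      (potDef (ϖ ^ 2 / 2) ξ * ‖g ξ‖ ^ 2 + R.hFexp ξ (g ξ))) ≤ R.energy (ϖ ^ 2 / 2) g := by
    rw [integral_add (integrable_finsetSum _ fun j _ => i1 j) i34,
      integral_finsetSum _ fun j _ => i1 j, h1, Fintype.sum_sum_type, add_assoc]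
    have := Finset.sum_le_sum fun j (_ : j ∈ Finset.univ) => hkin j
    have h3 : 0 ≤ ∑ μ : Fin 5, ∫ ξ, ‖pd (Sum.inr μ) g ξ‖ ^ 2 :=
      Finset.sum_nonneg fun _ _ => integral_nonneg fun _ => sq_nonneg _
    linarith
  refine le_trans ?_ h2
  rw [← integral_const_mul]
  refine integral_mono ((integrable_normSq hg).const_mul ϖ)
    ((integrable_finsetSum _ fun j _ => i1 j).add i34) fun ξ => ?_
  by_cases h0 : g ξ = 0
  · simp [h0, hFexp]
  · have h3 := far_potential hϖ (h ξ h0) (a := a ξ) rfl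
    have h4 := R.hFexp_lower ξ (g ξ)
    have h5 : ∑ j, (a ξ - (a ξ * qc ξ j) ^ 2) * ‖g ξ‖ ^ 2 =
        (4 * a ξ - a ξ ^ 2 * qsq ξ) * ‖g ξ‖ ^ 2 := by
      rw [qsq_eq, Fin.sum_univ_four]; ring
    have h6 := mul_le_mul_of_nonneg_right h3 (sq_nonneg ‖g ξ‖)
    have e1 : ∑ μ, xc ξ μ ^ 2 = xsq ξ := rfl
    have e2 : ∑ j, qc ξ j ^ 2 = qsq ξ := rfl
    rw [e1, e2] at h4
    simp only
    rw [h5]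
    nlinarith

/-- The energy density of the ground state representation, without the part that is small in the
tube around the circle of minima. -/
def nearDens (ϖ : ℝ) (g : Config → V) (ξ : Config) : ℝ :=
  (∑ i, ‖pd i g ξ + dWell ϖ ξ i • g ξ‖ ^ 2) + (R.vacExp ξ (g ξ) + 8 * rad ξ * ‖g ξ‖ ^ 2)

theorem continuous_vacExp {g : Config → V} (hg : Continuous g) :
    Continuous fun ξ => R.vacExp ξ (g ξ) := by
  have h1 : Continuous R.hVac := by
    have h2 : Continuous fun ξ => ∑ j, (((![qc ξ 0, qc ξ 1, 0, 0] : Fin 4 → ℝ) j : ℝ) : ℂ) •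
        bil R.lam (sMat j * sMat 1) R.psi := by
      refine continuous_finsetSum _ fun j _ => Continuous.smul
        (f := fun ξ => (((![qc ξ 0, qc ξ 1, 0, 0] : Fin 4 → ℝ) j : ℝ) : ℂ))
        (Complex.continuous_ofReal.comp ?_) continuous_const
      fin_cases j <;> simp <;> fun_prop
    exact Continuous.const_smul h2 (2 * Complex.I)
  exact Complex.continuous_re.comp (hg.inner (h1.clm_apply hg))

theorem integrable_vacExp {g : Config → V} (hg : IsTestFn g) :
    Integrable fun ξ => R.vacExp ξ (g ξ) + 8 * rad ξ * ‖g ξ‖ ^ 2 :=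
  integrable_of_test ((R.continuous_vacExp hg.continuous).add
    ((continuous_const.mul continuous_rad).mul (hg.continuous.norm.pow 2))) hg.2 fun ξ hξ => by
      simp [vacExp, image_eq_zero_of_notMem_tsupport hξ]

theorem continuous_nearDens (ϖ : ℝ) {g : Config → V} (hg : IsTestFn g) :
    Continuous (R.nearDens ϖ g) :=
  (continuous_finsetSum _ fun i _ => (isTestFn_shift hg i).continuous.norm.pow 2).add
    ((R.continuous_vacExp hg.continuous).add
    ((continuous_const.mul continuous_rad).mul (hg.continuous.norm.pow 2)))

theorem integrable_nearDens (ϖ : ℝ) {g : Config → V} (hg : IsTestFn g) :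
    Integrable (R.nearDens ϖ g) :=
  (integrable_finsetSum _ fun i _ => integrable_normSq (isTestFn_shift hg i)).add
    (R.integrable_vacExp hg)

/-- In the tube around the circle of minima the ground state representation is exact up to small
errors. -/
theorem near_energy {ϖ : ℝ} (hϖ : 1 ≤ ϖ) {g : Config → V} (hg : IsTestFn g)
    (h : ∀ ξ, g ξ ≠ 0 → well ϖ ξ ≤ 1 / 100) :
    |R.energy (ϖ ^ 2 / 2) g - ∫ ξ, R.nearDens ϖ g ξ| ≤ (ϖ / 500 + 5) * ∫ ξ, ‖g ξ‖ ^ 2 := by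
  have hϖ0 : 0 < ϖ := by linarith
  have i0 : ∀ i, Integrable fun ξ => ‖pd i g ξ‖ ^ 2 := fun i => integrable_normSq (hg.pd i)
  have i1 : ∀ i, Integrable fun ξ => ‖pd i g ξ + dWell ϖ ξ i • g ξ‖ ^ 2 := fun i =>
    integrable_normSq (isTestFn_shift hg i)
  have i2 : ∀ i, Integrable fun ξ => (ddWell ϖ ξ i - dWell ϖ ξ i ^ 2) * ‖g ξ‖ ^ 2 := fun i =>
    integrable_mul_normSq ((contDiff_ddWell ϖ i (n := 0)).continuous.sub
      ((contDiff_dWell ϖ i (n := 0)).continuous.pow 2)) hg.continuous hg.2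
  have i3 := integrable_mul_normSq (continuous_potDef (ϖ ^ 2 / 2)) hg.continuous hg.2
  have i4 := R.integrable_hFexp hg
  have i12 : ∀ i, Integrable fun ξ => ‖pd i g ξ + dWell ϖ ξ i • g ξ‖ ^ 2 +
      (ddWell ϖ ξ i - dWell ϖ ξ i ^ 2) * ‖g ξ‖ ^ 2 := fun i => (i1 i).add (i2 i)
  have i34 : Integrable fun ξ => potDef (ϖ ^ 2 / 2) ξ * ‖g ξ‖ ^ 2 + R.hFexp ξ (g ξ) := i3.add i4
  have h1 : R.energy (ϖ ^ 2 / 2) g = ∫ ξ, ((∑ i, (‖pd i g ξ + dWell ϖ ξ i • g ξ‖ ^ 2 +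
      (ddWell ϖ ξ i - dWell ϖ ξ i ^ 2) * ‖g ξ‖ ^ 2)) +
      (potDef (ϖ ^ 2 / 2) ξ * ‖g ξ‖ ^ 2 + R.hFexp ξ (g ξ))) := by
    rw [integral_add (integrable_finsetSum _ fun i _ => i12 i) i34,
      integral_finsetSum _ fun i _ => i12 i]
    have := fun i => integral_normSq_pd hg (i := i) (contDiff_dWell ϖ i (n := 0)).continuous
      (contDiff_ddWell ϖ i (n := 0)).continuous (hasLineDerivAt_dWell hϖ0 i)
    simp only [← this]
    rw [← integral_finsetSum _ fun i _ => i0 i,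
      ← integral_add (integrable_finsetSum _ fun i _ => i0 i) i34]
    simp only [energy, enDens, gradSq, add_assoc]
  have i5 : Integrable fun ξ => (∑ i, (‖pd i g ξ + dWell ϖ ξ i • g ξ‖ ^ 2 +
      (ddWell ϖ ξ i - dWell ϖ ξ i ^ 2) * ‖g ξ‖ ^ 2)) +
      (potDef (ϖ ^ 2 / 2) ξ * ‖g ξ‖ ^ 2 + R.hFexp ξ (g ξ)) :=
    (integrable_finsetSum _ fun i _ => (i1 i).add (i2 i)).add (i3.add i4)
  rw [h1, ← integral_sub i5 (R.integrable_nearDens ϖ hg), ← Real.norm_eq_abs, ← integral_const_mul]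
  refine norm_integral_le_of_norm_le ((integrable_normSq hg).const_mul _)
    (Filter.Eventually.of_forall fun ξ => ?_)
  by_cases h0 : g ξ = 0
  · simp [h0, hFexp, nearDens, vacExp]
  · obtain ⟨-, hb1, hb2, -⟩ := tube_bounds hϖ (h ξ h0)
    have h2 := tube_potential hϖ (h ξ h0)
    have h3 := R.hFexp_near ξ (g ξ) (m := 1 / 10) (by norm_num) hb1 hb2
    have h4 : (∑ i, (‖pd i g ξ + dWell ϖ ξ i • g ξ‖ ^ 2 +
        (ddWell ϖ ξ i - dWell ϖ ξ i ^ 2) * ‖g ξ‖ ^ 2)) +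
        (potDef (ϖ ^ 2 / 2) ξ * ‖g ξ‖ ^ 2 + R.hFexp ξ (g ξ)) - R.nearDens ϖ g ξ =
        ((∑ i, ddWell ϖ ξ i) - (∑ i, dWell ϖ ξ i ^ 2) + potDef (ϖ ^ 2 / 2) ξ - 8 * rad ξ) * ‖g ξ‖ ^ 2
        + (R.hFexp ξ (g ξ) - R.vacExp ξ (g ξ)) := by
      rw [nearDens, Finset.sum_add_distrib, ← Finset.sum_mul, Finset.sum_sub_distrib]
      ring
    rw [h4, Real.norm_eq_abs]
    refine (abs_add_le _ _).trans ?_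
    rw [abs_mul, abs_of_nonneg (sq_nonneg ‖g ξ‖)]
    have h5 := mul_le_mul_of_nonneg_right h2 (sq_nonneg ‖g ξ‖)
    nlinarith [sq_nonneg ‖g ξ‖]

end FermionRep

end DeformedSQM

namespace DeformedSQM

/-! ### Angular averages -/

/-- The angular integral of `exp (-a (1 - cos θ))`. -/
def angAvg (a : ℝ) : ℝ := ∫ θ in -Real.pi..Real.pi, Real.exp (-(a * (1 - Real.cos θ)))

theorem continuous_ang (a : ℝ) : Continuous fun θ => Real.exp (-(a * (1 - Real.cos θ))) := by
  fun_prop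

theorem angAvg_antitone : Antitone angAvg := fun a b h => by
  refine intervalIntegral.integral_mono_on (by linarith [Real.pi_pos])
    ((continuous_ang b).intervalIntegrable _ _) ((continuous_ang a).intervalIntegrable _ _)
    fun θ _ => ?_
  have : 0 ≤ 1 - Real.cos θ := by linarith [Real.cos_le_one θ]
  gcongr

theorem angAvg_pos (a : ℝ) : 0 < angAvg a :=
  intervalIntegral.intervalIntegral_pos_of_pos ((continuous_ang a).intervalIntegrable _ _)
    (fun _ => Real.exp_pos _) (by linarith [Real.pi_pos])

/-- Doubling the exponent at most halves the angular integral: substitute `θ = 2 φ` and use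
`sin² φ ≥ 1 - cos φ` for `|φ| ≤ π / 2`. -/
theorem angAvg_le {a : ℝ} (ha : 0 ≤ a) : angAvg a ≤ 2 * angAvg (2 * a) := by
  have hπ := Real.pi_pos
  have h1 : angAvg a = 2 * ∫ φ in -(Real.pi / 2)..(Real.pi / 2),
      Real.exp (-(a * (1 - Real.cos (2 * φ)))) := by
    have := intervalIntegral.integral_comp_mul_left (a := -(Real.pi / 2)) (b := Real.pi / 2)
      (fun θ => Real.exp (-(a * (1 - Real.cos θ)))) (two_ne_zero (α := ℝ))
    rw [this, angAvg, smul_eq_mul]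
    ring_nf
  have h2 : ∫ φ in -(Real.pi / 2)..(Real.pi / 2), Real.exp (-(a * (1 - Real.cos (2 * φ)))) ≤
      ∫ φ in -(Real.pi / 2)..(Real.pi / 2), Real.exp (-(2 * a * (1 - Real.cos φ))) := by
    refine intervalIntegral.integral_mono_on (by linarith)
      (Continuous.intervalIntegrable (by fun_prop) _ _)
      ((continuous_ang _).intervalIntegrable _ _) fun φ hφ => ?_
    have hc : 0 ≤ Real.cos φ := Real.cos_nonneg_of_mem_Icc hφ
    have hc1 := Real.cos_le_one φ
    rw [Real.cos_two_mul]
    refine Real.exp_le_exp.2 (neg_le_neg ?_)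
    nlinarith [mul_nonneg ha (mul_nonneg hc (sub_nonneg.2 hc1))]
  have h3 : ∫ φ in -(Real.pi / 2)..(Real.pi / 2), Real.exp (-(2 * a * (1 - Real.cos φ))) ≤
      angAvg (2 * a) := by
    refine intervalIntegral.integral_mono_interval (by linarith) (by linarith) (by linarith)
      (Filter.Eventually.of_forall fun _ => (Real.exp_pos _).le)
      ((continuous_ang _).intervalIntegrable _ _)
  rw [h1]; linarith

theorem abs_sin_le {ε : ℝ} (hε : 0 < ε) (θ : ℝ) :
    |Real.sin θ| ≤ ε + (1 - Real.cos θ) / (2 * ε) := by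
  have h0 : 0 ≤ 1 - Real.cos θ := by linarith [Real.cos_le_one θ]
  refine abs_le_of_sq_le_sq ?_ (by positivity)
  have h1 := Real.sin_sq_add_cos_sq θ
  have h2 : (ε + (1 - Real.cos θ) / (2 * ε)) ^ 2 =
      (ε - (1 - Real.cos θ) / (2 * ε)) ^ 2 + 2 * (1 - Real.cos θ) := by field_simp; ring
  nlinarith [sq_nonneg (ε - (1 - Real.cos θ) / (2 * ε)), Real.neg_one_le_cos θ]

/-- The weight `exp (-a (1 - cos θ))` concentrates at `θ = 0`. -/
theorem ang_moment_le {a ε : ℝ} (ha : 0 < a) (hε : 0 < ε) :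
    ∫ θ in -Real.pi..Real.pi, (|Real.sin θ| + (1 - Real.cos θ)) *
        Real.exp (-(a * (1 - Real.cos θ))) ≤ (ε + (1 + 1 / (2 * ε)) * (4 / a)) * angAvg a := by
  have hπ := Real.pi_pos
  have h1 : ∀ θ, (|Real.sin θ| + (1 - Real.cos θ)) * Real.exp (-(a * (1 - Real.cos θ))) ≤
      ε * Real.exp (-(a * (1 - Real.cos θ))) +
      (1 + 1 / (2 * ε)) * (2 / a) * Real.exp (-(a / 2 * (1 - Real.cos θ))) := fun θ => by
    set t := 1 - Real.cos θ with ht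
    have h2 : t ≤ 2 / a * Real.exp (a / 2 * t) := by
      have := Real.add_one_le_exp (a / 2 * t)
      calc t = 2 / a * (a / 2 * t) := by field_simp
        _ ≤ 2 / a * Real.exp (a / 2 * t) := by gcongr; linarith
    have h3 : t * Real.exp (-(a * t)) ≤ 2 / a * Real.exp (-(a / 2 * t)) := by
      calc t * Real.exp (-(a * t)) ≤ 2 / a * Real.exp (a / 2 * t) * Real.exp (-(a * t)) := by
            gcongr
        _ = 2 / a * Real.exp (-(a / 2 * t)) := by
            rw [mul_assoc, ← Real.exp_add]; ring_nf
    have h4 : |Real.sin θ| + t ≤ ε + (1 + 1 / (2 * ε)) * t := by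
      have := abs_sin_le hε θ
      rw [← ht] at this
      calc |Real.sin θ| + t ≤ ε + t / (2 * ε) + t := by linarith
        _ = ε + (1 + 1 / (2 * ε)) * t := by ring
    calc (|Real.sin θ| + t) * Real.exp (-(a * t))
        ≤ (ε + (1 + 1 / (2 * ε)) * t) * Real.exp (-(a * t)) := by gcongr
      _ = ε * Real.exp (-(a * t)) + (1 + 1 / (2 * ε)) * (t * Real.exp (-(a * t))) := by ring
      _ ≤ ε * Real.exp (-(a * t)) + (1 + 1 / (2 * ε)) * (2 / a * Real.exp (-(a / 2 * t))) := by
          gcongr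
      _ = _ := by ring
  have i1 : IntervalIntegrable (fun θ => ε * Real.exp (-(a * (1 - Real.cos θ)))) volume
      (-Real.pi) Real.pi := ((continuous_ang a).const_mul ε).intervalIntegrable _ _
  have i2 : IntervalIntegrable (fun θ => (1 + 1 / (2 * ε)) * (2 / a) *
      Real.exp (-(a / 2 * (1 - Real.cos θ)))) volume (-Real.pi) Real.pi :=
    ((continuous_ang (a / 2)).const_mul _).intervalIntegrable _ _
  have h5 := intervalIntegral.integral_mono_on (a := -Real.pi) (b := Real.pi) (by linarith)
    (Continuous.intervalIntegrable (by fun_prop) _ _) (i1.add i2) fun θ _ => h1 θ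
  refine h5.trans ?_
  rw [intervalIntegral.integral_add i1 i2, intervalIntegral.integral_const_mul,
    intervalIntegral.integral_const_mul]
  have h6 : angAvg (a / 2) ≤ 2 * angAvg a := by
    have := angAvg_le (a := a / 2) (by positivity)
    rwa [mul_div_cancel₀ a two_ne_zero] at this
  have h7 : (1 + 1 / (2 * ε)) * (2 / a) * angAvg (a / 2) ≤
      (1 + 1 / (2 * ε)) * (2 / a) * (2 * angAvg a) := by gcongr
  calc _ ≤ ε * angAvg a + (1 + 1 / (2 * ε)) * (2 / a) * (2 * angAvg a) := by
        unfold angAvg at h7 ⊢; linarith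
    _ = _ := by ring

/-- Integrals against a rotation invariant function only see angular averages. -/
theorem integral_mul_of_rot_invariant {Θ κ : Config → ℝ} (hΘ : Continuous Θ)
    (hΘc : HasCompactSupport Θ) (hinv : ∀ θ ξ, Θ (rot θ ξ) = Θ ξ) (hκ : Continuous κ) :
    2 * Real.pi * ∫ ξ, Θ ξ * κ ξ =
      ∫ ξ, Θ ξ * ∫ θ in (0 : ℝ)..2 * Real.pi, κ (rot (-θ) ξ) := by
  have hπ := Real.pi_pos
  have h1 : ∀ θ : ℝ, ∫ ξ, Θ ξ * κ ξ = ∫ ξ, Θ ξ * κ (rot (-θ) ξ) := fun θ => by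
    rw [← (measurePreserving_rot (-θ)).integral_comp
      (rotL (-θ)).toHomeomorph.measurableEmbedding (fun ξ => Θ ξ * κ ξ)]
    simp only [hinv]
  have hc : Continuous fun z : ℝ × Config => Θ z.2 * κ (rot (-z.1) z.2) :=
    (hΘ.comp continuous_snd).mul (hκ.comp contDiff_rot_uncurry.continuous)
  have hint : Integrable (fun z : ℝ × Config => Θ z.2 * κ (rot (-z.1) z.2))
      ((volume.restrict (Set.uIoc 0 (2 * Real.pi))).prod volume) := by
    have h2 : IntegrableOn (fun z : ℝ × Config => Θ z.2 * κ (rot (-z.1) z.2))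
        (Set.uIcc 0 (2 * Real.pi) ×ˢ tsupport Θ) (volume.prod volume) :=
      hc.continuousOn.integrableOn_compact (isCompact_uIcc.prod hΘc)
    have h3 : IntegrableOn (fun z : ℝ × Config => Θ z.2 * κ (rot (-z.1) z.2))
        (Set.uIoc 0 (2 * Real.pi) ×ˢ Set.univ) (volume.prod volume) := by
      refine (h2.mono_set (Set.prod_mono_left Set.uIoc_subset_uIcc)).of_forall_sdiff_eq_zero
        (measurableSet_uIoc.prod MeasurableSet.univ) fun z hz => ?_
      have : z.2 ∉ tsupport Θ := fun hm => hz.2 ⟨hz.1.1, hm⟩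
      simp [image_eq_zero_of_notMem_tsupport this]
    rw [IntegrableOn, ← Measure.prod_restrict, Measure.restrict_univ] at h3
    exact h3
  have h4 := intervalIntegral_integral_swap (a := 0) (b := 2 * Real.pi)
    (f := fun θ ξ => Θ ξ * κ (rot (-θ) ξ)) (μ := volume) hint
  simp only [← h1, intervalIntegral.integral_const, intervalIntegral.integral_const_mul] at h4
  rw [← h4]; simp

theorem exists_polar (ξ : Config) :
    ∃ α, qc ξ 1 = rad ξ * Real.cos α ∧ qc ξ 0 = rad ξ * Real.sin α := by
  set z : ℂ := ⟨qc ξ 1, qc ξ 0⟩ with hz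
  have h : ‖z‖ = rad ξ := by
    rw [Complex.norm_eq_sqrt_sq_add_sq, rad, add_comm]
  refine ⟨z.arg, ?_, ?_⟩
  · rw [← h, Complex.norm_mul_cos_arg]
  · rw [← h, Complex.norm_mul_sin_arg]

theorem rad_rot (θ : ℝ) (ξ : Config) : rad (rot θ ξ) = rad ξ := by
  rw [rad, rad, rot_qc]
  congr 1
  simp only [Matrix.cons_val]
  linear_combination (qc ξ 0 ^ 2 + qc ξ 1 ^ 2) * Real.sin_sq_add_cos_sq θ

theorem integral_rot_polar {F : ℝ → ℝ → ℝ} (ξ : Config) :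
    ∫ θ in (0 : ℝ)..2 * Real.pi, F (qc (rot (-θ) ξ) 0) (qc (rot (-θ) ξ) 1) =
      ∫ θ in -Real.pi..Real.pi, F (rad ξ * Real.sin θ) (rad ξ * Real.cos θ) := by
  obtain ⟨α, h1, h0⟩ := exists_polar ξ
  have e : ∀ θ, F (qc (rot (-θ) ξ) 0) (qc (rot (-θ) ξ) 1) =
      (fun θ => F (rad ξ * Real.sin θ) (rad ξ * Real.cos θ)) (θ + α) := fun θ => by
    rw [rot_qc]
    simp only [Matrix.cons_val, h0, h1, Real.cos_neg, Real.sin_neg, Real.sin_add, Real.cos_add]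
    congr 1 <;> ring
  simp only [e]
  rw [intervalIntegral.integral_comp_add_right
    (fun θ => F (rad ξ * Real.sin θ) (rad ξ * Real.cos θ))]
  have hp : Function.Periodic (fun θ => F (rad ξ * Real.sin θ) (rad ξ * Real.cos θ))
      (2 * Real.pi) := fun θ => by simp
  have := hp.intervalIntegral_add_eq (0 + α) (-Real.pi)
  rw [show 0 + α + 2 * Real.pi = 2 * Real.pi + α by ring,
    show -Real.pi + 2 * Real.pi = Real.pi by ring] at this
  exact this

/-- The localizing weight near the point `q₂ = ϖ` of the circle of minima. -/
def angWeight (ϖ : ℝ) (ξ : Config) : ℝ := Real.exp (-(2 * ϖ ^ 2 * (rad ξ - qc ξ 1)))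

theorem continuous_angWeight (ϖ : ℝ) : Continuous (angWeight ϖ) := by
  have := continuous_rad
  unfold angWeight; fun_prop

theorem angWeight_pos (ϖ : ℝ) (ξ : Config) : 0 < angWeight ϖ ξ := Real.exp_pos _

theorem integral_angWeight (ϖ : ℝ) (ξ : Config) :
    ∫ θ in (0 : ℝ)..2 * Real.pi, angWeight ϖ (rot (-θ) ξ) = angAvg (2 * ϖ ^ 2 * rad ξ) := by
  simp only [angWeight, rad_rot]
  rw [integral_rot_polar (F := fun _ b => Real.exp (-(2 * ϖ ^ 2 * (rad ξ - b)))), angAvg]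
  refine intervalIntegral.integral_congr fun θ _ => ?_
  show Real.exp _ = Real.exp _
  congr 1; ring

theorem integral_angWeight_moment {ϖ ε : ℝ} (hϖ : 0 < ϖ) (hε : 0 < ε) {ξ : Config}
    (hξ : 0 < rad ξ) :
    ∫ θ in (0 : ℝ)..2 * Real.pi, (|qc (rot (-θ) ξ) 0| + (rad (rot (-θ) ξ) - qc (rot (-θ) ξ) 1)) *
        angWeight ϖ (rot (-θ) ξ) ≤
      rad ξ * (ε + (1 + 1 / (2 * ε)) * (4 / (2 * ϖ ^ 2 * rad ξ))) *
        ∫ θ in (0 : ℝ)..2 * Real.pi, angWeight ϖ (rot (-θ) ξ) := by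
  rw [integral_angWeight]
  simp only [angWeight, rad_rot]
  rw [integral_rot_polar (F := fun a b => (|a| + (rad ξ - b)) *
    Real.exp (-(2 * ϖ ^ 2 * (rad ξ - b))))]
  have h := ang_moment_le (a := 2 * ϖ ^ 2 * rad ξ) (by positivity) hε
  have e : ∀ θ, (|rad ξ * Real.sin θ| + (rad ξ - rad ξ * Real.cos θ)) *
      Real.exp (-(2 * ϖ ^ 2 * (rad ξ - rad ξ * Real.cos θ))) = rad ξ * ((|Real.sin θ| +
      (1 - Real.cos θ)) * Real.exp (-(2 * ϖ ^ 2 * rad ξ * (1 - Real.cos θ)))) := fun θ => by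
    rw [abs_mul, abs_of_pos hξ, show 2 * ϖ ^ 2 * (rad ξ - rad ξ * Real.cos θ) =
      2 * ϖ ^ 2 * rad ξ * (1 - Real.cos θ) by ring]
    ring
  simp only [e, intervalIntegral.integral_const_mul]
  rw [mul_assoc (rad ξ)]
  exact mul_le_mul_of_nonneg_left h hξ.le

/-! ### Rotation invariance of the energy density -/

theorem well_rot (ϖ θ : ℝ) (ξ : Config) : well ϖ (rot θ ξ) = well ϖ ξ := by
  have h1 : qsq (rot θ ξ) = qsq ξ := sum_qc_rot_sq θ ξ
  have h2 : xsq (rot θ ξ) = xsq ξ := by simp only [xsq, rot_xc]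
  have h3 : qc (rot θ ξ) 2 ^ 2 + qc (rot θ ξ) 3 ^ 2 = qc ξ 2 ^ 2 + qc ξ 3 ^ 2 := by
    rw [rot_qc]
    simp only [Matrix.cons_val]
    linear_combination (qc ξ 2 ^ 2 + qc ξ 3 ^ 2) * Real.sin_sq_add_cos_sq θ
  rw [well, well, qPot, qPot, h1, h2, h3]

variable {V : Type*} [NormedAddCommGroup V] [InnerProductSpace ℂ V]

theorem gradSq_comp_rot {f : Config → V} (hf : Differentiable ℝ f) (θ : ℝ) (ξ : Config) :
    gradSq (fun ξ => f (rot θ ξ)) ξ = gradSq f (rot θ ξ) := by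
  have h1 : HasFDerivAt (rot θ) ((rotL θ : Config ≃L[ℝ] Config) : Config →L[ℝ] Config) ξ :=
    ((rotL θ : Config ≃L[ℝ] Config) : Config →L[ℝ] Config).hasFDerivAt
  have h2 : ∀ i, pd i (fun ξ => f (rot θ ξ)) ξ = fderiv ℝ f (rot θ ξ) (rot θ (unitVec i)) := by
    intro i
    have := (hf (rot θ ξ)).hasFDerivAt.comp ξ h1
    rw [pd, show (fun ξ => f (rot θ ξ)) = f ∘ rot θ from rfl, this.fderiv]
    rfl
  have hx : ∀ μ, rot θ (unitVec (Sum.inr μ)) = unitVec (Sum.inr μ) := fun μ => by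
    simp [rot, qPart, rotVec, qc, unitVec]
  have hq : ∀ j : Fin 4, rot θ (unitVec (Sum.inl j)) =
      Real.cos θ • unitVec (Sum.inl j) + Real.sin θ •
        (![unitVec (Sum.inl 1), -unitVec (Sum.inl 0), unitVec (Sum.inl 3),
          -unitVec (Sum.inl 2)] : Fin 4 → Config) j := fun j => by
    refine config_ext ?_ ?_
    · rw [rot_qc]
      ext l
      fin_cases j <;> fin_cases l <;> simp [qc, unitVec]
    · rw [rot_xc]
      ext l
      fin_cases j <;> simp [xc, unitVec]
  have key : ∀ a b : V, ‖Real.cos θ • a + Real.sin θ • b‖ ^ 2 +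
      ‖Real.cos θ • b + Real.sin θ • (-a)‖ ^ 2 = ‖a‖ ^ 2 + ‖b‖ ^ 2 := fun a b => by
    have hs := inner_re_symm (𝕜 := ℂ) a b
    simp only [RCLike.re_to_complex] at hs
    simp only [normSq_add, normSq_smul, inner_smul_smul_re, norm_neg, inner_neg_right,
      Complex.neg_re, hs]
    linear_combination (‖a‖ ^ 2 + ‖b‖ ^ 2) * Real.sin_sq_add_cos_sq θ
  simp only [gradSq, h2, Fintype.sum_sum_type, hx, hq, map_add, map_smul, Fin.sum_univ_four,
    Matrix.cons_val, map_neg]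
  have k1 := key (pd (Sum.inl 0) f (rot θ ξ)) (pd (Sum.inl 1) f (rot θ ξ))
  have k2 := key (pd (Sum.inl 2) f (rot θ ξ)) (pd (Sum.inl 3) f (rot θ ξ))
  simp only [pd] at k1 k2 ⊢
  linarith

namespace FermionRep

variable [CompleteSpace V] (R : FermionRep V)

theorem rotUL_apply (θ : ℝ) (v : V) : R.rotUL θ v = R.rotU θ v := rfl

theorem gradSq_rot {w : Config → V} (hw : Differentiable ℝ w) {θ : ℝ}
    (h : ∀ ξ, w (rot θ ξ) = R.rotU θ (w ξ)) (ξ : Config) : gradSq w (rot θ ξ) = gradSq w ξ := by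
  have e : (fun ξ => w (rot θ ξ)) = fun ξ => R.rotUL θ (w ξ) := by
    ext ξ; rw [h, rotUL_apply]
  rw [← gradSq_comp_rot hw, e]
  simp only [gradSq, pd_clm (R.rotUL θ) hw]
  simp only [rotUL_apply, norm_rotU]

theorem rotU_smul (θ c : ℝ) (v : V) : R.rotU θ (c • v) = c • R.rotU θ v := by
  rw [← rotUL_apply, map_smul, rotUL_apply]

theorem vacExp_rot (θ : ℝ) (ξ : Config) (v : V) :
    R.vacExp (rot θ ξ) (R.rotU θ v) = R.vacExp ξ v := by
  set c : ℝ → Fin 4 → ℝ := fun t => ![Real.cos t * qc ξ 0 - Real.sin t * qc ξ 1,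
    Real.cos t * qc ξ 1 + Real.sin t * qc ξ 0, 0, 0] with hc
  have hq : ∀ t, R.hVac (rot t ξ) = R.yukQ (c t) := fun t => by
    rw [hVac, rot_qc]; rfl
  have hcd : ∀ t j, HasDerivAt (fun t => c t j) ((![-c t 1, c t 0, -c t 3, c t 2] : Fin 4 → ℝ) j) t := by
    intro t j
    have hc := Real.hasDerivAt_cos t
    have hs := Real.hasDerivAt_sin t
    fin_cases j
    · exact ((hc.mul_const (qc ξ 0)).sub (hs.mul_const (qc ξ 1))).congr_deriv (by simp [c]; ring)
    · exact ((hc.mul_const (qc ξ 1)).add (hs.mul_const (qc ξ 0))).congr_deriv (by simp [c]; ring)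
    · simpa [c] using hasDerivAt_const t (0 : ℝ)
    · simpa [c] using hasDerivAt_const t (0 : ℝ)
  have hU : ∀ t, HasDerivAt (fun t => R.rotU t v) (R.rotX (R.rotU t v)) t := fun t => by
    simpa [rotU_zero_right] using R.hasDerivAt_rotU (hasDerivAt_const t v)
  have hd : ∀ t, HasDerivAt (fun t => inner ℂ (R.rotU t v) (R.yukQ (c t) (R.rotU t v))) 0 t := by
    intro t
    have h1 : HasDerivAt (fun t => R.yukQ (c t) (R.rotU t v))
        (R.yukQ (c t) (R.rotX (R.rotU t v)) + R.yukQ ![-c t 1, c t 0, -c t 3, c t 2] (R.rotU t v)) t := by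
      have e : ∀ q : Fin 4 → ℝ, ∀ u : V, R.yukQ q u = ∑ j, q j • ((2 * Complex.I) •
          bil R.lam (sMat j * sMat 1) R.psi u) := fun q u => by
        simp only [yukQ, smul_apply, sum_apply, Finset.smul_sum]
        refine Finset.sum_congr rfl fun j _ => ?_
        rw [← Complex.coe_smul (E := V), smul_comm]
      have hB : ∀ j, HasDerivAt (fun t => (2 * Complex.I) • bil R.lam (sMat j * sMat 1) R.psi (R.rotU t v))
          ((2 * Complex.I) • bil R.lam (sMat j * sMat 1) R.psi (R.rotX (R.rotU t v))) t := fun j =>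
        ((((2 * Complex.I) • bil R.lam (sMat j * sMat 1) R.psi : V →L[ℂ] V).restrictScalars
          ℝ).hasFDerivAt.comp_hasDerivAt t (hU t))
      simp only [e, ← Finset.sum_add_distrib]
      exact HasDerivAt.fun_sum fun j _ => (hcd t j).smul (F := V) (hB j)
    refine ((hU t).inner ℂ h1).congr_deriv ?_
    rw [← rotX_yukQ, rotX_skew]
    simp
  have := is_const_of_deriv_eq_zero (fun t => (hd t).differentiableAt) (fun t => (hd t).deriv) θ 0
  have h0 : R.hVac ξ = R.yukQ (c 0) := by rw [← hq, rot_zero]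
  rw [vacExp, vacExp, hq, this, rotU_zero, ← h0]

end FermionRep

end DeformedSQM

namespace DeformedSQM

/-! ### The Gaussian Poincaré inequality -/

/-- The unnormalized Gaussian weight. -/
def gauss (ϖ : ℝ) (ξ : Config) : ℝ := Real.exp (-(ϖ * ‖ξ‖ ^ 2))

theorem gauss_pos (ϖ : ℝ) (ξ : Config) : 0 < gauss ϖ ξ := Real.exp_pos _

theorem contDiff_gauss (ϖ : ℝ) {n : WithTop ℕ∞} : ContDiff ℝ n (gauss ϖ) :=
  Real.contDiff_exp.comp (contDiff_const.mul (contDiff_norm_sq ℝ)).neg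

theorem integrable_gauss {ϖ : ℝ} (hϖ : 0 < ϖ) : Integrable (gauss ϖ) := by
  have := (GaussianFourier.integrable_cexp_neg_mul_sq_norm_add (V := Config) (b := (ϖ : ℂ))
    (by simpa using hϖ) 0 0).norm
  refine this.congr (Filter.Eventually.of_forall fun ξ => ?_)
  simp only [gauss, Complex.norm_exp]
  congr 1
  simp [← Complex.ofReal_pow]

theorem integrable_normSq_gauss {ϖ : ℝ} (hϖ : 0 < ϖ) :
    Integrable fun ξ => ‖ξ‖ ^ 2 * gauss ϖ ξ := by
  have hc := (contDiff_gauss ϖ (n := 0)).continuous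
  refine ((integrable_gauss (half_pos hϖ)).const_mul (2 / ϖ)).mono'
    ((continuous_norm.pow 2).mul hc).aestronglyMeasurable (Filter.Eventually.of_forall fun ξ => ?_)
  rw [Real.norm_eq_abs, abs_of_nonneg (mul_nonneg (sq_nonneg _) (gauss_pos _ _).le)]
  have h2 : ‖ξ‖ ^ 2 ≤ 2 / ϖ * Real.exp (ϖ / 2 * ‖ξ‖ ^ 2) := by
    have := Real.add_one_le_exp (ϖ / 2 * ‖ξ‖ ^ 2)
    calc ‖ξ‖ ^ 2 = 2 / ϖ * (ϖ / 2 * ‖ξ‖ ^ 2) := by field_simp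
      _ ≤ _ := by gcongr; linarith
  calc ‖ξ‖ ^ 2 * gauss ϖ ξ ≤ 2 / ϖ * Real.exp (ϖ / 2 * ‖ξ‖ ^ 2) * gauss ϖ ξ := by
        gcongr; exact (gauss_pos _ _).le
    _ = 2 / ϖ * gauss (ϖ / 2) ξ := by
        rw [gauss, gauss, mul_assoc, ← Real.exp_add]; ring_nf

theorem abs_coord_le (ξ : Config) (i : Idx) : |ξ i| ≤ ‖ξ‖ := PiLp.norm_apply_le ξ i

theorem integrable_coord_mul_gauss {ϖ : ℝ} (hϖ : 0 < ϖ) (i j : Idx) :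
    Integrable fun ξ : Config => ξ i * ξ j * gauss ϖ ξ := by
  have hc := (contDiff_gauss ϖ (n := 0)).continuous
  refine (integrable_normSq_gauss hϖ).mono' (by fun_prop) (Filter.Eventually.of_forall fun ξ => ?_)
  rw [norm_mul, norm_mul, Real.norm_eq_abs, Real.norm_eq_abs, Real.norm_eq_abs,
    abs_of_pos (gauss_pos _ _), sq]
  have h1 := abs_coord_le ξ i
  have h2 := abs_coord_le ξ j
  have := (gauss_pos ϖ ξ).le
  gcongr

theorem integrable_coord_gauss {ϖ : ℝ} (hϖ : 0 < ϖ) (i : Idx) :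
    Integrable fun ξ : Config => ξ i * gauss ϖ ξ := by
  have hc := (contDiff_gauss ϖ (n := 0)).continuous
  refine ((integrable_normSq_gauss hϖ).add (integrable_gauss hϖ)).mono' (by fun_prop)
    (Filter.Eventually.of_forall fun ξ => ?_)
  rw [norm_mul, Real.norm_eq_abs, Real.norm_eq_abs, abs_of_pos (gauss_pos _ _)]
  have h1 := abs_coord_le ξ i
  have := (gauss_pos ϖ ξ).le
  calc |ξ i| * gauss ϖ ξ ≤ (‖ξ‖ ^ 2 + 1) * gauss ϖ ξ := by
        gcongr; nlinarith [sq_nonneg (‖ξ‖ - 1), norm_nonneg ξ]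
    _ = _ := by simp; ring

/-- The covariance of the Gaussian weight. -/
theorem integral_coord_mul_gauss {ϖ : ℝ} (hϖ : 0 < ϖ) (i j : Idx) :
    ∫ ξ : Config, ξ i * ξ j * gauss ϖ ξ = if i = j then (∫ ξ, gauss ϖ ξ) / (2 * ϖ) else 0 := by
  have hg : ∀ ξ, HasLineDerivAt ℝ (gauss ϖ) (-(2 * ϖ) * (ξ i * gauss ϖ ξ)) ξ (unitVec i) := by
    intro ξ
    have h1 : HasFDerivAt (fun ξ : Config => ‖ξ‖ ^ 2) (2 • innerSL ℝ ξ) ξ :=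
      (hasStrictFDerivAt_norm_sq ξ).hasFDerivAt
    have h2 := ((h1.const_mul ϖ).neg.exp).hasLineDerivAt (unitVec i)
    refine HasDerivAt.congr_deriv h2 ?_
    have h3 : inner ℝ ξ (EuclideanSpace.single i (1 : ℝ)) = ξ i := by
      rw [EuclideanSpace.inner_single_right]; simp
    simp [gauss, unitVec, h3]
    ring
  have hf : ∀ ξ, HasLineDerivAt ℝ (fun ξ : Config => ξ j) (if i = j then 1 else 0) ξ (unitVec i) := by
    intro ξ
    have := ((EuclideanSpace.proj j : Config →L[ℝ] ℝ).hasFDerivAt (x := ξ)).hasLineDerivAt (unitVec i)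
    refine HasDerivAt.congr_deriv this ?_
    simp [unitVec, eq_comm]
  have h := integral_bilinear_hasLineDerivAt_right_eq_neg_left_of_integrable (μ := volume)
    (B := ContinuousLinearMap.lsmul ℝ ℝ) (f := fun ξ : Config => ξ j) (g := gauss ϖ)
    (f' := fun _ => if i = j then 1 else 0) (g' := fun ξ => -(2 * ϖ) * (ξ i * gauss ϖ ξ))
    (v := unitVec i) (by simpa only [ContinuousLinearMap.lsmul_apply, smul_eq_mul] using
      (integrable_gauss hϖ).const_mul _)
    (by
      refine ((integrable_coord_mul_gauss hϖ i j).const_mul (-(2 * ϖ))).congr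
        (Filter.Eventually.of_forall fun ξ => ?_)
      simp; ring)
    (by simpa using integrable_coord_gauss hϖ j) (fun ξ _ => hf ξ) (fun ξ _ => hg ξ)
  simp only [ContinuousLinearMap.lsmul_apply, smul_eq_mul, integral_const_mul] at h
  have e : ∀ ξ : Config, ξ j * (-(2 * ϖ) * (ξ i * gauss ϖ ξ)) =
      -(2 * ϖ) * (ξ i * ξ j * gauss ϖ ξ) := fun ξ => by ring
  simp only [e, integral_const_mul] at h
  split_ifs at h ⊢
  · rw [eq_div_iff (by positivity)]; linarith
  · have : -(2 * ϖ) * ∫ ξ : Config, ξ i * ξ j * gauss ϖ ξ = 0 := by simpa using h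
    rcases mul_eq_zero.1 this with h | h
    · linarith
    · exact h

theorem norm_intervalIntegral_sq_le {F : ℝ → ℂ} (hF : Continuous F) {L : ℝ} (hL : 0 < L) :
    ‖∫ t in (0 : ℝ)..L, F t‖ ^ 2 ≤ L * ∫ t in (0 : ℝ)..L, ‖F t‖ ^ 2 := by
  have h1 := intervalIntegral.norm_integral_le_integral_norm (f := F) (μ := volume) hL.le
  set I := ∫ t in (0 : ℝ)..L, ‖F t‖ with hI
  have h2 : 0 ≤ ∫ t in (0 : ℝ)..L, (‖F t‖ - I / L) ^ 2 :=
    intervalIntegral.integral_nonneg hL.le fun t _ => sq_nonneg _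
  have e : ∀ t, (‖F t‖ - I / L) ^ 2 = ‖F t‖ ^ 2 - (2 * (I / L) * ‖F t‖ - (I / L) ^ 2) :=
    fun t => by ring
  have i1 : IntervalIntegrable (fun t => ‖F t‖ ^ 2) volume 0 L :=
    (hF.norm.pow 2).intervalIntegrable _ _
  have i2 : IntervalIntegrable (fun t => 2 * (I / L) * ‖F t‖) volume 0 L :=
    (continuous_const.mul hF.norm).intervalIntegrable _ _
  have i3 : IntervalIntegrable (fun _ : ℝ => (I / L) ^ 2) volume 0 L :=
    continuous_const.intervalIntegrable _ _
  simp only [e] at h2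
  rw [intervalIntegral.integral_sub i1 (i2.sub i3), intervalIntegral.integral_sub i2 i3,
    intervalIntegral.integral_const_mul, ← hI, intervalIntegral.integral_const] at h2
  simp only [sub_zero, smul_eq_mul] at h2
  have h3 : 2 * (I / L) * I - L * (I / L) ^ 2 = I ^ 2 / L := by field_simp; ring
  rw [h3, sub_nonneg, div_le_iff₀ hL] at h2
  calc ‖∫ t in (0 : ℝ)..L, F t‖ ^ 2 ≤ I ^ 2 := by gcongr
    _ ≤ _ := by linarith

/-- An orthogonal involution of two copies of configuration space. -/
def doubleRot (t : ℝ) : Config × Config →ₗ[ℝ] Config × Config :=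
  LinearMap.prod
    (Real.sin t • LinearMap.fst ℝ Config Config + Real.cos t • LinearMap.snd ℝ Config Config)
    (Real.cos t • LinearMap.fst ℝ Config Config - Real.sin t • LinearMap.snd ℝ Config Config)

theorem doubleRot_apply (t : ℝ) (z : Config × Config) : doubleRot t z =
    (Real.sin t • z.1 + Real.cos t • z.2, Real.cos t • z.1 - Real.sin t • z.2) := rfl

theorem continuous_doubleRot : Continuous fun p : ℝ × (Config × Config) => doubleRot p.1 p.2 := by
  simp only [doubleRot_apply]; fun_prop

theorem doubleRot_doubleRot (t : ℝ) : doubleRot t * doubleRot t = 1 := by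
  have h := Real.sin_sq_add_cos_sq t
  refine LinearMap.ext fun z => ?_
  rw [Module.End.mul_apply, doubleRot_apply, doubleRot_apply, Module.End.one_apply]
  refine Prod.ext ?_ ?_
  · calc _ = (Real.sin t ^ 2 + Real.cos t ^ 2) • z.1 := by module
      _ = z.1 := by rw [h, one_smul]
  · calc _ = (Real.sin t ^ 2 + Real.cos t ^ 2) • z.2 := by module
      _ = z.2 := by rw [h, one_smul]

theorem measurePreserving_doubleRot (t : ℝ) :
    MeasurePreserving (doubleRot t) (volume : Measure (Config × Config)) volume := by
  have h1 : LinearMap.det (doubleRot t) * LinearMap.det (doubleRot t) = 1 := by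
    rw [← map_mul, doubleRot_doubleRot, map_one]
  have h2 : |LinearMap.det (doubleRot t)| = 1 := by
    rcases mul_self_eq_one_iff.1 h1 with h | h <;> simp [h]
  refine ⟨(LinearMap.continuous_of_finiteDimensional _).measurable, ?_⟩
  have : ((volume : Measure Config).prod (volume : Measure Config)).IsAddHaarMeasure :=
    Measure.prod.instIsAddHaarMeasure _ _
  rw [Measure.volume_eq_prod]
  rw [Measure.map_linearMap_addHaar_eq_smul_addHaar _ (fun h => by simp [h] at h2), abs_inv, h2]
  simp

theorem gauss_doubleRot (ϖ t : ℝ) (z : Config × Config) :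
    gauss ϖ (doubleRot t z).1 * gauss ϖ (doubleRot t z).2 = gauss ϖ z.1 * gauss ϖ z.2 := by
  rw [gauss, gauss, gauss, gauss, ← Real.exp_add, ← Real.exp_add, doubleRot_apply]
  congr 1
  simp only [norm_add_sq_real, norm_sub_sq_real, norm_smul, mul_pow, Real.norm_eq_abs, sq_abs,
    inner_smul_left, inner_smul_right]
  simp only [conj_trivial]
  linear_combination (-ϖ * (‖z.1‖ ^ 2 + ‖z.2‖ ^ 2)) * Real.sin_sq_add_cos_sq t

/-- The density of the Dirichlet form on two copies of configuration space. -/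
def doubleDens (ϖ : ℝ) (f : Config → ℂ) (z : Config × Config) : ℝ :=
  ‖fderiv ℝ f z.1 z.2‖ ^ 2 * (gauss ϖ z.1 * gauss ϖ z.2)

theorem continuous_doubleDens (ϖ : ℝ) {f : Config → ℂ} (hf : IsTestFn f) :
    Continuous (doubleDens ϖ f) := by
  have hc := (contDiff_gauss ϖ (n := 0)).continuous
  have h1 : Continuous fun z : Config × Config => fderiv ℝ f z.1 z.2 :=
    ((hf.1.continuous_fderiv (by simp)).comp continuous_fst).clm_apply continuous_snd
  exact (h1.norm.pow 2).mul ((hc.comp continuous_fst).mul (hc.comp continuous_snd))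

theorem integrable_doubleDens {ϖ : ℝ} (hϖ : 0 < ϖ) {f : Config → ℂ} (hf : IsTestFn f) :
    Integrable (doubleDens ϖ f) (volume.prod volume) := by
  obtain ⟨C, hC⟩ := (hf.1.continuous_fderiv (by simp)).bounded_above_of_compact_support
    (hf.2.fderiv (𝕜 := ℝ))
  have h := ((integrable_gauss hϖ).mul_prod (integrable_normSq_gauss hϖ)).const_mul (C ^ 2)
  refine h.mono' (continuous_doubleDens ϖ hf).aestronglyMeasurable
    (Filter.Eventually.of_forall fun z => ?_)
  have g1 := gauss_pos ϖ z.1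
  have g2 := gauss_pos ϖ z.2
  rw [doubleDens, Real.norm_eq_abs, abs_of_nonneg (by positivity)]
  have h1 : ‖fderiv ℝ f z.1 z.2‖ ≤ C * ‖z.2‖ :=
    (ContinuousLinearMap.le_opNorm _ _).trans (by gcongr; exact hC _)
  calc _ ≤ (C * ‖z.2‖) ^ 2 * (gauss ϖ z.1 * gauss ϖ z.2) := by gcongr
    _ = _ := by ring

theorem integral_doubleDens {ϖ : ℝ} (hϖ : 0 < ϖ) {f : Config → ℂ} (hf : IsTestFn f) :
    ∫ z, doubleDens ϖ f z ∂(volume.prod volume) =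
      (∫ ξ, gauss ϖ ξ) / (2 * ϖ) * ∫ ξ, gradSq f ξ * gauss ϖ ξ := by
  rw [integral_prod _ (integrable_doubleDens hϖ hf), ← integral_const_mul]
  refine integral_congr_ae (Filter.Eventually.of_forall fun ξ => ?_)
  have e : ∀ η : Config, doubleDens ϖ f (ξ, η) = ∑ i, ∑ j, ((gauss ϖ ξ *
      (inner ℝ (pd i f ξ) (pd j f ξ))) * (η i * η j * gauss ϖ η)) := fun η => by
    have h1 : fderiv ℝ f ξ η = ∑ i, η i • pd i f ξ := by
      have h2 : η = ∑ i, η i • unitVec i := by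
        have := (EuclideanSpace.basisFun Idx ℝ).sum_repr η
        simpa [unitVec] using this.symm
      conv_lhs => rw [h2]
      simp [pd]
    have h3 : ‖fderiv ℝ f ξ η‖ ^ 2 = ∑ i, ∑ j, η i * η j * inner ℝ (pd i f ξ) (pd j f ξ) := by
      rw [← real_inner_self_eq_norm_sq, h1, sum_inner]
      simp only [inner_sum, inner_smul_left, inner_smul_right]
      refine Finset.sum_congr rfl fun i _ => Finset.sum_congr rfl fun j _ => ?_
      simp; ring
    simp only [doubleDens, h3, Finset.sum_mul]
    refine Finset.sum_congr rfl fun i _ => Finset.sum_congr rfl fun j _ => by ring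
  have hi : ∀ i j, Integrable fun η : Config => (gauss ϖ ξ *
      (inner ℝ (pd i f ξ) (pd j f ξ))) * (η i * η j * gauss ϖ η) := fun i j =>
    (integrable_coord_mul_gauss hϖ i j).const_mul _
  simp only [e]
  rw [integral_finsetSum _ fun i _ => integrable_finsetSum _ fun j _ => hi i j]
  simp only [integral_finsetSum _ fun j _ => hi _ j, integral_const_mul,
    integral_coord_mul_gauss hϖ, mul_ite, mul_zero, Finset.sum_ite_eq, Finset.mem_univ, if_true,
    real_inner_self_eq_norm_sq, gradSq, Finset.sum_mul, Finset.mul_sum]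
  refine Finset.sum_congr rfl fun i _ => by ring

theorem normSq_sub_mul_gauss_le {ϖ : ℝ} {f : Config → ℂ} (hf : IsTestFn f) (z : Config × Config) :
    ‖f z.1 - f z.2‖ ^ 2 * (gauss ϖ z.1 * gauss ϖ z.2) ≤
      Real.pi / 2 * ∫ t in (0 : ℝ)..Real.pi / 2, doubleDens ϖ f (doubleRot t z) := by
  have hc : Continuous fun t : ℝ => fderiv ℝ f (Real.sin t • z.1 + Real.cos t • z.2)
      (Real.cos t • z.1 - Real.sin t • z.2) := by
    have h1 : Continuous fun t : ℝ => Real.sin t • z.1 + Real.cos t • z.2 := by fun_prop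
    have h2 : Continuous fun t : ℝ => Real.cos t • z.1 - Real.sin t • z.2 := by fun_prop
    exact ((hf.1.continuous_fderiv (by simp)).comp h1).clm_apply h2
  have hd : ∀ t : ℝ, HasDerivAt (fun t => f (Real.sin t • z.1 + Real.cos t • z.2))
      (fderiv ℝ f (Real.sin t • z.1 + Real.cos t • z.2) (Real.cos t • z.1 - Real.sin t • z.2)) t := fun t => by
    have h1 : HasDerivAt (fun t : ℝ => Real.sin t • z.1 + Real.cos t • z.2)
        (Real.cos t • z.1 - Real.sin t • z.2) t := by
      have := ((Real.hasDerivAt_sin t).smul_const z.1).add ((Real.hasDerivAt_cos t).smul_const z.2)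
      refine this.congr_deriv ?_
      rw [neg_smul, sub_eq_add_neg]
    exact (hf.differentiable _).hasFDerivAt.comp_hasDerivAt t h1
  have h1 := intervalIntegral.integral_eq_sub_of_hasDerivAt (a := 0) (b := Real.pi / 2)
    (fun t _ => hd t) (hc.intervalIntegrable _ _)
  simp only [Real.sin_pi_div_two, Real.cos_pi_div_two, Real.sin_zero, Real.cos_zero, one_smul,
    zero_smul, add_zero, zero_add] at h1
  have h2 := norm_intervalIntegral_sq_le hc (L := Real.pi / 2) (by positivity)
  rw [h1] at h2
  have e : ∀ t, doubleDens ϖ f (doubleRot t z) = ‖fderiv ℝ f (Real.sin t • z.1 + Real.cos t • z.2)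
      (Real.cos t • z.1 - Real.sin t • z.2)‖ ^ 2 * (gauss ϖ z.1 * gauss ϖ z.2) := fun t => by
    rw [doubleDens, gauss_doubleRot, doubleRot_apply]
  simp only [e, intervalIntegral.integral_mul_const]
  have := mul_le_mul_of_nonneg_right h2 (mul_pos (gauss_pos ϖ z.1) (gauss_pos ϖ z.2)).le
  linarith

theorem integral_integral_doubleDens {ϖ : ℝ} (hϖ : 0 < ϖ) {f : Config → ℂ} (hf : IsTestFn f) :
    Integrable (fun z => ∫ t in (0 : ℝ)..Real.pi / 2, doubleDens ϖ f (doubleRot t z))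
      (volume.prod volume) ∧
    ∫ z, (∫ t in (0 : ℝ)..Real.pi / 2, doubleDens ϖ f (doubleRot t z)) ∂(volume.prod volume) =
      Real.pi / 2 * ∫ z, doubleDens ϖ f z ∂(volume.prod volume) := by
  have hmp : ∀ t, MeasurePreserving (doubleRot t) ((volume : Measure Config).prod volume)
    (volume.prod volume) := measurePreserving_doubleRot
  have hme : ∀ t, MeasurableEmbedding (doubleRot t) := fun t =>
    ((LinearEquiv.ofInvolutive (doubleRot t) fun z => by
      simpa using congrArg (fun A : Module.End ℝ (Config × Config) => A z)
        (doubleRot_doubleRot t)).toContinuousLinearEquiv.toHomeomorph).measurableEmbedding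
  have h1 : ∀ t, Integrable (fun z => doubleDens ϖ f (doubleRot t z)) (volume.prod volume) :=
    fun t => (hmp t).integrable_comp_of_integrable (integrable_doubleDens hϖ hf)
  have h2 : ∀ t, ∫ z, doubleDens ϖ f (doubleRot t z) ∂(volume.prod volume) =
      ∫ z, doubleDens ϖ f z ∂(volume.prod volume) := fun t =>
    (hmp t).integral_comp (hme t) _
  have hn : ∀ z, 0 ≤ doubleDens ϖ f z := fun z =>
    mul_nonneg (sq_nonneg _) (mul_pos (gauss_pos _ _) (gauss_pos _ _)).le
  have hint : Integrable (fun p : ℝ × (Config × Config) => doubleDens ϖ f (doubleRot p.1 p.2))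
      ((volume.restrict (Set.uIoc 0 (Real.pi / 2))).prod (volume.prod volume)) := by
    have hcont : Continuous fun p : ℝ × (Config × Config) => doubleDens ϖ f (doubleRot p.1 p.2) :=
      (continuous_doubleDens ϖ hf).comp continuous_doubleRot
    rw [integrable_prod_iff hcont.aestronglyMeasurable]
    refine ⟨Filter.Eventually.of_forall h1, ?_⟩
    simp only [Real.norm_eq_abs, abs_of_nonneg (hn _), h2]
    have : IsFiniteMeasure (volume.restrict (Set.uIoc 0 (Real.pi / 2))) := ⟨by simp [Set.uIoc]⟩
    exact integrable_const _
  refine ⟨?_, ?_⟩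
  · have := hint.integral_prod_right
    rw [Set.uIoc_of_le (by positivity)] at this
    simpa only [intervalIntegral.integral_of_le (show (0 : ℝ) ≤ Real.pi / 2 by positivity)] using this
  · rw [← intervalIntegral_integral_swap (f := fun t z => doubleDens ϖ f (doubleRot t z)) hint]
    simp only [h2, intervalIntegral.integral_const, sub_zero, smul_eq_mul]

theorem integral_normSq_sub {ϖ : ℝ} (hϖ : 0 < ϖ) {f : Config → ℂ} (hf : IsTestFn f) :
    ∫ z : Config × Config, ‖f z.1 - f z.2‖ ^ 2 * (gauss ϖ z.1 * gauss ϖ z.2) ∂(volume.prod volume) =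
      2 * (∫ ξ, gauss ϖ ξ) * (∫ ξ, ‖f ξ‖ ^ 2 * gauss ϖ ξ) - 2 * ‖∫ ξ, gauss ϖ ξ • f ξ‖ ^ 2 := by
  have hc := (contDiff_gauss ϖ (n := 0)).continuous
  have i0 := integrable_gauss hϖ
  have i1 : Integrable fun ξ => ‖f ξ‖ ^ 2 * gauss ϖ ξ :=
    integrable_of_test ((hf.continuous.norm.pow 2).mul hc) hf.2 fun ξ hξ => by
      simp [image_eq_zero_of_notMem_tsupport hξ]
  have i2 : Integrable fun ξ => gauss ϖ ξ • f ξ :=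
    (hf.smul (contDiff_gauss ϖ)).continuous.integrable_of_hasCompactSupport
      (hf.smul (contDiff_gauss ϖ)).2
  have i2' : Integrable fun ξ => (starRingEnd ℂ) (gauss ϖ ξ • f ξ) :=
    (Complex.conjLIE.integrable_comp_iff).2 i2
  have e : ∀ z : Config × Config, ‖f z.1 - f z.2‖ ^ 2 * (gauss ϖ z.1 * gauss ϖ z.2) =
      ((‖f z.1‖ ^ 2 * gauss ϖ z.1) * gauss ϖ z.2 + gauss ϖ z.1 * (‖f z.2‖ ^ 2 * gauss ϖ z.2)) -
      2 * (((starRingEnd ℂ) (gauss ϖ z.1 • f z.1)) * (gauss ϖ z.2 • f z.2)).re := fun z => by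
    have h1 : ‖f z.1 - f z.2‖ ^ 2 = ‖f z.1‖ ^ 2 + ‖f z.2‖ ^ 2
        - 2 * ((starRingEnd ℂ) (f z.1) * f z.2).re := by
      simp only [← Complex.normSq_eq_norm_sq, Complex.normSq_sub]
      have : (f z.1 * (starRingEnd ℂ) (f z.2)).re = ((starRingEnd ℂ) (f z.1) * f z.2).re := by
        simp
      rw [this]
    have h2 : (((starRingEnd ℂ) (gauss ϖ z.1 • f z.1)) * (gauss ϖ z.2 • f z.2)).re =
        gauss ϖ z.1 * gauss ϖ z.2 * ((starRingEnd ℂ) (f z.1) * f z.2).re := by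
      simp; ring
    rw [h1, h2]; ring
  have j1 : Integrable (fun z : Config × Config => (‖f z.1‖ ^ 2 * gauss ϖ z.1) * gauss ϖ z.2)
    (volume.prod volume) := i1.mul_prod i0
  have j2 : Integrable (fun z : Config × Config => gauss ϖ z.1 * (‖f z.2‖ ^ 2 * gauss ϖ z.2))
    (volume.prod volume) := i0.mul_prod i1
  have j3 : Integrable (fun z : Config × Config => ((starRingEnd ℂ) (gauss ϖ z.1 • f z.1)) *
    (gauss ϖ z.2 • f z.2)) (volume.prod volume) := i2'.mul_prod i2
  have j12 : Integrable (fun z : Config × Config => (‖f z.1‖ ^ 2 * gauss ϖ z.1) * gauss ϖ z.2 +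
    gauss ϖ z.1 * (‖f z.2‖ ^ 2 * gauss ϖ z.2)) (volume.prod volume) := j1.add j2
  have j3' : Integrable (fun z : Config × Config => 2 * (((starRingEnd ℂ) (gauss ϖ z.1 • f z.1)) *
    (gauss ϖ z.2 • f z.2)).re) (volume.prod volume) := j3.re.const_mul 2
  simp only [e]
  rw [integral_sub j12 j3', integral_add j1 j2, integral_const_mul,
    integral_prod_mul (fun ξ => ‖f ξ‖ ^ 2 * gauss ϖ ξ) (gauss ϖ),
    integral_prod_mul (gauss ϖ) (fun ξ => ‖f ξ‖ ^ 2 * gauss ϖ ξ)]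
  have h3 : ∫ z : Config × Config, (((starRingEnd ℂ) (gauss ϖ z.1 • f z.1)) *
      (gauss ϖ z.2 • f z.2)).re ∂(volume.prod volume) = ‖∫ ξ, gauss ϖ ξ • f ξ‖ ^ 2 := by
    have h4 := integral_re j3
    simp only [RCLike.re_to_complex] at h4
    rw [h4, integral_prod_mul (fun ξ => (starRingEnd ℂ) (gauss ϖ ξ • f ξ))
      (fun ξ => gauss ϖ ξ • f ξ), integral_conj, ← Complex.normSq_eq_conj_mul_self,
      Complex.ofReal_re, Complex.normSq_eq_norm_sq]
  rw [h3]; ring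

/-- The Gaussian Poincaré inequality. The proof rotates two independent copies into each other. -/
theorem gauss_poincare {ϖ : ℝ} (hϖ : 0 < ϖ) {f : Config → ℂ} (hf : IsTestFn f) :
    ∫ ξ, ‖f ξ‖ ^ 2 * gauss ϖ ξ ≤ Real.pi ^ 2 / (16 * ϖ) * (∫ ξ, gradSq f ξ * gauss ϖ ξ) +
      (∫ ξ, gauss ϖ ξ)⁻¹ * ‖∫ ξ, gauss ϖ ξ • f ξ‖ ^ 2 := by
  have hZ : 0 < ∫ ξ, gauss ϖ ξ := by
    refine (integral_pos_iff_support_of_nonneg (fun ξ => (gauss_pos ϖ ξ).le)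
      (integrable_gauss hϖ)).2 ?_
    have : Function.support (gauss ϖ) = Set.univ := by
      ext ξ; simp [(gauss_pos ϖ ξ).ne']
    rw [this]; simp
  obtain ⟨h1, h2⟩ := integral_integral_doubleDens hϖ hf
  have h3 := integral_mono_of_nonneg (μ := (volume : Measure Config).prod volume)
    (Filter.Eventually.of_forall fun z => mul_nonneg (sq_nonneg _)
      (mul_pos (gauss_pos ϖ z.1) (gauss_pos ϖ z.2)).le) (h1.const_mul (Real.pi / 2))
    (Filter.Eventually.of_forall fun z => normSq_sub_mul_gauss_le (ϖ := ϖ) hf z)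
  rw [integral_normSq_sub hϖ hf, integral_const_mul, h2, integral_doubleDens hϖ hf] at h3
  set Z := ∫ ξ, gauss ϖ ξ
  set A := ∫ ξ, ‖f ξ‖ ^ 2 * gauss ϖ ξ
  set B := ∫ ξ, gradSq f ξ * gauss ϖ ξ
  set M := ‖∫ ξ, gauss ϖ ξ • f ξ‖ ^ 2
  have h4 : A = (2 * Z * A - 2 * M) / (2 * Z) + Z⁻¹ * M := by field_simp; ring
  rw [h4]
  gcongr
  rw [div_le_iff₀ (by positivity)]
  refine h3.trans (le_of_eq ?_)
  field_simp
  ring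

end DeformedSQM

namespace DeformedSQM

/-! ### The spectral gap in the tube -/

/-- The point `q₂ = ϖ` of the circle of minima. -/
def basePt (ϖ : ℝ) : Config := ϖ • unitVec (Sum.inl 1)

theorem normSq_sub_basePt (ϖ : ℝ) (ξ : Config) : ‖ξ - basePt ϖ‖ ^ 2 =
    (rad ξ - ϖ) ^ 2 + 2 * ϖ * (rad ξ - qc ξ 1) + (qc ξ 2 ^ 2 + qc ξ 3 ^ 2) + xsq ξ := by
  have h1 : qc (ξ - basePt ϖ) = ![qc ξ 0, qc ξ 1 - ϖ, qc ξ 2, qc ξ 3] := by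
    ext j; fin_cases j <;> simp [qc, basePt, unitVec]
  have h2 : xc (ξ - basePt ϖ) = xc ξ := by
    ext j; simp [xc, basePt, unitVec]
  rw [norm_sq_config, h1, h2, Fin.sum_univ_four, xsq]
  simp only [Matrix.cons_val]
  linear_combination -rad_sq ξ

theorem gauss_poincare_basePt {ϖ : ℝ} (hϖ : 0 < ϖ) {f : Config → ℂ} (hf : IsTestFn f) :
    ∫ ξ, ‖f ξ‖ ^ 2 * gauss ϖ (ξ - basePt ϖ) ≤
      Real.pi ^ 2 / (16 * ϖ) * (∫ ξ, gradSq f ξ * gauss ϖ (ξ - basePt ϖ)) +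
      (∫ ξ, gauss ϖ ξ)⁻¹ * ‖∫ ξ, gauss ϖ (ξ - basePt ϖ) • f ξ‖ ^ 2 := by
  have hu : IsTestFn fun ξ => f (ξ + basePt ϖ) :=
    ⟨hf.1.comp (contDiff_id.add contDiff_const),
      hf.2.comp_homeomorph (Homeomorph.addRight (basePt ϖ))⟩
  have h := gauss_poincare hϖ hu
  have e : ∀ ξ, gradSq (fun ξ => f (ξ + basePt ϖ)) ξ = gradSq f (ξ + basePt ϖ) := fun ξ => by
    simp only [gradSq, pd, fderiv_comp_add_right]
  have h1 := integral_add_right_eq_self (μ := (volume : Measure Config))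
    (fun ξ => ‖f ξ‖ ^ 2 * gauss ϖ (ξ - basePt ϖ)) (basePt ϖ)
  have h2 := integral_add_right_eq_self (μ := (volume : Measure Config))
    (fun ξ => gradSq f ξ * gauss ϖ (ξ - basePt ϖ)) (basePt ϖ)
  have h3 := integral_add_right_eq_self (μ := (volume : Measure Config))
    (fun ξ => gauss ϖ (ξ - basePt ϖ) • f ξ) (basePt ϖ)
  simp only [add_sub_cancel_right] at h1 h2 h3
  rw [← h1, ← h2, ← h3]
  simpa only [e] using h

/-- In the tube the product of the radial and the angular weight is a Gaussian up to a bounded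
factor. -/
theorem tube_weight {ϖ : ℝ} (hϖ : 1 ≤ ϖ) {ξ : Config} (h : well ϖ ξ ≤ 1 / 100) :
    Real.exp (-(ϖ * well ϖ ξ)) * angWeight ϖ ξ ≤ Real.exp 1 * gauss ϖ (ξ - basePt ϖ) ∧
    gauss ϖ (ξ - basePt ϖ) ≤ Real.exp 1 * (Real.exp (-(ϖ * well ϖ ξ)) * angWeight ϖ ξ) := by
  have hϖ0 : 0 < ϖ := by linarith
  obtain ⟨-, h2, -, -⟩ := tube_bounds hϖ h
  have h3 := tube_rad hϖ h
  set d := rad ξ - ϖ with hd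
  set s := qc ξ 2 ^ 2 + qc ξ 3 ^ 2 with hs
  have hs0 : 0 ≤ s := by positivity
  have hq : qsq ξ - ϖ ^ 2 = ϖ * (2 * d + d ^ 2 / ϖ + s / ϖ) := by
    have h4 : qsq ξ = (d + ϖ) ^ 2 + s := by
      rw [qsq_eq, hd, sub_add_cancel, rad_sq, hs]; ring
    rw [h4]; field_simp; ring
  have e : ϖ * well ϖ ξ - ϖ * (d ^ 2 + s + xsq ξ) =
      d * (d ^ 2 + s) + (d ^ 2 + s) ^ 2 / (4 * ϖ) := by
    have h5 : well ϖ ξ = (1 / 4) * (2 * d + d ^ 2 / ϖ + s / ϖ) ^ 2 + s + xsq ξ := by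
      rw [well, qPot, hq, ← hs]; field_simp
    rw [h5]; field_simp; ring
  have hb : |ϖ * well ϖ ξ - ϖ * (d ^ 2 + s + xsq ξ)| ≤ 1 := by
    rw [e]
    have hd2 : d ^ 2 ≤ (3 / 10) ^ 2 := sq_le_sq' (abs_le.1 h3).1 (abs_le.1 h3).2
    have h6 : |d * (d ^ 2 + s)| ≤ 3 / 10 * (1 / 5) := by
      rw [abs_mul, abs_of_nonneg (add_nonneg (sq_nonneg d) hs0)]
      gcongr
      linarith
    have h7 : (d ^ 2 + s) ^ 2 / (4 * ϖ) ≤ 1 / 4 := by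
      rw [div_le_iff₀ (by positivity)]
      nlinarith [sq_nonneg d]
    have h8 : 0 ≤ (d ^ 2 + s) ^ 2 / (4 * ϖ) := by positivity
    rw [abs_le] at h6 ⊢
    constructor <;> linarith
  have hn := normSq_sub_basePt ϖ ξ
  rw [← hd, ← hs] at hn
  simp only [gauss, angWeight, ← Real.exp_add, hn, Real.exp_le_exp]
  rw [abs_le] at hb
  constructor <;> nlinarith

theorem tube_norm_le {ϖ : ℝ} (hϖ : 1 ≤ ϖ) {ξ : Config} (h : well ϖ ξ ≤ 1 / 100) :
    ‖ξ‖ ≤ ϖ + 2 := by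
  obtain ⟨h2, -, h3, -⟩ := tube_bounds hϖ h
  refine le_of_sq_le_sq ?_ (by positivity)
  have e1 : ∑ j, qc ξ j ^ 2 = qsq ξ := rfl
  have e2 : ∑ μ, xc ξ μ ^ 2 = xsq ξ := rfl
  rw [norm_sq_config, e1, e2]
  nlinarith [(abs_le.1 h2).2]

theorem rotT_eq_zero_of_invariant {c : Config → ℝ} (hc : Differentiable ℝ c)
    (h : ∀ θ ξ, c (rot θ ξ) = c ξ) (ξ : Config) : rotT c ξ = 0 := by
  have h1 := (hc (rot (-0) ξ)).hasFDerivAt.comp_hasDerivAt (0 : ℝ) (hasDerivAt_rot_neg ξ 0)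
  have e : c ∘ (fun θ => rot (-θ) ξ) = fun _ => c ξ := by
    ext θ; exact h _ _
  rw [e, map_neg, ← rotT_eq_fderiv] at h1
  have := h1.unique (hasDerivAt_const (0 : ℝ) (c ξ))
  rw [neg_zero, rot_zero] at this
  exact neg_eq_zero.1 this

theorem exp_one_sq_mul_pi_sq : Real.exp 1 * Real.exp 1 * (Real.pi ^ 2 / 16) ≤ 5 := by
  have h1 := Real.exp_one_lt_d9
  have h2 := Real.pi_lt_d2
  have h3 := Real.pi_pos
  have h4 : Real.pi ^ 2 ≤ 3.15 ^ 2 := by gcongr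
  have h5 : Real.exp 1 * Real.exp 1 ≤ 2.7182818286 * 2.7182818286 := by gcongr
  calc Real.exp 1 * Real.exp 1 * (Real.pi ^ 2 / 16)
      ≤ (2.7182818286 * 2.7182818286) * (3.15 ^ 2 / 16) := by gcongr
    _ ≤ 5 := by norm_num

variable {V : Type*} [NormedAddCommGroup V] [InnerProductSpace ℂ V]

theorem hasCompactSupport_of_test {F : Type*} [NormedAddCommGroup F] {f : Config → ℝ}
    {g : Config → F} (hg : HasCompactSupport g)
    (h : ∀ ξ, ξ ∉ tsupport g → f ξ = 0) : HasCompactSupport f := HasCompactSupport.intro hg h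

theorem well_le_of_mem_tsupport {F : Type*} [NormedAddCommGroup F] {ϖ r : ℝ} {g : Config → F}
    (h : ∀ ξ, g ξ ≠ 0 → well ϖ ξ ≤ r)
    {ξ : Config} (hξ : ξ ∈ tsupport g) : well ϖ ξ ≤ r :=
  closure_minimal (fun ξ hξ => h ξ hξ)
    (isClosed_le (contDiff_well ϖ (n := 0)).continuous continuous_const) hξ

namespace FermionRep

variable [CompleteSpace V] (R : FermionRep V)

theorem covD_smul {c : Config → ℝ} {g : Config → V} (hc : Differentiable ℝ c)
    (hg : Differentiable ℝ g) (h : ∀ θ ξ, c (rot θ ξ) = c ξ) (ξ : Config) :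
    R.covD (fun ξ => c ξ • g ξ) ξ = c ξ • R.covD g ξ := by
  have e : R.rotX (c ξ • g ξ) = c ξ • R.rotX (g ξ) := by
    rw [← Complex.coe_smul (E := V), map_smul, Complex.coe_smul]
  rw [covD, rotT_smul (hc ξ) (hg ξ), rotT_eq_zero_of_invariant hc h, zero_smul, add_zero, e, covD,
    smul_sub]

/-- The factor by which the ground state representation removes the radial weight. -/
def unweight (ϖ : ℝ) (g : Config → V) (ξ : Config) : V := Real.exp (ϖ / 2 * well ϖ ξ) • g ξ

omit [CompleteSpace V] in
theorem contDiff_expWell (c ϖ : ℝ) : ContDiff ℝ ∞ fun ξ => Real.exp (c * well ϖ ξ) :=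
  Real.contDiff_exp.comp (contDiff_const.mul (contDiff_well ϖ))

omit [CompleteSpace V] in
theorem pd_unweight {ϖ : ℝ} (hϖ : 0 < ϖ) {g : Config → V} (hg : Differentiable ℝ g) (i : Idx)
    (ξ : Config) : pd i (unweight ϖ g) ξ =
      Real.exp (ϖ / 2 * well ϖ ξ) • (pd i g ξ + dWell ϖ ξ i • g ξ) := by
  have hw : Differentiable ℝ (well ϖ) := (contDiff_well ϖ (n := 1)).differentiable (by simp)
  have hu : Differentiable ℝ fun ξ => ϖ / 2 * well ϖ ξ := hw.const_mul _
  have he : Differentiable ℝ fun ξ => Real.exp (ϖ / 2 * well ϖ ξ) := hu.exp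
  have h1 : pd i (fun ξ => Real.exp (ϖ / 2 * well ϖ ξ)) ξ =
      Real.exp (ϖ / 2 * well ϖ ξ) * dWell ϖ ξ i := by
    rw [pd_comp Real.differentiableAt_exp (hu ξ), Real.deriv_exp,
      pd_mul (differentiableAt_const _) (hw ξ), pd_const, pd_well hϖ]
    field_simp
    ring
  have h2 := pd_smul (he ξ) (hg ξ) i
  rw [h1] at h2
  rw [smul_add, smul_smul, ← h2]
  rfl

omit [CompleteSpace V] in
theorem gradSq_unweight {ϖ : ℝ} (hϖ : 0 < ϖ) {g : Config → V} (hg : Differentiable ℝ g)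
    (ξ : Config) : gradSq (unweight ϖ g) ξ = Real.exp (ϖ * well ϖ ξ) *
      ∑ i, ‖pd i g ξ + dWell ϖ ξ i • g ξ‖ ^ 2 := by
  simp only [gradSq, pd_unweight hϖ hg, normSq_smul, Finset.mul_sum]
  refine Finset.sum_congr rfl fun i _ => ?_
  rw [← Real.exp_nat_mul]
  congr 2
  push_cast; ring

theorem unweight_rot {ϖ : ℝ} {g : Config → V} (hg : Differentiable ℝ g)
    (h : ∀ ξ, R.covD g ξ = 0) (θ : ℝ) (ξ : Config) :
    unweight ϖ g (rot θ ξ) = R.rotU θ (unweight ϖ g ξ) := by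
  rw [unweight, unweight, well_rot, R.apply_rot hg h, rotU_smul]

theorem nearDens_rot {ϖ : ℝ} (hϖ : 0 < ϖ) {g : Config → V} (hg : IsTestFn g)
    (h : ∀ ξ, R.covD g ξ = 0) (θ : ℝ) (ξ : Config) :
    R.nearDens ϖ g (rot θ ξ) = R.nearDens ϖ g ξ := by
  have hd := hg.differentiable
  have hw : Differentiable ℝ (unweight ϖ g) :=
    (hg.smul (contDiff_expWell (ϖ / 2) ϖ)).differentiable
  have h1 : ∀ ξ, ∑ i, ‖pd i g ξ + dWell ϖ ξ i • g ξ‖ ^ 2 =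
      Real.exp (-(ϖ * well ϖ ξ)) * gradSq (unweight ϖ g) ξ := fun ξ => by
    rw [gradSq_unweight hϖ hd, ← mul_assoc, ← Real.exp_add, neg_add_cancel, Real.exp_zero, one_mul]
  rw [nearDens, nearDens, h1, h1, well_rot, R.gradSq_rot hw (R.unweight_rot hd h θ), rad_rot,
    R.apply_rot hd h, vacExp_rot, norm_rotU]

theorem nearDens_nonneg (ϖ : ℝ) (g : Config → V) (ξ : Config) : 0 ≤ R.nearDens ϖ g ξ :=
  add_nonneg (Finset.sum_nonneg fun _ _ => sq_nonneg _)
    (R.vacExp_nonneg ξ (g ξ) (rad_nonneg ξ) (rad_sq ξ).ge)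

/-- The component of `g` along the spinor ground state at `basePt ϖ`, against the Gaussian weight. -/
def vacMean (ϖ : ℝ) (g : Config → V) : ℂ :=
  ∫ ξ, gauss ϖ (ξ - basePt ϖ) • inner ℂ R.vac (unweight ϖ g ξ)

theorem norm_inner_vac_le (v : V) : ‖inner ℂ R.vac v‖ ≤ ‖v‖ := by
  simpa [R.norm_vac] using norm_inner_le_norm (𝕜 := ℂ) R.vac v

/-- The Poincaré inequality controls the component along the spinor ground state. -/
theorem vac_component_le {ϖ : ℝ} (hϖ : 1 ≤ ϖ) {g : Config → V} (hg : IsTestFn g)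
    (h : ∀ ξ, g ξ ≠ 0 → well ϖ ξ ≤ 1 / 100) :
    ∫ ξ, ‖inner ℂ R.vac (g ξ)‖ ^ 2 * angWeight ϖ ξ ≤
      5 / ϖ * (∫ ξ, (∑ i, ‖pd i g ξ + dWell ϖ ξ i • g ξ‖ ^ 2) * angWeight ϖ ξ) +
      Real.exp 1 * (∫ ξ, gauss ϖ ξ)⁻¹ * ‖R.vacMean ϖ g‖ ^ 2 := by
  have hϖ0 : 0 < ϖ := by linarith
  have hw : IsTestFn (unweight ϖ g) := hg.smul (contDiff_expWell (ϖ / 2) ϖ)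
  set L : V →L[ℂ] ℂ := innerSL ℂ R.vac with hL
  set f : Config → ℂ := fun ξ => inner ℂ R.vac (unweight ϖ g ξ) with hfdef
  have hLf : ∀ ξ, f ξ = (L.restrictScalars ℝ) (unweight ϖ g ξ) := fun ξ => rfl
  have hf : IsTestFn f :=
    ⟨(ContinuousLinearMap.contDiff (L.restrictScalars ℝ)).comp hw.1,
      HasCompactSupport.intro hw.2 fun ξ hξ => by
        rw [hLf, image_eq_zero_of_notMem_tsupport hξ, map_zero]⟩
  have hgf : ∀ ξ, gradSq f ξ ≤ gradSq (unweight ϖ g) ξ := fun ξ => by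
    have e : f = fun ξ => (L.restrictScalars ℝ) (unweight ϖ g ξ) := rfl
    simp only [gradSq, e, pd_clm _ hw.differentiable]
    refine Finset.sum_le_sum fun i _ => ?_
    have := R.norm_inner_vac_le (pd i (unweight ϖ g) ξ)
    gcongr
    exact this
  have hn : ∀ ξ, ‖f ξ‖ ^ 2 = Real.exp (ϖ * well ϖ ξ) * ‖inner ℂ R.vac (g ξ)‖ ^ 2 := fun ξ => by
    rw [hfdef]
    simp only [unweight]
    rw [← Complex.coe_smul (E := V), inner_smul_right, norm_mul, mul_pow, Complex.norm_real,
      Real.norm_eq_abs, sq_abs, ← Real.exp_nat_mul]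
    congr 2
    push_cast; ring
  have hcg : Continuous fun ξ => gauss ϖ (ξ - basePt ϖ) :=
    (contDiff_gauss ϖ (n := 0)).continuous.comp (continuous_id.sub continuous_const)
  have hca := continuous_angWeight ϖ
  set K : Config → ℝ := fun ξ => ∑ i, ‖pd i g ξ + dWell ϖ ξ i • g ξ‖ ^ 2 with hK
  have hKc : Continuous K :=
    continuous_finsetSum _ fun i _ => (isTestFn_shift hg i).continuous.norm.pow 2
  have hK0 : ∀ ξ, ξ ∉ tsupport g → K ξ = 0 := fun ξ hξ => by
    simp [hK, pd_eq_zero hξ, image_eq_zero_of_notMem_tsupport hξ]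
  have hgw : ∀ ξ, gradSq (unweight ϖ g) ξ = Real.exp (ϖ * well ϖ ξ) * K ξ :=
    gradSq_unweight hϖ0 hg.differentiable
  have i1 : Integrable fun ξ => ‖f ξ‖ ^ 2 * gauss ϖ (ξ - basePt ϖ) :=
    integrable_of_test ((hf.continuous.norm.pow 2).mul hcg) hf.2 fun ξ hξ => by
      simp [image_eq_zero_of_notMem_tsupport hξ]
  have i2 : Integrable fun ξ => gradSq f ξ * gauss ϖ (ξ - basePt ϖ) :=
    integrable_of_test ((continuous_gradSq hf.1).mul hcg) hf.2 fun ξ hξ => by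
      simp [gradSq, pd_eq_zero hξ]
  have i3 : Integrable fun ξ => K ξ * angWeight ϖ ξ :=
    integrable_of_test (hKc.mul hca) hg.2 fun ξ hξ => by simp [hK0 ξ hξ]
  have i4 : Integrable fun ξ => ‖inner ℂ R.vac (g ξ)‖ ^ 2 * angWeight ϖ ξ :=
    integrable_of_test (((continuous_const.inner hg.continuous).norm.pow 2).mul hca) hg.2
      fun ξ hξ => by simp [image_eq_zero_of_notMem_tsupport hξ]
  have hexp : ∀ ξ, Real.exp (ϖ * well ϖ ξ) * Real.exp (-(ϖ * well ϖ ξ)) = 1 := fun ξ => by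
    rw [← Real.exp_add, add_neg_cancel, Real.exp_zero]
  have h1 : ∫ ξ, ‖inner ℂ R.vac (g ξ)‖ ^ 2 * angWeight ϖ ξ ≤
      Real.exp 1 * ∫ ξ, ‖f ξ‖ ^ 2 * gauss ϖ (ξ - basePt ϖ) := by
    rw [← integral_const_mul]
    refine integral_mono i4 (i1.const_mul _) fun ξ => ?_
    by_cases h0 : g ξ = 0
    · simp [h0, hn]
    · have h2 := (tube_weight hϖ (h ξ h0)).1
      simp only
      rw [hn]
      calc ‖inner ℂ R.vac (g ξ)‖ ^ 2 * angWeight ϖ ξ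
          = Real.exp (ϖ * well ϖ ξ) * ‖inner ℂ R.vac (g ξ)‖ ^ 2 *
            (Real.exp (-(ϖ * well ϖ ξ)) * angWeight ϖ ξ) := by
              linear_combination (-‖inner ℂ R.vac (g ξ)‖ ^ 2 * angWeight ϖ ξ) * hexp ξ
        _ ≤ Real.exp (ϖ * well ϖ ξ) * ‖inner ℂ R.vac (g ξ)‖ ^ 2 *
            (Real.exp 1 * gauss ϖ (ξ - basePt ϖ)) := by gcongr
        _ = _ := by ring
  have h2 : ∫ ξ, gradSq f ξ * gauss ϖ (ξ - basePt ϖ) ≤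
      Real.exp 1 * ∫ ξ, K ξ * angWeight ϖ ξ := by
    rw [← integral_const_mul]
    refine integral_mono i2 (i3.const_mul _) fun ξ => ?_
    have hg1 := (gauss_pos ϖ (ξ - basePt ϖ)).le
    by_cases h0 : ξ ∈ tsupport g
    · have h2 := (tube_weight hϖ (well_le_of_mem_tsupport h h0)).2
      have hK1 : 0 ≤ K ξ := Finset.sum_nonneg fun _ _ => sq_nonneg _
      calc gradSq f ξ * gauss ϖ (ξ - basePt ϖ)
          ≤ Real.exp (ϖ * well ϖ ξ) * K ξ * gauss ϖ (ξ - basePt ϖ) := by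
            gcongr; exact (hgf ξ).trans (hgw ξ).le
        _ ≤ Real.exp (ϖ * well ϖ ξ) * K ξ *
            (Real.exp 1 * (Real.exp (-(ϖ * well ϖ ξ)) * angWeight ϖ ξ)) := by gcongr
        _ = _ := by linear_combination (Real.exp 1 * K ξ * angWeight ϖ ξ) * hexp ξ
    · have h3 : gradSq f ξ ≤ 0 := (hgf ξ).trans (by rw [hgw, hK0 ξ h0, mul_zero])
      simp only [hK0 ξ h0, zero_mul, mul_zero]
      exact mul_nonpos_of_nonpos_of_nonneg h3 hg1
  have h3 := gauss_poincare_basePt hϖ0 hf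
  have hKi : 0 ≤ ∫ ξ, K ξ * angWeight ϖ ξ := integral_nonneg fun ξ =>
    mul_nonneg (Finset.sum_nonneg fun _ _ => sq_nonneg _) (angWeight_pos _ _).le
  have hvm : ∫ ξ, gauss ϖ (ξ - basePt ϖ) • f ξ = R.vacMean ϖ g := rfl
  rw [hvm] at h3
  calc _ ≤ Real.exp 1 * (Real.pi ^ 2 / (16 * ϖ) * (Real.exp 1 * ∫ ξ, K ξ * angWeight ϖ ξ) +
      (∫ ξ, gauss ϖ ξ)⁻¹ * ‖R.vacMean ϖ g‖ ^ 2) := by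
        refine h1.trans ?_
        gcongr
        refine h3.trans ?_
        gcongr
    _ = (Real.exp 1 * Real.exp 1 * (Real.pi ^ 2 / 16)) / ϖ * (∫ ξ, K ξ * angWeight ϖ ξ) +
        Real.exp 1 * (∫ ξ, gauss ϖ ξ)⁻¹ * ‖R.vacMean ϖ g‖ ^ 2 := by field_simp
    _ ≤ _ := by
        gcongr
        exact exp_one_sq_mul_pi_sq

/-- The spectral gap of the ground state representation in the tube. -/
theorem nearDens_gap {ϖ : ℝ} (hϖ : 100000 ≤ ϖ) : ∃ C : ℝ, 0 ≤ C ∧ ∀ g : Config → V, IsTestFn g →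
    (∀ ξ, R.covD g ξ = 0) → (∀ ξ, g ξ ≠ 0 → well ϖ ξ ≤ 1 / 100) →
    9 * ϖ / 100 * ∫ ξ, ‖g ξ‖ ^ 2 ≤ (∫ ξ, R.nearDens ϖ g ξ) + C * ‖R.vacMean ϖ g‖ ^ 2 := by
  have hϖ1 : 1 ≤ ϖ := by linarith
  have hϖ0 : 0 < ϖ := by linarith
  have hπ := Real.pi_pos
  set M0 := angAvg (2 * ϖ ^ 2 * (ϖ - 3 / 10)) with hM0
  have hM0p : 0 < M0 := angAvg_pos _
  have hZ : 0 ≤ ∫ ξ, gauss ϖ ξ := integral_nonneg fun ξ => (gauss_pos ϖ ξ).le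
  set C1 := ϖ / 5 * (Real.exp 1 * (∫ ξ, gauss ϖ ξ)⁻¹) with hC1
  have hC1p : 0 ≤ C1 := by positivity
  refine ⟨2 * Real.pi * C1 / M0, by positivity, fun g hg hp h => ?_⟩
  have hca := continuous_angWeight ϖ
  have hts := fun ξ (hξ : ξ ∈ tsupport g) => well_le_of_mem_tsupport h hξ
  have hrad : ∀ ξ, ξ ∈ tsupport g → ϖ - 3 / 10 ≤ rad ξ ∧ rad ξ ≤ ϖ + 3 / 10 := fun ξ hξ => by
    have := abs_le.1 (tube_rad hϖ1 (hts ξ hξ))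
    constructor <;> linarith [this.1, this.2]
  have hninv : ∀ θ ξ, ‖g (rot θ ξ)‖ ^ 2 = ‖g ξ‖ ^ 2 := fun θ ξ => by
    rw [R.apply_rot hg.differentiable hp, norm_rotU]
  have hn0 : ∀ ξ, ξ ∉ tsupport g → ‖g ξ‖ ^ 2 = 0 := fun ξ hξ => by
    simp [image_eq_zero_of_notMem_tsupport hξ]
  have hnc : Continuous fun ξ => ‖g ξ‖ ^ 2 := hg.continuous.norm.pow 2
  have hncs := hasCompactSupport_of_test hg.2 hn0
  have hd0 : ∀ ξ, ξ ∉ tsupport g → R.nearDens ϖ g ξ = 0 := fun ξ hξ => by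
    simp [nearDens, vacExp, pd_eq_zero hξ, image_eq_zero_of_notMem_tsupport hξ]
  have hdc := R.continuous_nearDens ϖ hg
  -- angular averages of the energy density and of the probability density
  have a1 := integral_mul_of_rot_invariant hdc (hasCompactSupport_of_test hg.2 hd0)
    (R.nearDens_rot hϖ0 hg hp) hca
  have a2 := integral_mul_of_rot_invariant hnc hncs hninv hca
  have hmc : Continuous fun ξ => (|qc ξ 0| + (rad ξ - qc ξ 1)) * angWeight ϖ ξ := by
    have := continuous_rad
    fun_prop
  have a3 := integral_mul_of_rot_invariant hnc hncs hninv hmc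
  simp only [integral_angWeight] at a1 a2
  have hac : Continuous fun ξ => angAvg (2 * ϖ ^ 2 * rad ξ) := by
    simp only [← integral_angWeight]
    exact intervalIntegral.continuous_parametric_intervalIntegral_of_continuous'
      (f := fun ξ θ => angWeight ϖ (rot (-θ) ξ)) (hca.comp (contDiff_rot_uncurry.continuous.comp
        continuous_swap)) _ _
  have i1 : Integrable fun ξ => R.nearDens ϖ g ξ * angAvg (2 * ϖ ^ 2 * rad ξ) :=
    integrable_of_test (hdc.mul hac) hg.2 fun ξ hξ => by simp [hd0 ξ hξ]
  have i2 : Integrable fun ξ => ‖g ξ‖ ^ 2 * angAvg (2 * ϖ ^ 2 * rad ξ) :=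
    integrable_of_test (hnc.mul hac) hg.2 fun ξ hξ => by simp [hn0 ξ hξ]
  have b1 : ∫ ξ, R.nearDens ϖ g ξ * angAvg (2 * ϖ ^ 2 * rad ξ) ≤ M0 * ∫ ξ, R.nearDens ϖ g ξ := by
    rw [← integral_const_mul]
    refine integral_mono i1 ((R.integrable_nearDens ϖ hg).const_mul _) fun ξ => ?_
    by_cases hξ : ξ ∈ tsupport g
    · simp only
      rw [mul_comm M0]
      gcongr
      · exact R.nearDens_nonneg ϖ g ξ
      · exact angAvg_antitone (by gcongr; exact (hrad ξ hξ).1)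
    · simp [hd0 ξ hξ]
  have b2 : M0 / 2 * ∫ ξ, ‖g ξ‖ ^ 2 ≤ ∫ ξ, ‖g ξ‖ ^ 2 * angAvg (2 * ϖ ^ 2 * rad ξ) := by
    rw [← integral_const_mul]
    refine integral_mono ((integrable_normSq hg).const_mul _) i2 fun ξ => ?_
    by_cases hξ : ξ ∈ tsupport g
    · simp only
      rw [mul_comm (M0 / 2)]
      gcongr
      have h1 := angAvg_le (a := 2 * ϖ ^ 2 * (ϖ - 3 / 10))
        (mul_nonneg (by positivity) (by linarith))
      have h2 : angAvg (2 * (2 * ϖ ^ 2 * (ϖ - 3 / 10))) ≤ angAvg (2 * ϖ ^ 2 * rad ξ) := by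
        refine angAvg_antitone ?_
        calc 2 * ϖ ^ 2 * rad ξ ≤ 2 * ϖ ^ 2 * (2 * (ϖ - 3 / 10)) := by
              gcongr; linarith [(hrad ξ hξ).2]
          _ = _ := by ring
      linarith
    · simp [hn0 ξ hξ]
  -- the error of replacing the spinor ground state by its value at the base point
  have b3 : ∫ ξ, ‖g ξ‖ ^ 2 * ((|qc ξ 0| + (rad ξ - qc ξ 1)) * angWeight ϖ ξ) ≤
      ϖ / 400 * ∫ ξ, ‖g ξ‖ ^ 2 * angWeight ϖ ξ := by
    refine le_of_mul_le_mul_left ?_ (by positivity : 0 < 2 * Real.pi)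
    have e : 2 * Real.pi * (ϖ / 400 * ∫ ξ, ‖g ξ‖ ^ 2 * angWeight ϖ ξ) =
        ϖ / 400 * (2 * Real.pi * ∫ ξ, ‖g ξ‖ ^ 2 * angWeight ϖ ξ) := by ring
    rw [e, a2, a3, ← integral_const_mul]
    have hac3 : Continuous fun ξ => ∫ θ in (0 : ℝ)..2 * Real.pi,
        (|qc (rot (-θ) ξ) 0| + (rad (rot (-θ) ξ) - qc (rot (-θ) ξ) 1)) *
          angWeight ϖ (rot (-θ) ξ) :=
      intervalIntegral.continuous_parametric_intervalIntegral_of_continuous'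
        (f := fun ξ θ => (|qc (rot (-θ) ξ) 0| + (rad (rot (-θ) ξ) - qc (rot (-θ) ξ) 1)) *
          angWeight ϖ (rot (-θ) ξ)) (hmc.comp (contDiff_rot_uncurry.continuous.comp
        continuous_swap)) _ _
    refine integral_mono (integrable_of_test (hnc.mul hac3) hg.2 fun ξ hξ => by simp [hn0 ξ hξ])
      (i2.const_mul _) fun ξ => ?_
    by_cases hξ : ξ ∈ tsupport g
    · obtain ⟨hr1, hr2⟩ := hrad ξ hξ
      have hr : 0 < rad ξ := by linarith
      have h1 := integral_angWeight_moment hϖ0 (ε := 1 / 1000) (by norm_num) hr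
      rw [integral_angWeight] at h1
      have h2 : rad ξ * (1 / 1000 + (1 + 1 / (2 * (1 / 1000))) * (4 / (2 * ϖ ^ 2 * rad ξ))) ≤
          ϖ / 400 := by
        have h3 : rad ξ * (1 / 1000 + (1 + 1 / (2 * (1 / 1000))) * (4 / (2 * ϖ ^ 2 * rad ξ))) =
            rad ξ / 1000 + 1002 / ϖ ^ 2 := by field_simp; ring
        have h4 : 1002 / ϖ ^ 2 ≤ 1 := by
          rw [div_le_one (by positivity)]; nlinarith
        rw [h3]; linarith
      have h5 := h1.trans (mul_le_mul_of_nonneg_right h2 (angAvg_pos _).le)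
      have := mul_le_mul_of_nonneg_left h5 (sq_nonneg ‖g ξ‖)
      simp only
      linarith
    · simp [hn0 ξ hξ]
  -- the localized estimate
  set K : Config → ℝ := fun ξ => ∑ i, ‖pd i g ξ + dWell ϖ ξ i • g ξ‖ ^ 2 with hK
  have hKc : Continuous K :=
    continuous_finsetSum _ fun i _ => (isTestFn_shift hg i).continuous.norm.pow 2
  have hK0 : ∀ ξ, ξ ∉ tsupport g → K ξ = 0 := fun ξ hξ => by
    simp [hK, pd_eq_zero hξ, image_eq_zero_of_notMem_tsupport hξ]
  have c1 := R.vac_component_le hϖ1 hg h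
  have j1 : Integrable fun ξ => K ξ * angWeight ϖ ξ :=
    integrable_of_test (hKc.mul hca) hg.2 fun ξ hξ => by simp [hK0 ξ hξ]
  have j2 : Integrable fun ξ => ‖g ξ‖ ^ 2 * angWeight ϖ ξ :=
    integrable_of_test (hnc.mul hca) hg.2 fun ξ hξ => by simp [hn0 ξ hξ]
  have j3 : Integrable fun ξ => ‖inner ℂ R.vac (g ξ)‖ ^ 2 * angWeight ϖ ξ :=
    integrable_of_test (((continuous_const.inner hg.continuous).norm.pow 2).mul hca) hg.2
      fun ξ hξ => by simp [image_eq_zero_of_notMem_tsupport hξ]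
  have j4 : Integrable fun ξ => ‖g ξ‖ ^ 2 * ((|qc ξ 0| + (rad ξ - qc ξ 1)) * angWeight ϖ ξ) :=
    integrable_of_test (hnc.mul hmc) hg.2 fun ξ hξ => by simp [hn0 ξ hξ]
  have j5 : Integrable fun ξ => R.nearDens ϖ g ξ * angWeight ϖ ξ :=
    integrable_of_test (hdc.mul hca) hg.2 fun ξ hξ => by simp [hd0 ξ hξ]
  have c2 : (∫ ξ, K ξ * angWeight ϖ ξ) + ϖ / 5 * (∫ ξ, ‖g ξ‖ ^ 2 * angWeight ϖ ξ)
      - ϖ / 5 * (∫ ξ, ‖inner ℂ R.vac (g ξ)‖ ^ 2 * angWeight ϖ ξ)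
      - 8 * (∫ ξ, ‖g ξ‖ ^ 2 * ((|qc ξ 0| + (rad ξ - qc ξ 1)) * angWeight ϖ ξ)) ≤
      ∫ ξ, R.nearDens ϖ g ξ * angWeight ϖ ξ := by
    have k2 := j2.const_mul (ϖ / 5)
    have k3 := j3.const_mul (ϖ / 5)
    have k4 := j4.const_mul 8
    have k12 : Integrable fun ξ => K ξ * angWeight ϖ ξ + ϖ / 5 * (‖g ξ‖ ^ 2 * angWeight ϖ ξ) :=
      j1.add k2
    have k123 : Integrable fun ξ => K ξ * angWeight ϖ ξ + ϖ / 5 * (‖g ξ‖ ^ 2 * angWeight ϖ ξ) -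
      ϖ / 5 * (‖inner ℂ R.vac (g ξ)‖ ^ 2 * angWeight ϖ ξ) := k12.sub k3
    rw [← integral_const_mul, ← integral_const_mul, ← integral_const_mul, ← integral_add j1 k2,
      ← integral_sub k12 k3, ← integral_sub k123 k4]
    refine integral_mono (k123.sub k4) j5 fun ξ => ?_
    by_cases hξ : ξ ∈ tsupport g
    · obtain ⟨hr1, hr2⟩ := hrad ξ hξ
      have hq1 : |qc ξ 1| ≤ rad ξ := by
        refine abs_le_of_sq_le_sq ?_ (rad_nonneg ξ)
        rw [rad_sq]; nlinarith [sq_nonneg (qc ξ 0)]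
      have h1 := R.vacExp_lower ξ (g ξ) (rad_nonneg ξ) hq1
      have h2 : ‖inner ℂ R.vac (g ξ)‖ ^ 2 ≤ ‖g ξ‖ ^ 2 := by
        gcongr; exact R.norm_inner_vac_le _
      have h3 : ϖ / 5 * (‖g ξ‖ ^ 2 - ‖inner ℂ R.vac (g ξ)‖ ^ 2) ≤
          2 * rad ξ * (‖g ξ‖ ^ 2 - ‖inner ℂ R.vac (g ξ)‖ ^ 2) := by
        gcongr; linarith
      have h4 : K ξ + ϖ / 5 * ‖g ξ‖ ^ 2 - ϖ / 5 * ‖inner ℂ R.vac (g ξ)‖ ^ 2 -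
          8 * (‖g ξ‖ ^ 2 * (|qc ξ 0| + (rad ξ - qc ξ 1))) ≤ R.nearDens ϖ g ξ := by
        rw [nearDens]; linarith
      have := mul_le_mul_of_nonneg_right h4 (angWeight_pos ϖ ξ).le
      simp only
      linarith
    · simp [hd0 ξ hξ, hK0 ξ hξ, image_eq_zero_of_notMem_tsupport hξ]
  set A := ∫ ξ, ‖g ξ‖ ^ 2 * angWeight ϖ ξ with hA
  set B := ∫ ξ, K ξ * angWeight ϖ ξ with hB
  set W := ‖R.vacMean ϖ g‖ ^ 2 with hW
  have c3 : 9 * ϖ / 50 * A - C1 * W ≤ ∫ ξ, R.nearDens ϖ g ξ * angWeight ϖ ξ := by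
    have h1 := mul_le_mul_of_nonneg_left c1 (by positivity : 0 ≤ ϖ / 5)
    have h2 : ϖ / 5 * (5 / ϖ * B + Real.exp 1 * (∫ ξ, gauss ϖ ξ)⁻¹ * W) = B + C1 * W := by
      rw [hC1]; field_simp
    rw [h2] at h1
    linarith
  have c4 := mul_le_mul_of_nonneg_left c3 (by positivity : 0 ≤ 2 * Real.pi)
  rw [a1] at c4
  refine le_of_mul_le_mul_left ?_ hM0p
  have e1 : M0 * ((∫ ξ, R.nearDens ϖ g ξ) + 2 * Real.pi * C1 / M0 * W) =
      M0 * (∫ ξ, R.nearDens ϖ g ξ) + 2 * Real.pi * C1 * W := by field_simp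
  rw [e1]
  have e2 : M0 * (9 * ϖ / 100 * ∫ ξ, ‖g ξ‖ ^ 2) = 9 * ϖ / 50 * (M0 / 2 * ∫ ξ, ‖g ξ‖ ^ 2) := by ring
  rw [e2]
  have c5 := mul_le_mul_of_nonneg_left (b2.trans a2.ge) (by positivity : 0 ≤ 9 * ϖ / 50)
  linarith

theorem cutIn_rot (ϖ θ : ℝ) (ξ : Config) : cutIn ϖ (rot θ ξ) = cutIn ϖ ξ := by
  rw [cutIn, cutIn, well_rot]

/-- Up to one even direction, the energy of physical functions is at least `ϖ / 25`. -/
theorem energy_gap : ∃ ϖ₀ : ℝ, ∀ ϖ, ϖ₀ ≤ ϖ → ∃ Ψ : Config → V, IsTestFn Ψ ∧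
    (∀ ξ, R.par (Ψ ξ) = Ψ ξ) ∧ ∃ C : ℝ, 0 ≤ C ∧ ∀ g : Config → V, IsTestFn g →
    (∀ ξ, R.covD g ξ = 0) → ϖ / 25 * ∫ ξ, ‖g ξ‖ ^ 2 ≤
      R.energy (ϖ ^ 2 / 2) g + C * ‖∫ ξ, inner ℂ (Ψ ξ) (g ξ)‖ ^ 2 := by
  obtain ⟨C0, hC0, hb⟩ := exists_deriv_bump_bound
  set C1 := (Real.pi / 2) ^ 2 * C0 with hC1
  have hC1p : 0 ≤ C1 := by positivity
  refine ⟨max 100000 (100 * C1), fun ϖ hϖ => ?_⟩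
  have hϖ5 : 100000 ≤ ϖ := (le_max_left _ _).trans hϖ
  have hϖC : 100 * C1 ≤ ϖ := (le_max_right _ _).trans hϖ
  have hϖ1 : 1 ≤ ϖ := by linarith
  have hϖ0 : 0 < ϖ := by linarith
  obtain ⟨C, hC, hgap⟩ := R.nearDens_gap hϖ5
  have hgs : ContDiff ℝ ∞ fun ξ => gauss ϖ (ξ - basePt ϖ) :=
    (contDiff_gauss ϖ).comp (contDiff_id.sub contDiff_const)
  set a : Config → ℝ := fun ξ => gauss ϖ (ξ - basePt ϖ) * (Real.exp (ϖ / 2 * well ϖ ξ) * cutIn ϖ ξ)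
    with ha
  have hac : ContDiff ℝ ∞ a := hgs.mul ((contDiff_expWell _ ϖ).mul (contDiff_cutIn ϖ))
  have hacs : HasCompactSupport a := by
    refine HasCompactSupport.of_support_subset_isCompact
      (isCompact_closedBall (0 : Config) (ϖ + 2)) fun ξ hξ => ?_
    have h1 : well ϖ ξ ≤ 1 / 100 := by
      by_contra hcon
      exact hξ (by simp [ha, cutIn_eq_zero (not_le.1 hcon).le])
    exact mem_closedBall_zero_iff.2 (tube_norm_le hϖ1 h1)
  refine ⟨fun ξ => a ξ • R.vac, ⟨ContDiff.smul (F := V) (f := a) hac contDiff_const,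
    HasCompactSupport.intro hacs fun ξ hξ => by rw [image_eq_zero_of_notMem_tsupport hξ, zero_smul]⟩,
    fun ξ => ?_, C, hC, fun g hg hp => ?_⟩
  · simp only
    rw [← Complex.coe_smul (E := V), map_smul, R.par_vac]
  have hin := hg.smul (contDiff_cutIn ϖ)
  have hout := hg.smul (contDiff_cutOut ϖ)
  have hloc := R.energy_localization (ϖ ^ 2 / 2) (contDiff_cutIn ϖ) (contDiff_cutOut ϖ)
    (cutOut_sq_add ϖ) hg (C := C1) fun ξ => by
      rw [gradSq_cut]
      exact mul_le_mul_of_nonneg_left (gradSq_bump_le hb hϖ1 ξ) (by positivity)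
  have hfar := R.far_energy hϖ5 hout fun ξ hξ => by
    by_contra hcon
    exact hξ (by rw [cutOut_eq_zero (not_le.1 hcon).le, zero_smul])
  have hsupp : ∀ ξ, cutIn ϖ ξ • g ξ ≠ 0 → well ϖ ξ ≤ 1 / 100 := fun ξ hξ => by
    by_contra hcon
    exact hξ (by rw [cutIn_eq_zero (not_le.1 hcon).le, zero_smul])
  have hnear := R.near_energy hϖ1 hin hsupp
  have hpin : ∀ ξ, R.covD (fun ξ => cutIn ϖ ξ • g ξ) ξ = 0 := fun ξ => by
    rw [R.covD_smul ((contDiff_cutIn ϖ).differentiable (by simp)) hg.differentiable (cutIn_rot ϖ),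
      hp, smul_zero]
  have hg2 := hgap _ hin hpin hsupp
  have hvm : R.vacMean ϖ (fun ξ => cutIn ϖ ξ • g ξ) = ∫ ξ, inner ℂ (a ξ • R.vac) (g ξ) := by
    rw [vacMean]
    refine integral_congr_ae (Filter.Eventually.of_forall fun ξ => ?_)
    simp only [unweight, ha]
    rw [smul_smul, ← Complex.coe_smul (E := V), ← Complex.coe_smul (E := V), inner_smul_right,
      inner_smul_left, Complex.conj_ofReal, Complex.real_smul, ← mul_assoc, ← Complex.ofReal_mul]
  rw [hvm] at hg2
  have hsum : (∫ ξ, ‖cutIn ϖ ξ • g ξ‖ ^ 2) + ∫ ξ, ‖cutOut ϖ ξ • g ξ‖ ^ 2 = ∫ ξ, ‖g ξ‖ ^ 2 := by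
    rw [← integral_add (integrable_normSq hin) (integrable_normSq hout)]
    refine integral_congr_ae (Filter.Eventually.of_forall fun ξ => ?_)
    simp only [normSq_smul, ← add_mul, cutOut_sq_add, one_mul]
  have n1 : 0 ≤ ∫ ξ, ‖cutIn ϖ ξ • g ξ‖ ^ 2 := integral_nonneg fun _ => sq_nonneg _
  have n2 : 0 ≤ ∫ ξ, ‖cutOut ϖ ξ • g ξ‖ ^ 2 := integral_nonneg fun _ => sq_nonneg _
  have hnear' := (abs_le.1 hnear).1
  rw [← hsum] at hloc ⊢
  set A := ∫ ξ, ‖cutIn ϖ ξ • g ξ‖ ^ 2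
  set B := ∫ ξ, ‖cutOut ϖ ξ • g ξ‖ ^ 2
  have k1 : 9 * ϖ / 100 * A - (ϖ / 500 + 5) * A ≥ ϖ / 20 * A := by
    have : 9 * ϖ / 100 - (ϖ / 500 + 5) ≥ ϖ / 20 := by linarith
    nlinarith
  have k2 : ϖ * B ≥ ϖ / 20 * B := by nlinarith
  have k3 : C1 * (A + B) ≤ ϖ / 100 * (A + B) := by
    gcongr
    linarith
  linarith

end FermionRep

end DeformedSQM

namespace DeformedSQM

/-! ### The trial state -/

/-- The complex coordinate `q₂ - i q₁`, which the gauge rotation by `θ` multiplies by `exp (i θ)`. -/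
def zc (ξ : Config) : ℂ := ⟨qc ξ 1, -qc ξ 0⟩

theorem norm_zc (ξ : Config) : ‖zc ξ‖ = rad ξ := by
  rw [Complex.norm_eq_sqrt_sq_add_sq, rad, zc]
  congr 1
  ring

theorem cos_sin_eq_exp (θ : ℝ) :
    (⟨Real.cos θ, Real.sin θ⟩ : ℂ) = Complex.exp (θ * Complex.I) := by
  apply Complex.ext
  · rw [Complex.exp_ofReal_mul_I_re]
  · rw [Complex.exp_ofReal_mul_I_im]

theorem zc_rot (θ : ℝ) (ξ : Config) :
    zc (rot θ ξ) = (⟨Real.cos θ, Real.sin θ⟩ : ℂ) * zc ξ := by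
  rw [zc, rot_qc, zc]
  apply Complex.ext <;> simp <;> ring

theorem zc_add_smul (ξ η : Config) (s : ℝ) : zc (ξ + s • η) = zc ξ + (s : ℂ) * zc η := by
  apply Complex.ext <;> simp [zc, qc] <;> ring

theorem zc_eq (ξ : Config) : zc ξ = (qc ξ 1 : ℂ) - (qc ξ 0 : ℂ) * Complex.I := by
  apply Complex.ext <;> simp [zc]

theorem contDiff_zc {n : WithTop ℕ∞} : ContDiff ℝ n zc := by
  have e : zc = fun ξ => (qc ξ 1 : ℂ) - (qc ξ 0 : ℂ) * Complex.I := funext zc_eq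
  rw [e]
  have h : ∀ j, ContDiff ℝ n fun ξ => (qc ξ j : ℂ) := fun j =>
    Complex.ofRealCLM.contDiff.comp (contDiff_qc j)
  exact (h 1).sub ((h 0).mul contDiff_const)

theorem norm_zc_unitVec_le (i : Idx) : ‖zc (unitVec i)‖ ≤ 1 := by
  rw [norm_zc, rad, Real.sqrt_le_one]
  rcases i with i | i
  · fin_cases i <;> simp [qc, unitVec]
  · simp [qc, unitVec]

theorem rad_unweight_pos {ϖ : ℝ} (hϖ : 1 ≤ ϖ) {ξ : Config} (h : well ϖ ξ ≤ 1 / 100) :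
    1 / 2 ≤ rad ξ := by
  have := (abs_le.1 (tube_rad hϖ h)).1
  linarith

theorem gradSq_bump_smul_le {V : Type*} [NormedAddCommGroup V] [InnerProductSpace ℂ V]
    {c : Config → ℝ} {f : Config → V} {ξ : Config} (hc : DifferentiableAt ℝ c ξ)
    (hf : DifferentiableAt ℝ f ξ) : gradSq (fun ξ => c ξ • f ξ) ξ ≤
      2 * (c ξ ^ 2 * gradSq f ξ) + 2 * (gradSq c ξ * ‖f ξ‖ ^ 2) := by
  simp only [gradSq, pd_smul hc hf, Finset.mul_sum, Finset.sum_mul, ← Finset.sum_add_distrib]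
  refine Finset.sum_le_sum fun i _ => ?_
  have h1 := norm_add_le (c ξ • pd i f ξ) (pd i c ξ • f ξ)
  have h2 : ‖c ξ • pd i f ξ + pd i c ξ • f ξ‖ ^ 2 ≤
      2 * ‖c ξ • pd i f ξ‖ ^ 2 + 2 * ‖pd i c ξ • f ξ‖ ^ 2 := by
    have := sq_nonneg (‖c ξ • pd i f ξ‖ - ‖pd i c ξ • f ξ‖)
    have h3 := pow_le_pow_left₀ (norm_nonneg _) h1 2
    nlinarith
  rw [normSq_smul, normSq_smul] at h2
  rwa [Real.norm_eq_abs, sq_abs]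

theorem integrableOn_exp_well {ϖ : ℝ} (hϖ : 1 ≤ ϖ) :
    IntegrableOn (fun ξ => Real.exp (-(ϖ * well ϖ ξ))) {ξ | well ϖ ξ ≤ 1 / 100} := by
  have hwc : Continuous (well ϖ) := (contDiff_well ϖ (n := 0)).continuous
  have hec : Continuous fun ξ => Real.exp (-(ϖ * well ϖ ξ)) := by fun_prop
  have hsub : {ξ | well ϖ ξ ≤ 1 / 100} ⊆ Metric.closedBall 0 (ϖ + 2) := fun ξ hξ =>
    mem_closedBall_zero_iff.2 (tube_norm_le hϖ hξ)
  exact (hec.continuousOn.integrableOn_compact (isCompact_closedBall _ _)).mono_set hsub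

/-- The Boltzmann weight of the well is concentrated where the inner cutoff is `1`. -/
theorem exists_tube_mass : ∃ ϖ₀ : ℝ, ∀ ϖ, ϖ₀ ≤ ϖ →
    0 < ∫ ξ in {ξ | well ϖ ξ ≤ 1 / 200}, Real.exp (-(ϖ * well ϖ ξ)) ∧
    ∫ ξ in {ξ | well ϖ ξ ≤ 1 / 100}, Real.exp (-(ϖ * well ϖ ξ)) ≤
      2 * ∫ ξ in {ξ | well ϖ ξ ≤ 1 / 200}, Real.exp (-(ϖ * well ϖ ξ)) := by
  have ht := (Real.tendsto_pow_mul_exp_neg_atTop_nhds_zero 9).comp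
    (Filter.tendsto_id.atTop_div_const (by norm_num : (0 : ℝ) < 400))
  have hev := ht.eventually_le_const (u := ((1 / 50) / 800) ^ 9) (by positivity)
  obtain ⟨ϖ₁, h₁⟩ := Filter.eventually_atTop.1 hev
  refine ⟨max ϖ₁ 2, fun ϖ hϖ => ?_⟩
  have hϖ2 : 2 ≤ ϖ := (le_max_right _ _).trans hϖ
  have hϖ1 : 1 ≤ ϖ := by linarith
  have hϖ0 : 0 < ϖ := by linarith
  have hexp := h₁ ϖ ((le_max_left _ _).trans hϖ)
  simp only [Function.comp_apply, id] at hexp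
  have hwc : Continuous (well ϖ) := (contDiff_well ϖ (n := 0)).continuous
  have hec : Continuous fun ξ => Real.exp (-(ϖ * well ϖ ξ)) := by fun_prop
  set v := (volume (Metric.ball (0 : Config) 1)).toReal with hv
  have hfr : Module.finrank ℝ Config = 9 := by simp
  have hvol : ∀ (x : Config) {r : ℝ}, 0 ≤ r → (volume (Metric.closedBall x r)).toReal = r ^ 9 * v := by
    intro x r hr
    rw [Measure.addHaar_closedBall _ _ hr, hfr, ENNReal.toReal_mul,
      ENNReal.toReal_ofReal (by positivity)]
  have hv0 : 0 < v := ENNReal.toReal_pos (Metric.measure_ball_pos _ _ one_pos).ne'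
    measure_ball_lt_top.ne
  set S : ℝ → Set Config := fun r => {ξ | well ϖ ξ ≤ r} with hS
  have hSm : ∀ r, MeasurableSet (S r) := fun r => (isClosed_le hwc continuous_const).measurableSet
  have hSb : S (1 / 100) ⊆ Metric.closedBall 0 (ϖ + 2) := fun ξ hξ => by
    exact mem_closedBall_zero_iff.2 (tube_norm_le hϖ1 hξ)
  have hSb2 : S (1 / 200) ⊆ S (1 / 100) := fun ξ hξ => by
    have h1 : well ϖ ξ ≤ 1 / 200 := hξ
    show well ϖ ξ ≤ 1 / 100
    linarith
  have hB : Metric.closedBall (basePt ϖ) (1 / 50) ⊆ S (1 / 400) := fun ξ hξ => by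
    rw [mem_closedBall_iff_norm] at hξ
    have h1 := normSq_sub_basePt ϖ ξ
    have h2 : ‖ξ - basePt ϖ‖ ^ 2 ≤ (1 / 50) ^ 2 := by gcongr
    have h3 := rad_sq ξ
    have hq1 : qc ξ 1 ≤ rad ξ := by
      refine Real.le_sqrt_of_sq_le ?_
      nlinarith [sq_nonneg (qc ξ 0)]
    have h4 : 0 ≤ 2 * ϖ * (rad ξ - qc ξ 1) := mul_nonneg (by positivity) (by linarith)
    have hx := xsq_nonneg ξ
    set s := qc ξ 2 ^ 2 + qc ξ 3 ^ 2 with hs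
    have hs0 : 0 ≤ s := by positivity
    set d := rad ξ - ϖ with hd
    have hd2 : d ^ 2 ≤ (1 / 50) ^ 2 := by nlinarith [sq_nonneg d]
    have hd1 := abs_le_of_sq_le_sq' hd2 (by norm_num)
    have hs1 : s ≤ (1 / 50) ^ 2 := by nlinarith [sq_nonneg d]
    have hqs : qsq ξ - ϖ ^ 2 = d * (2 * ϖ + d) + s := by
      rw [qsq_eq, hd, hs]; linear_combination -h3
    have h5 : (qsq ξ - ϖ ^ 2) ^ 2 ≤ (ϖ / 20) ^ 2 := by
      rw [hqs]
      refine sq_le_sq' ?_ ?_ <;> nlinarith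
    show well ϖ ξ ≤ 1 / 400
    have h6 : qPot ϖ ξ / ϖ ^ 2 = (1 / 4) * ((qsq ξ - ϖ ^ 2) ^ 2 / ϖ ^ 2) + s := by
      rw [qPot, ← hs]; field_simp
    have h7 : (qsq ξ - ϖ ^ 2) ^ 2 / ϖ ^ 2 ≤ (1 / 20) ^ 2 := by
      rw [div_le_iff₀ (by positivity)]; linarith
    rw [well, h6]
    nlinarith [sq_nonneg d]
  have hfin : volume (S (1 / 100)) < ⊤ := (measure_mono hSb).trans_lt measure_closedBall_lt_top
  have hbd : IntegrableOn (fun ξ => Real.exp (-(ϖ * well ϖ ξ))) (S (1 / 100)) :=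
    integrableOn_exp_well hϖ1
  have hlow : Real.exp (-(ϖ / 400)) * ((1 / 50) ^ 9 * v) ≤
      ∫ ξ in S (1 / 200), Real.exp (-(ϖ * well ϖ ξ)) := by
    have hsub : Metric.closedBall (basePt ϖ) (1 / 50) ⊆ S (1 / 200) := fun ξ hξ => by
      have : well ϖ ξ ≤ 1 / 400 := hB hξ
      show well ϖ ξ ≤ 1 / 200
      linarith
    calc Real.exp (-(ϖ / 400)) * ((1 / 50) ^ 9 * v)
        = ∫ ξ in Metric.closedBall (basePt ϖ) (1 / 50), Real.exp (-(ϖ / 400)) := by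
          rw [setIntegral_const, Measure.real, hvol _ (by norm_num), smul_eq_mul, mul_comm]
      _ ≤ ∫ ξ in Metric.closedBall (basePt ϖ) (1 / 50), Real.exp (-(ϖ * well ϖ ξ)) := by
          refine setIntegral_mono_on (integrableOn_const measure_closedBall_lt_top.ne)
            (hbd.mono_set (hsub.trans hSb2)) measurableSet_closedBall fun ξ hξ => ?_
          have : well ϖ ξ ≤ 1 / 400 := hB hξ
          refine Real.exp_le_exp.2 (neg_le_neg ?_)
          nlinarith
      _ ≤ _ := setIntegral_mono_set (hbd.mono_set hSb2)
          (Filter.Eventually.of_forall fun ξ => (Real.exp_pos _).le) hsub.eventuallyLE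
  refine ⟨lt_of_lt_of_le (by positivity) hlow, ?_⟩
  have hup : ∫ ξ in S (1 / 100) \ S (1 / 200), Real.exp (-(ϖ * well ϖ ξ)) ≤
      Real.exp (-(ϖ / 200)) * ((ϖ + 2) ^ 9 * v) := by
    calc ∫ ξ in S (1 / 100) \ S (1 / 200), Real.exp (-(ϖ * well ϖ ξ))
        ≤ ∫ ξ in S (1 / 100) \ S (1 / 200), Real.exp (-(ϖ / 200)) := by
          refine setIntegral_mono_on (hbd.mono_set Set.sdiff_subset)
            (integrableOn_const ((measure_mono Set.sdiff_subset).trans_lt hfin).ne)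
            ((hSm _).diff (hSm _)) fun ξ hξ => ?_
          have : 1 / 200 < well ϖ ξ := not_le.1 hξ.2
          refine Real.exp_le_exp.2 (neg_le_neg ?_)
          nlinarith
      _ = (volume (S (1 / 100) \ S (1 / 200))).toReal * Real.exp (-(ϖ / 200)) := by
          rw [setIntegral_const, Measure.real, smul_eq_mul]
      _ ≤ (volume (Metric.closedBall (0 : Config) (ϖ + 2))).toReal * Real.exp (-(ϖ / 200)) := by
          gcongr
          · exact measure_closedBall_lt_top.ne
          · exact Set.sdiff_subset.trans hSb
      _ = _ := by rw [hvol _ (by positivity)]; ring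
  have hsplit : ∫ ξ in S (1 / 100), Real.exp (-(ϖ * well ϖ ξ)) =
      (∫ ξ in S (1 / 100) \ S (1 / 200), Real.exp (-(ϖ * well ϖ ξ))) +
        ∫ ξ in S (1 / 200), Real.exp (-(ϖ * well ϖ ξ)) := by
    have := setIntegral_sdiff (hSm (1 / 200)) hbd hSb2
    linarith
  have hcmp : Real.exp (-(ϖ / 200)) * ((ϖ + 2) ^ 9 * v) ≤
      Real.exp (-(ϖ / 400)) * ((1 / 50) ^ 9 * v) := by
    have e1 : Real.exp (-(ϖ / 200)) = Real.exp (-(ϖ / 400)) * Real.exp (-(ϖ / 400)) := by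
      rw [← Real.exp_add]; ring_nf
    have e2 : (ϖ + 2) ^ 9 ≤ (800 * (ϖ / 400)) ^ 9 := by gcongr; linarith
    have e3 : (800 * (ϖ / 400)) ^ 9 * Real.exp (-(ϖ / 400)) ≤ (1 / 50) ^ 9 := by
      calc (800 * (ϖ / 400)) ^ 9 * Real.exp (-(ϖ / 400))
          = 800 ^ 9 * ((ϖ / 400) ^ 9 * Real.exp (-(ϖ / 400))) := by rw [mul_pow]; ring
        _ ≤ 800 ^ 9 * ((1 / 50) / 800) ^ 9 := by gcongr
        _ = (1 / 50) ^ 9 := by rw [← mul_pow]; norm_num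
    calc Real.exp (-(ϖ / 200)) * ((ϖ + 2) ^ 9 * v)
        = Real.exp (-(ϖ / 400)) * (((ϖ + 2) ^ 9 * Real.exp (-(ϖ / 400))) * v) := by rw [e1]; ring
      _ ≤ Real.exp (-(ϖ / 400)) * (((800 * (ϖ / 400)) ^ 9 * Real.exp (-(ϖ / 400))) * v) := by
          gcongr
      _ ≤ _ := by gcongr
  show ∫ ξ in S (1 / 100), _ ≤ 2 * ∫ ξ in S (1 / 200), _
  rw [hsplit]
  linarith

variable {V : Type*} [NormedAddCommGroup V] [InnerProductSpace ℂ V]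

namespace FermionRep

variable [CompleteSpace V] (R : FermionRep V)

theorem hasDerivAt_rotU_const (v : V) (t : ℝ) :
    HasDerivAt (fun t => R.rotU t v) (R.rotX (R.rotU t v)) t := by
  simpa [rotU_zero_right] using R.hasDerivAt_rotU (hasDerivAt_const t v)

theorem rotU_add (α β : ℝ) (v : V) : R.rotU (α + β) v = R.rotU α (R.rotU β v) := by
  set u : ℝ → V := fun t => R.rotU (t + β) v - R.rotU t (R.rotU β v) with hu
  have hd : ∀ t, HasDerivAt u (R.rotX (u t)) t := fun t => by
    have h1 := ((R.hasDerivAt_rotU_const v (t + β)).comp_add_const t β).sub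
      (R.hasDerivAt_rotU_const (R.rotU β v) t)
    rw [← map_sub] at h1
    exact h1
  have hn : ∀ t, HasDerivAt (fun t => inner ℂ (u t) (u t)) 0 t := fun t => by
    refine ((hd t).inner ℂ (hd t)).congr_deriv ?_
    rw [rotX_skew]; simp
  have h0 : u 0 = 0 := by simp [hu, rotU_zero]
  have := is_const_of_deriv_eq_zero (fun t => (hn t).differentiableAt) (fun t => (hn t).deriv) α 0
  rw [h0, inner_zero_left, inner_self_eq_zero] at this
  exact sub_eq_zero.1 this

theorem rotU_angle {s t : ℝ} (h : (s : Real.Angle) = t) (v : V) : R.rotU s v = R.rotU t v := by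
  obtain ⟨k, hk⟩ := Real.Angle.angle_eq_iff_two_pi_dvd_sub.1 h
  have hp : Function.Periodic (fun s => R.rotU s v) (2 * Real.pi) := fun s => by
    simp only
    rw [rotU_add, rotU_two_pi]
  have := hp.int_mul k t
  rw [← this]
  congr 1
  linarith

theorem rotU_par (θ : ℝ) (v : V) : R.par (R.rotU θ v) = R.rotU θ (R.par v) := by
  have hpp : ∀ a b, R.psi a * R.psi b * R.par = R.par * (R.psi a * R.psi b) := fun a b => by
    rw [← mul_assoc, R.par_psi, neg_mul, mul_assoc (R.psi a) R.par, R.par_psi, mul_neg, neg_neg,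
      mul_assoc]
  refine R.rotU_comm (fun i => ?_) θ v
  fin_cases i
  · exact hpp 0 1
  · simpa [plane] using hpp 2 3
  · exact hpp 4 5
  · simpa [plane] using hpp 6 7

/-- The spinor ground state of the coupling to `q₁, q₂`, transported around the circle of minima. -/
def spin (ξ : Config) : V := R.rotU (zc ξ).arg R.vac

theorem norm_spin (ξ : Config) : ‖R.spin ξ‖ = 1 := by rw [spin, norm_rotU, R.norm_vac]

theorem spin_rot (θ : ℝ) {ξ : Config} (h : zc ξ ≠ 0) : R.spin (rot θ ξ) = R.rotU θ (R.spin ξ) := by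
  rw [spin, spin, ← rotU_add]
  refine R.rotU_angle ?_ _
  rw [zc_rot, cos_sin_eq_exp, Complex.arg_mul_coe_angle (Complex.exp_ne_zero _) h, Real.Angle.coe_add,
    Complex.arg_exp_mul_I]
  congr 1
  exact (Real.Angle.coe_toIocMod θ (-Real.pi))

/-- Away from `q₁ = q₂ = 0` the state `spin` is given by a smooth local angle. -/
theorem exists_local_angle {ξ : Config} (h : zc ξ ≠ 0) : ∃ t : Config → ℝ, ContDiffAt ℝ ∞ t ξ ∧
    (R.spin =ᶠ[nhds ξ] fun η => R.rotU (t η) R.vac) ∧ ∀ i, |pd i t ξ| ≤ 1 / rad ξ := by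
  obtain ⟨ε, c, hε, hslit, hang⟩ : ∃ (ε : ℂ) (c : ℝ), ‖ε‖ = 1 ∧ ε * zc ξ ∈ Complex.slitPlane ∧
      ∀ η, zc η ≠ 0 → ((zc η).arg : Real.Angle) = ((ε * zc η).arg + c : ℝ) := by
    rcases Complex.mem_slitPlane_or_neg_mem_slitPlane h with hs | hs
    · exact ⟨1, 0, by simp, by simpa using hs, fun η _ => by simp⟩
    · refine ⟨-1, Real.pi, by simp, by simpa using hs, fun η hη => ?_⟩
      rw [neg_one_mul, Real.Angle.coe_add, Complex.arg_neg_coe_angle hη, add_assoc,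
        Real.Angle.coe_pi_add_coe_pi, add_zero]
  set t : Config → ℝ := fun η => (Complex.log (ε * zc η)).im + c with ht
  have hlog : ContDiffAt ℝ ∞ (fun η => Complex.log (ε * zc η)) ξ :=
    ((Complex.contDiffAt_log hslit (n := ∞)).restrict_scalars ℝ).comp ξ
      (contDiff_const.mul contDiff_zc).contDiffAt
  have htc : ContDiffAt ℝ ∞ t ξ :=
    (Complex.imCLM.contDiff.contDiffAt.comp ξ hlog).add contDiffAt_const
  refine ⟨t, htc, ?_, fun i => ?_⟩
  · have : ∀ᶠ η in nhds ξ, zc η ≠ 0 :=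
      (contDiff_zc (n := 0)).continuous.continuousAt.eventually_ne h
    filter_upwards [this] with η hη
    rw [spin, ht]
    simp only [Complex.log_im]
    exact R.rotU_angle (hang η hη) _
  · have h1 : HasDerivAt (fun s : ℝ => ε * zc (ξ + s • unitVec i)) (ε * zc (unitVec i)) 0 := by
      have e : (fun s : ℝ => ε * zc (ξ + s • unitVec i)) = fun s : ℝ =>
          ε * (zc ξ + (s : ℂ) * zc (unitVec i)) := by
        ext s; rw [zc_add_smul]
      rw [e]
      have := (((Complex.ofRealCLM.hasDerivAt (x := (0 : ℝ))).mul_const (zc (unitVec i))).const_add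
        (zc ξ)).const_mul ε
      simpa using this
    have h2 := h1.clog_real (by simpa using hslit)
    have h3 := (Complex.imCLM.hasFDerivAt.comp_hasDerivAt (0 : ℝ) h2).add_const c
    have h4 := ((htc.differentiableAt (by simp)).hasFDerivAt.hasLineDerivAt (unitVec i))
    have h5 : pd i t ξ = (ε * zc (unitVec i) / (ε * zc (ξ + (0 : ℝ) • unitVec i))).im := by
      rw [pd]
      exact HasDerivAt.unique h4 h3
    rw [h5, zero_smul, add_zero]
    refine (Complex.abs_im_le_norm _).trans ?_
    rw [norm_div, norm_mul, norm_mul, hε, one_mul, one_mul, norm_zc ξ]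
    have := norm_zc_unitVec_le i
    have := rad_nonneg ξ
    gcongr

theorem contDiffAt_spin {ξ : Config} (h : zc ξ ≠ 0) : ContDiffAt ℝ ∞ R.spin ξ := by
  obtain ⟨t, htc, he, -⟩ := R.exists_local_angle h
  have hU : ContDiff ℝ ∞ fun s => R.rotU s R.vac := R.contDiff_rotU contDiff_id contDiff_const
  exact (hU.contDiffAt.comp ξ htc).congr_of_eventuallyEq he

theorem gradSq_spin_le {ξ : Config} (h : zc ξ ≠ 0) :
    gradSq R.spin ξ ≤ 9 * (1 / rad ξ * ‖R.rotX‖) ^ 2 := by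
  obtain ⟨t, htc, he, hb⟩ := R.exists_local_angle h
  have hpd : ∀ i, pd i R.spin ξ = pd i t ξ • R.rotX (R.rotU (t ξ) R.vac) := fun i => by
    have h1 := (R.hasDerivAt_rotU_const R.vac (t ξ)).hasFDerivAt.comp ξ
      (htc.differentiableAt (by simp)).hasFDerivAt
    rw [pd, he.fderiv_eq, show (fun η => R.rotU (t η) R.vac) = (fun s => R.rotU s R.vac) ∘ t from rfl,
      h1.fderiv]
    rfl
  have h2 : ∀ i, ‖pd i R.spin ξ‖ ^ 2 ≤ (1 / rad ξ * ‖R.rotX‖) ^ 2 := fun i => by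
    have h3 : ‖R.rotX (R.rotU (t ξ) R.vac)‖ ≤ ‖R.rotX‖ := by
      have := R.rotX.le_opNorm (R.rotU (t ξ) R.vac)
      rwa [norm_rotU, R.norm_vac, mul_one] at this
    rw [hpd, normSq_smul, mul_pow, ← sq_abs (pd i t ξ)]
    gcongr
    exact hb i
  calc gradSq R.spin ξ ≤ ∑ _i : Idx, (1 / rad ξ * ‖R.rotX‖) ^ 2 := Finset.sum_le_sum fun i _ => h2 i
    _ = _ := by simp

theorem vacExp_spin (ξ : Config) (c : ℝ) :
    R.vacExp ξ (c • R.spin ξ) + 8 * rad ξ * ‖c • R.spin ξ‖ ^ 2 = 0 := by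
  set s := (zc ξ).arg with hs
  set η := rot (-s) ξ with hη
  have h1 : rot s η = ξ := by rw [hη, rot_rot, add_neg_cancel, rot_zero]
  have h2 : c • R.spin ξ = R.rotU s (c • R.vac) := by rw [rotU_smul, spin]
  have hz : zc η = (rad ξ : ℂ) := by
    rw [hη, zc_rot, ← norm_zc]
    conv_lhs => rw [cos_sin_eq_exp, ← Complex.norm_mul_exp_arg_mul_I (zc ξ), ← hs]
    rw [mul_comm, mul_assoc, ← Complex.exp_add]
    simp
  have hq1 : qc η 1 = rad ξ := by simpa [zc] using congrArg Complex.re hz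
  have hq0 : qc η 0 = 0 := by simpa [zc] using congrArg Complex.im hz
  have h3 : R.vacExp ξ (c • R.spin ξ) = R.vacExp η (c • R.vac) := by
    rw [h2]; conv_lhs => rw [← h1]
    rw [vacExp_rot]
  have h4 : R.vacExp η (c • R.vac) = -(8 * rad ξ * c ^ 2) := by
    have h5 : R.hVac η (c • R.vac) = (-(8 * rad ξ)) • (c • R.vac) := by
      rw [hVac, hq0, hq1, yukQ_one]
      simp only [← Complex.coe_smul (E := V), map_smul]
      rw [← Finset.smul_sum, smul_comm (-(2 * Complex.I)), R.num_vac, smul_smul, smul_smul, smul_smul]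
      congr 1
      push_cast; ring
    have h6 := inner_smul_smul_re 1 (-(8 * rad ξ)) (c • R.vac) (c • R.vac)
    have h7 : (inner ℂ (c • R.vac) (c • R.vac)).re = ‖c • R.vac‖ ^ 2 := by
      simpa using inner_self_eq_norm_sq (𝕜 := ℂ) (c • R.vac)
    rw [one_smul, h7, normSq_smul, R.norm_vac] at h6
    rw [vacExp, h5, h6]; ring
  rw [h3, h4, normSq_smul, norm_spin]; ring

/-- The unweighted trial state. -/
def trialCore (ϖ : ℝ) (ξ : Config) : V := bump (well ϖ ξ) • R.spin ξ

/-- The trial state. -/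
def trial (ϖ : ℝ) (ξ : Config) : V := Real.exp (-(ϖ / 2) * well ϖ ξ) • R.trialCore ϖ ξ

omit [CompleteSpace V] in
theorem zc_ne_zero {ϖ : ℝ} (hϖ : 1 ≤ ϖ) {ξ : Config} (h : well ϖ ξ ≤ 1 / 100) : zc ξ ≠ 0 := by
  have := rad_unweight_pos hϖ h
  rw [← norm_zc] at this
  intro h0
  rw [h0, norm_zero] at this
  linarith

theorem isTestFn_trialCore {ϖ : ℝ} (hϖ : 1 ≤ ϖ) : IsTestFn (R.trialCore ϖ) := by
  have hwc : Continuous (well ϖ) := (contDiff_well ϖ (n := 0)).continuous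
  refine ⟨contDiff_iff_contDiffAt.2 fun ξ => ?_, ?_⟩
  · by_cases h : zc ξ = 0
    · have h1 : 1 / 100 < well ϖ ξ := by
        by_contra hcon
        exact zc_ne_zero hϖ (not_lt.1 hcon) h
      have h2 : R.trialCore ϖ =ᶠ[nhds ξ] fun _ => 0 := by
        filter_upwards [hwc.continuousAt.eventually_const_lt h1] with η hη
        rw [trialCore, bump_eq_zero hη.le, zero_smul]
      exact contDiffAt_const.congr_of_eventuallyEq h2
    · exact ContDiffAt.smul (F := V) (f := fun ξ => bump (well ϖ ξ))
        (contDiff_bump.comp (contDiff_well ϖ)).contDiffAt (R.contDiffAt_spin h)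
  · refine HasCompactSupport.intro (isCompact_closedBall (0 : Config) (ϖ + 2)) fun ξ hξ => ?_
    have : 1 / 100 ≤ well ϖ ξ := by
      by_contra hcon
      refine hξ ?_
      exact mem_closedBall_zero_iff.2 (tube_norm_le hϖ (not_le.1 hcon).le)
    rw [trialCore, bump_eq_zero this, zero_smul]

theorem isTestFn_trial {ϖ : ℝ} (hϖ : 1 ≤ ϖ) : IsTestFn (R.trial ϖ) :=
  (R.isTestFn_trialCore hϖ).smul (contDiff_expWell _ ϖ)

theorem par_trial (ϖ : ℝ) (ξ : Config) : R.par (R.trial ϖ ξ) = R.trial ϖ ξ := by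
  simp only [trial, trialCore, ← Complex.coe_smul (E := V), map_smul]
  rw [spin, rotU_par, R.par_vac]

theorem covD_trial {ϖ : ℝ} (hϖ : 1 ≤ ϖ) (ξ : Config) : R.covD (R.trial ϖ) ξ = 0 := by
  have h1 : ∀ θ ξ, R.trial ϖ (rot θ ξ) = R.rotU θ (R.trial ϖ ξ) := fun θ ξ => by
    rw [trial, trial, trialCore, trialCore, well_rot, rotU_smul, rotU_smul]
    by_cases h : zc ξ = 0
    · have h1 : 1 / 100 < well ϖ ξ := by
        by_contra hcon
        exact zc_ne_zero hϖ (not_lt.1 hcon) h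
      simp [bump_eq_zero h1.le]
    · rw [R.spin_rot θ h]
  have h2 : (fun θ => R.transform (R.trial ϖ) (θ, ξ)) = fun _ => R.trial ϖ ξ := by
    ext θ
    rw [transform, h1, ← rotU_add, add_neg_cancel, rotU_zero]
  have h3 := R.hasDerivAt_transform (R.isTestFn_trial hϖ).differentiable ξ 0
  rw [h2] at h3
  have h4 := h3.unique (hasDerivAt_const 0 _)
  rwa [rotU_zero, neg_zero, rot_zero, neg_eq_zero] at h4

theorem unweight_trial (ϖ : ℝ) : unweight ϖ (R.trial ϖ) = R.trialCore ϖ := by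
  ext1 ξ
  rw [unweight, trial, smul_smul, ← Real.exp_add]
  rw [show ϖ / 2 * well ϖ ξ + -(ϖ / 2) * well ϖ ξ = 0 by ring, Real.exp_zero, one_smul]

/-- The trial state has small energy. -/
theorem energy_trial : ∃ ϖ₀ C : ℝ, ∀ ϖ, ϖ₀ ≤ ϖ → 0 < ∫ ξ, ‖R.trial ϖ ξ‖ ^ 2 ∧
    R.energy (ϖ ^ 2 / 2) (R.trial ϖ) ≤ (ϖ / 500 + C) * ∫ ξ, ‖R.trial ϖ ξ‖ ^ 2 := by
  obtain ⟨C0, hC0, hb⟩ := exists_deriv_bump_bound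
  obtain ⟨ϖ₁, hmass⟩ := exists_tube_mass
  set C2 := 2 * (9 * (2 * ‖R.rotX‖) ^ 2) + 2 * C0 with hC2
  have hC2p : 0 ≤ C2 := by positivity
  refine ⟨max ϖ₁ 1, 2 * C2 + 5, fun ϖ hϖ => ?_⟩
  have hϖ1 : 1 ≤ ϖ := (le_max_right _ _).trans hϖ
  have hϖ0 : 0 < ϖ := by linarith
  obtain ⟨hm0, hm⟩ := hmass ϖ ((le_max_left _ _).trans hϖ)
  have htest := R.isTestFn_trial hϖ1
  have hcore := R.isTestFn_trialCore hϖ1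
  have hwc : Continuous (well ϖ) := (contDiff_well ϖ (n := 0)).continuous
  have hSm : ∀ r, MeasurableSet {ξ | well ϖ ξ ≤ r} := fun r =>
    (isClosed_le hwc continuous_const).measurableSet
  have hn : ∀ ξ, ‖R.trial ϖ ξ‖ ^ 2 = Real.exp (-(ϖ * well ϖ ξ)) * bump (well ϖ ξ) ^ 2 := fun ξ => by
    rw [trial, trialCore, normSq_smul, normSq_smul, norm_spin, ← Real.exp_nat_mul]
    rw [one_pow, mul_one]
    congr 2
    push_cast; ring
  have hi := integrable_normSq htest
  have hlow : ∫ ξ in {ξ | well ϖ ξ ≤ 1 / 200}, Real.exp (-(ϖ * well ϖ ξ)) ≤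
      ∫ ξ, ‖R.trial ϖ ξ‖ ^ 2 := by
    have e : ∫ ξ in {ξ | well ϖ ξ ≤ 1 / 200}, Real.exp (-(ϖ * well ϖ ξ)) =
        ∫ ξ in {ξ | well ϖ ξ ≤ 1 / 200}, ‖R.trial ϖ ξ‖ ^ 2 := by
      refine setIntegral_congr_fun (hSm _) fun ξ hξ => ?_
      rw [hn, bump_eq_one hξ]; ring
    rw [e]
    exact setIntegral_le_integral hi (Filter.Eventually.of_forall fun ξ => sq_nonneg _)
  refine ⟨lt_of_lt_of_le hm0 hlow, ?_⟩
  have hsupp : ∀ ξ, R.trial ϖ ξ ≠ 0 → well ϖ ξ ≤ 1 / 100 := fun ξ hξ => by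
    by_contra hcon
    exact hξ (by rw [trial, trialCore, bump_eq_zero (not_le.1 hcon).le, zero_smul, smul_zero])
  have hnear := (abs_le.1 (R.near_energy hϖ1 htest hsupp)).2
  have hgrad : ∀ ξ, well ϖ ξ ≤ 1 / 100 → gradSq (R.trialCore ϖ) ξ ≤ C2 := fun ξ hξ => by
    have hz := zc_ne_zero hϖ1 hξ
    have hr := rad_unweight_pos hϖ1 hξ
    have hr0 : 0 < rad ξ := by linarith
    have hbd : DifferentiableAt ℝ (fun ξ => bump (well ϖ ξ)) ξ :=
      (contDiff_bump.comp (contDiff_well ϖ)).differentiable (by simp) ξ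
    have h1 := gradSq_bump_smul_le hbd ((R.contDiffAt_spin hz).differentiableAt (by simp))
    refine h1.trans ?_
    rw [norm_spin, one_pow, mul_one, hC2]
    have h2 : gradSq R.spin ξ ≤ 9 * (2 * ‖R.rotX‖) ^ 2 := by
      refine (R.gradSq_spin_le hz).trans ?_
      have : 1 / rad ξ ≤ 2 := by rw [div_le_iff₀ hr0]; linarith
      gcongr
    have h3 := gradSq_bump_le hb hϖ1 ξ
    have h4 : bump (well ϖ ξ) ^ 2 ≤ 1 := pow_le_one₀ (bump_nonneg _) (bump_le_one _)
    have h5 := gradSq_nonneg R.spin ξ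
    have h6 : bump (well ϖ ξ) ^ 2 * gradSq R.spin ξ ≤ 1 * (9 * (2 * ‖R.rotX‖) ^ 2) := by gcongr
    linarith
  have hdens : ∀ ξ, R.nearDens ϖ (R.trial ϖ) ξ ≤
      Set.indicator {ξ | well ϖ ξ ≤ 1 / 100} (fun ξ => C2 * Real.exp (-(ϖ * well ϖ ξ))) ξ := fun ξ => by
    have hK : ∑ i, ‖pd i (R.trial ϖ) ξ + dWell ϖ ξ i • R.trial ϖ ξ‖ ^ 2 =
        Real.exp (-(ϖ * well ϖ ξ)) * gradSq (R.trialCore ϖ) ξ := by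
      rw [← unweight_trial, gradSq_unweight hϖ0 htest.differentiable, ← mul_assoc, ← Real.exp_add,
        neg_add_cancel, Real.exp_zero, one_mul]
    by_cases h : well ϖ ξ ≤ 1 / 100
    · rw [Set.indicator_of_mem (by exact h), nearDens, hK]
      have hW := R.vacExp_spin ξ (Real.exp (-(ϖ / 2) * well ϖ ξ) * bump (well ϖ ξ))
      rw [mul_smul] at hW
      have e : R.trial ϖ ξ = Real.exp (-(ϖ / 2) * well ϖ ξ) • bump (well ϖ ξ) • R.spin ξ := rfl
      rw [e, hW, add_zero, mul_comm]
      gcongr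
      exact hgrad ξ h
    · have hts : ξ ∉ tsupport (R.trial ϖ) := fun hm => h (well_le_of_mem_tsupport hsupp hm)
      rw [Set.indicator_of_notMem (by exact h)]
      simp [nearDens, vacExp, pd_eq_zero hts, image_eq_zero_of_notMem_tsupport hts]
  have hint : IntegrableOn (fun ξ => Real.exp (-(ϖ * well ϖ ξ))) {ξ | well ϖ ξ ≤ 1 / 100} :=
    integrableOn_exp_well hϖ1
  have hup : ∫ ξ, R.nearDens ϖ (R.trial ϖ) ξ ≤
      C2 * ∫ ξ in {ξ | well ϖ ξ ≤ 1 / 100}, Real.exp (-(ϖ * well ϖ ξ)) := by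
    rw [← integral_const_mul, ← integral_indicator (hSm _)]
    exact integral_mono (R.integrable_nearDens ϖ htest)
      (IntegrableOn.integrable_indicator (hint.const_mul C2) (hSm _)) hdens
  have h1 := mul_le_mul_of_nonneg_left (hm.trans (mul_le_mul_of_nonneg_left hlow zero_le_two)) hC2p
  linarith

end FermionRep

end DeformedSQM

namespace DeformedSQM

/-! ### A zero mode from the trial state -/

variable {V : Type*} [NormedAddCommGroup V] [InnerProductSpace ℂ V]

/-- A test function as an element of `L²`. -/
def IsTestFn.toL2 {f : Config → V} (h : IsTestFn f) : Lp V 2 (volume : Measure Config) :=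
  h.memLp.toLp f

theorem IsTestFn.inner_toL2 {f : Config → V} (h : IsTestFn f)
    (Ψ : Lp V 2 (volume : Measure Config)) :
    inner ℂ h.toL2 Ψ = ∫ ξ, inner ℂ (f ξ) (Ψ ξ) := by
  rw [L2.inner_def]
  refine integral_congr_ae ?_
  filter_upwards [h.memLp.coeFn_toLp] with ξ hξ
  rw [IsTestFn.toL2, hξ]

theorem IsTestFn.inner_toL2_toL2 {f g : Config → V} (hf : IsTestFn f) (hg : IsTestFn g) :
    inner ℂ hf.toL2 hg.toL2 = ∫ ξ, inner ℂ (f ξ) (g ξ) := by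
  rw [hf.inner_toL2]
  refine integral_congr_ae ?_
  filter_upwards [hg.memLp.coeFn_toLp] with ξ hξ
  rw [IsTestFn.toL2, hξ]

theorem IsTestFn.norm_toL2_sq {f : Config → V} (hf : IsTestFn f) :
    ‖hf.toL2‖ ^ 2 = ∫ ξ, ‖f ξ‖ ^ 2 := by
  have h := inner_self_eq_norm_sq_to_K (𝕜 := ℂ) hf.toL2
  rw [hf.inner_toL2_toL2] at h
  have h2 : ∫ ξ, inner ℂ (f ξ) (f ξ) = ((∫ ξ, ‖f ξ‖ ^ 2 : ℝ) : ℂ) := by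
    rw [← integral_complex_ofReal]
    refine integral_congr_ae (.of_forall fun ξ => ?_)
    simp
  rw [h2] at h
  exact (Complex.ofReal_injective (h.trans (Complex.ofReal_pow _ _).symm)).symm

theorem IsTestFn.integrable_inner {f : Config → V} (hf : IsTestFn f)
    (Ψ : Lp V 2 (volume : Measure Config)) : Integrable fun ξ => inner ℂ (f ξ) (Ψ ξ) := by
  refine (L2.integrable_inner (𝕜 := ℂ) hf.toL2 Ψ).congr ?_
  filter_upwards [hf.memLp.coeFn_toLp] with ξ hξ
  rw [IsTestFn.toL2, hξ]

theorem IsTestFn.toL2_add {f g : Config → V} (hf : IsTestFn f) (hg : IsTestFn g) :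
    (hf.add hg).toL2 = hf.toL2 + hg.toL2 :=
  MemLp.toLp_add hf.memLp hg.memLp

theorem IsTestFn.toL2_const_smul {f : Config → V} (hf : IsTestFn f) (c : ℂ) :
    (hf.const_smul c).toL2 = c • hf.toL2 :=
  MemLp.toLp_const_smul c hf.memLp

theorem IsTestFn.toL2_congr {f g : Config → V} (hf : IsTestFn f) (hg : IsTestFn g)
    (h : ∀ ξ, f ξ = g ξ) : hf.toL2 = hg.toL2 := by
  obtain rfl : f = g := funext h
  rfl

namespace FermionRep

variable [CompleteSpace V] (R : FermionRep V)

theorem dirac_add (k : ℝ) {f g : Config → V} (hf : Differentiable ℝ f) (hg : Differentiable ℝ g)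
    (ξ : Config) : R.dirac k (fun ξ => f ξ + g ξ) ξ = R.dirac k f ξ + R.dirac k g ξ := by
  have h : ∀ i, pd i (fun ξ => f ξ + g ξ) ξ = pd i f ξ + pd i g ξ := fun i =>
    congrFun (pd_add hf hg i) ξ
  simp only [dirac, h, map_add, smul_add, Finset.sum_add_distrib]
  abel

theorem dirac_const_smul (k : ℝ) (c : ℂ) {f : Config → V} (hf : Differentiable ℝ f)
    (ξ : Config) : R.dirac k (fun ξ => c • f ξ) ξ = c • R.dirac k f ξ := by
  have h : ∀ i, pd i (fun ξ => c • f ξ) ξ = c • pd i f ξ := fun i =>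
    pd_clm_complex (c • (1 : V →L[ℂ] V)) hf i |> fun h => by simpa using congrFun h ξ
  simp only [dirac, h, map_smul, Finset.smul_sum, smul_add, smul_smul, mul_comm c]

theorem covD_add {f g : Config → V} (hf : Differentiable ℝ f) (hg : Differentiable ℝ g)
    (ξ : Config) : R.covD (fun ξ => f ξ + g ξ) ξ = R.covD f ξ + R.covD g ξ := by
  rw [covD, rotT_add (hf ξ) (hg ξ), map_add, covD, covD]
  abel

theorem covD_const_smul (c : ℂ) {f : Config → V} (hf : Differentiable ℝ f) (ξ : Config) :
    R.covD (fun ξ => c • f ξ) ξ = c • R.covD f ξ := by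
  have h := rotT_clm_complex (c • (1 : V →L[ℂ] V)) hf ξ
  simp only [smul_apply, one_apply_eq_self] at h
  rw [covD, h, map_smul, covD, smul_sub]

/-- The range of the supercharge on the odd gauge-invariant test functions. -/
def oddRange (k : ℝ) : Submodule ℂ (Lp V 2 (volume : Measure Config)) where
  carrier := {Φ | ∃ (g : Config → V) (hg : IsTestFn g), (∀ ξ, R.covD g ξ = 0) ∧
    (∀ ξ, R.par (g ξ) = -g ξ) ∧ Φ = (R.isTestFn_dirac k hg).toL2}
  add_mem' := by
    rintro _ _ ⟨f, hf, hf1, hf2, rfl⟩ ⟨g, hg, hg1, hg2, rfl⟩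
    refine ⟨_, hf.add hg, fun ξ => ?_, fun ξ => ?_, ?_⟩
    · rw [R.covD_add hf.differentiable hg.differentiable, hf1, hg1, add_zero]
    · rw [map_add, hf2, hg2, neg_add]
    · rw [← IsTestFn.toL2_add]
      exact IsTestFn.toL2_congr _ _ fun ξ =>
        (R.dirac_add k hf.differentiable hg.differentiable ξ).symm
  zero_mem' := by
    refine ⟨fun _ => 0, isTestFn_zero, fun ξ => ?_, fun ξ => by simp, ?_⟩
    · simpa using R.covD_const_smul 0 (isTestFn_zero (V := V)).differentiable ξ
    · have h : (isTestFn_zero (V := V)).toL2 = 0 := MemLp.toLp_zero _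
      rw [← h]
      refine IsTestFn.toL2_congr _ _ fun ξ => ?_
      simpa using (R.dirac_const_smul k 0 (isTestFn_zero (V := V)).differentiable ξ).symm
  smul_mem' := by
    rintro c _ ⟨f, hf, hf1, hf2, rfl⟩
    refine ⟨_, hf.const_smul c, fun ξ => ?_, fun ξ => ?_, ?_⟩
    · rw [R.covD_const_smul c hf.differentiable, hf1, smul_zero]
    · rw [map_smul, hf2, smul_neg]
    · rw [← IsTestFn.toL2_const_smul]
      exact IsTestFn.toL2_congr _ _ fun ξ => (R.dirac_const_smul k c hf.differentiable ξ).symm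

theorem inner_par (v w : V) : inner ℂ (R.par v) w = inner ℂ v (R.par w) :=
  ContinuousLinearMap.isSelfAdjoint_iff_isSymmetric.1 R.par_sa v w

theorem inner_odd_even {v w : V} (hv : R.par v = -v) (hw : R.par w = w) : inner ℂ v w = 0 := by
  have h := R.inner_par v w
  rw [hv, hw, inner_neg_left] at h
  linear_combination (-1 / 2) * h

/-- The states that satisfy the gauge constraint weakly and are orthogonal to the odd test
functions. -/
def evenPhysical : Submodule ℂ (Lp V 2 (volume : Measure Config)) :=
  (Submodule.span ℂ {Φ | (∃ (τ : Config → V) (hτ : IsTestFn τ), Φ = (R.isTestFn_covD hτ).toL2) ∨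
    ∃ (η : Config → V) (hη : IsTestFn η), (∀ ξ, R.par (η ξ) = -η ξ) ∧ Φ = hη.toL2})ᗮ

theorem mem_evenPhysical {Ψ : Lp V 2 (volume : Measure Config)} : Ψ ∈ R.evenPhysical ↔
    (∀ τ : Config → V, IsTestFn τ → ∫ ξ, inner ℂ (R.covD τ ξ) (Ψ ξ) = 0) ∧
    ∀ η : Config → V, IsTestFn η → (∀ ξ, R.par (η ξ) = -η ξ) →
      ∫ ξ, inner ℂ (η ξ) (Ψ ξ) = 0 := by
  rw [evenPhysical, Submodule.mem_orthogonal]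
  constructor
  · intro h
    refine ⟨fun τ hτ => ?_, fun η hη h1 => ?_⟩
    · rw [← IsTestFn.inner_toL2 (R.isTestFn_covD hτ)]
      exact h _ (Submodule.subset_span (Or.inl ⟨τ, hτ, rfl⟩))
    · rw [← hη.inner_toL2]
      exact h _ (Submodule.subset_span (Or.inr ⟨η, hη, h1, rfl⟩))
  · rintro ⟨h1, h2⟩ u hu
    induction hu using Submodule.span_induction with
    | mem x hx =>
      rcases hx with ⟨τ, hτ, rfl⟩ | ⟨η, hη, h, rfl⟩
      · rw [IsTestFn.inner_toL2]; exact h1 τ hτ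
      · rw [IsTestFn.inner_toL2]; exact h2 η hη h
    | zero => simp
    | add x y _ _ hx hy => rw [inner_add_left, hx, hy, add_zero]
    | smul c x _ hx => rw [inner_smul_left, hx, mul_zero]

theorem toL2_mem_evenPhysical {g : Config → V} (hg : IsTestFn g) (h1 : ∀ ξ, R.covD g ξ = 0)
    (h2 : ∀ ξ, R.par (g ξ) = g ξ) : hg.toL2 ∈ R.evenPhysical := by
  rw [mem_evenPhysical]
  refine ⟨fun τ hτ => ?_, fun η hη h => ?_⟩
  · rw [← IsTestFn.inner_toL2 (R.isTestFn_covD hτ), IsTestFn.inner_toL2_toL2,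
      R.integral_inner_covD hτ hg]
    simp [h1]
  · rw [← hη.inner_toL2, IsTestFn.inner_toL2_toL2]
    simp [R.inner_odd_even (h _) (h2 _)]

theorem covD_dirac_eq_zero (k : ℝ) {g : Config → V} (hg : IsTestFn g) (h : ∀ ξ, R.covD g ξ = 0)
    (ξ : Config) : R.covD (R.dirac k g) ξ = 0 := by
  rw [R.covD_dirac k hg, show R.covD g = fun _ => (0 : ℂ) • (0 : V) from funext fun ξ => by simp [h],
    R.dirac_const_smul k 0 (isTestFn_zero (V := V)).differentiable, zero_smul]

theorem par_dirac_of_odd (k : ℝ) {g : Config → V} (hg : IsTestFn g)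
    (h : ∀ ξ, R.par (g ξ) = -g ξ) (ξ : Config) : R.par (R.dirac k g ξ) = R.dirac k g ξ := by
  have e : (fun ξ => R.par (g ξ)) = fun ξ => (-1 : ℂ) • g ξ := funext fun ξ => by simp [h]
  rw [R.par_dirac k hg.differentiable, e, R.dirac_const_smul k _ hg.differentiable]
  simp

theorem par_dirac_of_even (k : ℝ) {g : Config → V} (hg : IsTestFn g)
    (h : ∀ ξ, R.par (g ξ) = g ξ) (ξ : Config) : R.par (R.dirac k g ξ) = -R.dirac k g ξ := by
  rw [R.par_dirac k hg.differentiable, show (fun ξ => R.par (g ξ)) = g from funext h]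

theorem oddRange_le (k : ℝ) : R.oddRange k ≤ R.evenPhysical := by
  rintro _ ⟨g, hg, h1, h2, rfl⟩
  exact R.toL2_mem_evenPhysical _ (R.covD_dirac_eq_zero k hg h1) (R.par_dirac_of_odd k hg h2)

theorem hD_eq_dirac (k : ℝ) {φ : Config → V} (hφ : IsTestFn φ) (ξ : Config) :
    R.hD k φ ξ = (2 : ℂ) • R.dirac k (R.dirac k φ) ξ
      + (2 * Complex.I) • (xc ξ 0 • R.covD φ ξ) := by
  rw [R.two_smul_dirac_dirac k hφ, gauge_eq, ← Complex.coe_smul (E := V), smul_smul, smul_smul,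
    add_assoc, ← add_smul]
  push_cast
  rw [show 2 * (xc ξ 0 : ℂ) * -Complex.I + 2 * Complex.I * (xc ξ 0 : ℂ) = 0 by ring, zero_smul,
    add_zero]

/-- On even states that satisfy the gauge constraint, `H_k` vanishes weakly as soon as the state
is orthogonal to the range of the supercharge on odd states. -/
theorem integral_inner_hD_eq_zero (k : ℝ) {Ψ : Lp V 2 (volume : Measure Config)}
    (h : Ψ ∈ R.evenPhysical) (h' : Ψ ∈ (R.oddRange k)ᗮ) {φ : Config → V} (hφ : IsTestFn φ) :
    ∫ ξ, inner ℂ (R.hD k φ ξ) (Ψ ξ) = 0 := by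
  obtain ⟨hcov, hodd⟩ := R.mem_evenPhysical.1 h
  have hrange : ∀ g : Config → V, IsTestFn g → (∀ ξ, R.covD g ξ = 0) →
      (∀ ξ, R.par (g ξ) = -g ξ) → ∫ ξ, inner ℂ (R.dirac k g ξ) (Ψ ξ) = 0 := fun g hg h1 h2 => by
    rw [← IsTestFn.inner_toL2 (R.isTestFn_dirac k hg)]
    exact (Submodule.mem_orthogonal _ _).1 h' _ ⟨g, hg, h1, h2, rfl⟩
  have hadd : ∀ f g : Config → V, IsTestFn f → IsTestFn g → ∫ ξ, inner ℂ (f ξ + g ξ) (Ψ ξ)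
      = (∫ ξ, inner ℂ (f ξ) (Ψ ξ)) + ∫ ξ, inner ℂ (g ξ) (Ψ ξ) := fun f g hf hg => by
    simp only [inner_add_left]
    exact integral_add (hf.integrable_inner Ψ) (hg.integrable_inner Ψ)
  have hD2 : ∀ f : Config → V, IsTestFn f → IsTestFn (R.dirac k (R.dirac k f)) :=
    fun f hf => R.isTestFn_dirac k (R.isTestFn_dirac k hf)
  have hsq : ∀ f g : Config → V, IsTestFn f → IsTestFn g → ∀ ξ,
      R.dirac k (R.dirac k fun ξ => f ξ + g ξ) ξ = R.dirac k (R.dirac k f) ξ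
        + R.dirac k (R.dirac k g) ξ := fun f g hf hg ξ => by
    rw [show (R.dirac k fun ξ => f ξ + g ξ) = fun ξ => R.dirac k f ξ + R.dirac k g ξ from
      funext (R.dirac_add k hf.differentiable hg.differentiable)]
    exact R.dirac_add k (R.isTestFn_dirac k hf).differentiable
      (R.isTestFn_dirac k hg).differentiable ξ
  -- the square of the supercharge kills the even, the odd and the pure gauge part separately
  have hphys : ∀ p : Config → V, IsTestFn p → (∀ ξ, R.covD p ξ = 0) →
      ∫ ξ, inner ℂ (R.dirac k (R.dirac k p) ξ) (Ψ ξ) = 0 := by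
    intro p hp h0
    have hpp : IsTestFn fun ξ => R.par (p ξ) := hp.clm _
    have hpar2 : ∀ v, R.par (R.par v) = v := fun v =>
      congrArg (fun A : V →L[ℂ] V => A v) R.par_sq
    have hcp : ∀ ξ, R.covD (fun ξ => R.par (p ξ)) ξ = 0 := fun ξ => by
      rw [R.covD_par hp.differentiable, h0, map_zero]
    have he : IsTestFn fun ξ => p ξ + R.par (p ξ) := hp.add hpp
    have ho : IsTestFn fun ξ => p ξ + (-1 : ℂ) • R.par (p ξ) := hp.add (hpp.const_smul _)
    have he0 : ∀ ξ, R.par (p ξ + R.par (p ξ)) = p ξ + R.par (p ξ) := fun ξ => by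
      rw [map_add, hpar2, add_comm]
    have ho0 : ∀ ξ, R.par (p ξ + (-1 : ℂ) • R.par (p ξ)) = -(p ξ + (-1 : ℂ) • R.par (p ξ)) :=
      fun ξ => by rw [map_add, map_smul, hpar2]; simp
    have he1 : ∀ ξ, R.covD (fun ξ => p ξ + R.par (p ξ)) ξ = 0 := fun ξ => by
      rw [R.covD_add hp.differentiable hpp.differentiable, h0, hcp, add_zero]
    have e1 : ∫ ξ, inner ℂ (R.dirac k (R.dirac k fun ξ => p ξ + R.par (p ξ)) ξ) (Ψ ξ) = 0 :=
      hrange _ (R.isTestFn_dirac k he) (R.covD_dirac_eq_zero k he he1)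
        (R.par_dirac_of_even k he he0)
    have e2 : ∫ ξ, inner ℂ (R.dirac k (R.dirac k fun ξ => p ξ + (-1 : ℂ) • R.par (p ξ)) ξ) (Ψ ξ)
        = 0 := by
      refine hodd _ (hD2 _ ho) fun ξ => ?_
      exact R.par_dirac_of_even k (R.isTestFn_dirac k ho) (R.par_dirac_of_odd k ho ho0) ξ
    have e3 : ∀ ξ, R.dirac k (R.dirac k p) ξ + R.dirac k (R.dirac k p) ξ
        = R.dirac k (R.dirac k fun ξ => p ξ + R.par (p ξ)) ξ
        + R.dirac k (R.dirac k fun ξ => p ξ + (-1 : ℂ) • R.par (p ξ)) ξ := fun ξ => by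
      rw [← hsq p p hp hp, ← hsq _ _ he ho]
      congr 2
      ext ξ
      rw [neg_one_smul]
      abel
    have e4 := hadd _ _ (hD2 p hp) (hD2 p hp)
    simp only [e3] at e4
    rw [hadd _ _ (hD2 _ he) (hD2 _ ho), e1, e2] at e4
    linear_combination (-1 / 2) * e4
  obtain ⟨p, τ, hp, hτ, h0, hpτ⟩ := R.exists_gauge_decomposition hφ
  have hφ' : φ = fun ξ => p ξ + R.covD τ ξ := funext hpτ
  have hcτ := R.isTestFn_covD hτ
  have e1 : ∫ ξ, inner ℂ (R.dirac k (R.dirac k φ) ξ) (Ψ ξ) = 0 := by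
    rw [hφ']
    simp only [hsq _ _ hp hcτ]
    rw [hadd _ _ (hD2 _ hp) (hD2 _ hcτ), hphys p hp h0, zero_add]
    have : R.dirac k (R.dirac k (R.covD τ)) = R.covD (R.dirac k (R.dirac k τ)) := by
      rw [show R.dirac k (R.covD τ) = R.covD (R.dirac k τ) from
        funext fun ξ => (R.covD_dirac k hτ ξ).symm]
      exact funext fun ξ => (R.covD_dirac k (R.isTestFn_dirac k hτ) ξ).symm
    rw [this]
    exact hcov _ (hD2 _ hτ)
  have hx : ContDiff ℝ ∞ fun ξ : Config => xc ξ 0 := contDiff_xc 0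
  have hxφ : IsTestFn fun ξ => xc ξ 0 • φ ξ := hφ.smul hx
  have e2 : ∫ ξ, inner ℂ (xc ξ 0 • R.covD φ ξ) (Ψ ξ) = 0 := by
    have := hcov _ hxφ
    simp only [R.covD_smul (hx.differentiable (by simp)) hφ.differentiable
      (fun θ ξ => by rw [rot_xc])] at this
    exact this
  simp only [R.hD_eq_dirac k hφ]
  rw [hadd _ _ ((hD2 _ hφ).const_smul _) (((R.isTestFn_covD hφ).smul hx).const_smul _)]
  simp only [inner_smul_left]
  rw [integral_const_mul, integral_const_mul, e1, e2]
  simp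

/-- For large `ϖ` the trial state is not in the closure of the range of the supercharge on odd
states: there the supercharge is bounded below, while the trial state has small energy. -/
theorem exists_zero_mode : ∃ ϖ₀ : ℝ, ∀ ϖ, ϖ₀ ≤ ϖ → ∃ Ψ : Lp V 2 (volume : Measure Config), Ψ ≠ 0 ∧
    (∀ τ : Config → V, IsTestFn τ → ∫ ξ, inner ℂ (R.covD τ ξ) (Ψ ξ) = 0) ∧
    ∀ φ : Config → V, IsTestFn φ → ∫ ξ, inner ℂ (R.hD (ϖ ^ 2 / 2) φ ξ) (Ψ ξ) = 0 := by
  obtain ⟨ϖ₁, h1⟩ := R.energy_gap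
  obtain ⟨ϖ₂, C, h2⟩ := R.energy_trial
  refine ⟨max (max ϖ₁ ϖ₂) (max 1 (100 * C)), fun ϖ hϖ => ?_⟩
  simp only [max_le_iff] at hϖ
  obtain ⟨⟨hϖ1, hϖ2⟩, hϖ3, hϖ4⟩ := hϖ
  obtain ⟨Ψ', hΨ', hpar', C', -, hgap⟩ := h1 ϖ hϖ1
  obtain ⟨hpos, hen⟩ := h2 ϖ hϖ2
  set k := ϖ ^ 2 / 2 with hk
  have ht : IsTestFn (R.trial ϖ) := R.isTestFn_trial hϖ3
  set Ψ₀ := ht.toL2 with hΨ₀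
  have hn : 0 < ‖Ψ₀‖ ^ 2 := by rw [hΨ₀, IsTestFn.norm_toL2_sq]; exact hpos
  have ha : ‖(R.isTestFn_dirac k ht).toL2‖ ^ 2 ≤ (ϖ / 1000 + C / 2) * ‖Ψ₀‖ ^ 2 := by
    rw [hΨ₀, IsTestFn.norm_toL2_sq, IsTestFn.norm_toL2_sq]
    rw [R.energy_eq_dirac k ht (R.covD_trial hϖ3)] at hen
    linarith
  have hbd : ∀ y ∈ R.oddRange k, ‖inner ℂ Ψ₀ y‖ ^ 2 ≤ 1 / 2 * ‖Ψ₀‖ ^ 2 * ‖y‖ ^ 2 := by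
    rintro _ ⟨g, hg, hg1, hg2, rfl⟩
    have e : inner ℂ Ψ₀ (R.isTestFn_dirac k hg).toL2
        = inner ℂ (R.isTestFn_dirac k ht).toL2 hg.toL2 := by
      rw [hΨ₀, IsTestFn.inner_toL2_toL2, IsTestFn.inner_toL2_toL2,
        R.integral_inner_dirac k ht hg.1]
    have e2 : ∫ ξ, inner ℂ (Ψ' ξ) (g ξ) = 0 := by
      have : ∀ ξ, inner ℂ (Ψ' ξ) (g ξ) = 0 := fun ξ => by
        rw [← inner_conj_symm, R.inner_odd_even (hg2 ξ) (hpar' ξ), map_zero]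
      simp [this]
    have e3 := hgap g hg hg1
    rw [e2, R.energy_eq_dirac k hg hg1] at e3
    have e4 : ϖ / 50 * ‖hg.toL2‖ ^ 2 ≤ ‖(R.isTestFn_dirac k hg).toL2‖ ^ 2 := by
      rw [IsTestFn.norm_toL2_sq, IsTestFn.norm_toL2_sq]
      simp at e3
      linarith
    rw [e]
    have e5 : ‖inner ℂ (R.isTestFn_dirac k ht).toL2 hg.toL2‖ ^ 2
        ≤ ‖(R.isTestFn_dirac k ht).toL2‖ ^ 2 * ‖hg.toL2‖ ^ 2 := by
      rw [← mul_pow]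
      gcongr
      exact norm_inner_le_norm _ _
    have e6 := mul_le_mul_of_nonneg_right ha (sq_nonneg ‖hg.toL2‖)
    have e7 : ϖ / 1000 + C / 2 ≤ 1 / 2 * (ϖ / 50) := by linarith
    have e8 := mul_le_mul_of_nonneg_right e7 (mul_nonneg hn.le (sq_nonneg ‖hg.toL2‖))
    have e9 := mul_le_mul_of_nonneg_left e4 (mul_nonneg (by norm_num : (0 : ℝ) ≤ 1 / 2) hn.le)
    linarith
  set W := (R.oddRange k).topologicalClosure with hW
  have hclosed : IsClosed (W : Set (Lp V 2 (volume : Measure Config))) :=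
    Submodule.isClosed_topologicalClosure _
  have : CompleteSpace W := hclosed.completeSpace_coe
  have hbd' : ∀ y ∈ W, ‖inner ℂ Ψ₀ y‖ ^ 2 ≤ 1 / 2 * ‖Ψ₀‖ ^ 2 * ‖y‖ ^ 2 := by
    intro y hy
    have hcl : IsClosed {y : Lp V 2 (volume : Measure Config) |
        ‖inner ℂ Ψ₀ y‖ ^ 2 ≤ 1 / 2 * ‖Ψ₀‖ ^ 2 * ‖y‖ ^ 2} :=
      isClosed_le (by fun_prop) (by fun_prop)
    exact closure_minimal hbd hcl hy
  have hnot : Ψ₀ ∉ W := fun hmem => by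
    have := hbd' _ hmem
    rw [inner_self_eq_norm_sq_to_K, norm_pow, RCLike.norm_ofReal, abs_norm] at this
    nlinarith
  have hEcl : IsClosed (R.evenPhysical : Set (Lp V 2 (volume : Measure Config))) :=
    Submodule.isClosed_orthogonal _
  have hWE : W ≤ R.evenPhysical :=
    Submodule.topologicalClosure_minimal _ (R.oddRange_le k) hEcl
  refine ⟨Ψ₀ - W.starProjection Ψ₀, fun h0 => hnot ?_, ?_⟩
  · rw [sub_eq_zero.1 h0]; exact W.starProjection_apply_mem Ψ₀
  · have hE : Ψ₀ - W.starProjection Ψ₀ ∈ R.evenPhysical :=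
      Submodule.sub_mem _ (R.toL2_mem_evenPhysical ht (R.covD_trial hϖ3) (R.par_trial ϖ))
        (hWE (W.starProjection_apply_mem Ψ₀))
    have hO : Ψ₀ - W.starProjection Ψ₀ ∈ (R.oddRange k)ᗮ :=
      Submodule.orthogonal_le (Submodule.le_topologicalClosure _)
        (W.sub_starProjection_mem_orthogonal Ψ₀)
    exact ⟨(R.mem_evenPhysical.1 hE).1, fun φ hφ => R.integral_inner_hD_eq_zero k hE hO hφ⟩

end FermionRep
end DeformedSQM

namespace DeformedSQM

/-! ### Mollification -/

/-- Gauge-invariant mollifiers. -/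
theorem exists_radial_mollifier {ε : ℝ} (hε : 0 < ε) : ∃ ρ : Config → ℝ, ContDiff ℝ ∞ ρ ∧
    HasCompactSupport ρ ∧ (∀ ξ, 0 ≤ ρ ξ) ∧ ∫ ξ, ρ ξ = 1 ∧ (∀ ξ, ε < ‖ξ‖ → ρ ξ = 0) ∧
    ∀ ξ η, ‖ξ‖ = ‖η‖ → ρ ξ = ρ η := by
  set f : Config → ℝ := fun ξ => Real.smoothTransition (1 - ‖ξ‖ ^ 2 / ε ^ 2) with hf
  have hc : ContDiff ℝ ∞ f := Real.smoothTransition.contDiff.comp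
    (contDiff_const.sub ((contDiff_norm_sq ℝ).div_const _))
  have hz : ∀ ξ, ε < ‖ξ‖ → f ξ = 0 := fun ξ h => by
    refine Real.smoothTransition.zero_of_nonpos ?_
    have : 1 ≤ ‖ξ‖ ^ 2 / ε ^ 2 := by
      rw [le_div_iff₀ (by positivity), one_mul]
      gcongr
    linarith
  have hs : HasCompactSupport f :=
    HasCompactSupport.intro (isCompact_closedBall (0 : Config) ε) fun ξ hξ => hz ξ (by simpa using hξ)
  have h0 : ∀ ξ, 0 ≤ f ξ := fun ξ => Real.smoothTransition.nonneg _
  have hpos : 0 < ∫ ξ, f ξ := by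
    refine hc.continuous.integral_pos_of_hasCompactSupport_nonneg_nonzero hs h0 (x := 0) ?_
    simp [hf]
  refine ⟨fun ξ => (∫ η, f η)⁻¹ * f ξ, contDiff_const.mul hc, hs.mul_left, fun ξ => ?_, ?_,
    fun ξ h => by simp only [hz ξ h, mul_zero], fun ξ η h => by simp [hf, h]⟩
  · exact mul_nonneg (inv_nonneg.2 hpos.le) (h0 ξ)
  · rw [integral_const_mul, inv_mul_cancel₀ hpos.ne']

/-- Gauge-invariant cutoffs to large balls, with small gradients. -/
theorem exists_radial_cutoff : ∃ C : ℝ, 0 ≤ C ∧ ∀ r : ℝ, 0 < r → ∃ χ : Config → ℝ, ContDiff ℝ ∞ χ ∧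
    (∀ ξ, 2 * r < ‖ξ‖ → χ ξ = 0) ∧ (∀ ξ, 0 ≤ χ ξ) ∧ (∀ ξ, χ ξ ≤ 1) ∧
    (∀ ξ, ‖ξ‖ ≤ r → χ ξ = 1) ∧ (∀ ξ, gradSq χ ξ ≤ C / r ^ 2) ∧
    ∀ ξ η, ‖ξ‖ = ‖η‖ → χ ξ = χ η := by
  set f : Config → ℝ := fun ξ => Real.smoothTransition (2 - ‖ξ‖ ^ 2) with hf
  have hc : ContDiff ℝ ∞ f := Real.smoothTransition.contDiff.comp
    (contDiff_const.sub (contDiff_norm_sq ℝ))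
  have hz : ∀ ξ, 2 < ‖ξ‖ → f ξ = 0 := fun ξ h => by
    refine Real.smoothTransition.zero_of_nonpos ?_
    nlinarith
  have hs : HasCompactSupport f :=
    HasCompactSupport.intro (isCompact_closedBall (0 : Config) 2) fun ξ hξ => hz ξ (by simpa using hξ)
  have hg : HasCompactSupport (gradSq f) := by
    refine HasCompactSupport.intro hs fun ξ hξ => ?_
    have h1 : fderiv ℝ f ξ = 0 :=
      image_eq_zero_of_notMem_tsupport fun hm => hξ (tsupport_fderiv_subset ℝ hm)
    simp [gradSq, pd, h1]
  obtain ⟨C, hC⟩ := hg.exists_bound_of_continuous (continuous_gradSq hc)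
  refine ⟨C, (norm_nonneg _).trans (hC 0), fun r hr => ⟨fun ξ => f (r⁻¹ • ξ),
    hc.comp (contDiff_const_smul _), fun ξ h => hz _ ?_, fun ξ => Real.smoothTransition.nonneg _,
    fun ξ => Real.smoothTransition.le_one _, fun ξ h => Real.smoothTransition.one_of_one_le ?_,
    fun ξ => ?_, fun ξ η h => by simp [hf, norm_smul, h]⟩⟩
  · rw [norm_smul, norm_inv, Real.norm_of_nonneg hr.le, inv_mul_eq_div, lt_div_iff₀ hr]
    exact h
  · have : ‖r⁻¹ • ξ‖ ≤ 1 := by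
      rw [norm_smul, norm_inv, Real.norm_of_nonneg hr.le, inv_mul_eq_div, div_le_one₀ hr]
      exact h
    nlinarith [norm_nonneg (r⁻¹ • ξ)]
  · have h1 : gradSq (fun ξ => f (r⁻¹ • ξ)) ξ = (r⁻¹) ^ 2 * gradSq f (r⁻¹ • ξ) := by
      simp only [gradSq, pd, Finset.mul_sum]
      refine Finset.sum_congr rfl fun i _ => ?_
      rw [fderiv_comp_smul, ← mul_pow]
      simp [mul_pow]
    rw [h1, inv_pow, inv_mul_eq_div]
    gcongr
    exact (le_abs_self _).trans (hC _)

variable {V : Type*} [NormedAddCommGroup V] [InnerProductSpace ℂ V]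

/-- The convolution of `Φ` with the scalar function `c`. -/
def mol (c : Config → ℝ) (Φ : Config → V) : Config → V :=
  convolution Φ c (ContinuousLinearMap.lsmul ℝ ℝ (E := V)).flip volume

theorem mol_apply (c : Config → ℝ) (Φ : Config → V) (ξ : Config) :
    mol c Φ ξ = ∫ η, c (ξ - η) • Φ η := rfl

theorem contDiff_mol {c : Config → ℝ} (hc : ContDiff ℝ ∞ c) (hs : HasCompactSupport c)
    {Φ : Config → V} (hΦ : LocallyIntegrable Φ) : ContDiff ℝ ∞ (mol c Φ) :=
  hs.contDiff_convolution_right (n := ⊤) _ hΦ hc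

theorem fderiv_mol {c : Config → ℝ} (hc : ContDiff ℝ ∞ c) (hs : HasCompactSupport c)
    {Φ : Config → V} (hΦ : LocallyIntegrable Φ) (ξ w : Config) :
    fderiv ℝ (mol c Φ) ξ w = mol (fun ζ => fderiv ℝ c ζ w) Φ ξ := by
  have h := (hs.hasFDerivAt_convolution_right (ContinuousLinearMap.lsmul ℝ ℝ (E := V)).flip hΦ
    (hc.of_le (by simp)) ξ).fderiv
  rw [mol, h, convolution_precompR_apply _ hΦ (hs.fderiv ℝ) (hc.continuous_fderiv (by simp))]
  rfl

theorem integrable_smul_shift {c : Config → ℝ} (hc : Continuous c) (hs : HasCompactSupport c)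
    {Φ : Config → V} (hΦ : LocallyIntegrable Φ) (ξ : Config) :
    Integrable fun η => c (ξ - η) • Φ η :=
  hs.convolutionExists_right (ContinuousLinearMap.lsmul ℝ ℝ (E := V)).flip hΦ hc ξ

theorem inner_mol [CompleteSpace V] {c : Config → ℝ} (hc : Continuous c) (hs : HasCompactSupport c)
    {Φ : Config → V} (hΦ : LocallyIntegrable Φ) (v : V) (ξ : Config) :
    inner ℂ v (mol c Φ ξ) = ∫ η, inner ℂ (c (ξ - η) • v) (Φ η) := by
  rw [mol_apply, ← integral_inner (integrable_smul_shift hc hs hΦ ξ)]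
  refine integral_congr_ae (.of_forall fun η => ?_)
  simp only [← Complex.coe_smul (E := V), inner_smul_left, inner_smul_right, Complex.conj_ofReal]

namespace FermionRep

variable [CompleteSpace V] (R : FermionRep V)

theorem chg_dSuperpot (ξ : Config) : ∑ i, ∑ a, chg i a * dSuperpot ξ i a = 0 := by
  simp [Fintype.sum_sum_type, Fin.sum_univ_eight, Fin.sum_univ_four, Fin.sum_univ_five, chg,
    dSuperpot]

theorem inner_hF (ξ : Config) (v w : V) : inner ℂ (R.hF ξ v) w = inner ℂ v (R.hF ξ w) := by
  have h : R.hF ξ = (-(2 * Complex.I)) • ∑ i, R.cl (chg i) * R.cl (dSuperpot ξ i)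
      - ((2 * xc ξ 0 : ℝ) : ℂ) • (Complex.I • R.rotX) :=
    eq_sub_of_add_eq (R.sum_cl_dSuperpot ξ).symm
  have hswap : ∑ i, R.cl (chg i) (R.cl (dSuperpot ξ i) w)
      = -∑ i, R.cl (dSuperpot ξ i) (R.cl (chg i) w) := by
    rw [eq_neg_iff_add_eq_zero, ← Finset.sum_add_distrib]
    simp only [cl_anticomm, ← Finset.sum_smul, ← Complex.ofReal_sum]
    rw [chg_dSuperpot]
    simp
  simp only [h, sub_apply, smul_apply, sum_apply, mul_apply_eq_comp, inner_sub_left, inner_sub_right]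
  have h2 : (starRingEnd ℂ) 2 = 2 := map_ofNat _ 2
  congr 1
  · rw [hswap]
    simp only [inner_smul_left, inner_smul_right, sum_inner, inner_neg_right, inner_sum, cl_sa,
      map_neg, map_mul, h2, Complex.conj_I]
    ring
  · simp only [inner_smul_left, inner_smul_right, rotX_skew]
    simp [h2]

end FermionRep
end DeformedSQM

namespace DeformedSQM

variable {V : Type*} [NormedAddCommGroup V] [InnerProductSpace ℂ V]

theorem locallyIntegrable_Lp {E : Type*} [NormedAddCommGroup E]
    (Φ : Lp E 2 (volume : Measure Config)) : LocallyIntegrable (Φ : Config → E) :=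
  (Lp.memLp Φ).locallyIntegrable one_le_two

theorem integrable_inner_shift {c : Config → ℝ} (hc : Continuous c) (hs : HasCompactSupport c)
    (Φ : Lp V 2 (volume : Measure Config)) (v : V) (ξ : Config) :
    Integrable fun η => inner ℂ (c (ξ - η) • v) (Φ η) := by
  refine ((integrable_smul_shift hc hs (locallyIntegrable_Lp Φ) ξ).const_inner (𝕜 := ℂ) v).congr
    (.of_forall fun η => ?_)
  simp only [← Complex.coe_smul (E := V), inner_smul_left, inner_smul_right, Complex.conj_ofReal]

theorem fderiv_shift_smul {c : Config → ℝ} (hc : Differentiable ℝ c) (v : V) (ξ η w : Config) :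
    fderiv ℝ (fun η => c (ξ - η) • v) η w = (-(fderiv ℝ c (ξ - η) w)) • v := by
  have h1 : HasFDerivAt (fun η => c (ξ - η)) (-(fderiv ℝ c (ξ - η))) η := by
    have := (hc (ξ - η)).hasFDerivAt.comp η ((hasFDerivAt_id η).const_sub ξ)
    refine this.congr_fderiv ?_
    ext w; simp
  rw [(h1.smul_const v).fderiv]
  simp

theorem isTestFn_shift_smul {c : Config → ℝ} (hc : ContDiff ℝ ∞ c) (hs : HasCompactSupport c) (v : V)
    (ξ : Config) : IsTestFn fun η => c (ξ - η) • v := by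
  refine ⟨ContDiff.smul (F := V) (f := fun η => c (ξ - η)) (hc.comp (contDiff_const.sub contDiff_id))
    contDiff_const, ?_⟩
  have h : HasCompactSupport fun η => c (ξ - η) := hs.comp_homeomorph (Homeomorph.subLeft ξ)
  exact h.smul_right

theorem pd_pd_shift_smul {c : Config → ℝ} (hc : ContDiff ℝ ∞ c) (v : V) (ξ η : Config) (i : Idx) :
    pd i (pd i fun η => c (ξ - η) • v) η = pd i (pd i c) (ξ - η) • v := by
  have h1 : pd i (fun η => c (ξ - η) • v) = fun η => pd i c (ξ - η) • (-v) := funext fun η => by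
    rw [pd, fderiv_shift_smul (hc.differentiable (by simp)), neg_smul, smul_neg, pd]
  rw [h1, pd, fderiv_shift_smul ((contDiff_pd hc i).differentiable (by simp)), neg_smul, smul_neg,
    neg_neg]
  rfl

theorem pd_pd_mol {c : Config → ℝ} (hc : ContDiff ℝ ∞ c) (hs : HasCompactSupport c)
    {Φ : Config → V} (hΦ : LocallyIntegrable Φ) (i : Idx) (ξ : Config) :
    pd i (pd i (mol c Φ)) ξ = mol (pd i (pd i c)) Φ ξ := by
  have h1 : pd i (mol c Φ) = mol (pd i c) Φ := funext fun ξ => fderiv_mol hc hs hΦ ξ _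
  rw [h1]
  exact fderiv_mol (contDiff_pd hc i) (hasCompactSupport_pd hs i) hΦ ξ _

theorem rotVec_add (ξ η : Config) : rotVec (ξ + η) = rotVec ξ + rotVec η :=
  config_ext (by rw [rotVec_qc, qc_add, qc_add, rotVec_qc, rotVec_qc]
                 ext j; fin_cases j <;> simp <;> ring)
    (by rw [rotVec_xc, xc_add, rotVec_xc, rotVec_xc, add_zero])

namespace FermionRep

variable [CompleteSpace V] (R : FermionRep V)

/-- Mollification by a gauge-invariant kernel preserves the gauge constraint. -/
theorem covD_mol {ρ : Config → ℝ} (hρ : ContDiff ℝ ∞ ρ) (hs : HasCompactSupport ρ)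
    (hrad : ∀ ξ η, ‖ξ‖ = ‖η‖ → ρ ξ = ρ η) {Φ : Lp V 2 (volume : Measure Config)}
    (hΦ : ∀ τ : Config → V, IsTestFn τ → ∫ ξ, inner ℂ (R.covD τ ξ) (Φ ξ) = 0) (ξ : Config) :
    R.covD (mol ρ Φ) ξ = 0 := by
  have hloc := locallyIntegrable_Lp Φ
  refine ext_inner_left ℂ fun v => ?_
  have hd : Continuous fun ζ => fderiv ℝ ρ ζ (rotVec ξ) :=
    (hρ.continuous_fderiv (by simp)).clm_apply continuous_const
  have hds : HasCompactSupport fun ζ => fderiv ℝ ρ ζ (rotVec ξ) := hs.fderiv_apply ℝ _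
  have e1 : inner ℂ v (R.covD (mol ρ Φ) ξ) = (∫ η, inner ℂ (fderiv ℝ ρ (ξ - η) (rotVec ξ) • v) (Φ η))
      + ∫ η, inner ℂ (ρ (ξ - η) • R.rotX v) (Φ η) := by
    rw [← inner_mol hρ.continuous hs hloc, ← inner_mol hd hds hloc, R.rotX_skew, covD, rotT_eq_fderiv,
      fderiv_mol hρ hs hloc, inner_sub_right, sub_eq_add_neg]
  have i1 := integrable_inner_shift hd hds Φ v ξ
  have i2 := integrable_inner_shift hρ.continuous hs Φ (R.rotX v) ξ
  rw [e1, ← integral_add i1 i2, inner_zero_right, ← neg_eq_zero, ← integral_neg]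
  have h0 := hΦ _ (isTestFn_shift_smul hρ hs v ξ)
  rw [← h0]
  refine integral_congr_ae (.of_forall fun η => ?_)
  have hT : fderiv ℝ ρ (ξ - η) (rotVec ξ) = fderiv ℝ ρ (ξ - η) (rotVec η) := by
    have h1 := rotT_eq_zero_of_invariant (hρ.differentiable (by simp))
      (fun θ ξ => hrad _ _ (norm_rot θ ξ)) (ξ - η)
    rw [rotT_eq_fderiv] at h1
    have h2 := rotVec_add (ξ - η) η
    rw [sub_add_cancel] at h2
    rw [h2, map_add, h1, zero_add]
  have hX : R.rotX (ρ (ξ - η) • v) = ρ (ξ - η) • R.rotX v := by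
    rw [← Complex.coe_smul (E := V), map_smul, Complex.coe_smul]
  simp only [covD, rotT_eq_fderiv, fderiv_shift_smul (hρ.differentiable (by simp)), hT, hX]
  rw [← inner_add_left, ← inner_neg_left]
  congr 1
  rw [neg_smul]
  abel

theorem isTestFn_hD (k : ℝ) {φ : Config → V} (hφ : IsTestFn φ) : IsTestFn (R.hD k φ) := by
  rw [funext (R.hD_eq_dirac k hφ)]
  exact ((R.isTestFn_dirac k (R.isTestFn_dirac k hφ)).const_smul _).add
    (((R.isTestFn_covD hφ).smul (contDiff_xc 0)).const_smul _)

/-- The multiplicative part of `H_k`. -/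
def pot (k : ℝ) (ξ : Config) : V →L[ℂ] V := (potDef k ξ : ℂ) • 1 + R.hF ξ

theorem continuous_pot (k : ℝ) : Continuous (R.pot k) :=
  (Continuous.smul (f := fun ξ => (potDef k ξ : ℂ))
    (Complex.continuous_ofReal.comp (continuous_potDef k)) continuous_const).add R.continuous_hF

theorem inner_pot (k : ℝ) (ξ : Config) (v w : V) :
    inner ℂ (R.pot k ξ v) w = inner ℂ v (R.pot k ξ w) := by
  simp only [pot, add_apply, smul_apply, one_apply_eq_self, inner_add_left, inner_add_right, inner_hF,
    inner_smul_left, inner_smul_right, Complex.conj_ofReal]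

theorem hD_eq_pot (k : ℝ) {φ : Config → V} (hφ : ContDiff ℝ ∞ φ) (ξ : Config) :
    R.hD k φ ξ = -(∑ i, pd i (pd i φ) ξ) + R.pot k ξ (φ ξ) := by
  rw [R.hD_eq k hφ, pot, add_apply, smul_apply, one_apply_eq_self, add_assoc]

/-- For a weak solution of `H_k Φ = 0`, applying `H_k` to a mollification leaves only the commutator
with the potential. -/
theorem inner_hD_mol (k : ℝ) {ρ : Config → ℝ} (hρ : ContDiff ℝ ∞ ρ) (hs : HasCompactSupport ρ)
    {Φ : Lp V 2 (volume : Measure Config)}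
    (hΦ : ∀ φ : Config → V, IsTestFn φ → ∫ ξ, inner ℂ (R.hD k φ ξ) (Φ ξ) = 0) (ξ : Config) (v : V) :
    inner ℂ v (R.hD k (mol ρ Φ) ξ) =
      ∫ η, inner ℂ (ρ (ξ - η) • ((R.pot k ξ - R.pot k η) v)) (Φ η) := by
  have hloc := locallyIntegrable_Lp Φ
  have hφ := isTestFn_shift_smul hρ hs v ξ
  have hc2 : ∀ i, Continuous (pd i (pd i ρ)) := fun i => (contDiff_pd (contDiff_pd hρ i) i).continuous
  have hs2 : ∀ i, HasCompactSupport (pd i (pd i ρ)) := fun i =>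
    hasCompactSupport_pd (hasCompactSupport_pd hs i) i
  have i1 : ∀ i, Integrable fun η => inner ℂ (pd i (pd i ρ) (ξ - η) • v) (Φ η) := fun i =>
    integrable_inner_shift (hc2 i) (hs2 i) Φ v ξ
  have i2 := integrable_inner_shift hρ.continuous hs Φ (R.pot k ξ v) ξ
  have i3 := (R.isTestFn_hD k hφ).integrable_inner Φ
  have i4 : Integrable fun η => ∑ i, inner ℂ (pd i (pd i ρ) (ξ - η) • v) (Φ η) :=
    integrable_finsetSum _ fun i _ => i1 i
  have i5 : Integrable fun η => inner ℂ (ρ (ξ - η) • R.pot k ξ v) (Φ η)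
      - ∑ i, inner ℂ (pd i (pd i ρ) (ξ - η) • v) (Φ η) := i2.sub i4
  have e1 : inner ℂ v (R.hD k (mol ρ Φ) ξ) = (∫ η, inner ℂ (ρ (ξ - η) • R.pot k ξ v) (Φ η))
      - ∫ η, ∑ i, inner ℂ (pd i (pd i ρ) (ξ - η) • v) (Φ η) := by
    rw [integral_finsetSum _ fun i _ => i1 i, ← inner_mol hρ.continuous hs hloc]
    simp only [← inner_mol (hc2 _) (hs2 _) hloc]
    rw [R.hD_eq_pot k (contDiff_mol hρ hs hloc), R.inner_pot, inner_add_right, inner_neg_right,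
      inner_sum]
    simp only [pd_pd_mol hρ hs hloc]
    ring
  rw [e1, ← integral_sub i2 i4, ← sub_zero (∫ η, _ - _), ← hΦ _ hφ, ← integral_sub i5 i3]
  refine integral_congr_ae (.of_forall fun η => ?_)
  have hP : R.pot k η (ρ (ξ - η) • v) = ρ (ξ - η) • R.pot k η v := by
    rw [← Complex.coe_smul (E := V), map_smul, Complex.coe_smul]
  simp only [R.hD_eq_pot k hφ.1, pd_pd_shift_smul hρ, hP, sub_apply, smul_sub, inner_sub_left,
    inner_add_left, inner_neg_left, sum_inner]
  ring

end FermionRep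

/-! ### Estimates for mollifications -/

/-- The average of `‖Φ‖²` with the weight `ρ`. -/
def avgSq (ρ : Config → ℝ) (Φ : Config → V) (ξ : Config) : ℝ := ∫ η, ρ (ξ - η) * ‖Φ η‖ ^ 2

theorem integrable_normSq_Lp {E : Type*} [NormedAddCommGroup E]
    (Φ : Lp E 2 (volume : Measure Config)) :
    Integrable fun ξ => ‖Φ ξ‖ ^ 2 := (Lp.memLp Φ).integrable_norm_pow (by simp)

theorem integrable_avgSq {ρ : Config → ℝ} (hρ : Integrable ρ) (Φ : Lp V 2 (volume : Measure Config)) :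
    Integrable (avgSq ρ Φ) :=
  (integrable_normSq_Lp Φ).integrable_convolution (ContinuousLinearMap.mul ℝ ℝ).flip hρ

theorem integral_avgSq {ρ : Config → ℝ} (hρ : Integrable ρ) (h1 : ∫ ξ, ρ ξ = 1)
    (Φ : Lp V 2 (volume : Measure Config)) : ∫ ξ, avgSq ρ Φ ξ = ∫ ξ, ‖Φ ξ‖ ^ 2 := by
  have := integral_convolution (ContinuousLinearMap.mul ℝ ℝ).flip (integrable_normSq_Lp Φ) hρ
  simp only [ContinuousLinearMap.flip_apply, ContinuousLinearMap.mul_apply', h1, one_mul] at this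
  exact this

theorem sq_integral_le_avgSq {ρ : Config → ℝ} (hρ : Continuous ρ) (hs : HasCompactSupport ρ)
    (h0 : ∀ ξ, 0 ≤ ρ ξ) (h1 : ∫ ξ, ρ ξ = 1) (Φ : Lp V 2 (volume : Measure Config)) (ξ : Config) :
    (∫ η, ρ (ξ - η) * ‖Φ η‖) ^ 2 ≤ avgSq ρ Φ ξ := by
  have hc : Continuous fun η => ρ (ξ - η) := hρ.comp (continuous_const.sub continuous_id)
  have hcs : HasCompactSupport fun η => ρ (ξ - η) := hs.comp_homeomorph (Homeomorph.subLeft ξ)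
  set m := ∫ η, ρ (ξ - η) * ‖Φ η‖ with hm
  have i0 : Integrable fun η => ρ (ξ - η) := hc.integrable_of_hasCompactSupport hcs
  have i1 : Integrable fun η => ρ (ξ - η) * ‖Φ η‖ :=
    (integrable_smul_shift hρ hs (locallyIntegrable_Lp Φ) ξ).norm.congr (.of_forall fun η => by
      simp [norm_smul, abs_of_nonneg (h0 _)])
  obtain ⟨B, hB⟩ := hcs.exists_bound_of_continuous hc
  have i2 : Integrable fun η => ρ (ξ - η) * ‖Φ η‖ ^ 2 :=
    (integrable_normSq_Lp Φ).bdd_mul hc.aestronglyMeasurable (.of_forall hB)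
  have h : 0 ≤ ∫ η, ρ (ξ - η) * (‖Φ η‖ - m) ^ 2 :=
    integral_nonneg fun η => mul_nonneg (h0 _) (sq_nonneg _)
  have e : (fun η => ρ (ξ - η) * (‖Φ η‖ - m) ^ 2) = fun η =>
      (ρ (ξ - η) * ‖Φ η‖ ^ 2 - (2 * m) * (ρ (ξ - η) * ‖Φ η‖)) + m ^ 2 * ρ (ξ - η) := by
    ext η; ring
  have i3 : Integrable fun η => ρ (ξ - η) * ‖Φ η‖ ^ 2 - (2 * m) * (ρ (ξ - η) * ‖Φ η‖) :=
    i2.sub (i1.const_mul _)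
  rw [e, integral_add i3 (i0.const_mul _), integral_sub i2 (i1.const_mul _), integral_const_mul,
    integral_const_mul, ← hm, integral_sub_left_eq_self ρ volume ξ, h1] at h
  rw [avgSq]
  nlinarith

theorem norm_mol_le {ρ : Config → ℝ} (h0 : ∀ ξ, 0 ≤ ρ ξ) (Φ : Config → V) (ξ : Config) :
    ‖mol ρ Φ ξ‖ ≤ ∫ η, ρ (ξ - η) * ‖Φ η‖ := by
  rw [mol_apply]
  refine (norm_integral_le_integral_norm _).trans_eq ?_
  simp only [norm_smul, Real.norm_of_nonneg (h0 _)]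

theorem FermionRep.norm_hD_mol_le [CompleteSpace V] (R : FermionRep V) (k : ℝ) {ρ : Config → ℝ} (hρ : ContDiff ℝ ∞ ρ)
    (hs : HasCompactSupport ρ) (h0 : ∀ ξ, 0 ≤ ρ ξ) {Φ : Lp V 2 (volume : Measure Config)}
    (hΦ : ∀ φ : Config → V, IsTestFn φ → ∫ ξ, inner ℂ (R.hD k φ ξ) (Φ ξ) = 0) {δ : ℝ} {ξ : Config}
    (hδ : ∀ η, ρ (ξ - η) ≠ 0 → ‖R.pot k ξ - R.pot k η‖ ≤ δ) :
    ‖R.hD k (mol ρ Φ) ξ‖ ≤ δ * ∫ η, ρ (ξ - η) * ‖Φ η‖ := by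
  set v := R.hD k (mol ρ Φ) ξ with hv
  have i1 : Integrable fun η => ρ (ξ - η) * ‖Φ η‖ :=
    (integrable_smul_shift hρ.continuous hs (locallyIntegrable_Lp Φ) ξ).norm.congr
      (.of_forall fun η => by simp [norm_smul, abs_of_nonneg (h0 _)])
  have h1 : ‖v‖ ^ 2 ≤ ‖v‖ * (δ * ∫ η, ρ (ξ - η) * ‖Φ η‖) := by
    have e := R.inner_hD_mol k hρ hs hΦ ξ v
    rw [← hv, inner_self_eq_norm_sq_to_K] at e
    have e2 := congrArg norm e
    rw [norm_pow, RCLike.norm_ofReal, abs_norm] at e2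
    rw [e2, ← integral_const_mul, ← integral_const_mul]
    refine norm_integral_le_of_norm_le ((i1.const_mul _).const_mul _) (.of_forall fun η => ?_)
    by_cases hη : ρ (ξ - η) = 0
    · simp [hη]
    · refine (norm_inner_le_norm _ _).trans ?_
      rw [norm_smul, Real.norm_of_nonneg (h0 _)]
      have h2 : ‖(R.pot k ξ - R.pot k η) v‖ ≤ δ * ‖v‖ :=
        ((R.pot k ξ - R.pot k η).le_opNorm v).trans
          (mul_le_mul_of_nonneg_right (hδ η hη) (norm_nonneg _))
      calc ρ (ξ - η) * ‖(R.pot k ξ - R.pot k η) v‖ * ‖Φ η‖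
          ≤ ρ (ξ - η) * (δ * ‖v‖) * ‖Φ η‖ := by
            gcongr
            exact h0 _
        _ = _ := by ring
  rcases eq_or_lt_of_le (norm_nonneg v) with h | h
  · rw [← h]
    by_contra! hneg
    have hm : 0 ≤ ∫ η, ρ (ξ - η) * ‖Φ η‖ :=
      integral_nonneg fun η => mul_nonneg (h0 _) (norm_nonneg _)
    have hδ0 : δ < 0 := by
      by_contra! h3
      exact absurd (mul_nonneg h3 hm) hneg.not_ge
    have hz : ∀ η, ρ (ξ - η) * ‖Φ η‖ = 0 := fun η => by
      by_contra h3
      exact absurd ((norm_nonneg _).trans (hδ η (left_ne_zero_of_mul h3))) hδ0.not_ge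
    simp [hz] at hneg
  · nlinarith

/-- Mollifications converge weakly. -/
theorem exists_mol_close [CompleteSpace V] {f : Config → V} (hf : IsTestFn f) (Φ : Lp V 2 (volume : Measure Config))
    {δ : ℝ} (hδ : 0 < δ) : ∃ ε₀ > 0, ∀ ε ≤ ε₀, ∀ ρ : Config → ℝ, ContDiff ℝ ∞ ρ →
      HasCompactSupport ρ → (∀ ξ, 0 ≤ ρ ξ) → ∫ ξ, ρ ξ = 1 → (∀ ξ, ε < ‖ξ‖ → ρ ξ = 0) →
      ‖(∫ ξ, inner ℂ (f ξ) (mol ρ Φ ξ)) - ∫ ξ, inner ℂ (f ξ) (Φ ξ)‖ ≤ δ := by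
  obtain ⟨r, hr⟩ := hf.2.isCompact.isBounded.subset_closedBall (0 : Config)
  have hfz : ∀ ξ, r < ‖ξ‖ → f ξ = 0 := fun ξ h => image_eq_zero_of_notMem_tsupport fun hm => by
    have := hr hm
    simp at this
    linarith
  set K := Metric.closedBall (0 : Config) (r + 1) with hK
  obtain ⟨g, ig, hgn, hgK⟩ : ∃ g : Config → ℝ, Integrable g ∧ (∀ η, 0 ≤ g η) ∧
      ∀ η ∈ K, ‖Φ η‖ = g η :=
    ⟨fun η => ‖K.indicator Φ η‖, (((locallyIntegrable_Lp Φ).integrableOn_isCompact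
      (isCompact_closedBall _ _)).integrable_indicator measurableSet_closedBall).norm,
      fun η => norm_nonneg _, fun η h => by simp [h]⟩
  have hg0 : 0 ≤ ∫ η, g η := integral_nonneg hgn
  set A := (∫ η, g η) + 1 with hA
  have hA0 : 0 < A := by linarith
  have huc := hf.2.uniformContinuous_of_continuous hf.continuous
  obtain ⟨ε₁, hε₁, hclose⟩ := Metric.uniformContinuous_iff.1 huc (δ / A) (by positivity)
  refine ⟨min 1 (ε₁ / 2), by positivity, fun ε hε ρ hρ hs h0 h1 hz => ?_⟩
  have hε1 : ε ≤ 1 := hε.trans (min_le_left _ _)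
  have hε2 : ε < ε₁ := (hε.trans (min_le_right _ _)).trans_lt (by linarith)
  have hloc := locallyIntegrable_Lp Φ
  have hnear : ∀ ξ η, ρ (ξ - η) ≠ 0 → ‖ξ - η‖ ≤ ε := fun ξ η h => by
    by_contra! h'
    exact h (hz _ h')
  have hout : ∀ ξ η, ρ (ξ - η) ≠ 0 → η ∉ K → f ξ = 0 := fun ξ η h hη => hfz ξ (by
    have h2 : r + 1 < ‖η‖ := by simpa [hK] using hη
    have h3 := norm_sub_norm_le η ξ
    rw [norm_sub_rev] at h3
    linarith [hnear ξ η h])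
  set F : Config × Config → ℂ := fun z => inner ℂ (f z.1) (ρ (z.1 - z.2) • Φ z.2) with hF
  obtain ⟨B, hB⟩ := hs.exists_bound_of_continuous hρ.continuous
  have iF : Integrable F (volume.prod volume) := by
    have i0 : Integrable (fun z : Config × Config => (B * ‖f z.1‖) * g z.2) (volume.prod volume) :=
      ((hf.continuous.integrable_of_hasCompactSupport hf.2).norm.const_mul B).mul_prod ig
    have hm : StronglyMeasurable F := by
      have m1 : StronglyMeasurable fun z : Config × Config => f z.1 :=
        (hf.continuous.comp continuous_fst).stronglyMeasurable
      have m2 : StronglyMeasurable fun z : Config × Config => ρ (z.1 - z.2) :=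
        (hρ.continuous.comp (continuous_fst.sub continuous_snd)).stronglyMeasurable
      have m3 : StronglyMeasurable fun z : Config × Config => Φ z.2 :=
        (Lp.stronglyMeasurable Φ).comp_measurable measurable_snd
      exact m1.inner (𝕜 := ℂ) (m2.smul m3)
    refine i0.mono' hm.aestronglyMeasurable (.of_forall fun ⟨ξ, η⟩ => ?_)
    have hBg : 0 ≤ B := (norm_nonneg _).trans (hB 0)
    have hnn : 0 ≤ B * ‖f ξ‖ * g η := mul_nonneg (mul_nonneg hBg (norm_nonneg _)) (hgn η)
    by_cases hρ0 : ρ (ξ - η) = 0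
    · simpa only [hF, hρ0, zero_smul, inner_zero_right, norm_zero] using hnn
    by_cases hη : η ∈ K
    · refine (norm_inner_le_norm _ _).trans ?_
      rw [norm_smul, hgK η hη]
      have := hB (ξ - η)
      calc ‖f ξ‖ * (‖ρ (ξ - η)‖ * g η) ≤ ‖f ξ‖ * (B * g η) := by
            gcongr
            exact hgn η
        _ = _ := by ring
    · simpa only [hF, hout ξ η hρ0 hη, inner_zero_left, norm_zero] using hnn
  have e1 : ∫ ξ, inner ℂ (f ξ) (mol ρ Φ ξ) = ∫ η, ∫ ξ, F (ξ, η) := by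
    rw [← integral_integral_swap iF]
    refine integral_congr_ae (.of_forall fun ξ => ?_)
    simp only [hF]
    rw [mol_apply, integral_inner (integrable_smul_shift hρ.continuous hs hloc ξ)]
  rw [e1, ← integral_sub iF.integral_prod_right (hf.integrable_inner Φ)]
  have hbd : ∀ η, ‖(∫ ξ, F (ξ, η)) - inner ℂ (f η) (Φ η)‖ ≤ δ / A * g η := by
    intro η
    have hc : Continuous fun ξ => ρ (ξ - η) := hρ.continuous.comp (continuous_id.sub continuous_const)
    have hcs : HasCompactSupport fun ξ => ρ (ξ - η) := hs.comp_homeomorph (Homeomorph.subRight η)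
    have i0 : Integrable fun ξ => ρ (ξ - η) := hc.integrable_of_hasCompactSupport hcs
    have h3 : ∫ ξ, ρ (ξ - η) • (inner ℂ (f η) (Φ η) : ℂ) = inner ℂ (f η) (Φ η) := by
      rw [integral_smul_const, integral_sub_right_eq_self ρ, h1, one_smul]
    have h4 : ∀ ξ, F (ξ, η) = ρ (ξ - η) • (inner ℂ (f ξ) (Φ η) : ℂ) := fun ξ => by
      simp only [hF]
      rw [← Complex.coe_smul (E := V), inner_smul_right]
      simp
    have i1 : Integrable fun ξ => ρ (ξ - η) • (inner ℂ (f ξ) (Φ η) : ℂ) := by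
      have hcont : Continuous fun ξ => ρ (ξ - η) • (inner ℂ (f ξ) (Φ η) : ℂ) :=
        hc.smul (hf.continuous.inner continuous_const)
      exact hcont.integrable_of_hasCompactSupport hcs.smul_right
    simp only [h4]
    rw [← h3, ← integral_sub i1 (i0.smul_const _)]
    have h5 : δ / A * g η = ∫ ξ, ρ (ξ - η) * (δ / A * g η) := by
      rw [integral_mul_const, integral_sub_right_eq_self ρ, h1, one_mul]
    rw [h5]
    refine norm_integral_le_of_norm_le (i0.mul_const _) (.of_forall fun ξ => ?_)
    rw [← smul_sub, ← inner_sub_left, norm_smul, Real.norm_of_nonneg (h0 _)]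
    by_cases hρ0 : ρ (ξ - η) = 0
    · simp [hρ0]
    refine mul_le_mul_of_nonneg_left ?_ (h0 _)
    by_cases hη : η ∈ K
    · rw [← hgK η hη]
      refine (norm_inner_le_norm _ _).trans (mul_le_mul_of_nonneg_right ?_ (norm_nonneg _))
      rw [← dist_eq_norm]
      refine (hclose ?_).le
      rw [dist_eq_norm]
      exact (hnear ξ η hρ0).trans_lt hε2
    · have h6 : f η = 0 := hfz η (by
        have h2 : r + 1 < ‖η‖ := by simpa [hK] using hη
        linarith)
      rw [hout ξ η hρ0 hη, h6, sub_zero, inner_zero_left, norm_zero]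
      exact mul_nonneg (div_nonneg hδ.le hA0.le) (hgn η)
  refine (norm_integral_le_of_norm_le (ig.const_mul (δ / A)) (.of_forall hbd)).trans ?_
  rw [integral_const_mul, div_mul_eq_mul_div, div_le_iff₀ hA0]
  gcongr
  linarith

end DeformedSQM

namespace DeformedSQM

/-! ### Weak solutions orthogonal to the test state vanish -/

variable {V : Type*} [NormedAddCommGroup V] [InnerProductSpace ℂ V] [CompleteSpace V]

theorem eq_zero_of_test {Φ : Lp V 2 (volume : Measure Config)}
    (h : ∀ f : Config → V, IsTestFn f → ∫ ξ, inner ℂ (f ξ) (Φ ξ) = 0) : Φ = 0 := by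
  rw [Lp.eq_zero_iff_ae_eq_zero]
  refine ae_eq_zero_of_integral_contDiff_smul_eq_zero (locallyIntegrable_Lp Φ) fun g hg hs => ?_
  refine ext_inner_left ℂ fun v => ?_
  have hi : Integrable fun ξ => g ξ • Φ ξ :=
    (locallyIntegrable_Lp Φ).integrable_smul_left_of_hasCompactSupport hg.continuous hs
  have ht : IsTestFn fun ξ => g ξ • v :=
    ⟨ContDiff.smul (F := V) (f := g) hg contDiff_const, hs.smul_right⟩
  rw [inner_zero_right, ← integral_inner hi, ← h _ ht]
  refine integral_congr_ae (.of_forall fun η => ?_)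
  simp only [← Complex.coe_smul (E := V), inner_smul_left, inner_smul_right, Complex.conj_ofReal]

theorem norm_integral_inner_sq_le {f g : Config → V} (hf : IsTestFn f) (hg : IsTestFn g) :
    ‖∫ ξ, inner ℂ (f ξ) (g ξ)‖ ^ 2 ≤ (∫ ξ, ‖f ξ‖ ^ 2) * ∫ ξ, ‖g ξ‖ ^ 2 := by
  rw [← hf.inner_toL2_toL2 hg, ← hf.norm_toL2_sq, ← hg.norm_toL2_sq, ← mul_pow]
  gcongr
  exact norm_inner_le_norm _ _

namespace FermionRep

variable (R : FermionRep V)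

/-- The energy of a cut-off mollification of a weak solution of `H_k Φ = 0`. -/
theorem energy_mol_le (k : ℝ) {ρ χ : Config → ℝ} (hρ : ContDiff ℝ ∞ ρ) (hs : HasCompactSupport ρ)
    (h0 : ∀ ξ, 0 ≤ ρ ξ) (h1 : ∫ ξ, ρ ξ = 1) {Φ : Lp V 2 (volume : Measure Config)}
    (hΦ : ∀ φ : Config → V, IsTestFn φ → ∫ ξ, inner ℂ (R.hD k φ ξ) (Φ ξ) = 0)
    (hχ : ContDiff ℝ ∞ χ) (hχs : HasCompactSupport χ) (hχ0 : ∀ ξ, 0 ≤ χ ξ) (hχ1 : ∀ ξ, χ ξ ≤ 1)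
    {δ c : ℝ} (hδ0 : 0 ≤ δ) (hc0 : 0 ≤ c) (hgrad : ∀ ξ, gradSq χ ξ ≤ c)
    (hδ : ∀ ξ η, χ ξ ≠ 0 → ρ (ξ - η) ≠ 0 → ‖R.pot k ξ - R.pot k η‖ ≤ δ) :
    R.energy k (fun ξ => χ ξ • mol ρ Φ ξ) ≤ (δ + c) * ∫ ξ, ‖Φ ξ‖ ^ 2 := by
  have hu := contDiff_mol hρ hs (locallyIntegrable_Lp Φ)
  have iρ : Integrable ρ := hρ.continuous.integrable_of_hasCompactSupport hs
  have iw := integrable_avgSq iρ Φ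
  have hw := integral_avgSq iρ h1 Φ
  have hm : ∀ ξ, (∫ η, ρ (ξ - η) * ‖Φ η‖) ^ 2 ≤ avgSq ρ Φ ξ :=
    sq_integral_le_avgSq hρ.continuous hs h0 h1 Φ
  have hm0 : ∀ ξ, 0 ≤ ∫ η, ρ (ξ - η) * ‖Φ η‖ := fun ξ =>
    integral_nonneg fun η => mul_nonneg (h0 _) (norm_nonneg _)
  have hun : ∀ ξ, ‖mol ρ Φ ξ‖ ^ 2 ≤ avgSq ρ Φ ξ := fun ξ =>
    (pow_le_pow_left₀ (norm_nonneg _) (norm_mol_le h0 Φ ξ) 2).trans (hm ξ)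
  have hw0 : ∀ ξ, 0 ≤ avgSq ρ Φ ξ := fun ξ => (sq_nonneg _).trans (hm ξ)
  have ht : IsTestFn fun ξ => χ ξ • mol ρ Φ ξ :=
    ⟨ContDiff.smul (F := V) (f := χ) hχ hu, hχs.smul_right⟩
  have i2 : Integrable fun ξ => gradSq χ ξ * ‖mol ρ Φ ξ‖ ^ 2 := by
    refine (iw.const_mul c).mono' ((continuous_gradSq hχ).mul
      (hu.continuous.norm.pow 2)).aestronglyMeasurable (.of_forall fun ξ => ?_)
    rw [Real.norm_of_nonneg (mul_nonneg (gradSq_nonneg _ _) (sq_nonneg _))]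
    exact mul_le_mul (hgrad ξ) (hun ξ) (sq_nonneg _) hc0
  rw [R.energy_smul k hχ hu ht i2, add_mul, ← hw, ← integral_const_mul, ← integral_const_mul]
  refine add_le_add ?_ ?_
  · refine (Complex.re_le_norm _).trans (norm_integral_le_of_norm_le (iw.const_mul δ)
      (.of_forall fun ξ => ?_))
    by_cases hξ : χ ξ = 0
    · simpa [hξ] using mul_nonneg hδ0 (hw0 ξ)
    · refine (norm_inner_le_norm _ _).trans ?_
      have h2 := R.norm_hD_mol_le k hρ hs h0 hΦ (fun η => hδ ξ η hξ)
      have h3 : ‖χ ξ • χ ξ • mol ρ Φ ξ‖ ≤ ∫ η, ρ (ξ - η) * ‖Φ η‖ := by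
        rw [norm_smul, norm_smul, Real.norm_of_nonneg (hχ0 ξ)]
        refine le_trans ?_ (norm_mol_le h0 Φ ξ)
        have := norm_nonneg (mol ρ Φ ξ)
        calc χ ξ * (χ ξ * ‖mol ρ Φ ξ‖) ≤ 1 * (1 * ‖mol ρ Φ ξ‖) := by
              gcongr
              · exact mul_nonneg (hχ0 ξ) this
              · exact hχ1 ξ
              · exact hχ1 ξ
          _ = _ := by ring
      calc _ ≤ (∫ η, ρ (ξ - η) * ‖Φ η‖) * (δ * ∫ η, ρ (ξ - η) * ‖Φ η‖) :=
            mul_le_mul h3 h2 (norm_nonneg _) (hm0 ξ)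
        _ = δ * (∫ η, ρ (ξ - η) * ‖Φ η‖) ^ 2 := by ring
        _ ≤ _ := mul_le_mul_of_nonneg_left (hm ξ) hδ0
  · exact integral_mono i2 (iw.const_mul c) fun ξ =>
      mul_le_mul (hgrad ξ) (hun ξ) (sq_nonneg _) hc0

/-- For large `ϖ` a weak solution of `H_k Φ = 0` that satisfies the gauge constraint vanishes as soon
as it is orthogonal to one fixed state. -/
theorem eq_zero_of_orthogonal : ∃ ϖ₀ : ℝ, ∀ ϖ, ϖ₀ ≤ ϖ → ∃ Ψ : Config → V, IsTestFn Ψ ∧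
    ∀ Φ : Lp V 2 (volume : Measure Config),
    (∀ τ : Config → V, IsTestFn τ → ∫ ξ, inner ℂ (R.covD τ ξ) (Φ ξ) = 0) →
    (∀ φ : Config → V, IsTestFn φ → ∫ ξ, inner ℂ (R.hD (ϖ ^ 2 / 2) φ ξ) (Φ ξ) = 0) →
    ∫ ξ, inner ℂ (Ψ ξ) (Φ ξ) = 0 → Φ = 0 := by
  obtain ⟨ϖ₁, h1⟩ := R.energy_gap
  obtain ⟨Cχ, hCχ, hcut⟩ := exists_radial_cutoff
  refine ⟨max ϖ₁ 1, fun ϖ hϖ => ?_⟩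
  have hϖ0 : 0 < ϖ := lt_of_lt_of_le one_pos ((le_max_right _ _).trans hϖ)
  obtain ⟨Ψ, hΨ, -, C, hC, hgap⟩ := h1 ϖ ((le_max_left _ _).trans hϖ)
  refine ⟨Ψ, hΨ, fun Φ hcov hH hort => eq_zero_of_test fun f hf => ?_⟩
  set k := ϖ ^ 2 / 2
  set N := ∫ ξ, ‖Φ ξ‖ ^ 2 with hN
  have hN0 : 0 ≤ N := integral_nonneg fun ξ => by positivity
  set F := ∫ ξ, ‖f ξ‖ ^ 2 with hF
  have hF0 : 0 ≤ F := integral_nonneg fun ξ => by positivity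
  set L := ∫ ξ, inner ℂ (f ξ) (Φ ξ) with hL
  -- all errors are controlled by one small parameter
  have key : ∀ δ : ℝ, 0 < δ → δ ≤ 1 → ‖L‖ ^ 2 ≤ (50 / ϖ * F * (2 * N + C) + 2) * δ := by
    intro δ hδ hδ1
    obtain ⟨a, ha⟩ := hf.2.isCompact.isBounded.subset_closedBall (0 : Config)
    obtain ⟨b, hb⟩ := hΨ.2.isCompact.isBounded.subset_closedBall (0 : Config)
    set r := max (max a b) (max 1 (Cχ / δ)) with hr
    have hra : a ≤ r := (le_max_left _ _).trans (le_max_left _ _)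
    have hrb : b ≤ r := (le_max_right _ _).trans (le_max_left _ _)
    have hr1 : 1 ≤ r := (le_max_left _ _).trans (le_max_right _ _)
    have hrC : Cχ / δ ≤ r := (le_max_right _ _).trans (le_max_right _ _)
    have hr0 : 0 < r := by linarith
    obtain ⟨χ, hχ, hχz, hχ0, hχ1, hχr, hχg, hχrad⟩ := hcut r hr0
    have hχs : HasCompactSupport χ := HasCompactSupport.intro
      (isCompact_closedBall (0 : Config) (2 * r)) fun ξ hξ => hχz ξ (by simpa using hξ)
    have hgrad : ∀ ξ, gradSq χ ξ ≤ δ := fun ξ => by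
      refine (hχg ξ).trans ?_
      rw [div_le_iff₀ hδ] at hrC
      rw [div_le_iff₀ (by positivity)]
      nlinarith [mul_le_mul_of_nonneg_left hr1 (mul_nonneg hr0.le hδ.le)]
    obtain ⟨ε₁, hε₁, hclose⟩ := Metric.uniformContinuousOn_iff.1
      ((isCompact_closedBall (0 : Config) (2 * r + 1)).uniformContinuousOn_of_continuous
        (R.continuous_pot k).continuousOn) δ hδ
    obtain ⟨ε₂, hε₂, hwf⟩ := exists_mol_close hf Φ hδ
    obtain ⟨ε₃, hε₃, hwΨ⟩ := exists_mol_close hΨ Φ hδ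
    set ε := min (min 1 (ε₁ / 2)) (min ε₂ ε₃) with hε
    have hε0 : 0 < ε := by positivity
    have hεa : ε ≤ 1 := (min_le_left _ _).trans (min_le_left _ _)
    have hεb : ε < ε₁ := ((min_le_left _ _).trans (min_le_right _ _)).trans_lt (by linarith)
    obtain ⟨ρ, hρ, hs, h0, h1, hz, hrad⟩ := exists_radial_mollifier hε0
    have hwf := hwf ε ((min_le_right _ _).trans (min_le_left _ _)) ρ hρ hs h0 h1 hz
    have hwΨ := hwΨ ε ((min_le_right _ _).trans (min_le_right _ _)) ρ hρ hs h0 h1 hz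
    rw [hort, sub_zero] at hwΨ
    have hu := contDiff_mol hρ hs (locallyIntegrable_Lp Φ)
    have hg : IsTestFn fun ξ => χ ξ • mol ρ Φ ξ :=
      ⟨ContDiff.smul (F := V) (f := χ) hχ hu, hχs.smul_right⟩
    have hgc : ∀ ξ, R.covD (fun ξ => χ ξ • mol ρ Φ ξ) ξ = 0 := fun ξ => by
      rw [R.covD_smul (hχ.differentiable (by simp)) (hu.differentiable (by simp))
        (fun θ ξ => hχrad _ _ (norm_rot θ ξ)), R.covD_mol hρ hs hrad hcov, smul_zero]
    have hen := R.energy_mol_le k hρ hs h0 h1 hH hχ hχs hχ0 hχ1 hδ.le hδ.le hgrad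
      fun ξ η hξ hη => by
        have n1 : ‖ξ‖ ≤ 2 * r := by
          by_contra! h; exact hξ (hχz ξ h)
        have n2 : ‖ξ - η‖ ≤ ε := by
          by_contra! h; exact hη (hz _ h)
        have n3 := norm_sub_norm_le η ξ
        rw [norm_sub_rev] at n3
        have := hclose ξ (by simp; linarith) η (by simp; linarith)
          (by rw [dist_eq_norm]; exact n2.trans_lt hεb)
        rw [dist_eq_norm] at this
        exact this.le
    have hrep : ∀ h : Config → V, (∀ ξ, r < ‖ξ‖ → h ξ = 0) →
        ∫ ξ, inner ℂ (h ξ) (χ ξ • mol ρ Φ ξ) = ∫ ξ, inner ℂ (h ξ) (mol ρ Φ ξ) := fun h hh => by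
      refine integral_congr_ae (.of_forall fun ξ => ?_)
      by_cases hξ : ‖ξ‖ ≤ r
      · simp only [hχr ξ hξ, one_smul]
      · simp only [hh ξ (not_le.1 hξ), inner_zero_left]
    have hfr := hrep f fun ξ hξ => image_eq_zero_of_notMem_tsupport fun hm => by
      have := ha hm
      simp at this
      linarith
    have hΨr := hrep Ψ fun ξ hξ => image_eq_zero_of_notMem_tsupport fun hm => by
      have := hb hm
      simp at this
      linarith
    have hgap := hgap _ hg hgc
    have hcs := norm_integral_inner_sq_le hf hg
    rw [hΨr] at hgap
    rw [hfr] at hcs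
    set G := ∫ ξ, ‖χ ξ • mol ρ Φ ξ‖ ^ 2 with hG
    set P := ∫ ξ, inner ℂ (f ξ) (mol ρ Φ ξ) with hP
    set Q := ∫ ξ, inner ℂ (Ψ ξ) (mol ρ Φ ξ) with hQ
    have hQ2 : ‖Q‖ ^ 2 ≤ δ := by nlinarith [norm_nonneg Q]
    have hG2 : ϖ / 25 * G ≤ (2 * N + C) * δ := by
      nlinarith [mul_le_mul_of_nonneg_left hQ2 hC]
    have hG3 : G ≤ 25 / ϖ * ((2 * N + C) * δ) := by
      rw [div_mul_eq_mul_div, le_div_iff₀ hϖ0]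
      linarith
    have hL1 : ‖L‖ ≤ ‖P‖ + δ := by
      have := norm_sub_norm_le L P
      rw [norm_sub_rev] at this
      linarith
    have hL2 : ‖L‖ ^ 2 ≤ 2 * ‖P‖ ^ 2 + 2 * δ := by
      have h3 := pow_le_pow_left₀ (norm_nonneg L) hL1 2
      nlinarith [sq_nonneg (‖P‖ - δ)]
    have h4 := mul_le_mul_of_nonneg_left hG3 hF0
    calc ‖L‖ ^ 2 ≤ 2 * ‖P‖ ^ 2 + 2 * δ := hL2
      _ ≤ 2 * (F * (25 / ϖ * ((2 * N + C) * δ))) + 2 * δ := by linarith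
      _ = _ := by ring
  set D := 50 / ϖ * F * (2 * N + C) + 2 with hD
  have hD0 : 0 < D := by positivity
  have : ‖L‖ ^ 2 ≤ 0 := by
    refine le_of_forall_pos_le_add fun e he => ?_
    have h3 := key (min 1 (e / D)) (by positivity) (min_le_left _ _)
    have h4 : D * min 1 (e / D) ≤ D * (e / D) := by gcongr; exact min_le_right _ _
    rw [mul_div_cancel₀ _ hD0.ne'] at h4
    linarith
  have h5 : ‖L‖ = 0 := by nlinarith [norm_nonneg L]
  exact norm_eq_zero.1 h5

end FermionRep
end DeformedSQM

namespace DeformedSQM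

/-! ### The zero mode over the Fock space -/

theorem FermionRep.existsUnique_zero_mode {V : Type*} [NormedAddCommGroup V] [InnerProductSpace ℂ V]
    [CompleteSpace V] (R : FermionRep V) : ∃ ϖ₀ : ℝ, ∀ ϖ, ϖ₀ ≤ ϖ →
    ∃ Ψ : Lp V 2 (volume : Measure Config), ‖Ψ‖ = 1 ∧
      (∀ φ : Config → V, IsTestFn φ → ∫ ξ, inner ℂ (R.gauge φ ξ) (Ψ ξ) = 0) ∧
      (∀ φ : Config → V, IsTestFn φ → ∫ ξ, inner ℂ (R.hD (ϖ ^ 2 / 2) φ ξ) (Ψ ξ) = 0) ∧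
      ∀ Φ : Lp V 2 (volume : Measure Config),
        (∀ φ : Config → V, IsTestFn φ → ∫ ξ, inner ℂ (R.gauge φ ξ) (Φ ξ) = 0) →
        (∀ φ : Config → V, IsTestFn φ → ∫ ξ, inner ℂ (R.hD (ϖ ^ 2 / 2) φ ξ) (Φ ξ) = 0) →
        ∃ c : ℂ, Φ = c • Ψ := by
  obtain ⟨ϖ₁, h1⟩ := R.exists_zero_mode
  obtain ⟨ϖ₂, h2⟩ := R.eq_zero_of_orthogonal
  refine ⟨max ϖ₁ ϖ₂, fun ϖ hϖ => ?_⟩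
  obtain ⟨Ψ, hΨ0, hΨc, hΨH⟩ := h1 ϖ ((le_max_left _ _).trans hϖ)
  obtain ⟨f, hf, huniq⟩ := h2 ϖ ((le_max_right _ _).trans hϖ)
  have hgauge : ∀ (Φ : Lp V 2 (volume : Measure Config)) (φ : Config → V),
      ∫ ξ, inner ℂ (R.gauge φ ξ) (Φ ξ) = Complex.I * ∫ ξ, inner ℂ (R.covD φ ξ) (Φ ξ) := fun Φ φ => by
    simp only [gauge_eq, inner_smul_left, map_neg, Complex.conj_I, neg_neg]
    rw [integral_const_mul]
  have hlin : ∀ (g : Config → V) (_ : IsTestFn g) (Φ : Lp V 2 (volume : Measure Config)) (c : ℂ),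
      ∫ ξ, inner ℂ (g ξ) ((Φ - c • Ψ : Lp V 2 (volume : Measure Config)) ξ)
        = (∫ ξ, inner ℂ (g ξ) (Φ ξ)) - c * ∫ ξ, inner ℂ (g ξ) (Ψ ξ) := fun g hg Φ c => by
    rw [← hg.inner_toL2, ← hg.inner_toL2, ← hg.inner_toL2, inner_sub_right, inner_smul_right]
  have hne : ∫ ξ, inner ℂ (f ξ) (Ψ ξ) ≠ 0 := fun h => hΨ0 (huniq Ψ hΨc hΨH h)
  have hn : (‖Ψ‖ : ℂ) ≠ 0 := by simpa using hΨ0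
  have hscale : ∀ g : Config → V, IsTestFn g → ∫ ξ, inner ℂ (g ξ) (Ψ ξ) = 0 →
      ∫ ξ, inner ℂ (g ξ) (((‖Ψ‖ : ℂ)⁻¹ • Ψ : Lp V 2 (volume : Measure Config)) ξ) = 0 :=
    fun g hg h => by
      rw [← hg.inner_toL2, inner_smul_right, hg.inner_toL2, h, mul_zero]
  refine ⟨(‖Ψ‖ : ℂ)⁻¹ • Ψ, ?_, fun φ hφ => ?_, fun φ hφ => ?_, fun Φ hc hH => ?_⟩
  · rw [norm_smul, norm_inv, Complex.norm_real, norm_norm, inv_mul_cancel₀ (by simpa using hΨ0)]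
  · rw [hgauge, hscale _ (R.isTestFn_covD hφ) (hΨc φ hφ), mul_zero]
  · exact hscale _ (R.isTestFn_hD _ hφ) (hΨH φ hφ)
  · set c := (∫ ξ, inner ℂ (f ξ) (Φ ξ)) / ∫ ξ, inner ℂ (f ξ) (Ψ ξ) with hcdef
    have h0 : Φ - c • Ψ = 0 := by
      refine huniq _ (fun τ hτ => ?_) (fun φ hφ => ?_) ?_
      · have h3 := hc τ hτ
        rw [hgauge] at h3
        rw [hlin _ (R.isTestFn_covD hτ), hΨc τ hτ,
          (mul_eq_zero.1 h3).resolve_left Complex.I_ne_zero, mul_zero, sub_zero]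
      · rw [hlin _ (R.isTestFn_hD _ hφ), hΨH φ hφ, hH φ hφ, mul_zero, sub_zero]
      · rw [hlin f hf, hcdef, div_mul_cancel₀ _ hne, sub_self]
    refine ⟨c * ‖Ψ‖, ?_⟩
    rw [smul_smul, mul_assoc, mul_inv_cancel₀ hn, mul_one]
    exact sub_eq_zero.1 h0

/-- The fermion parity `(-1) ^ #S`. -/
def parMat : Matrix (Finset (Fin 8)) (Finset (Fin 8)) ℂ := Matrix.diagonal fun S => (-1) ^ S.card

theorem neg_one_pow_card_flip (j : Fin 8) (S : Finset (Fin 8)) :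
    (-1 : ℂ) ^ (symmDiff S {j}).card = -(-1) ^ S.card := by
  by_cases h : j ∈ S
  · have e : symmDiff S {j} = S.erase j := by
      ext i; simp only [Finset.mem_symmDiff, Finset.mem_singleton, Finset.mem_erase]
      by_cases hi : i = j <;> simp_all
    rw [e, ← Finset.card_erase_add_one h, pow_succ]
    ring
  · have e : symmDiff S {j} = insert j S := by
      ext i; simp only [Finset.mem_symmDiff, Finset.mem_singleton, Finset.mem_insert]
      by_cases hi : i = j <;> simp_all
    rw [e, Finset.card_insert_of_notMem h, pow_succ]
    ring

theorem parMat_mul_hop (j : Fin 8) (c : Finset (Fin 8) → ℂ) :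
    parMat * hop j c = -(hop j c * parMat) := by
  ext S T
  simp only [parMat, Matrix.diagonal_mul, Matrix.neg_apply, Matrix.mul_diagonal, hop, Matrix.of_apply]
  split_ifs with h
  · rw [h, neg_one_pow_card_flip]; ring
  · simp

theorem lam_psi_apply (j : Fin 8) (v : Fermion) (S : Finset (Fin 8)) :
    (lam j (psi j v)) S = (if j ∈ S then -(Complex.I / 2) else Complex.I / 2) * v S := by
  have e : lam j (psi j v) = (lam j * psi j) v := rfl
  rw [e, lam, psi, ← map_mul, hop_mul, Matrix.ofLp_toEuclideanCLM, Matrix.mulVec, dotProduct,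
    Finset.sum_eq_single S]
  · rw [Matrix.of_apply, symmDiff_symmDiff_cancel_right, if_pos rfl]
    congr 1
    have h1 := jwSign_mul_self j S
    have h2 := inv_sqrt_two_mul_self
    by_cases h : j ∈ S <;>
      simp only [lamCoeff, psiCoeff, jwSign_flip, mem_flip, h, lt_irrefl, if_true, if_false, not_true,
        not_false_iff, one_mul]
    · linear_combination (-Complex.I * jwSign j S * jwSign j S) * h2 - Complex.I / 2 * h1
    · linear_combination (Complex.I * jwSign j S * jwSign j S) * h2 + Complex.I / 2 * h1
  · intro T _ hT
    rw [Matrix.of_apply, symmDiff_symmDiff_cancel_right, if_neg hT, zero_mul]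
  · simp

/-- The occupation basis diagonalizes `-2i ∑ λ_a ψ_a`. -/
theorem num_apply (v : Fermion) (S : Finset (Fin 8)) :
    ((-(2 * Complex.I)) • ∑ a, lam a (psi a v)) S = ((8 - 2 * S.card : ℝ) : ℂ) * v S := by
  rw [PiLp.smul_apply, WithLp.ofLp_sum, Finset.sum_apply]
  simp only [lam_psi_apply, ← Finset.sum_mul, smul_eq_mul]
  rw [← mul_assoc]
  congr 1
  have h : ∀ j : Fin 8, (if j ∈ S then -(Complex.I / 2) else Complex.I / 2)
      = Complex.I / 2 - (if j ∈ S then Complex.I else 0) := fun j => by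
    split_ifs <;> ring
  simp only [h, Finset.sum_sub_distrib, Finset.sum_ite_mem, Finset.univ_inter, Finset.sum_const,
    Finset.card_univ, Fintype.card_fin, nsmul_eq_mul]
  push_cast
  linear_combination (2 * (S.card : ℂ) - 8) * Complex.I_mul_I

/-- The Fock space realizes the abstract data; `vac` is the state with all modes occupied. -/
def fermionRep : FermionRep Fermion where
  psi := psi
  lam := lam
  rel := ⟨psi_anticomm, lam_anticomm, lam_psi_anticomm⟩
  psi_sa := psi_isSelfAdjoint
  lam_sa := lam_isSelfAdjoint
  par := Matrix.toEuclideanCLM (𝕜 := ℂ) parMat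
  par_sq := by
    rw [← map_mul, parMat, Matrix.diagonal_mul_diagonal]
    simp [← mul_pow]
  par_sa := by
    refine IsSelfAdjoint.map ?_ (Matrix.toEuclideanCLM (𝕜 := ℂ))
    rw [IsSelfAdjoint, parMat, Matrix.star_eq_conjTranspose, Matrix.diagonal_conjTranspose]
    congr 1
    ext S
    simp
  par_psi a := by rw [psi, ← map_mul, parMat_mul_hop, map_neg, map_mul]
  par_lam a := by rw [lam, ← map_mul, parMat_mul_hop, map_neg, map_mul]
  vac := EuclideanSpace.single Finset.univ 1
  norm_vac := by simp
  par_vac := by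
    ext S
    rw [Matrix.ofLp_toEuclideanCLM, parMat, Matrix.mulVec_diagonal]
    by_cases h : S = Finset.univ
    · subst h; simp; norm_num
    · simp [h]
  num_vac := by
    ext S
    rw [num_apply, PiLp.smul_apply]
    by_cases h : S = Finset.univ
    · subst h; simp; norm_num
    · simp [h]
  num_gap v := by
    have h1 : ‖inner ℂ (EuclideanSpace.single (Finset.univ : Finset (Fin 8)) (1 : ℂ)) v‖ ^ 2
        = ∑ S, if S = Finset.univ then ‖v S‖ ^ 2 else 0 := by
      rw [EuclideanSpace.inner_single_left]; simp
    have h2 : (inner ℂ v ((-(2 * Complex.I)) • ∑ a, lam a (psi a v))).re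
        = ∑ S, (8 - 2 * (S.card : ℝ)) * ‖v S‖ ^ 2 := by
      rw [PiLp.inner_apply, Complex.re_sum]
      refine Finset.sum_congr rfl fun S _ => ?_
      rw [num_apply, ← smul_eq_mul, inner_smul_right, Complex.re_ofReal_mul]
      exact congrArg _ (inner_self_eq_norm_sq (𝕜 := ℂ) (v S))
    rw [h1, h2, EuclideanSpace.norm_sq_eq, Finset.mul_sum, Finset.mul_sum,
      ← Finset.sum_add_distrib, ← Finset.sum_add_distrib]
    refine Finset.sum_nonneg fun S _ => ?_
    split_ifs with h
    · subst h
      simp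
      nlinarith [sq_nonneg ‖v Finset.univ‖]
    · have h3 : S.card < 8 := by
        have := Finset.card_lt_univ_of_notMem (s := S) (x := (Finset.univ \ S).min' (by
          rw [Finset.sdiff_nonempty]; exact fun h' => h (Finset.univ_subset_iff.1 h'))) (by
          have := Finset.min'_mem (Finset.univ \ S) (by
            rw [Finset.sdiff_nonempty]; exact fun h' => h (Finset.univ_subset_iff.1 h'))
          exact (Finset.mem_sdiff.1 this).2)
        simpa using this
      have h4 : (S.card : ℝ) ≤ 7 := by exact_mod_cast Nat.lt_succ_iff.1 h3
      nlinarith [sq_nonneg ‖v S‖]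

theorem gaugeJ_eq : gaugeJ = fermionRep.gauge := rfl

theorem bilin_eq (θ η : Fin 8 → Fermion →L[ℂ] Fermion) (A : Matrix (Fin 8) (Fin 8) ℝ) :
    bilin θ A η = bil θ A η := rfl

theorem hamF_eq (ξ : Config) : hamF ξ = fermionRep.hF ξ := by
  unfold hamF FermionRep.hF
  have h1 : fermionRep.psi = psi := rfl
  have h2 : fermionRep.lam = lam := rfl
  rw [h1, h2]
  simp only [bilin_eq]

theorem hamDef_eq (k : ℝ) : hamDef k = fermionRep.hD k := by
  funext φ ξ
  unfold hamDef ham FermionRep.hD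
  rw [hamF_eq]

theorem distribEq_zero_iff {A : (Config → Fermion) → Config → Fermion} {Φ : PreHilbert} :
    DistribEq A Φ 0 ↔ ∀ φ : Config → Fermion, IsTestFn φ → ∫ ξ, inner ℂ (A φ ξ) (Φ ξ) = 0 :=
  forall₂_congr fun φ _ => by rw [integral_inner_zero]

end DeformedSQM

end

theorem proposition2 :
    ∃ k₀ : ℝ, ∀ k : ℝ, k₀ ≤ k →
      ∃ Ψ : DeformedSQM.physicalSpace, ‖Ψ‖ = 1 ∧ DeformedSQM.HamDefEq k Ψ 0 ∧
        ∀ Φ : DeformedSQM.physicalSpace, DeformedSQM.HamDefEq k Φ 0 → ∃ c : ℂ, Φ = c • Ψ := by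
  obtain ⟨ϖ₀, h⟩ := DeformedSQM.fermionRep.existsUnique_zero_mode
  refine ⟨max 1 (ϖ₀ ^ 2), fun k hk => ?_⟩
  have hk1 : 1 ≤ k := (le_max_left _ _).trans hk
  have hk2 : ϖ₀ ^ 2 ≤ 2 * k := by linarith [(le_max_right _ _).trans hk]
  obtain ⟨Ψ, hn, hJ, hH, huniq⟩ := h (Real.sqrt (2 * k)) (Real.le_sqrt_of_sq_le hk2)
  rw [Real.sq_sqrt (by linarith), mul_div_cancel_left₀ k two_ne_zero, ← DeformedSQM.hamDef_eq]
    at hH huniq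
  rw [← DeformedSQM.gaugeJ_eq] at hJ huniq
  exact ⟨⟨Ψ, DeformedSQM.distribEq_zero_iff.2 hJ⟩, hn, DeformedSQM.distribEq_zero_iff.2 hH,
    fun Φ hΦ => (huniq Φ (DeformedSQM.distribEq_zero_iff.1 Φ.2)
      (DeformedSQM.distribEq_zero_iff.1 hΦ)).imp fun c hc => Subtype.ext hc⟩
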